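/- **Setting.** Supermatrices are $4|4$ matrices; $\mathrm{Str}$ is the supertrace, $[\cdot,\cdot]$ and $\{\cdot,\cdot\}$ are the matrix commutator and anticommutator, and $\mathfrak g=\mathfrak{psl}(4|4,\mathbb C)=\mathfrak{sl}(4|4)/\langle 1\rangle$ is the complexification of $\mathfrak{psu}(2,2|4)$. Let $\Omega(X)=-\mathcal K X^{st}\mathcal K^{-1}$, $\mathcal K=\mathrm{diag}(K,K)$ with $K$ a symplectic form of $\mathbb C^4$; $\mathfrak g=\mathfrak g_0+\mathfrak g_1+\mathfrak g_2+\mathfrak g_3$ is the grading by the eigenvalues $i^k$ of $\Omega$, with projectors $P_k$, and $d=P_1+2P_2+3P_3$, $\hat d=3P_1+2P_2+P_3$. Let $R:\mathfrak g\to\mathfrak g$ be linear and parity preserving, antisymmetric, $\mathrm{Str}(RX\,Y)=-\mathrm{Str}(X\,RY)$, and a solution of the homogeneous classical Yang–Baxter equation $$[RX,RY]=R([RX,Y]+[X,RY]),$$ where $[\cdot,\cdot]$ in this equation is the superbracket. It is extended linearly to coefficients in superfields. **Fields.** The fields have coefficients in a supercommutative $\mathbb C$-algebra $B$ with two commuting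 even derivations $\partial_\pm$ (for example smooth functions on the worldsheet with values in a Grassmann algebra). They are: $g$ with values in $SL(4|4)$, where multiplication of $g$ by scalar functions is a gauge symmetry (so that $g$ represents a field in $PSL(4|4)$); ghosts $\lambda_1,\lambda_3$ and momenta $\omega_{1+},\omega_{3-}$ with bosonic coefficients and antifields $\omega^*_{1+},\omega^*_{3-}$ with fermionic coefficients, where the subscripts $1,3$ give the degree. In $\mathfrak g$ they satisfy $\{\lambda_1,\lambda_1\}=\{\lambda_3,\lambda_3\}=0$ (pure spinors) and $\{\lambda_1,\omega^*_{1+}\}=\{\lambda_3,\omega^*_{3-}\}=0$, and $\mathrm{Str}(\lambda_1\lambda_3)$ is invertible. For $A_1$ of degree $1$ and $A_3$ of degree $3$, define $\mathcal P_{13}A_1=A_1+[\lambda_3,S_2]$ and $\mathcal P_{31}A_3=A_3+[\lambda_1,S_2]$, with $S_2$ of degree $2$ such that $\{\lambda_1,\mathcal P_{13}A_1\}=0$, respectively $\{\lambda_3,\mathcal P_{31}A_3\}=0$, in $\mathfrak g$. Put $\mathrm{Ad}_gX=gXg^{-1}$, $A_\pm=-\partial_\pm g\,g^{-1}$, $A_{i\pm}=P_iA_\pm$,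 $D_\pm=\partial_\pm+[A_{0\pm},\cdot]$, $N_{0+}=-\{\omega_{1+},\lambda_3\}$, $N_{0-}=-\{\omega_{3-},\lambda_1\}$, $$\tilde j_-=g^{-1}(dA_-+4N_{0-}+4\omega^*_{3-})g,\qquad \tilde j_+=-g^{-1}(\hat dA_++4N_{0+}+4\omega^*_{1+})g,$$ $$S_0=\int\mathrm{Str}\Big(\tfrac14A_+dA_-+\omega_{1+}\partial_-\lambda_3+\omega_{3-}\partial_+\lambda_1+N_{0+}A_{0-}+N_{0-}A_{0+}-N_{0-}N_{0+}-\omega^*_{1+}\omega^*_{3-}\Big).$$ **BRST transformations.** For a constant fermionic parameter $\epsilon$ let $\Lambda(\epsilon)=g^{-1}(\epsilon\lambda_3-\epsilon\lambda_1)g$. The charge $Q_0$ acts by $$\epsilon Q_0g=(\epsilon\lambda_1+\epsilon\lambda_3)g,\quad \epsilon Q_0\omega_{1+}=-\epsilon(A_{1+}+\omega^*_{1+}),\quad \epsilon Q_0\omega_{3-}=-\epsilon(A_{3-}+\omega^*_{3-}),$$ $$\epsilon Q_0\omega^*_{1+}=D_+\epsilon\lambda_1-[N_{0+},\epsilon\lambda_1],\quad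 \epsilon Q_0\omega^*_{3-}=D_-\epsilon\lambda_3-[N_{0-},\epsilon\lambda_3],\quad \epsilon Q_0\lambda_i=0,$$ and $Q_1$ acts by $$\epsilon Q_1g=gR\Lambda(\epsilon),\quad \epsilon Q_1\omega^*_{1+}=\mathcal P_{13}P_1\big(g\,(R\partial_+\Lambda(\epsilon))\,g^{-1}\big),\quad \epsilon Q_1\omega^*_{3-}=\mathcal P_{31}P_3\big(g\,(R\partial_-\Lambda(\epsilon))\,g^{-1}\big),$$ and by zero on $\lambda_i$, $\omega_{1+}$, $\omega_{3-}$. **Claim.** The projectors $\mathcal P_{13},\mathcal P_{31}$ exist and are uniquely determined, the transformations generated by $Q=Q_0+\eta Q_1$, $\eta\in\mathbb C$, preserve the constraints on the fields, and the following hold. 1. The deformed action, a formal power series in $\eta$, $$S_{def}=S_0-\frac{\eta}{4}\int\mathrm{Str}\big(\tilde j_+\,\mathcal U(\eta)R\tilde j_-\big),\qquad \mathcal U(\eta)=\sum_{n\ge0}\big(\eta\,R\circ\mathrm{Ad}_g^{-1}\circ(d-4\mathcal P_{31}P_3)\circ\mathrm{Ad}_g\big)^n,$$ is invariant under $Q=Q_0+\eta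 Q_1$ to all orders in $\eta$. That is, if $V_n$ is the coefficient of $\eta^n$ in the Lagrangian density of $S_{def}$, then $\sum_{k+m=n}\epsilon Q_kV_m$ is a total derivative $\partial_+b+\partial_-c$ for every $n$, where $Q_k=0$ for $k\ge2$: the expansion of the BRST charge stops at first order. In particular, for smooth fields with values in a finitely generated Grassmann algebra on any torus, each coefficient of $S_{def}$, as an integral over the torus, gives $\sum_{k+m=n}\epsilon Q_k\int V_m=0$. 2. For every $\eta\in\mathbb C$ the charge $Q=Q_0+\eta Q_1$ is nilpotent off-shell up to gauge transformations: for constant fermionic $\epsilon,\epsilon'$ the result of transforming the fields first by $\epsilon'Q$ and then by $\epsilon Q$, minus the result in the opposite order, is, on all fields and without equations of motion, the sum of the local Lorentz transformation with parameter $2\epsilon\epsilon'\{\lambda_1,\lambda_3\}$, a multiplication $\delta g=zg$ by a bosonic function $z$, which is trivial in $PSL(4|4)$, and shifts $\delta\omega_{1+}=[\lambda_3,u]$, $\delta\omega_{3-}=[\lambda_1,v]$ with $u,v$ of degree $2$ with bosonic coefficients, the gauge symmetry from the pure spinor constraints. -/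

import Mathlib

open scoped TensorProduct ContDiff

noncomputable section

namespace PureSpinor

/-! ### Supermatrices and the Lie superalgebra `psl(4|4)` -/

/-- `4|4` supermatrices with entries in `B`. -/
abbrev SMat (B : Type*) := Matrix (Fin 4 ⊕ Fin 4) (Fin 4 ⊕ Fin 4) B

/-- The supertrace. -/
def str {B : Type*} [Ring B] (X : SMat B) : B :=
  X.toBlocks₁₁.trace - X.toBlocks₂₂.trace

/-- The commutator of matrices. -/
def comm {B : Type*} [Ring B] (X Y : SMat B) : SMat B := X * Y - Y * X

/-- The anticommutator of matrices. -/
def acomm {B : Type*} [Ring B] (X Y : SMat B) : SMat B := X * Y + Y * X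

/-- Subtraction of the traces of the two diagonal blocks. On a supertraceless matrix
`tr a = tr d`, so a multiple of the identity is subtracted: this is the canonical representative
of the class of the matrix in `psl(4|4) = sl(4|4) / ⟨1⟩`. -/
def tracelessPart {B : Type*} [Ring B] [Algebra ℂ B] (X : SMat B) : SMat B :=
  Matrix.fromBlocks
    (X.toBlocks₁₁ - Matrix.scalar (Fin 4) ((1 / 4 : ℂ) • X.toBlocks₁₁.trace)) X.toBlocks₁₂
    X.toBlocks₂₁ (X.toBlocks₂₂ - Matrix.scalar (Fin 4) ((1 / 4 : ℂ) • X.toBlocks₂₂.trace))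

/-- The space underlying `psl(4|4)`, the complexification of `psu(2,2|4)`: each class of
`sl(4|4)` modulo the identity has exactly one representative whose two diagonal blocks are
traceless. -/
def psl : Submodule ℂ (SMat ℂ) where
  carrier := {X | X.toBlocks₁₁.trace = 0 ∧ X.toBlocks₂₂.trace = 0}
  zero_mem' := by
    constructor <;> simp [Matrix.trace, Matrix.toBlocks₁₁, Matrix.toBlocks₂₂]
  add_mem' := by
    rintro X Y ⟨h1, h2⟩ ⟨h3, h4⟩
    simp only [Matrix.trace, Matrix.diag, Matrix.toBlocks₁₁, Matrix.toBlocks₂₂,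
      Matrix.of_apply] at h1 h2 h3 h4
    constructor <;>
      simp only [Matrix.trace, Matrix.diag, Matrix.toBlocks₁₁, Matrix.toBlocks₂₂,
        Matrix.of_apply, Matrix.add_apply, Finset.sum_add_distrib, h1, h2, h3, h4, add_zero]
  smul_mem' := by
    rintro c X ⟨h1, h2⟩
    simp only [Matrix.trace, Matrix.diag, Matrix.toBlocks₁₁, Matrix.toBlocks₂₂,
      Matrix.of_apply] at h1 h2
    constructor <;>
      simp only [Matrix.trace, Matrix.diag, Matrix.toBlocks₁₁, Matrix.toBlocks₂₂,
        Matrix.of_apply, Matrix.smul_apply, ← Finset.smul_sum, h1, h2, smul_zero]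

theorem tracelessPart_mem (X : SMat ℂ) : tracelessPart X ∈ psl := by
  constructor <;>
    simp [tracelessPart, Matrix.trace_sub, Matrix.scalar_apply, Matrix.trace_diagonal]

/-- The projection of supermatrices onto `psl(4|4)`; on `sl(4|4)` it is the quotient map. -/
def toPsl (X : SMat ℂ) : psl := ⟨tracelessPart X, tracelessPart_mem X⟩

/-- The block diagonal (bosonic) part of a supermatrix. -/
def diagPart {B : Type*} [Ring B] (X : SMat B) : SMat B :=
  Matrix.fromBlocks X.toBlocks₁₁ 0 0 X.toBlocks₂₂

/-- The block off-diagonal (fermionic) part of a supermatrix. -/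
def offDiagPart {B : Type*} [Ring B] (X : SMat B) : SMat B :=
  Matrix.fromBlocks 0 X.toBlocks₁₂ X.toBlocks₂₁ 0

/-- The superbracket of `psl(4|4)`: the commutator, except that it is the anticommutator on two
block off-diagonal arguments. -/
def pslBracket (X Y : psl) : psl :=
  toPsl (comm (X : SMat ℂ) Y + 2 • (offDiagPart (Y : SMat ℂ) * offDiagPart (X : SMat ℂ)))

/-- `R` preserves the parity of elements of `psl(4|4)`. -/
def IsEvenOperator (R : psl →ₗ[ℂ] psl) : Prop :=
  ∀ X : psl, ((R (toPsl (diagPart X)) : psl) : SMat ℂ) = diagPart (R X : SMat ℂ) ∧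
    ((R (toPsl (offDiagPart X)) : psl) : SMat ℂ) = offDiagPart (R X : SMat ℂ)

/-- `R` is antisymmetric for the supertrace form. -/
def IsAntisymmetric (R : psl →ₗ[ℂ] psl) : Prop :=
  ∀ X Y : psl, str ((R X : SMat ℂ) * (Y : SMat ℂ)) = -str ((X : SMat ℂ) * (R Y : SMat ℂ))

/-- The homogeneous classical Yang-Baxter equation. -/
def SolvesCYBE (R : psl →ₗ[ℂ] psl) : Prop :=
  ∀ X Y : psl, pslBracket (R X) (R Y) = R (pslBracket (R X) Y + pslBracket X (R Y))

/-- The extension of `R` to matrices with entries in a `ℂ`-algebra, linear over the entries: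
`x E_ij ↦ R(E_ij) x`. -/
def extend {B : Type*} [Ring B] [Algebra ℂ B] (R : psl →ₗ[ℂ] psl) (X : SMat B) : SMat B :=
  ∑ i, ∑ j, Matrix.of fun k l =>
    algebraMap ℂ B ((R (toPsl (Matrix.single i j 1)) : SMat ℂ) k l) * X i j

/-! ### The `ℤ₄` grading -/

/-- The symplectic form of `ℂ⁴`, which satisfies `K⁻¹ = -K`. -/
def symplectic (B : Type*) [Ring B] : Matrix (Fin 4) (Fin 4) B :=
  !![0, -1, 0, 0; 1, 0, 0, 0; 0, 0, 0, -1; 0, 0, 1, 0]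

/-- The supertranspose. -/
def superTranspose {B : Type*} [Ring B] (X : SMat B) : SMat B :=
  Matrix.fromBlocks X.toBlocks₁₁.transpose (-X.toBlocks₂₁.transpose)
    X.toBlocks₁₂.transpose X.toBlocks₂₂.transpose

/-- The automorphism `Ω(X) = -𝒦 Xˢᵗ 𝒦⁻¹ = 𝒦 Xˢᵗ 𝒦`, `𝒦 = diag(K, K)`, of order four. Its
eigenspace for `iᵏ` is the component of degree `k`; the one of degree zero is
`sp(4) ⊕ sp(4)`, the complexification of `so(4,1) ⊕ so(5)`. -/
def omega {B : Type*} [Ring B] (X : SMat B) : SMat B :=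
  Matrix.fromBlocks (symplectic B) 0 0 (symplectic B) * superTranspose X *
    Matrix.fromBlocks (symplectic B) 0 0 (symplectic B)

/-- The projector `P_k` onto the component of degree `k` of `psl(4|4)`,
`P_k = (1/4) ∑_j i^(-kj) Ωʲ`. -/
def proj {B : Type*} [Ring B] [Algebra ℂ B] (k : ℕ) (X : SMat B) : SMat B :=
  tracelessPart ((1 / 4 : ℂ) •
    ∑ j ∈ Finset.range 4, (Complex.I ^ (3 * k * j)) • (omega^[j] X))

/-- `d = P₁ + 2 P₂ + 3 P₃`. -/
def dPS {B : Type*} [Ring B] [Algebra ℂ B] (X : SMat B) : SMat B :=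
  proj 1 X + (2 : ℂ) • proj 2 X + (3 : ℂ) • proj 3 X

/-- `d̂ = 3 P₁ + 2 P₂ + P₃`. -/
def dPSt {B : Type*} [Ring B] [Algebra ℂ B] (X : SMat B) : SMat B :=
  (3 : ℂ) • proj 1 X + (2 : ℂ) • proj 2 X + proj 3 X

/-! ### Superfields on the worldsheet -/

/-- The structure of an algebra of superfields on a two-dimensional worldsheet on a `ℂ`-algebra
`B`: a `ℤ₂`-grading, given by its parity automorphism, for which `B` is supercommutative, and two
commuting even derivations, the light-cone derivatives. -/
structure Worldsheet (B : Type*) [Ring B] [Algebra ℂ B] where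
  parity : B →ₐ[ℂ] B
  parity_parity : ∀ a, parity (parity a) = a
  even_comm : ∀ a b, parity a = a → a * b = b * a
  odd_anticomm : ∀ a b, parity a = -a → parity b = -b → a * b = -(b * a)
  dPlus : B →ₗ[ℂ] B
  dMinus : B →ₗ[ℂ] B
  dPlus_mul : ∀ a b, dPlus (a * b) = dPlus a * b + a * dPlus b
  dMinus_mul : ∀ a b, dMinus (a * b) = dMinus a * b + a * dMinus b
  parity_dPlus : ∀ a, parity (dPlus a) = dPlus (parity a)
  parity_dMinus : ∀ a, parity (dMinus a) = dMinus (parity a)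
  dPlus_dMinus : ∀ a, dPlus (dMinus a) = dMinus (dPlus a)

section Fields

variable {B : Type*} [Ring B] [Algebra ℂ B]

/-- `ε` is an odd constant. -/
def Worldsheet.IsOddConstant (W : Worldsheet B) (ε : B) : Prop :=
  W.parity ε = -ε ∧ W.dPlus ε = 0 ∧ W.dMinus ε = 0

/-- All entries of the matrix are even. -/
def Worldsheet.EvenEntries (W : Worldsheet B) (X : SMat B) : Prop :=
  ∀ i j, W.parity (X i j) = X i j

/-- All entries of the matrix are odd. -/
def Worldsheet.OddEntries (W : Worldsheet B) (X : SMat B) : Prop :=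
  ∀ i j, W.parity (X i j) = -X i j

/-- `X` is an even supermatrix: diagonal blocks with even entries, off-diagonal blocks with odd
entries. -/
def Worldsheet.IsEvenSuper (W : Worldsheet B) (X : SMat B) : Prop :=
  W.EvenEntries (diagPart X) ∧ W.OddEntries (offDiagPart X)

/-- The determinant of a matrix whose entries commute, by Leibniz' formula. -/
def det4 (M : Matrix (Fin 4) (Fin 4) B) : B :=
  ∑ σ : Equiv.Perm (Fin 4),
    Equiv.Perm.sign σ • (M (σ 0) 0 * M (σ 1) 1 * M (σ 2) 2 * M (σ 3) 3)

/-- `g` is an element of the supergroup `SL(4|4)`: an invertible even supermatrix with blocks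
`a, b, c, d` whose Berezinian `det (a - b d⁻¹ c) / det d` is one. -/
def Worldsheet.IsSL (W : Worldsheet B) (g : SMat B) : Prop :=
  W.IsEvenSuper g ∧ IsUnit g ∧ ∃ e : Matrix (Fin 4) (Fin 4) B,
    g.toBlocks₂₂ * e = 1 ∧ e * g.toBlocks₂₂ = 1 ∧
    det4 (g.toBlocks₁₁ - g.toBlocks₁₂ * e * g.toBlocks₂₁) = det4 g.toBlocks₂₂

/-- The fields: the group element `g`, the ghosts `λ₁, λ₃`, their momenta `ω₁₊, ω₃₋` and the
antifields `ω*₁₊, ω*₃₋`. -/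
@[ext]
structure Fields (B : Type*) where
  g : SMat B
  lam1 : SMat B
  lam3 : SMat B
  om1 : SMat B
  om3 : SMat B
  ast1 : SMat B
  ast3 : SMat B

instance : Add (Fields B) where
  add φ ψ := ⟨φ.g + ψ.g, φ.lam1 + ψ.lam1, φ.lam3 + ψ.lam3, φ.om1 + ψ.om1, φ.om3 + ψ.om3,
    φ.ast1 + ψ.ast1, φ.ast3 + ψ.ast3⟩

instance : Zero (Fields B) where
  zero := ⟨0, 0, 0, 0, 0, 0, 0⟩

instance : SMul ℂ (Fields B) where
  smul c φ := ⟨c • φ.g, c • φ.lam1, c • φ.lam3, c • φ.om1, c • φ.om3, c • φ.ast1, c • φ.ast3⟩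

/-- The degrees, the statistics and the constraints of the fields. The ghosts are pure spinors:
`{λ₁, λ₁} = {λ₃, λ₃} = 0` in `psl(4|4)`; and `Str(λ₁ λ₃)` is invertible. -/
structure Fields.Admissible (W : Worldsheet B) (φ : Fields B) : Prop where
  g_mem : W.IsSL φ.g
  lam1_even : W.EvenEntries φ.lam1
  lam1_grade : proj 1 φ.lam1 = φ.lam1
  lam1_pure : tracelessPart (acomm φ.lam1 φ.lam1) = 0
  lam3_even : W.EvenEntries φ.lam3
  lam3_grade : proj 3 φ.lam3 = φ.lam3
  lam3_pure : tracelessPart (acomm φ.lam3 φ.lam3) = 0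
  lam_regular : IsUnit (str (φ.lam1 * φ.lam3))
  om1_even : W.EvenEntries φ.om1
  om1_grade : proj 1 φ.om1 = φ.om1
  om3_even : W.EvenEntries φ.om3
  om3_grade : proj 3 φ.om3 = φ.om3
  ast1_odd : W.OddEntries φ.ast1
  ast1_grade : proj 1 φ.ast1 = φ.ast1
  ast1_constraint : tracelessPart (acomm φ.lam1 φ.ast1) = 0
  ast3_odd : W.OddEntries φ.ast3
  ast3_grade : proj 3 φ.ast3 = φ.ast3
  ast3_constraint : tracelessPart (acomm φ.lam3 φ.ast3) = 0

/-- `z` is the projection of `y` along the image of `[l, ·]` to the kernel of `[m, ·]`: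
`z = y + [l, S₂]` with `S₂` of degree two and `[m, z] = 0` in `psl(4|4)`. -/
def IsGhostProj (l m y z : SMat B) : Prop :=
  ∃ S : SMat B, proj 2 S = S ∧ z = y + comm l S ∧ tracelessPart (acomm m z) = 0

open Classical in
/-- The projection of `y` along the image of `[l, ·]` to the kernel of `[m, ·]`. -/
def ghostProj (l m y : SMat B) : SMat B :=
  if h : ∃ z, IsGhostProj l m y z then h.choose else y

/-- The projector `𝒫₃₁`, precomposed with `P₃`. -/
def Fields.P31 (φ : Fields B) (X : SMat B) : SMat B := ghostProj φ.lam1 φ.lam3 (proj 3 X)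

/-- The projector `𝒫₁₃`, precomposed with `P₁`. -/
def Fields.P13 (φ : Fields B) (X : SMat B) : SMat B := ghostProj φ.lam3 φ.lam1 (proj 1 X)

/-- `Ad_g X = g X g⁻¹`. -/
def Fields.Ad (φ : Fields B) (X : SMat B) : SMat B := φ.g * X * Ring.inverse φ.g

/-- `Ad_g⁻¹ X = g⁻¹ X g`. -/
def Fields.AdInv (φ : Fields B) (X : SMat B) : SMat B := Ring.inverse φ.g * X * φ.g

/-- `A₊ = -∂₊g g⁻¹`. -/
def Fields.Ap (φ : Fields B) (W : Worldsheet B) : SMat B :=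
  -(φ.g.map W.dPlus * Ring.inverse φ.g)

/-- `A₋ = -∂₋g g⁻¹`. -/
def Fields.Am (φ : Fields B) (W : Worldsheet B) : SMat B :=
  -(φ.g.map W.dMinus * Ring.inverse φ.g)

/-- `N₀₊ = -{ω₁₊, λ₃}`. -/
def Fields.Np (φ : Fields B) : SMat B := -acomm φ.om1 φ.lam3

/-- `N₀₋ = -{ω₃₋, λ₁}`. -/
def Fields.Nm (φ : Fields B) : SMat B := -acomm φ.om3 φ.lam1

/-- `j̃₊ = -g⁻¹ (3 A₁₊ + 2 A₂₊ + A₃₊ + 4 N₀₊ + 4 ω*₁₊) g`. -/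
def Fields.jp (φ : Fields B) (W : Worldsheet B) : SMat B :=
  -φ.AdInv (dPSt (φ.Ap W) + (4 : ℂ) • φ.Np + (4 : ℂ) • φ.ast1)

/-- `j̃₋ = g⁻¹ (A₁₋ + 2 A₂₋ + 3 A₃₋ + 4 N₀₋ + 4 ω*₃₋) g`. -/
def Fields.jm (φ : Fields B) (W : Worldsheet B) : SMat B :=
  φ.AdInv (dPS (φ.Am W) + (4 : ℂ) • φ.Nm + (4 : ℂ) • φ.ast3)

/-- The Lagrangian density of `S₀`. -/
def Fields.L0 (φ : Fields B) (W : Worldsheet B) : B :=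
  str ((1 / 4 : ℂ) • (φ.Ap W * dPS (φ.Am W))
    + φ.om1 * φ.lam3.map W.dMinus + φ.om3 * φ.lam1.map W.dPlus
    + φ.Np * proj 0 (φ.Am W) + φ.Nm * proj 0 (φ.Ap W)
    - φ.Nm * φ.Np - φ.ast1 * φ.ast3)

/-- The operator `R ∘ Ad_g⁻¹ ∘ (d - 4 𝒫₃₁) ∘ Ad_g`. -/
def Fields.RK (φ : Fields B) (R : psl →ₗ[ℂ] psl) (X : SMat B) : SMat B :=
  extend R (φ.AdInv (dPS (φ.Ad X) - (4 : ℂ) • φ.P31 (φ.Ad X)))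

/-- The coefficient of `ηⁿ` in the Lagrangian density of
`S_def = S₀ - (η/4) Str(j̃₊, U(η) R j̃₋)`, `U(η) = ∑ₙ (η R Ad_g⁻¹ (d - 4 𝒫₃₁) Ad_g)ⁿ`. -/
def Fields.Ldef (φ : Fields B) (W : Worldsheet B) (R : psl →ₗ[ℂ] psl) : ℕ → B
  | 0 => φ.L0 W
  | n + 1 => -((1 / 4 : ℂ) • str (φ.jp W * (φ.RK R)^[n] (extend R (φ.jm W))))

/-- `D₊X - [N₀₊, X]`, with `D₊ = ∂₊ + [A₀₊, ·]`. -/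
def Fields.Dp (φ : Fields B) (W : Worldsheet B) (X : SMat B) : SMat B :=
  X.map W.dPlus + comm (proj 0 (φ.Ap W)) X - comm φ.Np X

/-- `D₋X - [N₀₋, X]`, with `D₋ = ∂₋ + [A₀₋, ·]`. -/
def Fields.Dm (φ : Fields B) (W : Worldsheet B) (X : SMat B) : SMat B :=
  X.map W.dMinus + comm (proj 0 (φ.Am W)) X - comm φ.Nm X

/-- `RΛ(ε)`, `Λ(ε) = g⁻¹ (ελ₃ - ελ₁) g`. -/
def Fields.RLam (φ : Fields B) (R : psl →ₗ[ℂ] psl) (ε : B) : SMat B :=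
  extend R (φ.AdInv (ε • φ.lam3 - ε • φ.lam1))

/-- The BRST variation `εQ₀` of the fields. -/
def Fields.Q0 (φ : Fields B) (W : Worldsheet B) (ε : B) : Fields B where
  g := (ε • φ.lam1 + ε • φ.lam3) * φ.g
  lam1 := 0
  lam3 := 0
  om1 := -(ε • (proj 1 (φ.Ap W) + φ.ast1))
  om3 := -(ε • (proj 3 (φ.Am W) + φ.ast3))
  ast1 := φ.Dp W (ε • φ.lam1)
  ast3 := φ.Dm W (ε • φ.lam3)

/-- The BRST variation `εQ₁` of the fields. -/
def Fields.Q1 (φ : Fields B) (W : Worldsheet B) (R : psl →ₗ[ℂ] psl) (ε : B) : Fields B where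
  g := φ.g * φ.RLam R ε
  lam1 := 0
  lam3 := 0
  om1 := 0
  om3 := 0
  ast1 := φ.P13 (φ.Ad ((φ.RLam R ε).map W.dPlus))
  ast3 := φ.P31 (φ.Ad ((φ.RLam R ε).map W.dMinus))

/-- The variation `εQₙ`, where `Qₙ` is the coefficient of `ηⁿ` in the BRST charge: the expansion
stops at first order. -/
def Fields.Q (φ : Fields B) (W : Worldsheet B) (R : psl →ₗ[ℂ] psl) (ε : B) : ℕ → Fields B
  | 0 => φ.Q0 W ε
  | 1 => φ.Q1 W R ε
  | _ + 2 => 0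

/-- The BRST transformation `φ ↦ φ + ε(Q₀ + ηQ₁)φ`. -/
def Fields.brst (φ : Fields B) (W : Worldsheet B) (R : psl →ₗ[ℂ] psl) (η : ℂ) (ε : B) :
    Fields B :=
  φ + (φ.Q W R ε 0 + η • φ.Q W R ε 1)

/-- The infinitesimal gauge transformations: local Lorentz transformations with parameter `θ` of
degree zero; `δg = z g` with a function `z`, which is trivial in `PSL(4|4)`; and the shifts
`δω₁₊ = [λ₃, u]`, `δω₃₋ = [λ₁, v]`, with `u, v` of degree two, which come from the pure spinor
constraints. -/
def Fields.gauge (φ : Fields B) (θ : SMat B) (z : B) (u v : SMat B) : Fields B where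
  g := (θ + Matrix.scalar (Fin 4 ⊕ Fin 4) z) * φ.g
  lam1 := comm θ φ.lam1
  lam3 := comm θ φ.lam3
  om1 := comm θ φ.om1 + comm φ.lam3 u
  om3 := comm θ φ.om3 + comm φ.lam1 v
  ast1 := comm θ φ.ast1
  ast3 := comm θ φ.ast3

end Fields

/-! ### Superfields on a torus -/

/-- The smooth functions of the light-cone coordinates `(σ⁺, σ⁻)` with periods `p` and `q`. -/
def torusFunctions (p q : ℝ × ℝ) : Subalgebra ℂ (ℝ × ℝ → ℂ) where
  carrier := {f | ContDiff ℝ ∞ f ∧ (∀ x, f (x + p) = f x) ∧ ∀ x, f (x + q) = f x}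
  mul_mem' := by
    rintro f h ⟨hf, hf1, hf2⟩ ⟨hh, hh1, hh2⟩
    exact ⟨hf.mul hh, fun x => by simp [hf1, hh1], fun x => by simp [hf2, hh2]⟩
  add_mem' := by
    rintro f h ⟨hf, hf1, hf2⟩ ⟨hh, hh1, hh2⟩
    exact ⟨hf.add hh, fun x => by simp [hf1, hh1], fun x => by simp [hf2, hh2]⟩
  algebraMap_mem' := fun c =>
    ⟨(contDiff_const : ContDiff ℝ ∞ fun _ : ℝ × ℝ => c), fun _ => rfl, fun _ => rfl⟩

theorem torusFunctions_differentiable {p q : ℝ × ℝ} (f : torusFunctions p q) :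
    Differentiable ℝ (f : ℝ × ℝ → ℂ) :=
  f.2.1.differentiable (by simp)

/-- The derivative in the direction `w`. -/
def torusDeriv (p q w : ℝ × ℝ) : torusFunctions p q →ₗ[ℂ] torusFunctions p q where
  toFun f := ⟨fun x => fderiv ℝ (f : ℝ × ℝ → ℂ) x w,
    (f.2.1.fderiv_right (m := ∞) (by simp)).clm_apply contDiff_const,
    fun x => by
      have h : fderiv ℝ (fun y => (f : ℝ × ℝ → ℂ) (y + p)) x = fderiv ℝ (f : ℝ × ℝ → ℂ) (x + p) :=
        fderiv_comp_add_right p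
      rw [show (fun y => (f : ℝ × ℝ → ℂ) (y + p)) = f from funext f.2.2.1] at h
      exact (congrArg (fun L => L w) h).symm,
    fun x => by
      have h : fderiv ℝ (fun y => (f : ℝ × ℝ → ℂ) (y + q)) x = fderiv ℝ (f : ℝ × ℝ → ℂ) (x + q) :=
        fderiv_comp_add_right q
      rw [show (fun y => (f : ℝ × ℝ → ℂ) (y + q)) = f from funext f.2.2.2] at h
      exact (congrArg (fun L => L w) h).symm⟩
  map_add' f h := by
    ext x
    have := fderiv_add (𝕜 := ℝ) (x := x) (torusFunctions_differentiable f x)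
      (torusFunctions_differentiable h x)
    simpa using congrArg (fun L => L w) this
  map_smul' c f := by
    ext x
    have := fderiv_const_smul (𝕜 := ℝ) (x := x) (torusFunctions_differentiable f x) c
    simpa using congrArg (fun L => L w) this

/-- The integral over the torus, `dσ⁺ dσ⁻` being pulled back to the unit square along
`(s, t) ↦ s p + t q`. -/
def torusIntegral (p q : ℝ × ℝ) : torusFunctions p q →ₗ[ℂ] ℂ where
  toFun f := ((|p.1 * q.2 - p.2 * q.1| : ℝ) : ℂ) *
    ∫ x in Set.Icc ((0, 0) : ℝ × ℝ) (1, 1), (f : ℝ × ℝ → ℂ) (x.1 • p + x.2 • q)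
  map_add' f h := by
    have hc : ∀ f : torusFunctions p q, MeasureTheory.IntegrableOn
        (fun x : ℝ × ℝ => (f : ℝ × ℝ → ℂ) (x.1 • p + x.2 • q)) (Set.Icc (0, 0) (1, 1)) :=
      fun f => ((torusFunctions_differentiable f).continuous.comp
        (by fun_prop)).continuousOn.integrableOn_compact isCompact_Icc
    rw [← mul_add, ← MeasureTheory.integral_add (hc f) (hc h)]
    rfl
  map_smul' c f := by
    have := MeasureTheory.integral_const_mul
      (μ := MeasureTheory.volume.restrict (Set.Icc ((0, 0) : ℝ × ℝ) (1, 1))) c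
      (fun x : ℝ × ℝ => (f : ℝ × ℝ → ℂ) (x.1 • p + x.2 • q))
    simp only [RingHom.id_apply, smul_eq_mul]
    rw [mul_left_comm, ← this]
    rfl

/-- The Grassmann algebra with `N` generators. -/
abbrev Grassmann (N : ℕ) := ExteriorAlgebra ℂ (Fin N → ℂ)

/-- The parity automorphism of the Grassmann algebra. -/
def grassmannParity (N : ℕ) : Grassmann N →ₐ[ℂ] Grassmann N := CliffordAlgebra.involute

/-- Superfields on the torus: smooth functions with values in a Grassmann algebra. -/
def TorusFields (p q : ℝ × ℝ) (N : ℕ) := torusFunctions p q ⊗[ℂ] Grassmann N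

instance (p q : ℝ × ℝ) (N : ℕ) : Ring (TorusFields p q N) :=
  inferInstanceAs (Ring (torusFunctions p q ⊗[ℂ] Grassmann N))

instance (p q : ℝ × ℝ) (N : ℕ) : Algebra ℂ (TorusFields p q N) :=
  inferInstanceAs (Algebra ℂ (torusFunctions p q ⊗[ℂ] Grassmann N))

/-- The superfield `f u`, for a function `f` and an element `u` of the Grassmann algebra. -/
def TorusFields.mk {p q : ℝ × ℝ} {N : ℕ} (f : torusFunctions p q) (u : Grassmann N) :
    TorusFields p q N := f ⊗ₜ[ℂ] u

theorem TorusFields.mk_mul {p q : ℝ × ℝ} {N : ℕ} (f h : torusFunctions p q)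
    (u v : Grassmann N) : mk f u * mk h v = mk (f * h) (u * v) :=
  Algebra.TensorProduct.tmul_mul_tmul f h u v

theorem TorusFields.induction {p q : ℝ × ℝ} {N : ℕ} {motive : TorusFields p q N → Prop}
    (zero : motive 0) (mk : ∀ f u, motive (TorusFields.mk f u))
    (add : ∀ x y, motive x → motive y → motive (x + y)) (a : TorusFields p q N) : motive a :=
  TensorProduct.induction_on a zero mk add

theorem grassmannParity_ι (N : ℕ) (v : Fin N → ℂ) :
    grassmannParity N (ExteriorAlgebra.ι ℂ v) = -ExteriorAlgebra.ι ℂ v :=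
  CliffordAlgebra.involute_ι v

theorem grassmannParity_parity (N : ℕ) (u : Grassmann N) :
    grassmannParity N (grassmannParity N u) = u :=
  CliffordAlgebra.involute_involute u

theorem ι_mul_grassmann (N : ℕ) (v : Fin N → ℂ) (y : Grassmann N) :
    ExteriorAlgebra.ι ℂ v * y = grassmannParity N y * ExteriorAlgebra.ι ℂ v := by
  induction y using ExteriorAlgebra.induction with
  | algebraMap r => rw [AlgHom.commutes]; exact (Algebra.commutes r _).symm
  | ι w =>
    rw [grassmannParity_ι, neg_mul, eq_neg_iff_add_eq_zero]
    exact ExteriorAlgebra.ι_add_mul_swap v w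
  | mul a b ha hb => rw [map_mul, ← mul_assoc, ha, mul_assoc, hb, mul_assoc]
  | add a b ha hb => rw [map_add, mul_add, ha, hb, add_mul]

theorem grassmann_mul_comm (N : ℕ) (u : Grassmann N) : ∀ y : Grassmann N,
    (u + grassmannParity N u) * y = y * (u + grassmannParity N u) ∧
    (u - grassmannParity N u) * y = grassmannParity N y * (u - grassmannParity N u) := by
  induction u using CliffordAlgebra.left_induction with
  | algebraMap r =>
    intro y
    have h : grassmannParity N (algebraMap ℂ _ r) = algebraMap ℂ _ r := AlgHom.commutes _ r
    erw [h]
    refine ⟨?_, by simp⟩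
    rw [← map_add]
    exact Algebra.commutes _ _
  | add a b ha hb =>
    intro y
    obtain ⟨h1, h2⟩ := ha y
    obtain ⟨h3, h4⟩ := hb y
    constructor
    · have e : a + b + grassmannParity N (a + b) =
          (a + grassmannParity N a) + (b + grassmannParity N b) := by rw [map_add]; abel
      rw [e, add_mul, mul_add, h1, h3]
    · have e : a + b - grassmannParity N (a + b) =
          (a - grassmannParity N a) + (b - grassmannParity N b) := by rw [map_add]; abel
      rw [e, add_mul, mul_add, h2, h4]
  | ι_mul a v ha =>
    intro y
    have e0 : grassmannParity N (ExteriorAlgebra.ι ℂ v * a) =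
        -(ExteriorAlgebra.ι ℂ v * grassmannParity N a) := by
      rw [map_mul, grassmannParity_ι, neg_mul]
    have h1 := (ha y).1
    have h2 := (ha y).2
    have hv := ι_mul_grassmann N v (grassmannParity N y)
    rw [grassmannParity_parity] at hv
    constructor
    · have e : ExteriorAlgebra.ι ℂ v * a + grassmannParity N (ExteriorAlgebra.ι ℂ v * a) =
          ExteriorAlgebra.ι ℂ v * (a - grassmannParity N a) := by
        rw [e0, mul_sub, sub_eq_add_neg]
      erw [e]
      rw [mul_assoc, h2, ← mul_assoc, hv, mul_assoc]
    · have e : ExteriorAlgebra.ι ℂ v * a - grassmannParity N (ExteriorAlgebra.ι ℂ v * a) =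
          ExteriorAlgebra.ι ℂ v * (a + grassmannParity N a) := by
        rw [e0, mul_add, sub_neg_eq_add]
      erw [e]
      rw [mul_assoc, h1, ← mul_assoc, ι_mul_grassmann N v y, mul_assoc]

/-- The parity automorphism of the superfields on the torus. -/
def torusParity (p q : ℝ × ℝ) (N : ℕ) : TorusFields p q N →ₐ[ℂ] TorusFields p q N :=
  (Algebra.TensorProduct.map (AlgHom.id ℂ (torusFunctions p q)) (grassmannParity N) :
    torusFunctions p q ⊗[ℂ] Grassmann N →ₐ[ℂ] torusFunctions p q ⊗[ℂ] Grassmann N)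

theorem torus_mul_comm (p q : ℝ × ℝ) (N : ℕ) (a b : TorusFields p q N) :
    (a + torusParity p q N a) * b = b * (a + torusParity p q N a) ∧
    (a - torusParity p q N a) * b = torusParity p q N b * (a - torusParity p q N a) := by
  induction a using TorusFields.induction with
  | zero => simp
  | add x y hx hy =>
    have e1 : x + y + torusParity p q N (x + y) =
        (x + torusParity p q N x) + (y + torusParity p q N y) := by rw [map_add]; abel
    have e2 : x + y - torusParity p q N (x + y) =
        (x - torusParity p q N x) + (y - torusParity p q N y) := by rw [map_add]; abel
    rw [e1, e2]
    exact ⟨by rw [add_mul, mul_add, hx.1, hy.1], by rw [add_mul, mul_add, hx.2, hy.2]⟩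
  | mk f u =>
    induction b using TorusFields.induction with
    | zero => simp
    | add x y hx hy =>
      exact ⟨by rw [mul_add, hx.1, hy.1, add_mul], by rw [mul_add, hx.2, hy.2, map_add, add_mul]⟩
    | mk h w =>
      obtain ⟨h1, h2⟩ := grassmann_mul_comm N u w
      have e1 : TorusFields.mk f u + torusParity p q N (TorusFields.mk f u) =
          TorusFields.mk f (u + grassmannParity N u) := (TensorProduct.tmul_add _ _ _).symm
      have e2 : TorusFields.mk f u - torusParity p q N (TorusFields.mk f u) =
          TorusFields.mk f (u - grassmannParity N u) := (TensorProduct.tmul_sub _ _ _).symm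
      have e3 : torusParity p q N (TorusFields.mk h w) =
          TorusFields.mk h (grassmannParity N w) := rfl
      rw [e1, e2, e3]
      simp only [TorusFields.mk_mul, h1, h2, mul_comm f h, and_self]

theorem torusDeriv_mul (p q w : ℝ × ℝ) (f h : torusFunctions p q) :
    torusDeriv p q w (f * h) = torusDeriv p q w f * h + f * torusDeriv p q w h := by
  ext x
  have := fderiv_mul (𝕜 := ℝ) (torusFunctions_differentiable f x)
    (torusFunctions_differentiable h x)
  have := congrArg (fun L => L w) this
  change fderiv ℝ ((f : ℝ × ℝ → ℂ) * (h : ℝ × ℝ → ℂ)) x w =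
    fderiv ℝ (f : ℝ × ℝ → ℂ) x w * (h : ℝ × ℝ → ℂ) x +
      (f : ℝ × ℝ → ℂ) x * fderiv ℝ (h : ℝ × ℝ → ℂ) x w
  rw [this]
  change (f : ℝ × ℝ → ℂ) x * fderiv ℝ (h : ℝ × ℝ → ℂ) x w +
    (h : ℝ × ℝ → ℂ) x * fderiv ℝ (f : ℝ × ℝ → ℂ) x w = _
  ring

theorem torusDeriv_comm (p q v w : ℝ × ℝ) (f : torusFunctions p q) :
    torusDeriv p q v (torusDeriv p q w f) = torusDeriv p q w (torusDeriv p q v f) := by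
  ext x
  have hd : DifferentiableAt ℝ (fderiv ℝ (f : ℝ × ℝ → ℂ)) x :=
    ((f.2.1.fderiv_right (m := 1) (by norm_cast)).differentiable (by simp)) x
  have key : ∀ v w : ℝ × ℝ, fderiv ℝ (fun y => fderiv ℝ (f : ℝ × ℝ → ℂ) y w) x v =
      fderiv ℝ (fderiv ℝ (f : ℝ × ℝ → ℂ)) x v w := by
    intro v w
    rw [fderiv_clm_apply hd (differentiableAt_const w)]
    simp
  change fderiv ℝ (fun y => fderiv ℝ (f : ℝ × ℝ → ℂ) y w) x v =
    fderiv ℝ (fun y => fderiv ℝ (f : ℝ × ℝ → ℂ) y v) x w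
  rw [key, key]
  exact (f.2.1.contDiffAt.isSymmSndFDerivAt (by rw [minSmoothness_of_isRCLikeNormedField]; norm_cast)) v w

/-- The derivative of superfields on the torus in the direction `w`. -/
def torusFieldDeriv (p q : ℝ × ℝ) (N : ℕ) (w : ℝ × ℝ) :
    TorusFields p q N →ₗ[ℂ] TorusFields p q N :=
  (LinearMap.rTensor (Grassmann N) (torusDeriv p q w) :
    torusFunctions p q ⊗[ℂ] Grassmann N →ₗ[ℂ] torusFunctions p q ⊗[ℂ] Grassmann N)

theorem torusFieldDeriv_mul (p q : ℝ × ℝ) (N : ℕ) (w : ℝ × ℝ) (a b : TorusFields p q N) :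
    torusFieldDeriv p q N w (a * b) =
      torusFieldDeriv p q N w a * b + a * torusFieldDeriv p q N w b := by
  induction a using TorusFields.induction with
  | zero => simp
  | add x y hx hy => rw [add_mul, map_add, hx, hy, map_add, add_mul, add_mul]; abel
  | mk f u =>
    induction b using TorusFields.induction with
    | zero => simp
    | add x y hx hy => rw [mul_add, map_add, hx, hy, map_add, mul_add, mul_add]; abel
    | mk h v =>
      have e : ∀ (k : torusFunctions p q) (x : Grassmann N), torusFieldDeriv p q N w
          (TorusFields.mk k x) = TorusFields.mk (torusDeriv p q w k) x := fun _ _ => rfl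
      simp only [TorusFields.mk_mul, e, torusDeriv_mul]
      exact TensorProduct.add_tmul _ _ _

theorem torusParity_deriv (p q : ℝ × ℝ) (N : ℕ) (w : ℝ × ℝ) (a : TorusFields p q N) :
    torusParity p q N (torusFieldDeriv p q N w a) =
      torusFieldDeriv p q N w (torusParity p q N a) := by
  induction a using TorusFields.induction with
  | zero => simp
  | add x y hx hy => simp only [map_add, hx, hy]
  | mk f u => rfl

theorem anticomm_of_parity {B : Type*} [Ring B] [Algebra ℂ B] (P : B →ₐ[ℂ] B) {a b : B}
    (ha : P a = -a) (hb : P b = -b) (h : (a - P a) * b = P b * (a - P a)) :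
    a * b = -(b * a) := by
  rw [ha, hb, sub_neg_eq_add, ← two_smul ℂ a, smul_mul_assoc, mul_smul_comm, neg_mul] at h
  exact smul_right_injective _ (two_ne_zero' ℂ) h

/-- The superfields on the torus with the light-cone derivatives `∂₊, ∂₋`. -/
def torus (p q : ℝ × ℝ) (N : ℕ) : Worldsheet (TorusFields p q N) where
  parity := torusParity p q N
  parity_parity a := by
    induction a using TorusFields.induction with
    | zero => simp
    | add x y hx hy => rw [map_add, map_add, hx, hy]
    | mk f u =>
      exact congrArg (TorusFields.mk f) (grassmannParity_parity N u)
  even_comm a b ha := by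
    have h := (torus_mul_comm p q N a b).1
    rw [ha, ← two_smul ℂ a, smul_mul_assoc, mul_smul_comm] at h
    exact smul_right_injective _ (two_ne_zero' ℂ) h
  odd_anticomm a b ha hb :=
    anticomm_of_parity (torusParity p q N) ha hb (torus_mul_comm p q N a b).2
  dPlus := torusFieldDeriv p q N (1, 0)
  dMinus := torusFieldDeriv p q N (0, 1)
  dPlus_mul := torusFieldDeriv_mul p q N (1, 0)
  dMinus_mul := torusFieldDeriv_mul p q N (0, 1)
  parity_dPlus := torusParity_deriv p q N (1, 0)
  parity_dMinus := torusParity_deriv p q N (0, 1)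
  dPlus_dMinus a := by
    induction a using TorusFields.induction with
    | zero => simp
    | add x y hx hy => simp only [map_add, hx, hy]
    | mk f u =>
      exact congrArg (fun k => TorusFields.mk k u) (torusDeriv_comm p q (1, 0) (0, 1) f)

/-- The coefficient of `ηⁿ` in the action `S_def` on the torus, with values in the Grassmann
algebra. -/
def torusAction (p q : ℝ × ℝ) (N : ℕ) (R : psl →ₗ[ℂ] psl) (n : ℕ)
    (φ : Fields (TorusFields p q N)) : Grassmann N :=
  TensorProduct.lid ℂ (Grassmann N)
    (LinearMap.rTensor (Grassmann N) (torusIntegral p q) (φ.Ldef (torus p q N) R n))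

end PureSpinor

end

/-!
The theorem rests on four facts.

*The ghost projectors.* For pure spinors `l`, `m` of opposite odd degrees with `Str (l m)`
invertible, the condition `{m, y + [l, S₂]} = 0` in `psl` has the explicit solution
`S₂ = 2 Str (l m)⁻¹ σ {m, y}`, where `σ = diag (1, -1)`. Indeed a `4 × 4` matrix `P` which is
symmetric for the symplectic transpose is a combination of the identity and five gamma matrices, so
that two of them satisfy a Clifford relation (`clifford`), and this yields
`{m, [l, σT]} = -½ Str (l m) T` for `T = {m, y}` (`GhostPair.acomm_comm_sig`). Uniqueness follows by
duality with respect to the supertrace form (`GhostPair.unique`).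

*One chirality at a time.* The fields `(g, λ₁, λ₃, ω₁₊, ω*₁₊)` with `∂₊`, and
`(g, λ₃, λ₁, ω₃₋, ω*₃₋)` with `∂₋`, are two instances of one structure, `Sector`. A BRST
transformation acts on either by `g ↦ (1 + V) g` and by shifts of the momentum and of the antifield
(`Sector.vary`). All of these are multiples of an odd `ε`, so the change of any expression is exactly
its first-order variation. The group `SL(4|4)` is preserved because the Berezinian of `1 + Z` is
`1 + Str Z` to first order (`IsSL.translate`), and the currents are in `sl(4|4)` because a derivation
maps the Berezinian to the supertrace (`IsSL.str_inverse_mul_map`).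

*Invariance.* Let `j` be the current of one chirality in the frame of the right action,
`𝒦 = Ad_g⁻¹ (d - 4 𝒫) Ad_g` and `Y = RΛ(ε)`. Up to the sign of `Λ`, the charge `Q₀` changes `j` by `∂Λ`
(`Sector.Ok.v0_j`) and `𝒦` by `-[Λ, ·]` (`Sector.Ok.v0_K`, from `Sector.Ok.O_comm`), while `Q₁`
changes `j` by `-𝒦 ∂Y - [Y, j]` and `𝒦` by `[𝒦, [Y, ·]]` (`Sector.Ok.v1_j`, `Sector.Ok.v1_K`). With
the classical Yang-Baxter equation for superfields (`SolvesCYBE.comm_extend`) these combine to a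
recursion for the currents `w n = (𝒦R)ⁿ j` of the series: the `Q₀` variation of `R (w (n + 1))` and
the `Q₁` variation of `R (w n)` add up to `[R (w n), Y]` (`Sector.Ok.w_rec`,
`Sector.Ok.extend_comm_of`). The operators `𝒦` of the two chiralities are transposed to each other and
`R` is antisymmetric, so from order two on the variations of the Lagrangian cancel identically
(`Fields.invariance_add_two`). Order one needs, besides, the `Q₁` variation of the undeformed
Lagrangian (`Fields.L0_v1`). Order zero is a total derivative because the connection `-dg g⁻¹` is flat
(`Fields.invariance_zero`), and total derivatives integrate to zero over a torus
(`torusIntegral_deriv`).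

*Nilpotency.* The change of `RΛ(ε)` under the transformation with parameter `ε'`, antisymmetrized
in the two parameters, is `η [RΛ(ε), RΛ(ε')]` by the Yang-Baxter equation (`Fields.varyRLam_sub`).
It cancels the commutator of the two deformed right translations of `g`, and what is left of the
commutator of two transformations is the Lorentz transformation with parameter `2εε'{λ₁, λ₃}`, up to
an element of the centre of `sl(4|4)` (`IsSl.exists_eq_add_scalar`), which is the scalar function `z`
(`Fields.group_commutator`). The antifields close without further terms
(`Sector.Ok.antifield_commutator`), and the momenta close up to shifts `[m, S₂]`, which come from the
ghost projectors (`Sector.Ok.momentum_commutator`).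
-/

open scoped TensorProduct ContDiff

set_option linter.unusedSectionVars false

noncomputable section

namespace PureSpinor

/-! ### Linearity of the elementary operations on supermatrices -/

section Linear

variable {B : Type*} [Ring B] [Algebra ℂ B]

/-- The grading matrix `diag(1, -1)`. -/
def sig (B : Type*) [Ring B] : SMat B := Matrix.fromBlocks 1 0 0 (-1)

theorem sig_mul_sig : sig B * sig B = 1 := by
  simp [sig, Matrix.fromBlocks_multiply]

/-- The operation `M ↦ K Mᵗ K` on `4 × 4` matrices, in terms of which `Ω` acts on the blocks of a
supermatrix; as `K⁻¹ = -K`, it is minus the symplectic transpose. -/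
def kflip (M : Matrix (Fin 4) (Fin 4) B) : Matrix (Fin 4) (Fin 4) B :=
  symplectic B * M.transpose * symplectic B

theorem kflip_eq (M : Matrix (Fin 4) (Fin 4) B) : kflip M =
    !![-M 1 1, M 0 1, -M 3 1, M 2 1; M 1 0, -M 0 0, M 3 0, -M 2 0;
      -M 1 3, M 0 3, -M 3 3, M 2 3; M 1 2, -M 0 2, M 3 2, -M 2 2] := by
  ext i j
  fin_cases i <;> fin_cases j <;>
    (simp only [kflip, Matrix.mul_apply, Fin.sum_univ_four, Matrix.transpose_apply]
     simp [symplectic])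

theorem omega_fromBlocks (a b c d : Matrix (Fin 4) (Fin 4) B) :
    omega (Matrix.fromBlocks a b c d) =
      Matrix.fromBlocks (kflip a) (-kflip c) (kflip b) (kflip d) := by
  simp [omega, superTranspose, kflip, Matrix.fromBlocks_multiply]

theorem tracelessPart_fromBlocks (a b c d : Matrix (Fin 4) (Fin 4) B) :
    tracelessPart (Matrix.fromBlocks a b c d) =
      Matrix.fromBlocks (a - Matrix.scalar (Fin 4) ((1 / 4 : ℂ) • a.trace)) b
        c (d - Matrix.scalar (Fin 4) ((1 / 4 : ℂ) • d.trace)) := by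
  simp [tracelessPart]

theorem str_fromBlocks (a b c d : Matrix (Fin 4) (Fin 4) B) :
    str (Matrix.fromBlocks a b c d) = a.trace - d.trace := by
  simp [str]

theorem kflip_map (f : B →ₗ[ℂ] B) (M : Matrix (Fin 4) (Fin 4) B) :
    kflip (M.map f) = (kflip M).map f := by
  rw [kflip_eq, kflip_eq]
  ext i j
  fin_cases i <;> fin_cases j <;> simp

theorem kflip_add (M N : Matrix (Fin 4) (Fin 4) B) : kflip (M + N) = kflip M + kflip N := by
  simp [kflip, mul_add, add_mul]

theorem kflip_smul (c : ℂ) (M : Matrix (Fin 4) (Fin 4) B) : kflip (c • M) = c • kflip M := by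
  simp [kflip]

theorem kflip_kflip (M : Matrix (Fin 4) (Fin 4) B) : kflip (kflip M) = M := by
  rw [kflip_eq, kflip_eq]
  ext i j
  fin_cases i <;> fin_cases j <;> simp

theorem trace_kflip (M : Matrix (Fin 4) (Fin 4) B) : (kflip M).trace = -M.trace := by
  rw [kflip_eq]
  simp [Matrix.trace, Fin.sum_univ_four]
  abel

theorem trace_map {A : Type*} [Ring A] [Algebra ℂ A] (f : A →ₗ[ℂ] B)
    (M : Matrix (Fin 4) (Fin 4) A) :
    (M.map f).trace = f M.trace := by
  simp [Matrix.trace, map_sum]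

theorem str_map {A : Type*} [Ring A] [Algebra ℂ A] (f : A →ₗ[ℂ] B) (X : SMat A) :
    str (X.map f) = f (str X) := by
  rw [← Matrix.fromBlocks_toBlocks X, Matrix.fromBlocks_map, str_fromBlocks, str_fromBlocks,
    trace_map, trace_map, map_sub]

theorem omega_map (f : B →ₗ[ℂ] B) (X : SMat B) : omega (X.map f) = (omega X).map f := by
  rw [← Matrix.fromBlocks_toBlocks X, Matrix.fromBlocks_map, omega_fromBlocks, omega_fromBlocks,
    Matrix.fromBlocks_map]
  simp only [kflip_map]
  congr 1
  ext i j; simp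

theorem tracelessPart_map {A : Type*} [Ring A] [Algebra ℂ A] (f : A →ₗ[ℂ] B)
    (X : SMat A) :
    tracelessPart (X.map f) = (tracelessPart X).map f := by
  rw [← Matrix.fromBlocks_toBlocks X, Matrix.fromBlocks_map, tracelessPart_fromBlocks,
    tracelessPart_fromBlocks, Matrix.fromBlocks_map]
  simp only [trace_map, ← map_smul]
  congr 1
  · ext i j; by_cases h : i = j <;> simp [Matrix.scalar_apply, h]
  · ext i j; by_cases h : i = j <;> simp [Matrix.scalar_apply, h]

/-- `omega` as a linear map. -/
def omegaLin : SMat B →ₗ[ℂ] SMat B where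
  toFun := omega
  map_add' X Y := by
    rw [← Matrix.fromBlocks_toBlocks X, ← Matrix.fromBlocks_toBlocks Y, Matrix.fromBlocks_add]
    simp only [omega_fromBlocks, kflip_add, Matrix.fromBlocks_add, neg_add]
  map_smul' c X := by
    rw [← Matrix.fromBlocks_toBlocks X, Matrix.fromBlocks_smul]
    simp only [omega_fromBlocks, kflip_smul, Matrix.fromBlocks_smul, smul_neg, RingHom.id_apply]

/-- `tracelessPart` as a linear map. -/
def tracelessLin : SMat B →ₗ[ℂ] SMat B where
  toFun := tracelessPart
  map_add' X Y := by
    rw [← Matrix.fromBlocks_toBlocks X, ← Matrix.fromBlocks_toBlocks Y, Matrix.fromBlocks_add]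
    simp only [tracelessPart_fromBlocks, Matrix.fromBlocks_add, Matrix.trace_add, smul_add,
      map_add]
    congr 1 <;> abel
  map_smul' c X := by
    rw [← Matrix.fromBlocks_toBlocks X, Matrix.fromBlocks_smul]
    simp only [tracelessPart_fromBlocks, Matrix.fromBlocks_smul, Matrix.trace_smul,
      RingHom.id_apply, smul_sub]
    congr 2
    · rw [smul_comm]; ext i j; by_cases h : i = j <;> simp [Matrix.scalar_apply, h]
    · rw [smul_comm]; ext i j; by_cases h : i = j <;> simp [Matrix.scalar_apply, h]

theorem tracelessLin_apply (X : SMat B) : tracelessLin X = tracelessPart X := rfl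

/-- `proj k` as a linear map. -/
def projLin (k : ℕ) : SMat B →ₗ[ℂ] SMat B :=
  tracelessLin ∘ₗ ((1 / 4 : ℂ) • ∑ j ∈ Finset.range 4, (Complex.I ^ (3 * k * j)) • omegaLin ^ j)

theorem projLin_apply (k : ℕ) (X : SMat B) : projLin k X = proj k X := by
  simp only [projLin, proj, LinearMap.comp_apply, LinearMap.smul_apply, LinearMap.sum_apply,
    tracelessLin_apply, Module.End.pow_apply]
  rfl

theorem tracelessPart_add (X Y : SMat B) :
    tracelessPart (X + Y) = tracelessPart X + tracelessPart Y := map_add tracelessLin X Y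
theorem tracelessPart_sub (X Y : SMat B) :
    tracelessPart (X - Y) = tracelessPart X - tracelessPart Y := map_sub tracelessLin X Y
theorem tracelessPart_neg (X : SMat B) :
    tracelessPart (-X) = -tracelessPart X := map_neg tracelessLin X
theorem tracelessPart_smul (c : ℂ) (X : SMat B) :
    tracelessPart (c • X) = c • tracelessPart X := map_smul tracelessLin c X
theorem tracelessPart_zero : tracelessPart (0 : SMat B) = 0 := map_zero tracelessLin
theorem omega_add (X Y : SMat B) : omega (X + Y) = omega X + omega Y := map_add omegaLin X Y
theorem omega_sub (X Y : SMat B) : omega (X - Y) = omega X - omega Y := map_sub omegaLin X Y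
theorem omega_neg (X : SMat B) : omega (-X) = -omega X := map_neg omegaLin X
theorem omega_smul (c : ℂ) (X : SMat B) : omega (c • X) = c • omega X := map_smul omegaLin c X
theorem omega_zero : omega (0 : SMat B) = 0 := map_zero omegaLin
theorem proj_add (k : ℕ) (X Y : SMat B) : proj k (X + Y) = proj k X + proj k Y := by
  simp only [← projLin_apply, map_add]
theorem proj_sub (k : ℕ) (X Y : SMat B) : proj k (X - Y) = proj k X - proj k Y := by
  simp only [← projLin_apply, map_sub]
theorem proj_neg (k : ℕ) (X : SMat B) : proj k (-X) = -proj k X := by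
  simp only [← projLin_apply, map_neg]
theorem proj_smul (k : ℕ) (c : ℂ) (X : SMat B) : proj k (c • X) = c • proj k X := by
  simp only [← projLin_apply, map_smul]
theorem proj_zero (k : ℕ) : proj k (0 : SMat B) = 0 := by
  simp only [← projLin_apply, map_zero]
theorem str_add (X Y : SMat B) : str (X + Y) = str X + str Y := by
  simp only [str, Matrix.trace, Matrix.diag, Matrix.toBlocks₁₁, Matrix.toBlocks₂₂,
    Matrix.of_apply, Matrix.add_apply, Finset.sum_add_distrib]
  abel
theorem str_neg (X : SMat B) : str (-X) = -str X := by
  simp only [str, Matrix.trace, Matrix.diag, Matrix.toBlocks₁₁, Matrix.toBlocks₂₂,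
    Matrix.of_apply, Matrix.neg_apply, Finset.sum_neg_distrib]
  abel
theorem str_sub (X Y : SMat B) : str (X - Y) = str X - str Y := by
  rw [sub_eq_add_neg, str_add, str_neg, sub_eq_add_neg]
theorem str_smul (c : ℂ) (X : SMat B) : str (c • X) = c • str X := by
  simp only [str, Matrix.trace, Matrix.diag, Matrix.toBlocks₁₁, Matrix.toBlocks₂₂,
    Matrix.of_apply, Matrix.smul_apply, ← Finset.smul_sum, smul_sub]
theorem str_zero : str (0 : SMat B) = 0 := by
  have := str_smul 0 (0 : SMat B); simpa using this
theorem str_bsmul (e : B) (X : SMat B) : str (e • X) = e * str X := by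
  simp only [str, Matrix.trace, Matrix.diag, Matrix.toBlocks₁₁, Matrix.toBlocks₂₂,
    Matrix.of_apply, Matrix.smul_apply, mul_sub, smul_eq_mul, Finset.mul_sum]

theorem comm_add (X Y Z : SMat B) : comm X (Y + Z) = comm X Y + comm X Z := by
  simp only [comm, mul_add, add_mul]; abel
theorem comm_sub (X Y Z : SMat B) : comm X (Y - Z) = comm X Y - comm X Z := by
  simp only [comm, mul_sub, sub_mul]; abel
theorem comm_smul (c : ℂ) (X Y : SMat B) : comm X (c • Y) = c • comm X Y := by
  simp only [comm, mul_smul_comm, smul_mul_assoc, smul_sub]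
theorem comm_zero (X : SMat B) : comm X 0 = 0 := by simp [comm]
theorem add_comm' (X Y Z : SMat B) : comm (X + Y) Z = comm X Z + comm Y Z := by
  simp only [comm, mul_add, add_mul]; abel
theorem sub_comm' (X Y Z : SMat B) : comm (X - Y) Z = comm X Z - comm Y Z := by
  simp only [comm, mul_sub, sub_mul]; abel
theorem neg_comm' (X Y : SMat B) : comm (-X) Y = -comm X Y := by
  simp only [comm, mul_neg, neg_mul]; abel
theorem smul_comm' (c : ℂ) (X Y : SMat B) : comm (c • X) Y = c • comm X Y := by
  simp only [comm, mul_smul_comm, smul_mul_assoc, smul_sub]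
theorem zero_comm' (X : SMat B) : comm 0 X = 0 := by simp [comm]
theorem comm_swap (X Y : SMat B) : comm X Y = -comm Y X := by simp [comm]
theorem acomm_swap (X Y : SMat B) : acomm X Y = acomm Y X := by simp [acomm, add_comm]
theorem acomm_add (X Y Z : SMat B) : acomm X (Y + Z) = acomm X Y + acomm X Z := by
  simp only [acomm, mul_add, add_mul]; abel
theorem acomm_sub (X Y Z : SMat B) : acomm X (Y - Z) = acomm X Y - acomm X Z := by
  simp only [acomm, mul_sub, sub_mul]; abel
theorem acomm_smul (c : ℂ) (X Y : SMat B) : acomm X (c • Y) = c • acomm X Y := by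
  simp only [acomm, mul_smul_comm, smul_mul_assoc, smul_add]

/-- Leibniz' rule for the entrywise action of a derivation on a product of matrices. -/
theorem map_mul_of_leibniz {n : Type*} [Fintype n] (f : B →ₗ[ℂ] B)
    (hf : ∀ a b, f (a * b) = f a * b + a * f b)
    (X Y : Matrix n n B) : (X * Y).map f = X.map f * Y + X * Y.map f := by
  ext i j
  simp only [Matrix.map_apply, Matrix.mul_apply, map_sum, hf, Matrix.add_apply,
    Finset.sum_add_distrib]

theorem comm_map_of_leibniz (f : B →ₗ[ℂ] B) (hf : ∀ a b, f (a * b) = f a * b + a * f b)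
    (X Y : SMat B) : (comm X Y).map f = comm (X.map f) Y + comm X (Y.map f) := by
  have h : ∀ X Y : SMat B, (X - Y).map f = X.map f - Y.map f := fun X Y => by ext; simp
  rw [comm, h, map_mul_of_leibniz f hf, map_mul_of_leibniz f hf, comm, comm]
  abel

/-! ### The grading -/

theorem kflip_scalar (c : B) : kflip (Matrix.scalar (Fin 4) c) = -Matrix.scalar (Fin 4) c := by
  rw [kflip_eq]
  ext i j
  fin_cases i <;> fin_cases j <;> simp [Matrix.scalar_apply]

theorem kflip_sub (M N : Matrix (Fin 4) (Fin 4) B) : kflip (M - N) = kflip M - kflip N := by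
  simp [kflip, mul_sub, sub_mul]

theorem tracelessPart_omega (X : SMat B) : tracelessPart (omega X) = omega (tracelessPart X) := by
  rw [← Matrix.fromBlocks_toBlocks X]
  simp only [omega_fromBlocks, tracelessPart_fromBlocks, trace_kflip, kflip_sub, kflip_scalar,
    smul_neg, map_neg]

theorem trace_sub_scalar (M : Matrix (Fin 4) (Fin 4) B) :
    (M - Matrix.scalar (Fin 4) ((1 / 4 : ℂ) • M.trace)).trace = 0 := by
  rw [Matrix.trace_sub, Matrix.scalar_apply, Matrix.trace_diagonal]
  simp only [Finset.sum_const, Finset.card_univ, Fintype.card_fin, ← Nat.cast_smul_eq_nsmul ℂ,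
    smul_smul]
  norm_num

theorem tracelessPart_tracelessPart (X : SMat B) :
    tracelessPart (tracelessPart X) = tracelessPart X := by
  rw [← Matrix.fromBlocks_toBlocks X]
  simp only [tracelessPart_fromBlocks, trace_sub_scalar, smul_zero, map_zero, sub_zero]

/-- `Ω²` is the parity automorphism, so the degree modulo two tells diagonal from off-diagonal
blocks. -/
theorem omega_omega (X : SMat B) : omega (omega X) = sig B * X * sig B := by
  rw [← Matrix.fromBlocks_toBlocks X]
  simp only [omega_fromBlocks, sig, Matrix.fromBlocks_multiply, kflip_kflip]
  have : ∀ M : Matrix (Fin 4) (Fin 4) B, kflip (-M) = -kflip M := fun M => by simp [kflip]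
  simp [this, kflip_kflip]

theorem omega_omega_omega_omega (X : SMat B) : omega (omega (omega (omega X))) = X := by
  rw [omega_omega, omega_omega]
  calc _ = (sig B * sig B) * X * (sig B * sig B) := by noncomm_ring
    _ = X := by rw [sig_mul_sig, one_mul, mul_one]

theorem tracelessPart_eq_self_iff (X : SMat B) :
    tracelessPart X = X ↔ X.toBlocks₁₁.trace = 0 ∧ X.toBlocks₂₂.trace = 0 := by
  constructor
  · intro h
    rw [← h]
    simp only [tracelessPart, Matrix.toBlocks_fromBlocks₁₁, Matrix.toBlocks_fromBlocks₂₂,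
      trace_sub_scalar, and_self]
  · rintro ⟨h1, h2⟩
    simp only [tracelessPart, h1, h2, smul_zero, map_zero, sub_zero]
    exact Matrix.fromBlocks_toBlocks X

/-- `X` is an eigenvector of `Ω` for `iᵏ`: it has degree `k`, up to the traces of its blocks. -/
def Gr (k : ℕ) (X : SMat B) : Prop := omega X = (Complex.I ^ k) • X

theorem Gr.add {k : ℕ} {X Y : SMat B} (hX : Gr k X) (hY : Gr k Y) : Gr k (X + Y) := by
  rw [Gr] at *; rw [omega_add, hX, hY, smul_add]
theorem Gr.neg {k : ℕ} {X : SMat B} (hX : Gr k X) : Gr k (-X) := by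
  rw [Gr] at *; rw [omega_neg, hX, smul_neg]
theorem Gr.sub {k : ℕ} {X Y : SMat B} (hX : Gr k X) (hY : Gr k Y) : Gr k (X - Y) := by
  rw [sub_eq_add_neg]; exact hX.add hY.neg
theorem Gr.smul {k : ℕ} {X : SMat B} (c : ℂ) (hX : Gr k X) : Gr k (c • X) := by
  rw [Gr] at *; rw [omega_smul, hX, smul_comm]
theorem Gr.tracelessPart {k : ℕ} {X : SMat B} (hX : Gr k X) : Gr k (tracelessPart X) := by
  rw [Gr] at *; rw [← tracelessPart_omega, hX, tracelessPart_smul]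
theorem Gr.map {k : ℕ} {X : SMat B} (hX : Gr k X) (f : B →ₗ[ℂ] B) : Gr k (X.map f) := by
  rw [Gr] at *; rw [omega_map, hX]; ext i j; simp
theorem Gr.zero {k : ℕ} : Gr k (0 : SMat B) := by
  rw [Gr, omega_zero, smul_zero]

theorem bsmul_eq_map (e : B) (X : SMat B) : e • X = X.map (LinearMap.mulLeft ℂ e) := rfl

theorem Gr.bsmul {k : ℕ} {X : SMat B} (e : B) (hX : Gr k X) : Gr k (e • X) := by
  rw [bsmul_eq_map]; exact hX.map _

theorem Gr.congr {k l : ℕ} {X : SMat B} (hX : Gr k X) (h : k % 4 = l % 4) : Gr l X := by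
  rw [Gr] at *
  rw [hX, Complex.I_pow_eq_pow_mod k, Complex.I_pow_eq_pow_mod l, h]

theorem proj_eq (k : ℕ) (X : SMat B) : proj k X = tracelessPart ((1 / 4 : ℂ) •
    (X + (Complex.I ^ (3 * k)) • omega X + (Complex.I ^ (6 * k)) • omega (omega X) +
      (Complex.I ^ (9 * k)) • omega (omega (omega X)))) := by
  simp only [proj, Finset.sum_range_succ, Finset.sum_range_zero, Function.iterate_succ,
    Function.iterate_zero, Function.comp, id]
  simp only [mul_zero, pow_zero, one_smul, zero_add, mul_one]
  congr 4
  · congr 2; ring_nf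
  · congr 1; ring_nf

theorem proj_tracelessPart (k : ℕ) (X : SMat B) : proj k (tracelessPart X) = proj k X := by
  rw [proj_eq, proj_eq]
  simp only [← tracelessPart_omega, ← tracelessPart_smul, ← tracelessPart_add,
    tracelessPart_tracelessPart]

theorem tracelessPart_proj (k : ℕ) (X : SMat B) : tracelessPart (proj k X) = proj k X := by
  rw [proj_eq, tracelessPart_tracelessPart]

theorem proj_map (k : ℕ) (f : B →ₗ[ℂ] B) (X : SMat B) : proj k (X.map f) = (proj k X).map f := by
  rw [proj_eq, proj_eq, ← tracelessPart_map]
  simp only [omega_map]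
  congr 1
  ext i j
  simp

theorem proj_bsmul (k : ℕ) (e : B) (X : SMat B) : proj k (e • X) = e • proj k X := by
  rw [bsmul_eq_map, bsmul_eq_map, proj_map]

theorem tracelessPart_bsmul (e : B) (X : SMat B) :
    tracelessPart (e • X) = e • tracelessPart X := by
  rw [bsmul_eq_map, bsmul_eq_map, tracelessPart_map]

theorem Gr.proj_eq {j : ℕ} {X : SMat B} (hX : Gr j X) (k : ℕ) :
    proj k X = if j % 4 = k % 4 then PureSpinor.tracelessPart X else 0 := by
  rw [Gr] at hX
  rw [PureSpinor.proj_eq]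
  simp only [hX, omega_smul, smul_smul]
  rw [show (1 / 4 : ℂ) • (X + (Complex.I ^ (3 * k) * Complex.I ^ j) • X +
    (Complex.I ^ (6 * k) * (Complex.I ^ j * Complex.I ^ j)) • X +
    (Complex.I ^ (9 * k) * (Complex.I ^ j * Complex.I ^ j * Complex.I ^ j)) • X) =
    ((1 / 4 : ℂ) * (1 + (Complex.I ^ (3 * k + j)) +
      (Complex.I ^ (3 * k + j)) ^ 2 + (Complex.I ^ (3 * k + j)) ^ 3)) • X by
    rw [show 6 * k = 3 * k * 2 by ring, show 9 * k = 3 * k * 3 by ring, pow_mul, pow_mul, pow_add]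
    module]
  have h4 : (3 * k + j) % 4 = 0 ↔ j % 4 = k % 4 := by omega
  rw [tracelessPart_smul, Complex.I_pow_eq_pow_mod]
  have hlt : (3 * k + j) % 4 < 4 := Nat.mod_lt _ (by norm_num)
  split_ifs with h
  · rw [h4.2 h]; norm_num
  · have h0 : (3 * k + j) % 4 ≠ 0 := fun h' => h (h4.1 h')
    generalize (3 * k + j) % 4 = m at *
    have e3 : Complex.I ^ 3 = -Complex.I := Complex.I_pow_three
    have e2 : Complex.I ^ 2 = -1 := Complex.I_sq
    interval_cases m
    · exact absurd rfl h0
    · simp [e2, e3]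
    · rw [e2]; norm_num
    · rw [e3, neg_sq, e2, Odd.neg_pow (by decide : Odd 3), e3]; simp

theorem proj_gr (k : ℕ) (X : SMat B) : Gr k (proj k X) := by
  rw [proj_eq]
  apply Gr.tracelessPart
  rw [Gr]
  simp only [omega_smul, omega_add, omega_omega_omega_omega, smul_smul, smul_add]
  have h : ∀ a, Complex.I ^ k * (1 / 4 * Complex.I ^ (3 * (a + 1) * k)) =
      1 / 4 * Complex.I ^ (3 * a * k) := by
    intro a
    rw [mul_left_comm, ← pow_add, show k + 3 * (a + 1) * k = 4 * k + 3 * a * k by ring, pow_add,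
      pow_mul, Complex.I_pow_four, one_pow, one_mul]
  have h0 := h 0
  have h1 := h 1
  have h2 := h 2
  have h3 : (1 / 4 : ℂ) * Complex.I ^ (9 * k) = Complex.I ^ k * (1 / 4) := by
    rw [mul_comm, show 9 * k = 4 * (2 * k) + k by ring, pow_add, pow_mul, Complex.I_pow_four]
    simp
  norm_num only at h0 h1 h2 h3 ⊢
  simp only [zero_mul, pow_zero, mul_one] at h0
  rw [h0, h1, h2, h3]
  abel

theorem proj_eq_self_iff (k : ℕ) (X : SMat B) :
    proj k X = X ↔ Gr k X ∧ tracelessPart X = X := by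
  constructor
  · intro h
    constructor
    · rw [← h]; exact proj_gr k X
    · rw [← h]; exact tracelessPart_proj k X
  · rintro ⟨h1, h2⟩
    rw [h1.proj_eq, if_pos rfl, h2]

theorem proj_proj (j k : ℕ) (X : SMat B) :
    proj k (proj j X) = if j % 4 = k % 4 then proj j X else 0 := by
  rw [(proj_gr j X).proj_eq, tracelessPart_proj]

/-- A supermatrix is the sum of its homogeneous components, up to the traces of its blocks. -/
theorem tracelessPart_eq_sum (X : SMat B) :
    tracelessPart X = proj 0 X + proj 1 X + proj 2 X + proj 3 X := by
  simp only [proj_eq, ← tracelessPart_add]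
  congr 1
  simp only [← smul_add]
  have e3 : Complex.I ^ 3 = -Complex.I := Complex.I_pow_three
  have e2 : Complex.I ^ 2 = -1 := Complex.I_sq
  have hI : ∀ n, Complex.I ^ (n + 4) = Complex.I ^ n := fun n => by
    rw [pow_add, Complex.I_pow_four, mul_one]
  have e6 : Complex.I ^ 6 = -1 := by rw [hI 2, e2]
  have e9 : Complex.I ^ 9 = Complex.I := by rw [hI 5, hI 1, pow_one]
  have e12 : Complex.I ^ 12 = 1 := by rw [hI 8, hI 4, hI 0, pow_zero]
  have e18 : Complex.I ^ 18 = -1 := by rw [hI 14, hI 10, hI 6, e6]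
  have e27 : Complex.I ^ 27 = -Complex.I := by
    rw [hI 23, hI 19, hI 15, hI 11, hI 7, hI 3, e3]
  norm_num [e3, e6, e9, e12, e18, e27]
  module

/-! ### Block form of homogeneous matrices -/

theorem omega_sig_conj {k : ℕ} {X : SMat B} (h : Gr k X) :
    sig B * X * sig B = ((-1 : ℂ) ^ k) • X := by
  rw [Gr] at h
  rw [← omega_omega, h, omega_smul, h, smul_smul, ← mul_pow, Complex.I_mul_I]

theorem sig_mul_mul_sig (a b c d : Matrix (Fin 4) (Fin 4) B) :
    sig B * Matrix.fromBlocks a b c d * sig B = Matrix.fromBlocks a (-b) (-c) d := by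
  simp [sig, Matrix.fromBlocks_multiply]

/-- `X` is block off-diagonal. -/
def IsOff (X : SMat B) : Prop := X.toBlocks₁₁ = 0 ∧ X.toBlocks₂₂ = 0
/-- `X` is block diagonal. -/
def IsDiag (X : SMat B) : Prop := X.toBlocks₁₂ = 0 ∧ X.toBlocks₂₁ = 0

theorem eq_zero_of_eq_neg {M : Type*} [AddCommGroup M] [Module ℂ M] {x : M} (h : x = -x) :
    x = 0 := by
  have : (2 : ℂ) • x = 0 := by rw [two_smul]; nth_rewrite 2 [h]; exact add_neg_cancel x
  exact (smul_eq_zero.1 this).resolve_left two_ne_zero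

theorem Gr.isOff {k : ℕ} {X : SMat B} (h : Gr k X) (hk : Odd k) : IsOff X := by
  have := omega_sig_conj h
  rw [← Matrix.fromBlocks_toBlocks X, sig_mul_mul_sig, hk.neg_one_pow, Matrix.fromBlocks_smul,
    Matrix.fromBlocks_inj] at this
  obtain ⟨h1, -, -, h2⟩ := this
  rw [neg_one_smul] at h1 h2
  exact ⟨eq_zero_of_eq_neg h1, eq_zero_of_eq_neg h2⟩

theorem Gr.isDiag {k : ℕ} {X : SMat B} (h : Gr k X) (hk : Even k) : IsDiag X := by
  have := omega_sig_conj h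
  rw [← Matrix.fromBlocks_toBlocks X, sig_mul_mul_sig, hk.neg_one_pow, Matrix.fromBlocks_smul,
    Matrix.fromBlocks_inj] at this
  obtain ⟨-, h1, h2, -⟩ := this
  rw [one_smul] at h1 h2
  exact ⟨eq_zero_of_eq_neg h1.symm, eq_zero_of_eq_neg h2.symm⟩

theorem IsOff.tracelessPart_eq {X : SMat B} (h : IsOff X) : tracelessPart X = X := by
  rw [tracelessPart_eq_self_iff, h.1, h.2]; simp

theorem IsOff.str_eq {X : SMat B} (h : IsOff X) : str X = 0 := by
  simp [str, h.1, h.2]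

end Linear

/-! ### Supermatrices with homogeneous entries -/

section Super

variable {B : Type*} [Ring B] [Algebra ℂ B]

local notation "M₄" => Matrix (Fin 4) (Fin 4)

theorem transpose_mul_of_commute {M N : M₄ B} (h : ∀ i j k, M i j * N j k = N j k * M i j) :
    (M * N).transpose = N.transpose * M.transpose := by
  ext i j
  simp only [Matrix.transpose_apply, Matrix.mul_apply]
  exact Finset.sum_congr rfl fun k _ => h _ _ _

theorem transpose_mul_of_anticommute {M N : M₄ B}
    (h : ∀ i j k, M i j * N j k = -(N j k * M i j)) :
    (M * N).transpose = -(N.transpose * M.transpose) := by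
  ext i j
  simp only [Matrix.transpose_apply, Matrix.mul_apply, Matrix.neg_apply,
    ← Finset.sum_neg_distrib]
  exact Finset.sum_congr rfl fun k _ => h _ _ _

theorem trace_mul_of_commute {M N : M₄ B} (h : ∀ i j k, M i j * N j k = N j k * M i j) :
    (M * N).trace = (N * M).trace := by
  simp only [Matrix.trace, Matrix.diag, Matrix.mul_apply]
  rw [Finset.sum_comm]
  exact Finset.sum_congr rfl fun _ _ => Finset.sum_congr rfl fun _ _ => h _ _ _

theorem trace_mul_of_anticommute {M N : M₄ B}
    (h : ∀ i j k, M i j * N j k = -(N j k * M i j)) :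
    (M * N).trace = -(N * M).trace := by
  simp only [Matrix.trace, Matrix.diag, Matrix.mul_apply, ← Finset.sum_neg_distrib]
  rw [Finset.sum_comm]
  exact Finset.sum_congr rfl fun _ _ => Finset.sum_congr rfl fun _ _ => h _ _ _

theorem symplectic_mul_symplectic : symplectic B * symplectic B = -1 := by
  ext i j
  fin_cases i <;> fin_cases j <;> simp [symplectic]

theorem kflip_mul_of_commute {M N : M₄ B} (h : ∀ i j k, M i j * N j k = N j k * M i j) :
    kflip (M * N) = -(kflip N * kflip M) := by
  have e : kflip N * kflip M = symplectic B * N.transpose * (symplectic B * symplectic B) *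
      M.transpose * symplectic B := by simp only [kflip]; noncomm_ring
  rw [e, symplectic_mul_symplectic, kflip, transpose_mul_of_commute h]
  noncomm_ring

theorem kflip_mul_of_anticommute {M N : M₄ B}
    (h : ∀ i j k, M i j * N j k = -(N j k * M i j)) :
    kflip (M * N) = kflip N * kflip M := by
  have e : kflip N * kflip M = symplectic B * N.transpose * (symplectic B * symplectic B) *
      M.transpose * symplectic B := by simp only [kflip]; noncomm_ring
  rw [e, symplectic_mul_symplectic, kflip, transpose_mul_of_anticommute h]
  noncomm_ring

theorem kflip_neg (M : M₄ B) : kflip (-M) = -kflip M := by simp [kflip]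

theorem str_omega (X : SMat B) : str (omega X) = -str X := by
  rw [← Matrix.fromBlocks_toBlocks X, omega_fromBlocks, str_fromBlocks, str_fromBlocks,
    trace_kflip, trace_kflip]
  abel

theorem str_tracelessPart_mul (S Z : SMat B) (hS : tracelessPart S = S)
    (hZ : tracelessPart Z = 0) : str (S * Z) = 0 ∧ str (Z * S) = 0 := by
  rw [tracelessPart_eq_self_iff] at hS
  rw [← Matrix.fromBlocks_toBlocks Z, tracelessPart_fromBlocks, ← Matrix.fromBlocks_zero,
    Matrix.fromBlocks_inj] at hZ
  obtain ⟨h1, h2, h3, h4⟩ := hZ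
  rw [sub_eq_zero] at h1 h4
  rw [← Matrix.fromBlocks_toBlocks Z, ← Matrix.fromBlocks_toBlocks S]
  generalize S.toBlocks₁₁ = a at *
  generalize S.toBlocks₂₂ = d at *
  rw [h1, h2, h3, h4]
  generalize (1 / 4 : ℂ) • Z.toBlocks₁₁.trace = x
  generalize (1 / 4 : ℂ) • Z.toBlocks₂₂.trace = y
  have e1 : ∀ (M : M₄ B) (x : B), (M * Matrix.scalar (Fin 4) x).trace = M.trace * x := by
    intro M x
    simp [Matrix.trace, Matrix.scalar_apply, Matrix.mul_diagonal, Finset.sum_mul]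
  have e2 : ∀ (M : M₄ B) (x : B), (Matrix.scalar (Fin 4) x * M).trace = x * M.trace := by
    intro M x
    simp [Matrix.trace, Matrix.scalar_apply, Matrix.diagonal_mul, Finset.mul_sum]
  simp only [Matrix.fromBlocks_multiply, str_fromBlocks, mul_zero, zero_mul, add_zero, zero_add,
    e1, e2, hS.1, hS.2, sub_zero, and_self]

theorem eq_scalar_of_tracelessPart_eq_zero {Z : SMat B} (h : tracelessPart Z = 0)
    (hs : str Z = 0) : Z = Matrix.scalar (Fin 4 ⊕ Fin 4) ((1 / 4 : ℂ) • Z.toBlocks₁₁.trace) := by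
  rw [str, sub_eq_zero] at hs
  rw [← Matrix.fromBlocks_toBlocks Z, tracelessPart_fromBlocks, ← Matrix.fromBlocks_zero,
    Matrix.fromBlocks_inj] at h
  obtain ⟨h1, h2, h3, h4⟩ := h
  rw [sub_eq_zero] at h1 h4
  have e : Z = Matrix.fromBlocks Z.toBlocks₁₁ Z.toBlocks₁₂ Z.toBlocks₂₁ Z.toBlocks₂₂ :=
    (Matrix.fromBlocks_toBlocks Z).symm
  rw [← hs] at h4
  rw [h2, h3, h4] at e
  generalize (1 / 4 : ℂ) • Z.toBlocks₁₁.trace = x at *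
  rw [e, h1]
  simp only [Matrix.scalar_apply]
  exact Matrix.fromBlocks_diagonal _ _ |>.trans (by congr 1; ext i; cases i <;> rfl)

theorem tracelessPart_scalar (c : B) : tracelessPart (Matrix.scalar (Fin 4 ⊕ Fin 4) c) = 0 := by
  have e : Matrix.scalar (Fin 4 ⊕ Fin 4) c =
      Matrix.fromBlocks (Matrix.scalar (Fin 4) c) 0 0 (Matrix.scalar (Fin 4) c) := by
    simp only [Matrix.scalar_apply]
    exact ((Matrix.fromBlocks_diagonal _ _).trans (by congr 1; ext i; cases i <;> rfl)).symm
  have ht : (1 / 4 : ℂ) • (Matrix.scalar (Fin 4) c).trace = c := by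
    simp only [Matrix.scalar_apply, Matrix.trace_diagonal, Finset.sum_const, Finset.card_univ,
      Fintype.card_fin, ← Nat.cast_smul_eq_nsmul ℂ, smul_smul]
    norm_num
  rw [e, tracelessPart_fromBlocks, ht, sub_self, Matrix.fromBlocks_zero]

/-- The value of the scalar matrix `X - tracelessPart X`, for `X` without supertrace. -/
def scal (X : SMat B) : B := (1 / 4 : ℂ) • X.toBlocks₁₁.trace

theorem eq_tracelessPart_add_scalar {X : SMat B} (hs : str X = 0) :
    X = tracelessPart X + Matrix.scalar (Fin 4 ⊕ Fin 4) (scal X) := by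
  have hs' := hs
  have e : X - tracelessPart X = Matrix.fromBlocks (Matrix.scalar (Fin 4) (scal X)) 0 0
      (Matrix.scalar (Fin 4) (scal X)) := by
    rw [str, sub_eq_zero] at hs
    conv_lhs => rw [← Matrix.fromBlocks_toBlocks X]
    rw [tracelessPart_fromBlocks, ← hs, sub_eq_add_neg, Matrix.fromBlocks_neg,
      Matrix.fromBlocks_add]
    simp [scal]
  rw [sub_eq_iff_eq_add'] at e
  conv_lhs => rw [e]
  congr 1
  simp only [Matrix.scalar_apply]
  exact Matrix.fromBlocks_diagonal _ _ |>.trans (by congr 1; ext i; cases i <;> rfl)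

/-! ### Matrices with central entries -/

/-- All entries of the matrix are central. -/
def CentralEntries (X : SMat B) : Prop := ∀ i j b, X i j * b = b * X i j

theorem scalar_mul_central {X : SMat B} (h : CentralEntries X) (c : B) :
    Matrix.scalar (Fin 4 ⊕ Fin 4) c * X = X * Matrix.scalar (Fin 4 ⊕ Fin 4) c := by
  ext i j
  simp only [Matrix.scalar_apply, Matrix.diagonal_mul, Matrix.mul_diagonal]
  exact (h i j c).symm

theorem scalar_mul_of_central {c : B} (h : ∀ b, c * b = b * c) (X : SMat B) :
    Matrix.scalar (Fin 4 ⊕ Fin 4) c * X = X * Matrix.scalar (Fin 4 ⊕ Fin 4) c := by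
  ext i j
  simp only [Matrix.scalar_apply, Matrix.diagonal_mul, Matrix.mul_diagonal]
  exact h _

theorem CentralEntries.toBlocks {X : SMat B} (h : CentralEntries X) :
    (∀ i j b, X.toBlocks₁₁ i j * b = b * X.toBlocks₁₁ i j) ∧
    (∀ i j b, X.toBlocks₁₂ i j * b = b * X.toBlocks₁₂ i j) ∧
    (∀ i j b, X.toBlocks₂₁ i j * b = b * X.toBlocks₂₁ i j) ∧
    (∀ i j b, X.toBlocks₂₂ i j * b = b * X.toBlocks₂₂ i j) :=
  ⟨fun _ _ => h _ _, fun _ _ => h _ _, fun _ _ => h _ _, fun _ _ => h _ _⟩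

theorem IsOff.eq {X : SMat B} (h : IsOff X) :
    X = Matrix.fromBlocks 0 X.toBlocks₁₂ X.toBlocks₂₁ 0 := by
  conv_lhs => rw [← Matrix.fromBlocks_toBlocks X, h.1, h.2]
theorem IsDiag.eq {X : SMat B} (h : IsDiag X) :
    X = Matrix.fromBlocks X.toBlocks₁₁ 0 0 X.toBlocks₂₂ := by
  conv_lhs => rw [← Matrix.fromBlocks_toBlocks X, h.1, h.2]

theorem kflip_zero : kflip (0 : M₄ B) = 0 := by simp [kflip]

theorem omega_mul_off_off {l y : SMat B} (hl : IsOff l) (hy : IsOff y) (hc : CentralEntries l) :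
    omega (l * y) = omega y * omega l ∧ omega (y * l) = omega l * omega y := by
  obtain ⟨-, h1, h2, -⟩ := hc.toBlocks
  rw [hl.eq, hy.eq]
  simp only [Matrix.fromBlocks_multiply, omega_fromBlocks, mul_zero, zero_mul, add_zero, zero_add,
    kflip_zero, neg_zero]
  rw [kflip_mul_of_commute fun i j k => h1 i j _, kflip_mul_of_commute fun i j k => h2 i j _,
    kflip_mul_of_commute fun i j k => (h2 j k _).symm,
    kflip_mul_of_commute fun i j k => (h1 j k _).symm]
  simp

theorem omega_mul_off_diag {l y : SMat B} (hl : IsOff l) (hy : IsDiag y) (hc : CentralEntries l) :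
    omega (l * y) = -(omega y * omega l) ∧ omega (y * l) = -(omega l * omega y) := by
  obtain ⟨-, h1, h2, -⟩ := hc.toBlocks
  rw [hl.eq, hy.eq]
  simp only [Matrix.fromBlocks_multiply, omega_fromBlocks, mul_zero, zero_mul, add_zero, zero_add,
    kflip_zero, neg_zero, Matrix.fromBlocks_neg]
  rw [kflip_mul_of_commute fun i j k => h1 i j _, kflip_mul_of_commute fun i j k => h2 i j _,
    kflip_mul_of_commute fun i j k => (h2 j k _).symm,
    kflip_mul_of_commute fun i j k => (h1 j k _).symm]
  simp

theorem Gr.acomm_central {i j : ℕ} {l y : SMat B} (hl : Gr i l) (hy : Gr j y) (hi : Odd i)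
    (hj : Odd j) (hc : CentralEntries l) : Gr (i + j) (acomm l y) := by
  obtain ⟨h1, h2⟩ := omega_mul_off_off (hl.isOff hi) (hy.isOff hj) hc
  rw [Gr] at *
  rw [acomm, omega_add, h1, h2, hl, hy, pow_add]
  simp only [smul_mul_smul_comm, smul_add, mul_comm]
  abel

theorem Gr.comm_central {i j : ℕ} {l y : SMat B} (hl : Gr i l) (hy : Gr j y) (hi : Odd i)
    (hj : Even j) (hc : CentralEntries l) : Gr (i + j) (comm l y) := by
  obtain ⟨h1, h2⟩ := omega_mul_off_diag (hl.isOff hi) (hy.isDiag hj) hc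
  rw [Gr] at *
  rw [comm, omega_sub, h1, h2, hl, hy, pow_add]
  simp only [smul_mul_smul_comm, smul_sub, mul_comm]
  abel

/-- The supertrace of a product with an off-diagonal matrix with central entries is
antisymmetric. -/
theorem str_mul_off_central {l w : SMat B} (hl : IsOff l) (hc : CentralEntries l) :
    str (l * w) = -str (w * l) := by
  obtain ⟨-, h1, h2, -⟩ := hc.toBlocks
  rw [hl.eq, ← Matrix.fromBlocks_toBlocks w]
  simp only [Matrix.fromBlocks_multiply, str_fromBlocks, mul_zero, zero_mul, add_zero, zero_add]
  rw [trace_mul_of_commute fun i j k => h1 i j _, trace_mul_of_commute fun i j k => h2 i j _]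
  abel

theorem str_acomm_central {l w : SMat B} (hl : IsOff l) (hc : CentralEntries l) :
    str (acomm l w) = 0 := by
  rw [acomm, str_add, str_mul_off_central hl hc, neg_add_cancel]

theorem IsOff.mul {X Y : SMat B} (hX : IsOff X) (hY : IsOff Y) : IsDiag (X * Y) := by
  rw [hX.eq, hY.eq, Matrix.fromBlocks_multiply]
  constructor <;> simp
theorem IsOff.mul_diag {X Y : SMat B} (hX : IsOff X) (hY : IsDiag Y) : IsOff (X * Y) := by
  rw [hX.eq, hY.eq, Matrix.fromBlocks_multiply]
  constructor <;> simp

/-! ### Even supermatrices -/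

variable (W : Worldsheet B)

/-- The ring automorphism of the supermatrices whose fixed points are the even supermatrices. -/
def twist (X : SMat B) : SMat B := sig B * X.map W.parity * sig B

theorem twist_mul (X Y : SMat B) : twist W (X * Y) = twist W X * twist W Y := by
  have : (X * Y).map W.parity = X.map W.parity * (sig B * sig B) * Y.map W.parity := by
    rw [sig_mul_sig, mul_one]; exact Matrix.map_mul (f := W.parity)
  rw [twist, this, twist, twist]
  noncomm_ring

theorem twist_one : twist W 1 = 1 := by
  have : (1 : SMat B).map W.parity = 1 := Matrix.map_one _ (map_zero _) (map_one _)
  rw [twist, this, mul_one, sig_mul_sig]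

theorem isEvenSuper_fromBlocks (a b c d : M₄ B) : W.IsEvenSuper (Matrix.fromBlocks a b c d) ↔
    (∀ i j, W.parity (a i j) = a i j) ∧ (∀ i j, W.parity (b i j) = -b i j) ∧
    (∀ i j, W.parity (c i j) = -c i j) ∧ (∀ i j, W.parity (d i j) = d i j) := by
  simp [Worldsheet.IsEvenSuper, Worldsheet.EvenEntries, Worldsheet.OddEntries, diagPart,
    offDiagPart, forall_and]
  tauto

theorem isEvenSuper_iff (X : SMat B) : W.IsEvenSuper X ↔ twist W X = X := by
  rw [← Matrix.fromBlocks_toBlocks X, isEvenSuper_fromBlocks, twist, Matrix.fromBlocks_map,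
    sig_mul_mul_sig, Matrix.fromBlocks_inj]
  simp only [← Matrix.ext_iff, Matrix.map_apply, Matrix.neg_apply, neg_eq_iff_eq_neg]

variable {W}

theorem Worldsheet.IsEvenSuper.mul {X Y : SMat B} (hX : W.IsEvenSuper X) (hY : W.IsEvenSuper Y) :
    W.IsEvenSuper (X * Y) := by
  rw [isEvenSuper_iff] at *; rw [twist_mul, hX, hY]
theorem Worldsheet.IsEvenSuper.add {X Y : SMat B} (hX : W.IsEvenSuper X) (hY : W.IsEvenSuper Y) :
    W.IsEvenSuper (X + Y) := by
  rw [isEvenSuper_iff] at *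
  have : (X + Y).map W.parity = X.map W.parity + Y.map W.parity := by ext; simp
  rw [twist, this, mul_add, add_mul]; exact congrArg₂ _ hX hY
theorem Worldsheet.IsEvenSuper.smul {X : SMat B} (c : ℂ) (hX : W.IsEvenSuper X) :
    W.IsEvenSuper (c • X) := by
  rw [isEvenSuper_iff] at *
  have : (c • X).map W.parity = c • X.map W.parity := by ext; simp
  rw [twist, this, mul_smul_comm, smul_mul_assoc]; exact congrArg _ hX
theorem Worldsheet.IsEvenSuper.neg {X : SMat B} (hX : W.IsEvenSuper X) : W.IsEvenSuper (-X) := by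
  have := hX.smul (-1); rwa [neg_one_smul] at this
theorem Worldsheet.IsEvenSuper.sub {X Y : SMat B} (hX : W.IsEvenSuper X) (hY : W.IsEvenSuper Y) :
    W.IsEvenSuper (X - Y) := by
  rw [sub_eq_add_neg]; exact hX.add hY.neg
theorem Worldsheet.IsEvenSuper.comm {X Y : SMat B} (hX : W.IsEvenSuper X) (hY : W.IsEvenSuper Y) :
    W.IsEvenSuper (comm X Y) := (hX.mul hY).sub (hY.mul hX)
theorem Worldsheet.IsEvenSuper.one : W.IsEvenSuper 1 := (isEvenSuper_iff W 1).2 (twist_one W)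
theorem Worldsheet.IsEvenSuper.inverse {g h : SMat B} (hg : W.IsEvenSuper g) (h1 : g * h = 1)
    (h2 : h * g = 1) : W.IsEvenSuper h := by
  rw [isEvenSuper_iff] at *
  have := twist_mul W h g
  rw [h2, twist_one, hg] at this
  calc twist W h = twist W h * (g * h) := by rw [h1, mul_one]
    _ = h := by rw [← mul_assoc, ← this, one_mul]
theorem Worldsheet.IsEvenSuper.map {X : SMat B} (hX : W.IsEvenSuper X) (f : B →ₗ[ℂ] B)
    (hf : ∀ b, W.parity (f b) = f (W.parity b)) : W.IsEvenSuper (X.map f) := by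
  rw [← Matrix.fromBlocks_toBlocks X, isEvenSuper_fromBlocks] at hX
  rw [← Matrix.fromBlocks_toBlocks X, Matrix.fromBlocks_map, isEvenSuper_fromBlocks]
  simp only [Matrix.map_apply, hf, hX.1, hX.2.1, hX.2.2.1, hX.2.2.2, map_neg, implies_true,
    and_self]
theorem isEvenSuper_fromBlocks' {X : SMat B} (hX : W.IsEvenSuper X) :
    (∀ i j, W.parity (X.toBlocks₁₁ i j) = X.toBlocks₁₁ i j) ∧
    (∀ i j, W.parity (X.toBlocks₁₂ i j) = -X.toBlocks₁₂ i j) ∧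
    (∀ i j, W.parity (X.toBlocks₂₁ i j) = -X.toBlocks₂₁ i j) ∧
    (∀ i j, W.parity (X.toBlocks₂₂ i j) = X.toBlocks₂₂ i j) := by
  rwa [← Matrix.fromBlocks_toBlocks X, isEvenSuper_fromBlocks] at hX

/-- `Ω` reverses products of even supermatrices up to a sign: the signs of the supertranspose are
those from moving odd entries past each other. Hence `Ω` is an automorphism for the commutator. -/
theorem omega_mul {X Y : SMat B} (hX : W.IsEvenSuper X) (hY : W.IsEvenSuper Y) :
    omega (X * Y) = -(omega Y * omega X) := by
  obtain ⟨a, b, c, d⟩ := isEvenSuper_fromBlocks' hX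
  obtain ⟨a', b', c', d'⟩ := isEvenSuper_fromBlocks' hY
  rw [← Matrix.fromBlocks_toBlocks X, ← Matrix.fromBlocks_toBlocks Y]
  simp only [Matrix.fromBlocks_multiply, omega_fromBlocks, kflip_add]
  rw [kflip_mul_of_commute fun i j k => W.even_comm _ _ (a i j),
    kflip_mul_of_anticommute fun i j k => W.odd_anticomm _ _ (b i j) (c' j k),
    kflip_mul_of_commute fun i j k => (W.even_comm _ _ (a' j k)).symm,
    kflip_mul_of_commute fun i j k => W.even_comm _ _ (d i j),
    kflip_mul_of_commute fun i j k => W.even_comm _ _ (a i j),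
    kflip_mul_of_commute fun i j k => (W.even_comm _ _ (d' j k)).symm,
    kflip_mul_of_anticommute fun i j k => W.odd_anticomm _ _ (c i j) (b' j k),
    kflip_mul_of_commute fun i j k => W.even_comm _ _ (d i j), Matrix.fromBlocks_neg]
  simp only [neg_mul, mul_neg, neg_add, neg_neg]

theorem str_mul_comm {X Y : SMat B} (hX : W.IsEvenSuper X) (hY : W.IsEvenSuper Y) :
    str (X * Y) = str (Y * X) := by
  obtain ⟨a, b, c, d⟩ := isEvenSuper_fromBlocks' hX
  obtain ⟨a', b', c', d'⟩ := isEvenSuper_fromBlocks' hY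
  rw [← Matrix.fromBlocks_toBlocks X, ← Matrix.fromBlocks_toBlocks Y]
  simp only [Matrix.fromBlocks_multiply, str_fromBlocks, Matrix.trace_add]
  rw [trace_mul_of_commute fun i j k => W.even_comm _ _ (a i j),
    trace_mul_of_anticommute fun i j k => W.odd_anticomm _ _ (b i j) (c' j k),
    trace_mul_of_anticommute fun i j k => W.odd_anticomm _ _ (c i j) (b' j k),
    trace_mul_of_commute fun i j k => W.even_comm _ _ (d i j)]
  abel

theorem str_comm {X Y : SMat B} (hX : W.IsEvenSuper X) (hY : W.IsEvenSuper Y) :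
    str (comm X Y) = 0 := by
  rw [comm, str_sub, str_mul_comm hX hY, sub_self]

theorem Gr.comm {i j : ℕ} {X Y : SMat B} (hX : Gr i X) (hY : Gr j Y) (eX : W.IsEvenSuper X)
    (eY : W.IsEvenSuper Y) : Gr (i + j) (comm X Y) := by
  rw [Gr] at *
  rw [PureSpinor.comm, omega_sub, omega_mul eX eY, omega_mul eY eX, hX, hY, pow_add]
  simp only [smul_mul_smul_comm, smul_sub, mul_comm]
  abel

theorem Worldsheet.IsEvenSuper.omega {X : SMat B} (hX : W.IsEvenSuper X) : W.IsEvenSuper (omega X) := by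
  obtain ⟨a, b, c, d⟩ := isEvenSuper_fromBlocks' hX
  rw [← Matrix.fromBlocks_toBlocks X, omega_fromBlocks, isEvenSuper_fromBlocks]
  have h1 : ∀ M : M₄ B, (∀ i j, W.parity (M i j) = M i j) →
      ∀ i j, W.parity (kflip M i j) = kflip M i j := by
    intro M hM i j
    rw [kflip_eq]
    fin_cases i <;> fin_cases j <;> simp [hM]
  have h2 : ∀ M : M₄ B, (∀ i j, W.parity (M i j) = -M i j) →
      ∀ i j, W.parity (kflip M i j) = -kflip M i j := by
    intro M hM i j
    rw [kflip_eq]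
    fin_cases i <;> fin_cases j <;> simp [hM]
  refine ⟨h1 _ a, fun i j => ?_, h2 _ b, h1 _ d⟩
  rw [Matrix.neg_apply, map_neg, h2 _ c]

theorem parity_trace {M : M₄ B} (h : ∀ i j, W.parity (M i j) = M i j) :
    W.parity M.trace = M.trace := by
  simp [Matrix.trace, map_sum, h]

theorem Worldsheet.IsEvenSuper.tracelessPart {X : SMat B} (hX : W.IsEvenSuper X) :
    W.IsEvenSuper (tracelessPart X) := by
  obtain ⟨a, b, c, d⟩ := isEvenSuper_fromBlocks' hX
  rw [← Matrix.fromBlocks_toBlocks X, tracelessPart_fromBlocks, isEvenSuper_fromBlocks]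
  have h1 : ∀ M : M₄ B, (∀ i j, W.parity (M i j) = M i j) →
      ∀ i j, W.parity ((M - Matrix.scalar (Fin 4) ((1 / 4 : ℂ) • M.trace)) i j) =
        (M - Matrix.scalar (Fin 4) ((1 / 4 : ℂ) • M.trace)) i j := by
    intro M hM i j
    by_cases h : i = j <;> simp [Matrix.scalar_apply, h, hM, parity_trace hM]
  exact ⟨h1 _ a, b, c, h1 _ d⟩

theorem Worldsheet.IsEvenSuper.proj {X : SMat B} (hX : W.IsEvenSuper X) (k : ℕ) :
    W.IsEvenSuper (proj k X) := by
  rw [proj_eq]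
  exact (((((hX.add (hX.omega.smul _)).add (hX.omega.omega.smul _)).add
    (hX.omega.omega.omega.smul _))).smul _).tracelessPart

theorem parity_scal {X : SMat B} (hX : W.IsEvenSuper X) : W.parity (scal X) = scal X := by
  rw [scal, map_smul, parity_trace (isEvenSuper_fromBlocks' hX).1]

theorem central_of_even {b : B} (h : W.parity b = b) (c : B) : b * c = c * b :=
  W.even_comm b c h

/-- Elements of `sl(4|4)` with coefficients in the superfields: even supermatrices without
supertrace. -/
structure IsSl (W : Worldsheet B) (X : SMat B) : Prop where
  even : W.IsEvenSuper X
  str_eq : str X = 0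

theorem IsSl.add {X Y : SMat B} (hX : IsSl W X) (hY : IsSl W Y) : IsSl W (X + Y) :=
  ⟨hX.1.add hY.1, by rw [str_add, hX.2, hY.2, add_zero]⟩
theorem IsSl.neg {X : SMat B} (hX : IsSl W X) : IsSl W (-X) :=
  ⟨hX.1.neg, by rw [str_neg, hX.2, neg_zero]⟩
theorem IsSl.sub {X Y : SMat B} (hX : IsSl W X) (hY : IsSl W Y) : IsSl W (X - Y) :=
  ⟨hX.1.sub hY.1, by rw [str_sub, hX.2, hY.2, sub_zero]⟩
theorem IsSl.smul {X : SMat B} (hX : IsSl W X) (c : ℂ) : IsSl W (c • X) :=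
  ⟨hX.1.smul c, by rw [str_smul, hX.2, smul_zero]⟩
theorem IsSl.comm {X Y : SMat B} (hX : IsSl W X) (hY : IsSl W Y) : IsSl W (comm X Y) :=
  ⟨hX.1.comm hY.1, str_comm hX.1 hY.1⟩
theorem IsSl.map {X : SMat B} (hX : IsSl W X) (f : B →ₗ[ℂ] B)
    (hf : ∀ b, W.parity (f b) = f (W.parity b)) : IsSl W (X.map f) :=
  ⟨hX.1.map f hf, by rw [str_map, hX.2, map_zero]⟩
theorem str_of_traceless {X : SMat B} (h : tracelessPart X = X) : str X = 0 := by
  rw [tracelessPart_eq_self_iff] at h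
  rw [str, h.1, h.2, sub_zero]
theorem IsSl.proj {X : SMat B} (hX : W.IsEvenSuper X) (k : ℕ) : IsSl W (proj k X) :=
  ⟨hX.proj k, str_of_traceless (tracelessPart_proj k X)⟩
theorem IsSl.tracelessPart {X : SMat B} (hX : W.IsEvenSuper X) : IsSl W (tracelessPart X) :=
  ⟨hX.tracelessPart, str_of_traceless (tracelessPart_tracelessPart X)⟩
theorem IsSl.conj {X g h : SMat B} (hX : IsSl W X) (hg : W.IsEvenSuper g) (hh : W.IsEvenSuper h)
    (h1 : h * g = 1) : IsSl W (g * X * h) :=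
  ⟨(hg.mul hX.1).mul hh, by
    rw [str_mul_comm (hg.mul hX.1) hh, ← mul_assoc, h1, one_mul, hX.2]⟩

/-- In `sl(4|4)`, matrices with the same image in `psl(4|4)` differ by a central scalar. -/
theorem IsSl.exists_eq_add_scalar {X Y : SMat B} (hX : IsSl W X) (hY : IsSl W Y)
    (h : PureSpinor.tracelessPart X = PureSpinor.tracelessPart Y) :
    ∃ c, W.parity c = c ∧ X = Y + Matrix.scalar (Fin 4 ⊕ Fin 4) c := by
  refine ⟨scal X - scal Y, by rw [map_sub, parity_scal hX.1, parity_scal hY.1], ?_⟩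
  have h1 := eq_tracelessPart_add_scalar hX.2
  have h2 := eq_tracelessPart_add_scalar hY.2
  rw [map_sub]
  conv_lhs => rw [h1, h]
  conv_rhs => rw [h2]
  have : scal (PureSpinor.tracelessPart Y + Matrix.scalar (Fin 4 ⊕ Fin 4) (scal Y)) = scal Y := by
    rw [← h2]
  rw [this]
  abel

theorem IsSl.comm_congr {X Y : SMat B} (hX : IsSl W X) (hY : IsSl W Y)
    (h : PureSpinor.tracelessPart X = PureSpinor.tracelessPart Y) (Z : SMat B) :
    PureSpinor.comm X Z = PureSpinor.comm Y Z := by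
  obtain ⟨c, hc, rfl⟩ := hX.exists_eq_add_scalar hY h
  rw [PureSpinor.comm, PureSpinor.comm, add_mul, mul_add,
    scalar_mul_of_central (central_of_even hc)]
  abel

theorem IsSl.comm_tracelessPart {X : SMat B} (hX : IsSl W X) (Z : SMat B) :
    PureSpinor.comm (PureSpinor.tracelessPart X) Z = PureSpinor.comm X Z :=
  (IsSl.tracelessPart hX.1).comm_congr hX (tracelessPart_tracelessPart X) Z

theorem IsSl.comm_tracelessPart_right {X : SMat B} (hX : IsSl W X) (Z : SMat B) :
    PureSpinor.comm Z (PureSpinor.tracelessPart X) = PureSpinor.comm Z X := by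
  rw [comm_swap, hX.comm_tracelessPart, ← comm_swap]

theorem IsSl.conj_congr {X Y g h : SMat B} (hX : IsSl W X) (hY : IsSl W Y)
    (hXY : PureSpinor.tracelessPart X = PureSpinor.tracelessPart Y) (h1 : g * h = 1) :
    PureSpinor.tracelessPart (g * X * h) = PureSpinor.tracelessPart (g * Y * h) := by
  obtain ⟨c, hc, rfl⟩ := hX.exists_eq_add_scalar hY hXY
  rw [mul_add, add_mul, ← scalar_mul_of_central (central_of_even hc), mul_assoc _ g h, h1, mul_one,
    tracelessPart_add, tracelessPart_scalar, add_zero]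

/-- The components of a commutator with a homogeneous matrix. -/
theorem proj_comm {A X : SMat B} (hA : IsSl W A) (hX : W.IsEvenSuper X) {j : ℕ} (hj : Gr j X)
    {k k' : ℕ} (h : (k' + j) % 4 = k % 4) :
    proj k (comm A X) = tracelessPart (comm (proj k' A) X) := by
  have key : ∀ i, proj k (comm (proj i A) X) =
      if (i + j) % 4 = k % 4 then tracelessPart (comm (proj i A) X) else 0 := fun i =>
    ((proj_gr i A).comm hj (hA.1.proj i) hX).proj_eq k
  rw [← hA.comm_tracelessPart, tracelessPart_eq_sum]
  simp only [add_comm', proj_add, key]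
  have hm : ∀ i, proj i A = proj (i % 4) A := by
    intro i
    simp only [proj, Complex.I_pow_eq_pow_mod (3 * i * _),
      Complex.I_pow_eq_pow_mod (3 * (i % 4) * _)]
    have : ∀ x, 3 * i * x % 4 = 3 * (i % 4) * x % 4 := fun x =>
      ((Nat.ModEq.refl 3).mul (Nat.mod_modEq i 4).symm).mul_right x
    simp only [this]
  rw [hm k']
  have : k' % 4 < 4 := Nat.mod_lt _ (by norm_num)
  have hk : (k' % 4 + j) % 4 = k % 4 := by omega
  generalize k' % 4 = m at *
  interval_cases m
  · rw [if_pos hk, if_neg (by omega), if_neg (by omega), if_neg (by omega)]; abel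
  · rw [if_neg (by omega), if_pos hk, if_neg (by omega), if_neg (by omega)]; abel
  · rw [if_neg (by omega), if_neg (by omega), if_pos hk, if_neg (by omega)]; abel
  · rw [if_neg (by omega), if_neg (by omega), if_neg (by omega), if_pos hk]; abel

/-- Components whose degrees do not add up to zero are orthogonal. -/
theorem str_mul_eq_zero {X Y : SMat B} {i j : ℕ} (hX : Gr i X) (hY : Gr j Y)
    (eX : W.IsEvenSuper X) (eY : W.IsEvenSuper Y) (h : (i + j) % 4 ≠ 0) : str (X * Y) = 0 := by
  have h1 := str_omega (X * Y)
  rw [omega_mul eX eY, str_neg, neg_inj, hX, hY, smul_mul_smul_comm, str_smul, ← pow_add,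
    str_mul_comm eY eX] at h1
  have h2 : (Complex.I ^ (j + i) - 1) • str (X * Y) = 0 := by rw [sub_smul, h1, one_smul, sub_self]
  refine (smul_eq_zero.1 h2).resolve_left ?_
  rw [Complex.I_pow_eq_pow_mod, add_comm]
  have hlt : (i + j) % 4 < 4 := Nat.mod_lt _ (by norm_num)
  generalize (i + j) % 4 = m at *
  interval_cases m
  · exact absurd rfl h
  · simp [Complex.ext_iff]
  · norm_num [Complex.I_sq]
  · simp [Complex.I_pow_three, Complex.ext_iff]

/-- A product with an element of `psl(4|4)` does not see scalars. -/
theorem str_mul_tracelessPart (X : SMat B) {Y : SMat B} (hY : tracelessPart Y = Y) :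
    str (tracelessPart X * Y) = str (X * Y) := by
  have : tracelessPart (X - tracelessPart X) = 0 := by
    rw [tracelessPart_sub, tracelessPart_tracelessPart, sub_self]
  have h := (str_tracelessPart_mul Y _ hY this).2
  rw [sub_mul, str_sub, sub_eq_zero] at h
  exact h.symm

theorem str_tracelessPart_mul' (X : SMat B) {Y : SMat B} (hY : tracelessPart Y = Y) :
    str (Y * tracelessPart X) = str (Y * X) := by
  have : tracelessPart (X - tracelessPart X) = 0 := by
    rw [tracelessPart_sub, tracelessPart_tracelessPart, sub_self]
  have h := (str_tracelessPart_mul Y _ hY this).1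
  rw [mul_sub, str_sub, sub_eq_zero] at h
  exact h.symm

/-- Invariance of the supertrace form. -/
theorem str_comm_mul {X Y Z : SMat B} (hX : W.IsEvenSuper X) (hY : W.IsEvenSuper Y)
    (hZ : W.IsEvenSuper Z) : str (comm X Y * Z) = str (X * comm Y Z) := by
  simp only [comm, sub_mul, mul_sub, str_sub]
  rw [mul_assoc Y X Z, str_mul_comm hY (hX.mul hZ)]
  simp only [mul_assoc]

end Super

/-! ### The projection to the kernel of a pure spinor -/

section Ghost

variable {B : Type*} [Ring B] [Algebra ℂ B]

local notation "M₄" => Matrix (Fin 4) (Fin 4)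

theorem eq_of_kflip_eq_neg {P : M₄ B} (hP : kflip P = -P) : P =
    !![P 0 0, 0, P 0 2, P 0 3; 0, P 0 0, P 1 2, P 1 3;
      P 1 3, -P 0 3, P 2 2, 0; -P 1 2, P 0 2, 0, P 2 2] := by
  rw [kflip_eq] at hP
  have e := fun i j => congrFun (congrFun hP i) j
  have h01 : P 0 1 = -P 0 1 := e 0 1
  have h10 : P 1 0 = -P 1 0 := e 1 0
  have h23 : P 2 3 = -P 2 3 := e 2 3
  have h32 : P 3 2 = -P 3 2 := e 3 2
  have h11 : -P 1 1 = -P 0 0 := e 0 0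
  have h33 : -P 3 3 = -P 2 2 := e 2 2
  have h20 : -P 1 3 = -P 2 0 := e 2 0
  have h21 : P 0 3 = -P 2 1 := e 2 1
  have h30 : P 1 2 = -P 3 0 := e 3 0
  have h31 : -P 0 2 = -P 3 1 := e 3 1
  ext i j
  fin_cases i <;> fin_cases j <;> simp
  · exact eq_zero_of_eq_neg h01
  · exact eq_zero_of_eq_neg h10
  · exact neg_inj.1 h11
  · exact (neg_inj.1 h20).symm
  · rw [h21, neg_neg]
  · exact eq_zero_of_eq_neg h23
  · rw [h30, neg_neg]
  · exact (neg_inj.1 h31).symm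
  · exact eq_zero_of_eq_neg h32
  · exact neg_inj.1 h33

/-- `clifford` for matrices in coordinates: `K Mᵗ K = -M` leaves six parameters. -/
theorem clifford_aux (a b c d e f a' b' c' d' e' f' : B)
    (h : ∀ x ∈ [a, b, c, d, e, f], ∀ y : B, y * x = x * y) :
    (!![a, 0, b, c; 0, a, d, e; e, -c, f, 0; -d, b, 0, f] : M₄ B) *
      !![a', 0, b', c'; 0, a', d', e'; e', -c', f', 0; -d', b', 0, f'] +
      !![a', 0, b', c'; 0, a', d', e'; e', -c', f', 0; -d', b', 0, f'] *
      !![a, 0, b, c; 0, a, d, e; e, -c, f, 0; -d, b, 0, f] =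
      (a + f) • !![a', 0, b', c'; 0, a', d', e'; e', -c', f', 0; -d', b', 0, f'] +
      (a' + f') • !![a, 0, b, c; 0, a, d, e; e, -c, f, 0; -d, b, 0, f] +
      Matrix.scalar (Fin 4)
        (b * e' + e * b' - c * d' - d * c' - (f * a' + a * f')) := by
  simp only [List.forall_mem_cons, List.not_mem_nil, false_imp_iff, implies_true, and_true] at h
  obtain ⟨ha, hb, hc, hd, he, hf⟩ := h
  ext i j
  fin_cases i <;> fin_cases j <;>
    (simp only [Matrix.add_apply, Matrix.mul_apply, Fin.sum_univ_four, Matrix.scalar_apply,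
      Matrix.smul_apply, smul_eq_mul]
     simp [add_mul, ha a', ha b', ha c', ha d', ha e', ha f', hb a', hb c', hb d', hb e',
      hb f', hc a', hc b', hc d', hc e', hc f', hd a', hd b', hd c', hd e', hd f',
      he a', he b', he c', he d', he f', hf a', hf b', hf c', hf d', hf e', hf f']
     try abel)

/-- The Clifford relation: the matrices `P` with `K Pᵗ K = -P` are spanned by the identity and five
anticommuting gamma matrices. -/
theorem clifford {P Q : M₄ B} (hP : kflip P = -P) (hQ : kflip Q = -Q)
    (hc : ∀ i j b, P i j * b = b * P i j) : ∃ c : B, P * Q + Q * P =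
      (1 / 2 : ℂ) • (P.trace • Q) + (1 / 2 : ℂ) • (Q.trace • P) + Matrix.scalar (Fin 4) c := by
  have e := clifford_aux (P 0 0) (P 0 2) (P 0 3) (P 1 2) (P 1 3) (P 2 2)
    (Q 0 0) (Q 0 2) (Q 0 3) (Q 1 2) (Q 1 3) (Q 2 2) (by
      simp only [List.forall_mem_cons, List.not_mem_nil, false_imp_iff, implies_true, and_true]
      exact ⟨fun _ => (hc _ _ _).symm, fun _ => (hc _ _ _).symm, fun _ => (hc _ _ _).symm,
        fun _ => (hc _ _ _).symm, fun _ => (hc _ _ _).symm, fun _ => (hc _ _ _).symm⟩)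
  rw [← eq_of_kflip_eq_neg hP, ← eq_of_kflip_eq_neg hQ] at e
  have ht : ∀ P : M₄ B, kflip P = -P → (1 / 2 : ℂ) • P.trace = P 0 0 + P 2 2 := by
    intro P hP
    rw [eq_of_kflip_eq_neg hP]
    simp only [Matrix.trace, Fin.sum_univ_four, Matrix.diag]
    simp
    module
  exact ⟨_, by rw [e, ← ht P hP, ← ht Q hQ, smul_assoc, smul_assoc]⟩

/-- A pair of pure spinors `l, m` of odd degrees `i, j` with `i + j = 0` modulo four, such that
`Str (l m)` is invertible. Bosonic coefficients enter only through the centrality of the entries. -/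
structure GhostPair (i j : ℕ) (l m : SMat B) : Prop where
  odd_left : Odd i
  odd_right : Odd j
  add_mod : (i + j) % 4 = 0
  gr_left : Gr i l
  gr_right : Gr j m
  central_left : CentralEntries l
  central_right : CentralEntries m
  pure_left : tracelessPart (acomm l l) = 0
  pure_right : tracelessPart (acomm m m) = 0
  regular : IsUnit (str (l * m))

variable {i j : ℕ} {l m : SMat B}

theorem GhostPair.symm (h : GhostPair i j l m) : GhostPair j i m l :=
  ⟨h.2, h.1, by rw [add_comm]; exact h.3, h.5, h.4, h.7, h.6, h.9, h.8, by
    rw [str_mul_off_central (h.gr_right.isOff h.2) h.central_right, IsUnit.neg_iff]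
    exact h.regular⟩

theorem GhostPair.isOff_left (h : GhostPair i j l m) : IsOff l := h.gr_left.isOff h.odd_left
theorem GhostPair.isOff_right (h : GhostPair i j l m) : IsOff m := h.gr_right.isOff h.odd_right

/-- A pure spinor squares to a scalar. -/
theorem sq_eq_scalar_of_pure {l : SMat B} (h1 : IsOff l) (h2 : CentralEntries l)
    (h3 : tracelessPart (acomm l l) = 0) : ∃ c : B, l * l = Matrix.scalar (Fin 4 ⊕ Fin 4) c := by
  have h4 := eq_scalar_of_tracelessPart_eq_zero h3 (str_acomm_central h1 h2)
  refine ⟨(1 / 2 : ℂ) • ((1 / 4 : ℂ) • (acomm l l).toBlocks₁₁.trace), ?_⟩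
  have : l * l = (1 / 2 : ℂ) • acomm l l := by rw [acomm]; module
  rw [this]
  nth_rewrite 1 [h4]
  ext i j
  by_cases h : i = j <;> simp [Matrix.scalar_apply, h]

theorem comm_scalar_central {l : SMat B} (h : CentralEntries l) (c : B) :
    comm l (Matrix.scalar (Fin 4 ⊕ Fin 4) c) = 0 := by
  rw [comm, scalar_mul_central h, sub_self]

theorem IsOff.sig_mul_comm {S : SMat B} (h : IsOff S) : sig B * S = -(S * sig B) := by
  rw [h.eq, sig, Matrix.fromBlocks_multiply, Matrix.fromBlocks_multiply, Matrix.fromBlocks_neg]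
  simp

theorem omega_sig_mul {S : SMat B} (h : IsDiag S) : omega (sig B * S) = sig B * omega S := by
  rw [h.eq, sig, Matrix.fromBlocks_multiply]
  simp [omega_fromBlocks, Matrix.fromBlocks_multiply, kflip_neg, kflip_zero]

theorem tracelessPart_sig_mul {S : SMat B} (h : tracelessPart S = S) :
    tracelessPart (sig B * S) = sig B * S := by
  rw [tracelessPart_eq_self_iff] at *
  rw [← Matrix.fromBlocks_toBlocks S, sig, Matrix.fromBlocks_multiply]
  simp [h.1, h.2]

/-- The matrix `S₂` of the projection, `z = y + [l, S₂]`. -/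
def ghostShift (l m y : SMat B) : SMat B :=
  ((2 : ℂ) • Ring.inverse (str (l * m))) • (sig B * tracelessPart (acomm m y))

theorem GhostPair.gr_acomm (h : GhostPair i j l m) {y : SMat B} (hy : Gr j y) :
    Gr 2 (acomm m y) := by
  refine (h.gr_right.acomm_central hy h.odd_right h.odd_right h.central_right).congr ?_
  have := h.odd_right
  obtain ⟨k, rfl⟩ := this
  omega

theorem GhostPair.gr_shift (h : GhostPair i j l m) {y : SMat B} (hy : Gr j y) :
    Gr 2 (ghostShift l m y) := by
  have h1 := (h.gr_acomm hy).tracelessPart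
  have h2 := h1.isDiag even_two
  refine Gr.bsmul _ ?_
  rw [Gr] at *
  rw [omega_sig_mul h2, h1, mul_smul_comm]

theorem traceless_shift (y : SMat B) : tracelessPart (ghostShift l m y) = ghostShift l m y := by
  rw [ghostShift, tracelessPart_bsmul, tracelessPart_sig_mul (tracelessPart_tracelessPart _)]

/-- The map `T ↦ {m, [l, σT]}` multiplies `T = {m, y}` by `-½ Str (l m)`, modulo the centre. As
`T` commutes with `m`, the left side is `σ {[m, l], T}`, and the blocks of `[m, l]` and of `T` are
subject to the Clifford relation; `T` is traceless, and the blocks of `[m, l]` have the traces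
`∓ Str (l m)`. -/
theorem GhostPair.acomm_comm_sig (h : GhostPair i j l m) {y : SMat B} (hy : Gr j y) :
    tracelessPart (acomm m (comm l (sig B * tracelessPart (acomm m y)))) =
      (-(1 / 2 : ℂ)) • (str (l * m) • tracelessPart (acomm m y)) := by
  have gT := (h.gr_acomm hy).tracelessPart
  have dT := gT.isDiag even_two
  have tT := tracelessPart_tracelessPart (acomm m y)
  -- `m` commutes with `T = {m, y}`, because `m²` is a scalar.
  have mT : m * tracelessPart (acomm m y) = tracelessPart (acomm m y) * m := by
    have e := eq_tracelessPart_add_scalar (str_acomm_central (w := y) h.isOff_right h.central_right)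
    obtain ⟨c, hc⟩ := sq_eq_scalar_of_pure h.isOff_right h.central_right h.pure_right
    have h2 : m * acomm m y = acomm m y * m := by
      have h3 : (m * m) * y = y * (m * m) := by
        rw [hc, scalar_mul_of_central]
        intro b
        have := congrFun (congrFun hc (Sum.inl 0)) (Sum.inl 0)
        simp only [Matrix.scalar_apply, Matrix.diagonal_apply_eq, Matrix.mul_apply] at this
        rw [← this, Finset.sum_mul, Finset.mul_sum]
        refine Finset.sum_congr rfl fun k _ => ?_
        rw [mul_assoc, h.central_right k, ← mul_assoc, h.central_right _ k, mul_assoc]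
      calc m * acomm m y = (m * m) * y + m * y * m := by rw [acomm]; noncomm_ring
        _ = y * (m * m) + m * y * m := by rw [h3]
        _ = acomm m y * m := by rw [acomm]; noncomm_ring
    rw [eq_sub_of_add_eq e.symm, mul_sub, sub_mul, h2, scalar_mul_central h.central_right]
  generalize hT : tracelessPart (acomm m y) = T at *
  have hl := h.isOff_left.sig_mul_comm
  have hm := h.isOff_right.sig_mul_comm
  -- `{m, [l, σT]} = σ {[m, l], T}`.
  have e1 : acomm m (comm l (sig B * T)) = sig B * acomm (comm m l) T := by
    have a1 : l * (sig B * T) = -(sig B * (l * T)) := by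
      rw [← mul_assoc, ← mul_assoc, ← neg_mul, hl, neg_neg]
    have a2 : ∀ Z, m * (sig B * Z) = -(sig B * (m * Z)) := fun Z => by
      rw [← mul_assoc, ← mul_assoc, ← neg_mul, hm, neg_neg]
    calc acomm m (comm l (sig B * T)) = m * (l * (sig B * T)) - m * (sig B * (T * l)) +
          (l * (sig B * T)) * m - sig B * (T * (l * m)) := by
          simp only [acomm, comm]; noncomm_ring
      _ = sig B * (m * l * T + (m * T) * l - l * (T * m) - T * l * m) := by
          rw [a1, mul_neg, a2, a2]; noncomm_ring
      _ = _ := by rw [show m * T * l = T * m * l by rw [mT], show l * (T * m) = l * (m * T) by rw [mT],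
          acomm, comm]; noncomm_ring
  rw [e1]
  obtain ⟨hl1, hl2, hl3, hl4⟩ := h.central_left.toBlocks
  obtain ⟨hm1, hm2, hm3, hm4⟩ := h.central_right.toBlocks
  have cU : CentralEntries (comm m l) := by
    intro a b x
    simp only [comm, Matrix.sub_apply, Matrix.mul_apply, sub_mul, mul_sub, Finset.sum_mul,
      Finset.mul_sum]
    congr 1 <;> refine Finset.sum_congr rfl fun k _ => ?_
    · rw [mul_assoc, h.central_left, ← mul_assoc, h.central_right, ← mul_assoc]
    · rw [mul_assoc, h.central_right, ← mul_assoc, h.central_left, ← mul_assoc]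
  have oU : omega (comm m l) = -comm m l := by
    obtain ⟨h1, h2⟩ := omega_mul_off_off h.isOff_left h.isOff_right h.central_left
    have h3 : Complex.I ^ i * Complex.I ^ j = 1 := by
      rw [← pow_add, Complex.I_pow_eq_pow_mod, h.add_mod, pow_zero]
    rw [comm, omega_sub, h1, h2, h.gr_left, h.gr_right, smul_mul_smul_comm, smul_mul_smul_comm,
      h3, mul_comm, h3]
    simp
  have dU : IsDiag (comm m l) := by
    have h1 := h.isOff_left.mul h.isOff_right
    have h2 := h.isOff_right.mul h.isOff_left
    rw [comm, h1.eq, h2.eq, sub_eq_add_neg, Matrix.fromBlocks_neg, Matrix.fromBlocks_add]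
    constructor <;> simp
  -- The blocks of `[m, l]` have the traces `∓ Str (l m)`.
  have t1 : (comm m l).toBlocks₁₁.trace = -str (l * m) ∧
      (comm m l).toBlocks₂₂.trace = str (l * m) := by
    rw [comm, h.isOff_left.eq, h.isOff_right.eq, Matrix.fromBlocks_multiply,
      Matrix.fromBlocks_multiply, sub_eq_add_neg, Matrix.fromBlocks_neg, Matrix.fromBlocks_add]
    simp only [mul_zero, zero_mul, add_zero, zero_add, Matrix.toBlocks_fromBlocks₁₁,
      Matrix.toBlocks_fromBlocks₂₂, str_fromBlocks, Matrix.trace_add, Matrix.trace_neg]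
    rw [trace_mul_of_commute fun i j k => hm2 i j _, trace_mul_of_commute fun i j k => hm3 i j _]
    constructor <;> abel
  generalize comm m l = U at *
  have k1 : ∀ Z : SMat B, IsDiag Z → omega Z = -Z →
      kflip Z.toBlocks₁₁ = -Z.toBlocks₁₁ ∧ kflip Z.toBlocks₂₂ = -Z.toBlocks₂₂ := by
    intro Z hZ hZ'
    rw [hZ.eq, omega_fromBlocks, Matrix.fromBlocks_neg, Matrix.fromBlocks_inj] at hZ'
    exact ⟨hZ'.1, hZ'.2.2.2⟩
  obtain ⟨u1, u2⟩ := k1 U dU oU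
  obtain ⟨v1, v2⟩ := k1 T dT (by rw [gT, Complex.I_sq, neg_one_smul])
  rw [tracelessPart_eq_self_iff] at tT
  obtain ⟨c1, hc1⟩ := clifford u1 v1 fun i j => cU _ _
  obtain ⟨c2, hc2⟩ := clifford u2 v2 fun i j => cU _ _
  have e2 : sig B * acomm U T = Matrix.fromBlocks
      (U.toBlocks₁₁ * T.toBlocks₁₁ + T.toBlocks₁₁ * U.toBlocks₁₁) 0 0
      (-(U.toBlocks₂₂ * T.toBlocks₂₂ + T.toBlocks₂₂ * U.toBlocks₂₂)) := by
    conv_lhs => rw [dT.eq, dU.eq, sig, acomm]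
    simp [Matrix.fromBlocks_multiply, Matrix.fromBlocks_add]
  have e3 : sig B * acomm U T = (-(1 / 2 : ℂ)) • (str (l * m) • T) +
      Matrix.fromBlocks (Matrix.scalar (Fin 4) c1) 0 0 (-(Matrix.scalar (Fin 4) c2)) := by
    rw [e2, hc1, hc2, t1.1, t1.2, tT.1, tT.2]
    conv_rhs => rw [dT.eq]
    simp only [Matrix.fromBlocks_smul, Matrix.fromBlocks_add, smul_zero, zero_smul, add_zero]
    congr 1
    · simp
    · simp [add_comm]
  have e4 : tracelessPart (Matrix.fromBlocks (Matrix.scalar (Fin 4) c1) 0 0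
      (-(Matrix.scalar (Fin 4) c2))) = 0 := by
    have ht : ∀ c : B, (1 / 4 : ℂ) • (Matrix.scalar (Fin 4) c).trace = c := by
      intro c
      simp only [Matrix.scalar_apply, Matrix.trace_diagonal, Finset.sum_const, Finset.card_univ,
        Fintype.card_fin, ← Nat.cast_smul_eq_nsmul ℂ, smul_smul]
      norm_num
    rw [tracelessPart_fromBlocks, ht, Matrix.trace_neg, smul_neg, ht, sub_self, map_neg,
      sub_neg_eq_add, neg_add_cancel, Matrix.fromBlocks_zero]
  rw [e3, tracelessPart_add, e4, add_zero, tracelessPart_smul, tracelessPart_bsmul,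
    (tracelessPart_eq_self_iff T).2 tT]

theorem bsmul_comm_of_central {e : B} (he : ∀ b, e * b = b * e) (X Y : SMat B) :
    comm X (e • Y) = e • comm X Y := by
  have : X * (e • Y) = e • (X * Y) := by
    ext i j
    simp only [Matrix.mul_apply, Matrix.smul_apply, smul_eq_mul, Finset.mul_sum]
    exact Finset.sum_congr rfl fun k _ => by rw [← mul_assoc, ← he, mul_assoc]
  rw [comm, comm, this, smul_mul_assoc, smul_sub]

theorem bsmul_acomm_of_central {l : SMat B} (hl : CentralEntries l) (e : B) (X : SMat B) :
    acomm l (e • X) = e • acomm l X := by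
  have : l * (e • X) = e • (l * X) := by
    ext i j
    simp only [Matrix.mul_apply, Matrix.smul_apply, smul_eq_mul, Finset.mul_sum]
    exact Finset.sum_congr rfl fun k _ => by rw [← mul_assoc, hl, mul_assoc]
  rw [acomm, acomm, this, smul_mul_assoc, smul_add]

theorem bsmul_comm_left_of_central {l : SMat B} (hl : CentralEntries l) (e : B) (X : SMat B) :
    comm l (e • X) = e • comm l X := by
  have : l * (e • X) = e • (l * X) := by
    ext i j
    simp only [Matrix.mul_apply, Matrix.smul_apply, smul_eq_mul, Finset.mul_sum]
    exact Finset.sum_congr rfl fun k _ => by rw [← mul_assoc, hl, mul_assoc]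
  rw [comm, comm, this, smul_mul_assoc, smul_sub]

/-- The explicit solution of the conditions which define the projection. -/
theorem GhostPair.isGhostProj (h : GhostPair i j l m) {y : SMat B} (hy : Gr j y) :
    IsGhostProj l m y (y + comm l (ghostShift l m y)) := by
  refine ⟨_, (proj_eq_self_iff _ _).2 ⟨h.gr_shift hy, traceless_shift y⟩, rfl, ?_⟩
  rw [ghostShift, bsmul_comm_left_of_central h.central_left, acomm_add,
    bsmul_acomm_of_central h.central_right, tracelessPart_add, tracelessPart_bsmul,
    h.acomm_comm_sig hy, smul_comm _ (-(1 / 2 : ℂ)), smul_smul, smul_mul_assoc,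
    Ring.inverse_mul_cancel _ h.regular, smul_assoc, one_smul]
  module

/-- The supertrace of a product of `[l, S]` with an element of the kernel of `{l, ·}`. -/
theorem str_comm_mul_of_acomm {l S z : SMat B} (hl : IsOff l) (hc : CentralEntries l)
    (hS : tracelessPart S = S) (hz : tracelessPart (acomm l z) = 0) :
    str (comm l S * z) = 0 := by
  have h1 : comm l S * z = l * (S * z) - S * (l * z) := by rw [comm]; noncomm_ring
  have h2 := (str_tracelessPart_mul S _ hS hz).1
  rw [h1, str_sub, str_mul_off_central hl hc, ← neg_add', ← str_add, mul_assoc, ← mul_add,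
    add_comm (z * l), ← acomm, h2, neg_zero]

theorem str_mul_comm_of_acomm {l S z : SMat B} (hl : IsOff l) (hc : CentralEntries l)
    (hS : tracelessPart S = S) (hz : tracelessPart (acomm l z) = 0) :
    str (z * comm l S) = 0 := by
  have h1 : z * comm l S = z * l * S - z * S * l := by rw [comm]; noncomm_ring
  have h2 := (str_tracelessPart_mul S _ hS hz).2
  have h3 := str_mul_off_central (w := z * S) hl hc
  rw [h1, str_sub, ← sub_eq_zero.2 h2, acomm, add_mul, str_add, mul_assoc l z S, h3]
  abel

/-- The supertrace form is nondegenerate. -/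
theorem eq_zero_of_str_mul {X : SMat B} (h : ∀ a b, str (X * Matrix.single a b 1) = 0) :
    X = 0 := by
  ext a b
  have := h b a
  have e : str (X * Matrix.single b a 1) = X a b ∨ str (X * Matrix.single b a 1) = -X a b := by
    have e : ∀ c, (X * Matrix.single b a (1 : B)) c c = if c = a then X a b else 0 := by
      intro c
      split_ifs with hc
      · rw [hc]; simp
      · exact (Matrix.mul_single_apply_of_ne (hbj := hc) ..)
    simp only [str, Matrix.trace, Matrix.diag, Matrix.toBlocks₁₁, Matrix.toBlocks₂₂,
      Matrix.of_apply, e]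
    cases a <;> simp
  rw [this] at e
  rcases e with e | e
  · exact e.symm
  · simpa using e.symm

theorem str_off_mul_diag {X Y : SMat B} (hX : IsOff X) (hY : IsDiag Y) : str (X * Y) = 0 :=
  (hX.mul_diag hY).str_eq

theorem str_mul_proj {X Y : SMat B} {i j : ℕ} (hX : Gr j X) (hi : Odd i) (hj : Odd j)
    (hij : (i + j) % 4 = 0) (hY : CentralEntries Y) (oY : IsOff Y) :
    str (X * proj i Y) = str (X * Y) := by
  have oX := hX.isOff hj
  have hI : Complex.I ^ (3 * i) * Complex.I ^ i = 1 := by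
    rw [← pow_add, show 3 * i + i = 4 * i by ring, pow_mul, Complex.I_pow_four, one_pow]
  have key : str (X * omega Y) = Complex.I ^ i • str (X * Y) := by
    have h1 := str_omega (Y * X)
    rw [(omega_mul_off_off oY oX hY).1, hX, smul_mul_assoc, str_smul, str_mul_off_central oY hY,
      neg_neg] at h1
    rw [← h1, smul_smul, ← pow_add, Complex.I_pow_eq_pow_mod, hij, pow_zero, one_smul]
  have o2 : omega (omega Y) = -Y := by
    rw [omega_omega, oY.sig_mul_comm, neg_mul, mul_assoc, sig_mul_sig, mul_one]
  have oo : IsOff (omega Y) := by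
    rw [oY.eq, omega_fromBlocks, kflip_zero]
    constructor <;> simp
  have e : proj i Y = (1 / 2 : ℂ) • (Y + Complex.I ^ (3 * i) • omega Y) := by
    have h6 : Complex.I ^ (6 * i) = -1 := by
      rw [show 6 * i = (2 * 3) * i by ring, pow_mul, pow_mul, Complex.I_sq,
        Odd.neg_one_pow (by decide : Odd 3), hi.neg_one_pow]
    have h9 : Complex.I ^ (9 * i) = -Complex.I ^ (3 * i) := by
      rw [show 9 * i = 6 * i + 3 * i by ring, pow_add, h6, neg_one_mul]
    rw [proj_eq, o2, omega_neg, h6, h9, tracelessPart_smul]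
    simp only [tracelessPart_add, tracelessPart_smul, tracelessPart_neg, oY.tracelessPart_eq,
      oo.tracelessPart_eq]
    module
  rw [e, mul_smul_comm, mul_add, mul_smul_comm, str_smul, str_add, str_smul, key, smul_smul, hI]
  module

theorem central_single (a b : Fin 4 ⊕ Fin 4) : CentralEntries (Matrix.single a b (1 : B)) := by
  intro i j x
  by_cases h : a = i ∧ b = j <;> simp [Matrix.single, h]

/-- Uniqueness of the projection. The difference of two solutions is a commutator with `l`, hence
orthogonal to every solution `x` of `{l, x} = 0`. By existence with the roles of the two ghosts
exchanged, every matrix of the dual degree is such an `x` up to a commutator with `m`, to which the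
difference is orthogonal as well; so it vanishes. -/
theorem GhostPair.unique (h : GhostPair i j l m) {y z z' : SMat B} (hz : IsGhostProj l m y z)
    (hz' : IsGhostProj l m y z') : z = z' := by
  obtain ⟨S, hS, rfl, h1⟩ := hz
  obtain ⟨S', hS', rfl, h2⟩ := hz'
  rw [add_right_inj, ← sub_eq_zero, ← comm_sub]
  have h3 : tracelessPart (acomm m (comm l (S - S'))) = 0 := by
    have : acomm m (comm l (S - S')) =
        acomm m (y + comm l S) - acomm m (y + comm l S') := by
      rw [← acomm_sub, comm_sub]; congr 1; abel
    rw [this, tracelessPart_sub, h1, h2, sub_zero]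
  have hT := (proj_eq_self_iff 2 (S - S')).1 (by rw [proj_sub, hS, hS'])
  generalize S - S' = T at *
  have g := hT.1.isDiag even_two
  have gl : Gr j (comm l T) := by
    refine (h.gr_left.comm_central hT.1 h.odd_left even_two h.central_left).congr ?_
    have := h.add_mod
    obtain ⟨a, ha⟩ := h.odd_left
    omega
  have go := gl.isOff h.odd_right
  apply eq_zero_of_str_mul
  intro a b
  have key : ∀ Y : SMat B, CentralEntries Y → IsOff Y → str (comm l T * Y) = 0 := by
    intro Y hY oY
    rw [← str_mul_proj gl h.odd_left h.odd_right h.add_mod hY oY]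
    obtain ⟨S, hS, -, hz⟩ := h.symm.isGhostProj (y := proj i Y) (proj_gr i Y)
    generalize hzz : proj i Y + comm m (ghostShift m l (proj i Y)) = z at hz
    rw [eq_sub_of_add_eq hzz, mul_sub, str_sub,
      str_comm_mul_of_acomm h.isOff_left h.central_left hT.2 hz,
      str_mul_comm_of_acomm h.isOff_right h.central_right (traceless_shift _) h3, sub_zero]
  rcases a with a | a <;> rcases b with b | b
  · refine str_off_mul_diag go ?_
    constructor <;> ext <;> simp [Matrix.toBlocks₁₂, Matrix.toBlocks₂₁]
  · refine key _ (central_single _ _) ?_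
    constructor <;> ext <;> simp [Matrix.toBlocks₁₁, Matrix.toBlocks₂₂]
  · refine key _ (central_single _ _) ?_
    constructor <;> ext <;> simp [Matrix.toBlocks₁₁, Matrix.toBlocks₂₂]
  · refine str_off_mul_diag go ?_
    constructor <;> ext <;> simp [Matrix.toBlocks₁₂, Matrix.toBlocks₂₁]

theorem GhostPair.existsUnique (h : GhostPair i j l m) {y : SMat B} (hy : Gr j y) :
    ∃! z, IsGhostProj l m y z :=
  ⟨_, h.isGhostProj hy, fun _ hz => h.unique hz (h.isGhostProj hy)⟩

theorem GhostPair.ghostProj_eq (h : GhostPair i j l m) {y z : SMat B}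
    (hz : IsGhostProj l m y z) : ghostProj l m y = z := by
  have hex : ∃ z, IsGhostProj l m y z := ⟨z, hz⟩
  rw [ghostProj, dif_pos hex]
  exact h.unique hex.choose_spec hz

theorem GhostPair.ghostProj_eq_shift (h : GhostPair i j l m) {y : SMat B} (hy : Gr j y) :
    ghostProj l m y = y + comm l (ghostShift l m y) := h.ghostProj_eq (h.isGhostProj hy)

theorem GhostPair.isGhostProj_ghostProj (h : GhostPair i j l m) {y : SMat B} (hy : Gr j y) :
    IsGhostProj l m y (ghostProj l m y) := by
  rw [h.ghostProj_eq_shift hy]; exact h.isGhostProj hy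

theorem ghostShift_add (l m y y' : SMat B) :
    ghostShift l m (y + y') = ghostShift l m y + ghostShift l m y' := by
  rw [ghostShift, acomm_add, tracelessPart_add, mul_add, smul_add, ghostShift, ghostShift]

theorem ghostShift_smul (l m y : SMat B) (c : ℂ) :
    ghostShift l m (c • y) = c • ghostShift l m y := by
  rw [ghostShift, acomm_smul, tracelessPart_smul, mul_smul_comm, smul_comm, ghostShift]

theorem GhostPair.ghostProj_add (h : GhostPair i j l m) {y y' : SMat B} (hy : Gr j y)
    (hy' : Gr j y') : ghostProj l m (y + y') = ghostProj l m y + ghostProj l m y' := by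
  rw [h.ghostProj_eq_shift hy, h.ghostProj_eq_shift hy', h.ghostProj_eq_shift (hy.add hy'),
    ghostShift_add, comm_add]
  abel

theorem GhostPair.ghostProj_smul (h : GhostPair i j l m) {y : SMat B} (hy : Gr j y) (c : ℂ) :
    ghostProj l m (c • y) = c • ghostProj l m y := by
  rw [h.ghostProj_eq_shift hy, h.ghostProj_eq_shift (hy.smul c), ghostShift_smul, comm_smul,
    smul_add]

theorem GhostPair.ghostProj_bsmul (h : GhostPair i j l m) {y : SMat B} (hy : Gr j y) (e : B) :
    ghostProj l m (e • y) = e • ghostProj l m y := by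
  refine h.ghostProj_eq ?_
  obtain ⟨S, hS, hz, h0⟩ := h.isGhostProj_ghostProj hy
  refine ⟨e • S, by rw [proj_bsmul, hS], ?_, ?_⟩
  · rw [bsmul_comm_left_of_central h.central_left, hz, smul_add]
  · rw [bsmul_acomm_of_central h.central_right, tracelessPart_bsmul, h0, smul_zero]

theorem GhostPair.ghostProj_gr (h : GhostPair i j l m) {y : SMat B} (hy : Gr j y) :
    Gr j (ghostProj l m y) := by
  rw [h.ghostProj_eq_shift hy]
  refine hy.add ((h.gr_left.comm_central (h.gr_shift hy) h.odd_left even_two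
    h.central_left).congr ?_)
  have := h.add_mod
  obtain ⟨a, ha⟩ := h.odd_left
  omega

theorem GhostPair.acomm_ghostProj (h : GhostPair i j l m) {y : SMat B} (hy : Gr j y) :
    tracelessPart (acomm m (ghostProj l m y)) = 0 := by
  obtain ⟨-, -, -, h0⟩ := h.isGhostProj_ghostProj hy
  exact h0

/-- The projections along the two ghosts are transposes of each other. -/
theorem GhostPair.str_ghostProj_mul (h : GhostPair i j l m) {x y : SMat B} (hx : Gr i x)
    (hy : Gr j y) : str (ghostProj m l x * y) = str (x * ghostProj l m y) := by
  have h1 := h.ghostProj_eq_shift hy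
  have h2 := h.symm.ghostProj_eq_shift hx
  have h3 := str_mul_comm_of_acomm h.isOff_left h.central_left (traceless_shift (m := m) (l := l) y)
    (h.symm.acomm_ghostProj hx)
  have h4 := str_comm_mul_of_acomm h.isOff_right h.central_right
    (traceless_shift (m := l) (l := m) x) (h.acomm_ghostProj hy)
  rw [← sub_eq_of_eq_add' h1, mul_sub, str_sub] at h3
  rw [← sub_eq_of_eq_add' h2, sub_mul, str_sub] at h4
  rw [sub_eq_zero] at h3 h4
  rw [← h3, h4]

end Ghost

/-! ### The extension of the operator `R` to superfields -/

section Extension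

variable {B : Type*} [Ring B] [Algebra ℂ B]

theorem toPsl_coe (X : SMat ℂ) : (toPsl X : SMat ℂ) = tracelessPart X := rfl

/-- `toPsl` as a linear map. -/
def toPslLin : SMat ℂ →ₗ[ℂ] psl :=
  LinearMap.codRestrict psl tracelessLin tracelessPart_mem

theorem toPslLin_apply (X : SMat ℂ) : toPslLin X = toPsl X := rfl

theorem toPsl_coe_psl (X : psl) : toPsl (X : SMat ℂ) = X :=
  Subtype.ext ((tracelessPart_eq_self_iff _).2 X.2)

/-- The matrix `M x`, for a numerical matrix `M` and a superfield `x`. -/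
def ten (M : SMat ℂ) (x : B) : SMat B := M.map (LinearMap.toSpanSingleton ℂ B x)

theorem ten_apply (M : SMat ℂ) (x : B) (i j) : ten M x i j = M i j • x := rfl

theorem ten_add (M N : SMat ℂ) (x : B) : ten (M + N) x = ten M x + ten N x := by
  ext; simp [ten_apply, add_smul]
theorem ten_smul (c : ℂ) (M : SMat ℂ) (x : B) : ten (c • M) x = ten M (c • x) := by
  ext; simp only [ten_apply, Matrix.smul_apply, smul_assoc]; rw [smul_comm]
theorem ten_neg (M : SMat ℂ) (x : B) : ten (-M) x = -ten M x := by
  ext; simp [ten_apply]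
theorem ten_sum {ι : Type*} (s : Finset ι) (M : ι → SMat ℂ) (x : B) :
    ten (∑ i ∈ s, M i) x = ∑ i ∈ s, ten (M i) x := by
  ext i j; simp only [ten_apply, Matrix.sum_apply, Finset.sum_smul]
theorem ten_mul (M N : SMat ℂ) (x y : B) : ten M x * ten N y = ten (M * N) (x * y) := by
  ext i j
  simp only [ten_apply, Matrix.mul_apply, Finset.sum_smul, smul_mul_smul_comm]

theorem tracelessPart_ten (M : SMat ℂ) (x : B) :
    tracelessPart (ten M x) = ten (tracelessPart M) x := tracelessPart_map _ M

theorem str_ten (M : SMat ℂ) (x : B) : str (ten M x) = str M • x := str_map _ M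

theorem sum_ten_single (X : SMat B) : X = ∑ i, ∑ j, ten (Matrix.single i j 1) (X i j) := by
  ext a b
  simp only [Matrix.sum_apply, ten_apply]
  rw [Finset.sum_eq_single a, Finset.sum_eq_single b]
  · simp
  · intro j _ hj; simp [Matrix.single, hj]
  · simp
  · intro i _ hi
    refine Finset.sum_eq_zero fun j _ => ?_
    simp [Matrix.single, hi]
  · simp

variable (R : psl →ₗ[ℂ] psl)

theorem extend_eq (X : SMat B) :
    extend R X = ∑ i, ∑ j, ten (R (toPsl (Matrix.single i j 1)) : SMat ℂ) (X i j) := by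
  simp only [extend]
  refine Finset.sum_congr rfl fun i _ => Finset.sum_congr rfl fun j _ => ?_
  ext k l
  simp [ten_apply, Algebra.smul_def]

theorem ten_add_right (M : SMat ℂ) (x y : B) : ten M (x + y) = ten M x + ten M y := by
  ext; simp [ten_apply]
theorem ten_map (M : SMat ℂ) (f : B →ₗ[ℂ] B) (x : B) : (ten M x).map f = ten M (f x) := by
  ext; simp [ten_apply]

/-- `extend R` as a linear map. -/
def extendLin : SMat B →ₗ[ℂ] SMat B where
  toFun := extend R
  map_add' X Y := by
    simp only [extend_eq, Matrix.add_apply, ten_add_right, Finset.sum_add_distrib]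
  map_smul' c X := by
    simp only [extend_eq, Matrix.smul_apply, RingHom.id_apply, Finset.smul_sum]
    refine Finset.sum_congr rfl fun i _ => Finset.sum_congr rfl fun j _ => ?_
    ext k l
    simp only [ten_apply, Matrix.smul_apply]
    rw [smul_comm]

theorem extend_add (X Y : SMat B) : extend R (X + Y) = extend R X + extend R Y :=
  map_add (extendLin R) X Y
theorem extend_sub (X Y : SMat B) : extend R (X - Y) = extend R X - extend R Y :=
  map_sub (extendLin R) X Y
theorem extend_smul (c : ℂ) (X : SMat B) : extend R (c • X) = c • extend R X :=
  map_smul (extendLin R) c X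
theorem extend_zero : extend R (0 : SMat B) = 0 := map_zero (extendLin R)

theorem extend_map (f : B →ₗ[ℂ] B) (X : SMat B) : extend R (X.map f) = (extend R X).map f := by
  have h : ∀ {ι : Type} (s : Finset ι) (Z : ι → SMat B),
      (∑ i ∈ s, Z i).map f = ∑ i ∈ s, (Z i).map f := by
    intro ι s Z; ext a b; simp [Matrix.sum_apply]
  simp only [extend_eq, h, ten_map, Matrix.map_apply]

theorem extend_bsmul (e : B) (X : SMat B) : extend R (e • X) = e • extend R X := by
  rw [bsmul_eq_map, bsmul_eq_map, extend_map]

theorem extend_ten (M : SMat ℂ) (x : B) : extend R (ten M x) = ten (R (toPsl M) : SMat ℂ) x := by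
  have e : (R (toPsl M) : SMat ℂ) =
      ∑ i, ∑ j, M i j • (R (toPsl (Matrix.single i j 1)) : SMat ℂ) := by
    have : M = ∑ i, ∑ j, M i j • Matrix.single i j (1 : ℂ) := by
      conv_lhs => rw [Matrix.matrix_eq_sum_single M]
      simp
    conv_lhs => rw [this, ← toPslLin_apply]
    simp only [map_sum, map_smul, toPslLin_apply, Submodule.coe_sum, Submodule.coe_smul]
  rw [extend_eq, e]
  simp only [ten_sum, ten_smul, ten_apply]

/-- Additive induction over the tensors `M ⊗ x`. -/
theorem ten_induction {motive : SMat B → Prop} (X : SMat B) (zero : motive 0)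
    (add : ∀ X Y, motive X → motive Y → motive (X + Y)) (ten : ∀ M x, motive (ten M x)) :
    motive X := by
  rw [sum_ten_single X]
  exact Finset.sum_induction _ _ (fun a b => add a b) zero fun i _ =>
    Finset.sum_induction _ _ (fun a b => add a b) zero fun j _ => ten _ _

theorem toPsl_tracelessPart (M : SMat ℂ) : toPsl (tracelessPart M) = toPsl M :=
  Subtype.ext (tracelessPart_tracelessPart M)

theorem extend_tracelessPart (X : SMat B) : extend R (tracelessPart X) = extend R X := by
  induction X using ten_induction with
  | zero => rw [tracelessPart_zero]
  | add X Y hX hY => rw [tracelessPart_add, extend_add, hX, hY, extend_add]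
  | ten M x => rw [tracelessPart_ten, extend_ten, extend_ten, toPsl_tracelessPart]

theorem extend_congr {X Y : SMat B} (h : tracelessPart X = tracelessPart Y) :
    extend R X = extend R Y := by
  rw [← extend_tracelessPart, h, extend_tracelessPart]

theorem tracelessPart_psl (M : psl) : tracelessPart (M : SMat ℂ) = M :=
  (tracelessPart_eq_self_iff _).2 M.2

theorem tracelessPart_extend (X : SMat B) : tracelessPart (extend R X) = extend R X := by
  induction X using ten_induction with
  | zero => rw [extend_zero, tracelessPart_zero]
  | add X Y hX hY => rw [extend_add, tracelessPart_add, hX, hY]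
  | ten M x => rw [extend_ten, tracelessPart_ten, tracelessPart_psl]

variable {R}

theorem str_extend_mul (hR : IsAntisymmetric R) (X Y : SMat B) :
    str (extend R X * Y) = -str (X * extend R Y) := by
  induction X using ten_induction with
  | zero => simp only [extend_zero, zero_mul, str_zero, neg_zero]
  | add X X' hX hX' => simp only [extend_add, add_mul, str_add, hX, hX', neg_add]
  | ten M x =>
    induction Y using ten_induction with
    | zero => simp only [extend_zero, mul_zero, str_zero, neg_zero]
    | add Y Y' hY hY' => simp only [extend_add, mul_add, str_add, hY, hY', neg_add]
    | ten N y =>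
      have h := hR (toPsl M) (toPsl N)
      rw [toPsl_coe, toPsl_coe, str_tracelessPart_mul' _ (tracelessPart_psl _),
        str_mul_tracelessPart _ (tracelessPart_psl _)] at h
      rw [extend_ten, extend_ten, ten_mul, ten_mul, str_ten, str_ten, h, neg_smul]

variable {W : Worldsheet B}

theorem even_ten_of_diag {M : SMat ℂ} {x : B} (hM : IsDiag M) (hx : W.parity x = x) :
    W.IsEvenSuper (ten M x) := by
  rw [hM.eq, ten, Matrix.fromBlocks_map, isEvenSuper_fromBlocks]
  simp [hx]

theorem even_ten_of_off {M : SMat ℂ} {x : B} (hM : IsOff M) (hx : W.parity x = -x) :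
    W.IsEvenSuper (ten M x) := by
  rw [hM.eq, ten, Matrix.fromBlocks_map, isEvenSuper_fromBlocks]
  simp [hx]

theorem IsDiag.tracelessPart {X : SMat B} (h : IsDiag X) : IsDiag (tracelessPart X) := by
  rw [h.eq, tracelessPart_fromBlocks]; constructor <;> simp

theorem IsDiag.diagPart {X : SMat B} (h : IsDiag X) : diagPart X = X := by
  rw [h.eq, PureSpinor.diagPart]; simp
theorem IsOff.offDiagPart {X : SMat B} (h : IsOff X) : offDiagPart X = X := by
  rw [h.eq, PureSpinor.offDiagPart]; simp
theorem IsDiag.offDiagPart {X : SMat B} (h : IsDiag X) : offDiagPart X = 0 := by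
  rw [h.eq, PureSpinor.offDiagPart]; simp
theorem isDiag_diagPart (X : SMat B) : IsDiag (diagPart X) := by
  rw [diagPart]; constructor <;> simp
theorem isOff_offDiagPart (X : SMat B) : IsOff (offDiagPart X) := by
  rw [offDiagPart]; constructor <;> simp

theorem IsEvenOperator.isDiag (hR : IsEvenOperator R) {X : psl} (h : IsDiag (X : SMat ℂ)) :
    IsDiag (R X : SMat ℂ) := by
  have := (hR X).1
  rw [h.diagPart, toPsl_coe_psl] at this
  rw [this]; exact isDiag_diagPart _

theorem IsEvenOperator.isOff (hR : IsEvenOperator R) {X : psl} (h : IsOff (X : SMat ℂ)) :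
    IsOff (R X : SMat ℂ) := by
  have := (hR X).2
  rw [h.offDiagPart, toPsl_coe_psl] at this
  rw [this]; exact isOff_offDiagPart _

/-- Induction for even superfields with values in `psl(4|4)`. -/
theorem even_induction {motive : SMat B → Prop} {X : SMat B} (hX : W.IsEvenSuper X)
    (tX : tracelessPart X = X) (zero : motive 0)
    (add : ∀ X Y, motive X → motive Y → motive (X + Y))
    (diag : ∀ (M : psl) (x : B), IsDiag (M : SMat ℂ) → W.parity x = x → motive (ten M x))
    (off : ∀ (M : psl) (x : B), IsOff (M : SMat ℂ) → W.parity x = -x → motive (ten M x)) :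
    motive X := by
  have e : X = ∑ i, ∑ j, ten (toPsl (Matrix.single i j 1) : SMat ℂ) (X i j) := by
    have h : ∀ (Z : SMat B), tracelessPart Z = tracelessLin Z := fun _ => rfl
    conv_lhs => rw [← tX, sum_ten_single X, h]
    simp only [map_sum, tracelessLin_apply, tracelessPart_ten, toPsl_coe]
  rw [e]
  obtain ⟨h1, h2, h3, h4⟩ := isEvenSuper_fromBlocks' hX
  refine Finset.sum_induction _ _ (fun a b => add a b) zero fun i _ =>
    Finset.sum_induction _ _ (fun a b => add a b) zero fun j _ => ?_
  rcases i with i | i <;> rcases j with j | j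
  · refine diag _ _ ?_ (h1 i j)
    refine IsDiag.tracelessPart ?_
    constructor <;> ext <;> simp [Matrix.toBlocks₁₂, Matrix.toBlocks₂₁]
  · have : IsOff (Matrix.single (Sum.inl i) (Sum.inr j) (1 : ℂ)) := by
      constructor <;> ext <;> simp [Matrix.toBlocks₁₁, Matrix.toBlocks₂₂]
    refine off _ _ ?_ (h2 i j)
    rw [toPsl_coe, this.tracelessPart_eq]; exact this
  · have : IsOff (Matrix.single (Sum.inr i) (Sum.inl j) (1 : ℂ)) := by
      constructor <;> ext <;> simp [Matrix.toBlocks₁₁, Matrix.toBlocks₂₂]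
    refine off _ _ ?_ (h3 i j)
    rw [toPsl_coe, this.tracelessPart_eq]; exact this
  · refine diag _ _ ?_ (h4 i j)
    refine IsDiag.tracelessPart ?_
    constructor <;> ext <;> simp [Matrix.toBlocks₁₂, Matrix.toBlocks₂₁]

theorem Worldsheet.IsEvenSuper.zero : W.IsEvenSuper (0 : SMat B) := by
  have := (Worldsheet.IsEvenSuper.one (W := W)).smul 0
  rwa [zero_smul] at this

theorem IsSl.extend (hR : IsEvenOperator R) {X : SMat B} (hX : W.IsEvenSuper X) :
    IsSl W (extend R X) := by
  refine ⟨?_, str_of_traceless (tracelessPart_extend R X)⟩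
  rw [← extend_tracelessPart]
  refine even_induction hX.tracelessPart (tracelessPart_tracelessPart X)
    (motive := fun X => W.IsEvenSuper (PureSpinor.extend R X)) ?_ ?_ ?_ ?_
  · rw [extend_zero]; exact Worldsheet.IsEvenSuper.zero
  · intro X Y hX hY; rw [extend_add]; exact hX.add hY
  · intro M x hM hx
    rw [extend_ten, toPsl_coe_psl]
    exact even_ten_of_diag (hR.isDiag hM) hx
  · intro M x hM hx
    rw [extend_ten, toPsl_coe_psl]
    exact even_ten_of_off (hR.isOff hM) hx

/-- The matrix whose class is the superbracket. -/
def superBr (M N : SMat ℂ) : SMat ℂ := comm M N + 2 • (offDiagPart N * offDiagPart M)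

/-- A numerical matrix and a superfield of equal parity: `M x` is an even supermatrix. -/
def SameParity (W : Worldsheet B) (M : SMat ℂ) (x : B) : Prop :=
  (IsDiag M ∧ W.parity x = x) ∨ (IsOff M ∧ W.parity x = -x)

/-- On even supermatrices the commutator is the Grassmann envelope of the superbracket. -/
theorem comm_ten {M N : SMat ℂ} {x y : B} (hM : SameParity W M x) (hN : SameParity W N y) :
    comm (ten M x) (ten N y) = ten (superBr M N) (x * y) := by
  have main : ∀ s : ℂ, y * x = s • (x * y) → superBr M N = M * N - s • (N * M) →
      comm (ten M x) (ten N y) = ten (superBr M N) (x * y) := by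
    intro s h1 h2
    rw [comm, ten_mul, ten_mul, h1, h2, sub_eq_add_neg (M * N), ten_add, ten_neg, ten_smul,
      sub_eq_add_neg]
  rcases hM with ⟨h1, h2⟩ | ⟨h1, h2⟩
  · refine main 1 (by rw [W.even_comm x y h2, one_smul]) ?_
    rw [superBr, h1.offDiagPart, mul_zero, smul_zero, add_zero, one_smul, comm]
  · rcases hN with ⟨h3, h4⟩ | ⟨h3, h4⟩
    · refine main 1 (by rw [W.even_comm y x h4, one_smul]) ?_
      rw [superBr, h3.offDiagPart, zero_mul, smul_zero, add_zero, one_smul, comm]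
    · refine main (-1) (by rw [W.odd_anticomm y x h4 h2, neg_one_smul]) ?_
      rw [superBr, h1.offDiagPart, h3.offDiagPart, comm]
      module

theorem SameParity.map (hR : IsEvenOperator R) {M : psl} {x : B} (h : SameParity W M x) :
    SameParity W (R M : SMat ℂ) x :=
  h.imp (fun h => ⟨hR.isDiag h.1, h.2⟩) fun h => ⟨hR.isOff h.1, h.2⟩

/-- The classical Yang-Baxter equation for superfields with values in `psl(4|4)`. -/
theorem SolvesCYBE.comm_extend (hR : IsEvenOperator R) (hYB : SolvesCYBE R) {X Y : SMat B}
    (hX : IsSl W X) (hY : IsSl W Y) :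
    tracelessPart (comm (extend R X) (extend R Y)) =
      extend R (comm (extend R X) Y + comm X (extend R Y)) := by
  rw [← hX.comm_tracelessPart, ← hY.comm_tracelessPart_right, ← extend_tracelessPart R X,
    ← extend_tracelessPart R Y]
  refine even_induction hX.1.tracelessPart (tracelessPart_tracelessPart X)
    (motive := fun X => ∀ Y, W.IsEvenSuper Y → tracelessPart Y = Y →
      tracelessPart (comm (extend R X) (extend R Y)) =
      extend R (comm (extend R X) Y + comm X (extend R Y))) ?_ ?_ ?_ ?_ _
        hY.1.tracelessPart (tracelessPart_tracelessPart Y)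
  · intro Y _ _
    simp only [extend_zero, zero_comm', tracelessPart_zero, add_zero]
  · intro X X' h h' Y e t
    have h := h Y e t
    have h' := h' Y e t
    simp only [extend_add, add_comm', tracelessPart_add] at h h' ⊢
    rw [h, h']
    abel
  all_goals
    intro M x hM hx Y eY tY
    refine even_induction eY tY (motive := fun Y =>
      tracelessPart (comm (extend R (ten M x)) (extend R Y)) =
      extend R (comm (extend R (ten M x)) Y + comm (ten M x) (extend R Y))) ?_ ?_ ?_ ?_
    · simp only [extend_zero, comm_zero, tracelessPart_zero, add_zero]
    · intro Y Y' h h'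
      simp only [extend_add, comm_add, tracelessPart_add] at h h' ⊢
      rw [h, h']
      abel
  all_goals
    intro N y hN hy
    have pM : SameParity W (M : SMat ℂ) x := by first | exact .inl ⟨hM, hx⟩ | exact .inr ⟨hM, hx⟩
    have pN : SameParity W (N : SMat ℂ) y := by first | exact .inl ⟨hN, hy⟩ | exact .inr ⟨hN, hy⟩
    have h := congrArg (fun Z : psl => ten (Z : SMat ℂ) (x * y)) (hYB M N)
    simp only [pslBracket, toPsl_coe] at h
    rw [extend_ten, extend_ten, toPsl_coe_psl, toPsl_coe_psl, comm_ten (pM.map hR) (pN.map hR),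
      comm_ten (pM.map hR) pN, comm_ten pM (pN.map hR), ← ten_add, extend_ten, tracelessPart_ten]
    rw [← toPslLin_apply, map_add, toPslLin_apply, toPslLin_apply]
    exact h

end Extension

/-! ### Infinitesimal variations -/

section Infinitesimal

variable {B : Type*} [Ring B] [Algebra ℂ B] {W : Worldsheet B} {ε : B}

theorem odd_sq (hε : W.parity ε = -ε) : ε * ε = 0 :=
  eq_zero_of_eq_neg (W.odd_anticomm ε ε hε hε)

/-- In a supercommutative algebra, moving an odd element to the left applies the parity. -/
theorem mul_odd (hε : W.parity ε = -ε) (b : B) : b * ε = ε * W.parity b := by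
  have h1 := W.even_comm (b + W.parity b) ε (by rw [map_add, W.parity_parity, add_comm])
  have h2 := W.odd_anticomm (b - W.parity b) ε
    (by rw [map_sub, W.parity_parity, neg_sub]) hε
  have h3 : (2 : ℂ) • (b * ε) = (2 : ℂ) • (ε * W.parity b) := by
    rw [add_mul, mul_add] at h1
    rw [sub_mul, mul_sub] at h2
    have h4 := congrArg₂ (· + ·) h1 h2
    rw [two_smul, two_smul]
    have e1 : b * ε + b * ε = b * ε + W.parity b * ε + (b * ε - W.parity b * ε) := by abel
    rw [e1, h4]; abel
  exact smul_right_injective _ (two_ne_zero' ℂ) h3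

variable {m n k : Type*} [Fintype m] [Fintype n] [Fintype k]

/-- The matrix is a multiple of the odd parameter `ε`, hence infinitesimal: products of two such
matrices vanish. -/
def Inf (ε : B) (X : Matrix m n B) : Prop := ∃ v : Matrix m n B, X = ε • v

theorem mul_bsmul (hε : W.parity ε = -ε) (X : Matrix m n B) (Y : Matrix n k B) :
    X * (ε • Y) = ε • (X.map W.parity * Y) := by
  ext i j
  simp only [Matrix.mul_apply, Matrix.smul_apply, smul_eq_mul, Finset.mul_sum, Matrix.map_apply]
  exact Finset.sum_congr rfl fun l _ => by rw [← mul_assoc, mul_odd hε, mul_assoc]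

theorem Inf.mul_left (hε : W.parity ε = -ε) {Y : Matrix n k B} (h : Inf ε Y) (X : Matrix m n B) :
    Inf ε (X * Y) := by
  obtain ⟨v, rfl⟩ := h
  exact ⟨_, mul_bsmul hε X v⟩
theorem Inf.mul_right {X : Matrix m n B} (h : Inf ε X) (Y : Matrix n k B) : Inf ε (X * Y) := by
  obtain ⟨v, rfl⟩ := h
  exact ⟨v * Y, by rw [Matrix.smul_mul]⟩
theorem Inf.add {X Y : Matrix m n B} (hX : Inf ε X) (hY : Inf ε Y) : Inf ε (X + Y) := by
  obtain ⟨v, rfl⟩ := hX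
  obtain ⟨w, rfl⟩ := hY
  exact ⟨v + w, by rw [smul_add]⟩
theorem Inf.neg {X : Matrix m n B} (hX : Inf ε X) : Inf ε (-X) := by
  obtain ⟨v, rfl⟩ := hX
  exact ⟨-v, by rw [smul_neg]⟩
theorem Inf.sub {X Y : Matrix m n B} (hX : Inf ε X) (hY : Inf ε Y) : Inf ε (X - Y) := by
  rw [sub_eq_add_neg]; exact hX.add hY.neg
theorem Inf.smul {X : Matrix m n B} (hX : Inf ε X) (c : ℂ) : Inf ε (c • X) := by
  obtain ⟨v, rfl⟩ := hX
  exact ⟨c • v, by rw [smul_comm]⟩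
theorem Inf.bsmul (v : Matrix m n B) : Inf ε (ε • v) := ⟨v, rfl⟩
theorem Inf.mul_eq_zero (hε : W.parity ε = -ε) {X : Matrix m n B} {Y : Matrix n k B}
    (hX : Inf ε X) (hY : Inf ε Y) : X * Y = 0 := by
  obtain ⟨v, rfl⟩ := hX
  obtain ⟨w, rfl⟩ := hY
  rw [Matrix.smul_mul, mul_bsmul hε, smul_smul, odd_sq hε, zero_smul]

theorem bsmul_map_of_const {f : B →ₗ[ℂ] B} (hf : ∀ a b, f (a * b) = f a * b + a * f b)
    (h0 : f ε = 0) (X : SMat B) : (ε • X).map f = ε • X.map f := by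
  ext i j
  simp [hf, h0]

theorem Inf.map_of_const {X : SMat B} (hX : Inf ε X) {f : B →ₗ[ℂ] B}
    (hf : ∀ a b, f (a * b) = f a * b + a * f b) (h0 : f ε = 0) : Inf ε (X.map f) := by
  obtain ⟨v, rfl⟩ := hX
  exact ⟨_, bsmul_map_of_const hf h0 v⟩
theorem Inf.proj {X : SMat B} (hX : Inf ε X) (k : ℕ) : Inf ε (proj k X) := by
  obtain ⟨v, rfl⟩ := hX
  exact ⟨_, proj_bsmul k ε v⟩
theorem Inf.extend {X : SMat B} (hX : Inf ε X) (R : psl →ₗ[ℂ] psl) : Inf ε (extend R X) := by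
  obtain ⟨v, rfl⟩ := hX
  exact ⟨_, extend_bsmul R ε v⟩
theorem Inf.comm_left (hε : W.parity ε = -ε) {X : SMat B} (hX : Inf ε X) (Y : SMat B) :
    Inf ε (comm X Y) := (hX.mul_right Y).sub (hX.mul_left hε Y)
theorem Inf.comm_right (hε : W.parity ε = -ε) {X : SMat B} (hX : Inf ε X) (Y : SMat B) :
    Inf ε (comm Y X) := (hX.mul_left hε Y).sub (hX.mul_right Y)
theorem Inf.acomm_left (hε : W.parity ε = -ε) {X : SMat B} (hX : Inf ε X) (Y : SMat B) :
    Inf ε (acomm X Y) := (hX.mul_right Y).add (hX.mul_left hε Y)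
theorem GhostPair.inf_ghostProj {i j : ℕ} {l m : SMat B} (h : GhostPair i j l m) {X : SMat B}
    (hX : Inf ε X) : Inf ε (ghostProj l m (PureSpinor.proj j X)) := by
  obtain ⟨v, rfl⟩ := hX
  rw [proj_bsmul, h.ghostProj_bsmul (proj_gr j v)]
  exact ⟨_, rfl⟩

end Infinitesimal

/-! ### The Berezinian -/

section Determinant

/-- The first-order expansion of the determinant, valid as soon as all products of two entries
vanish. -/
theorem det_one_add_of_mul_eq_zero {R n : Type*} [CommRing R] [Fintype n] [DecidableEq n]
    {N : Matrix n n R} (h : ∀ i j k l, N i j * N k l = 0) : (1 + N).det = 1 + N.trace := by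
  have key : ∀ s : Finset n, (1 + Matrix.of fun i j => if j ∈ s then N i j else 0).det =
      1 + ∑ j ∈ s, N j j := by
    intro s
    induction s using Finset.induction_on with
    | empty =>
      have : (Matrix.of fun (i j : n) => if j ∈ (∅ : Finset n) then N i j else 0) = 0 := by
        ext; simp
      rw [this]; simp
    | insert a s ha ih =>
      have e : (1 + Matrix.of fun i j => if j ∈ insert a s then N i j else 0) =
          (1 + Matrix.of fun i j => if j ∈ s then N i j else 0) *
            (1 + Matrix.replicateCol Unit (fun i => N i a) *
              Matrix.replicateRow Unit (Pi.single a (1 : R))) := by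
        have h0 : (Matrix.of fun i j => if j ∈ s then N i j else 0) *
            (Matrix.replicateCol Unit (fun i => N i a) *
              Matrix.replicateRow Unit (Pi.single a (1 : R))) = 0 := by
          ext i j
          rw [Matrix.mul_apply, Matrix.zero_apply]
          refine Finset.sum_eq_zero fun x _ => ?_
          simp only [Matrix.of_apply, Matrix.mul_apply, Matrix.replicateCol_apply,
            Finset.univ_unique, Finset.sum_singleton]
          split_ifs
          · rw [← mul_assoc, h, zero_mul]
          · rw [zero_mul]
        rw [mul_add, add_mul, add_mul, h0, mul_one, mul_one, one_mul, add_zero, add_assoc]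
        congr 1
        ext i j
        by_cases hj : j = a
        · subst hj; simp [Matrix.mul_apply, ha]
        · simp [Matrix.mul_apply, hj]
      rw [e, Matrix.det_mul, ih, Matrix.det_one_add_replicateCol_mul_replicateRow,
        Finset.sum_insert ha]
      simp only [single_one_dotProduct, mul_add, add_mul, mul_one, one_mul, Finset.sum_mul, h,
        Finset.sum_const_zero, add_zero]
      ring
  have h2 : (Matrix.of fun i j => if j ∈ Finset.univ then N i j else 0) = N := by ext; simp
  have := key Finset.univ
  rwa [h2] at this

/-- Jacobi's formula for a derivation of a commutative ring. -/
theorem derivation_det {R n : Type*} [CommRing R] [Fintype n] [DecidableEq n] (D : R →+ R)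
    (hD : ∀ a b, D (a * b) = D a * b + a * D b) {M N : Matrix n n R} (h : M.map D = M * N) :
    D M.det = M.det * N.trace := by
  have hD1 : D 1 = 0 := by
    have := hD 1 1
    simpa using this
  -- The dual number `a + (D a) τ` depends on `a` by a ring homomorphism.
  let f : R →+* TrivSqZeroExt R R :=
    { toFun := fun a => (TrivSqZeroExt.inl a + TrivSqZeroExt.inr (D a))
      map_one' := by simp [hD1]
      map_zero' := by simp
      map_add' := fun a b => by
        ext <;> simp
      map_mul' := fun a b => by
        ext
        · simp
        · simp [hD]; ring }
  have hf : M.map f = M.map (TrivSqZeroExt.inlHom R R) *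
      (1 + N.map (TrivSqZeroExt.inr : R → TrivSqZeroExt R R)) := by
    have h1 : M.map f = M.map (TrivSqZeroExt.inlHom R R) +
        (M.map D).map (TrivSqZeroExt.inr : R → TrivSqZeroExt R R) := by
      ext i j <;> simp [f]
    rw [h1, h, mul_add, mul_one]
    congr 1
    ext i j
    · simp [Matrix.mul_apply, TrivSqZeroExt.fst_sum]
    · simp [Matrix.mul_apply, TrivSqZeroExt.snd_sum, mul_comm]
  have h2 := RingHom.map_det f M
  rw [RingHom.mapMatrix_apply, hf, Matrix.det_mul, det_one_add_of_mul_eq_zero (by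
    intro i j k l; simp [Matrix.map_apply]),
    ← RingHom.mapMatrix_apply, ← RingHom.map_det] at h2
  have h3 := congrArg TrivSqZeroExt.snd h2
  simpa [f, Matrix.trace, TrivSqZeroExt.snd_sum, TrivSqZeroExt.fst_sum] using h3

variable {B : Type*} [Ring B] [Algebra ℂ B]

/-- The subalgebra of even elements. -/
def Worldsheet.evens (W : Worldsheet B) : Subalgebra ℂ B where
  carrier := {b | W.parity b = b}
  mul_mem' := fun {a b} ha hb => by
    exact (map_mul W.parity a b).trans (congrArg₂ _ ha hb)
  add_mem' := fun {a b} ha hb => by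
    exact (map_add W.parity a b).trans (congrArg₂ _ ha hb)
  algebraMap_mem' := fun c => W.parity.commutes c

instance (W : Worldsheet B) : CommRing W.evens :=
  { (inferInstance : Ring W.evens) with
    mul_comm := fun a _ => Subtype.ext (W.even_comm _ _ a.2) }

local notation "M₄" => Matrix (Fin 4) (Fin 4)

variable {W : Worldsheet B}

/-- A matrix with even entries as a matrix over the commutative ring of even elements. -/
def toEvens {M : M₄ B} (h : ∀ i j, W.parity (M i j) = M i j) : M₄ W.evens :=
  Matrix.of fun i j => ⟨M i j, h i j⟩

theorem det4_eq {M : M₄ B} (h : ∀ i j, W.parity (M i j) = M i j) :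
    det4 M = ((toEvens h).det : B) := by
  have hv : ∀ x : W.evens, (x : B) = W.evens.val x := fun _ => rfl
  rw [det4, Matrix.det_apply, hv, map_sum]
  refine Finset.sum_congr rfl fun σ _ => ?_
  rw [Fin.prod_univ_four, Units.smul_def, Units.smul_def, map_zsmul, map_mul, map_mul, map_mul]
  rfl

theorem even_mul {M N : M₄ B} (hM : ∀ i j, W.parity (M i j) = M i j)
    (hN : ∀ i j, W.parity (N i j) = N i j) (i j : Fin 4) :
    W.parity ((M * N) i j) = (M * N) i j := by
  simp [Matrix.mul_apply, map_sum, hM, hN]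
theorem even_odd_mul {M N : M₄ B} (hM : ∀ i j, W.parity (M i j) = M i j)
    (hN : ∀ i j, W.parity (N i j) = -N i j) (i j : Fin 4) :
    W.parity ((M * N) i j) = -(M * N) i j := by
  simp [Matrix.mul_apply, map_sum, hM, hN]
theorem odd_odd_mul {M N : M₄ B} (hM : ∀ i j, W.parity (M i j) = -M i j)
    (hN : ∀ i j, W.parity (N i j) = -N i j) (i j : Fin 4) :
    W.parity ((M * N) i j) = (M * N) i j := by
  simp [Matrix.mul_apply, map_sum, hM, hN]

theorem toEvens_mul {M N : M₄ B} (hM : ∀ i j, W.parity (M i j) = M i j)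
    (hN : ∀ i j, W.parity (N i j) = N i j) :
    toEvens (even_mul hM hN) = toEvens hM * toEvens hN := by
  ext i j
  simp [toEvens, Matrix.mul_apply]

theorem trace_toEvens {M : M₄ B} (h : ∀ i j, W.parity (M i j) = M i j) :
    (((toEvens h).trace : W.evens) : B) = M.trace := by
  simp [Matrix.trace, toEvens]

theorem det4_mul_one_add {ε : B} (hε : W.parity ε = -ε) {M N : M₄ B}
    (hM : ∀ i j, W.parity (M i j) = M i j) (hN : ∀ i j, W.parity (N i j) = N i j)
    (h : Inf ε N) : det4 (M + M * N) = det4 M * (1 + N.trace) := by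
  have h1 : ∀ i j, W.parity ((1 + N) i j) = (1 + N) i j := by
    intro i j; by_cases hij : i = j <;> simp [hij, hN]
  have e : M + M * N = M * (1 + N) := by rw [mul_add, mul_one]
  have e1 : toEvens h1 = 1 + toEvens hN := by
    ext i j; by_cases hij : i = j <;> simp [toEvens, Matrix.one_apply, hij]
  rw [e, det4_eq (even_mul hM h1), toEvens_mul hM h1, Matrix.det_mul, e1, det_one_add_of_mul_eq_zero,
    det4_eq hM]
  · simp [trace_toEvens hN]
  · obtain ⟨v, rfl⟩ := h
    intro i j k l
    apply Subtype.ext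
    simp only [toEvens, Matrix.of_apply, MulMemClass.mk_mul_mk, Matrix.smul_apply, smul_eq_mul,
      ZeroMemClass.coe_zero]
    rw [mul_assoc, ← mul_assoc _ ε, mul_odd hε, ← mul_assoc, ← mul_assoc, odd_sq hε, zero_mul,
      zero_mul]

theorem derivation_det4 {f : B →ₗ[ℂ] B} (hf : ∀ a b, f (a * b) = f a * b + a * f b)
    (hp : ∀ a, W.parity (f a) = f (W.parity a)) {M N : M₄ B}
    (hM : ∀ i j, W.parity (M i j) = M i j) (hN : ∀ i j, W.parity (N i j) = N i j)
    (h : M.map f = M * N) : f (det4 M) = det4 M * N.trace := by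
  let D : W.evens →+ W.evens :=
    { toFun := fun a => ⟨f a, (hp a).trans (congrArg f a.2)⟩
      map_zero' := Subtype.ext (map_zero f)
      map_add' := fun a b => Subtype.ext (map_add f (a : B) b) }
  have h1 := derivation_det D (fun a b => Subtype.ext (hf a b)) (M := toEvens hM)
    (N := toEvens hN) (by
      rw [← toEvens_mul hM hN]
      ext i j
      exact congrFun (congrFun h i) j)
  have h2 := congrArg (fun x : W.evens => (x : B)) h1
  simp only [MulMemClass.coe_mul, trace_toEvens, ← det4_eq hM] at h2
  rw [← h2, det4_eq hM]
  rfl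

/-- The first variation of the Schur complement `s = a - b d⁻¹ c` under right multiplication by
an infinitesimal matrix with blocks `p, q, r, t`. -/
theorem schur_variation (a b c d e p q r t : M₄ B) (h : e * d = 1) :
    (a * p + b * r) - (a * q + b * t) * e * c + b * (e * (c * q + d * t) * e) * c -
      b * e * (c * p + d * r) = (a - b * e * c) * (p - q * e * c) := by
  have h' : ∀ X, e * (d * X) = X := fun X => by rw [← mul_assoc, h, one_mul]
  simp only [mul_add, add_mul, mul_sub, sub_mul, mul_assoc, h']
  abel

theorem add_mul_eq_fromBlocks (g Z : SMat B) : g + g * Z = Matrix.fromBlocks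
    (g.toBlocks₁₁ + (g.toBlocks₁₁ * Z.toBlocks₁₁ + g.toBlocks₁₂ * Z.toBlocks₂₁))
    (g.toBlocks₁₂ + (g.toBlocks₁₁ * Z.toBlocks₁₂ + g.toBlocks₁₂ * Z.toBlocks₂₂))
    (g.toBlocks₂₁ + (g.toBlocks₂₁ * Z.toBlocks₁₁ + g.toBlocks₂₂ * Z.toBlocks₂₁))
    (g.toBlocks₂₂ + (g.toBlocks₂₁ * Z.toBlocks₁₂ + g.toBlocks₂₂ * Z.toBlocks₂₂)) := by
  conv_lhs => rw [← Matrix.fromBlocks_toBlocks g, ← Matrix.fromBlocks_toBlocks Z,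
    Matrix.fromBlocks_multiply, Matrix.fromBlocks_add]

/-- An infinitesimal right translation by an element without supertrace preserves `SL(4|4)`. -/
theorem IsSL.translate {ε : B} (hε : W.parity ε = -ε) {g Z : SMat B} (hg : W.IsSL g)
    (hZ : IsSl W Z) (hi : Inf ε Z) : W.IsSL (g + g * Z) := by
  obtain ⟨eg, ug, e, h1, h2, h3⟩ := hg
  have ZZ := hi.mul_eq_zero hε hi
  refine ⟨eg.add (eg.mul hZ.1), ?_, ?_⟩
  · have : IsUnit (1 + Z) :=
      ⟨⟨1 + Z, 1 - Z, by noncomm_ring; simp [ZZ], by noncomm_ring; simp [ZZ]⟩, rfl⟩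
    rw [show g + g * Z = g * (1 + Z) by rw [mul_add, mul_one]]
    exact ug.mul this
  obtain ⟨ea, eb, ec, ed⟩ := isEvenSuper_fromBlocks' eg
  obtain ⟨ep, eq, er, et⟩ := isEvenSuper_fromBlocks' hZ.1
  have hs := hZ.2
  have hi' : Inf ε Z.toBlocks₁₁ ∧ Inf ε Z.toBlocks₁₂ ∧ Inf ε Z.toBlocks₂₁ ∧
      Inf ε Z.toBlocks₂₂ := by
    obtain ⟨v, rfl⟩ := hi
    exact ⟨⟨v.toBlocks₁₁, rfl⟩, ⟨v.toBlocks₁₂, rfl⟩, ⟨v.toBlocks₂₁, rfl⟩, ⟨v.toBlocks₂₂, rfl⟩⟩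
  obtain ⟨ip, iq, ir, it⟩ := hi'
  rw [str] at hs
  rw [add_mul_eq_fromBlocks]
  simp only [Matrix.toBlocks_fromBlocks₁₁, Matrix.toBlocks_fromBlocks₁₂,
    Matrix.toBlocks_fromBlocks₂₁, Matrix.toBlocks_fromBlocks₂₂]
  generalize g.toBlocks₁₁ = a at *
  generalize g.toBlocks₁₂ = b at *
  generalize g.toBlocks₂₁ = c at *
  generalize g.toBlocks₂₂ = d at *
  generalize Z.toBlocks₁₁ = p at *
  generalize Z.toBlocks₁₂ = q at *
  generalize Z.toBlocks₂₁ = r at *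
  generalize Z.toBlocks₂₂ = t at *
  have ee : ∀ i j, W.parity (e i j) = e i j := by
    have h4 : d * e.map W.parity = 1 := by
      have hd : d.map W.parity = d := by ext i j; exact ed i j
      calc d * e.map W.parity = d.map W.parity * e.map W.parity := by rw [hd]
        _ = (d * e).map W.parity := (Matrix.map_mul (f := W.parity)).symm
        _ = 1 := by rw [h1]; exact Matrix.map_one _ (map_zero _) (map_one _)
    have h5 : e.map W.parity = e := by
      calc e.map W.parity = e * d * e.map W.parity := by rw [h2, one_mul]
        _ = e := by rw [mul_assoc, h4, mul_one]
    intro i j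
    exact congrFun (congrFun h5 i) j
  have ia : Inf ε (a * p + b * r) := (ip.mul_left hε a).add (ir.mul_left hε b)
  have ib : Inf ε (a * q + b * t) := (iq.mul_left hε a).add (it.mul_left hε b)
  have ic : Inf ε (c * p + d * r) := (ip.mul_left hε c).add (ir.mul_left hε d)
  have id : Inf ε (c * q + d * t) := (iq.mul_left hε c).add (it.mul_left hε d)
  have sv := schur_variation a b c d e p q r t h2
  have dv : d * (e * c * q + t) = c * q + d * t := by
    rw [mul_add, ← mul_assoc, ← mul_assoc, h1, one_mul]
  generalize a * p + b * r = δa at *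
  generalize a * q + b * t = δb at *
  generalize c * p + d * r = δc at *
  generalize hδd : c * q + d * t = δd at *
  have z1 : δd * e * δd = 0 := (id.mul_right e).mul_eq_zero hε id
  refine ⟨e - e * δd * e, ?_, ?_, ?_⟩
  · calc (d + δd) * (e - e * δd * e) =
        d * e + δd * e - (d * e) * δd * e - (δd * e * δd) * e := by noncomm_ring
      _ = 1 := by rw [h1, z1]; noncomm_ring
  · calc (e - e * δd * e) * (d + δd) =
        e * d + e * δd - e * δd * (e * d) - e * (δd * e * δd) := by noncomm_ring
      _ = 1 := by rw [h2, z1]; noncomm_ring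
  have s1 : a + δa - (b + δb) * (e - e * δd * e) * (c + δc) =
      (a - b * e * c) + (a - b * e * c) * (p - q * e * c) := by
    have z2 : δb * (e * δd * e) = 0 := by
      rw [mul_assoc e]; exact ib.mul_eq_zero hε ((id.mul_right e).mul_left hε e)
    have z3 : δb * e * δc = 0 := (ib.mul_right e).mul_eq_zero hε ic
    have z4 : e * δd * e * δc = 0 := by
      exact (((id.mul_left hε e)).mul_right e).mul_eq_zero hε ic
    rw [← sv]
    calc _ = a + δa - (b * e * c + b * e * δc - b * (e * δd * e) * c - b * (e * δd * e * δc) +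
          δb * e * c + δb * e * δc - δb * (e * δd * e) * (c + δc)) := by noncomm_ring
      _ = _ := by rw [z2, z3, z4]; noncomm_ring
  have iN : Inf ε (p - q * e * c) := ip.sub ((iq.mul_right e).mul_right c)
  have iN' : Inf ε (e * c * q + t) := (iq.mul_left hε (e * c)).add it
  have eec := even_odd_mul ee ec
  have eN : ∀ i j, W.parity ((p - q * e * c) i j) = (p - q * e * c) i j := by
    intro i j
    rw [Matrix.sub_apply, map_sub, ep, mul_assoc, odd_odd_mul eq eec]
  have eN' : ∀ i j, W.parity ((e * c * q + t) i j) = (e * c * q + t) i j := by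
    intro i j
    rw [Matrix.add_apply, map_add, et, odd_odd_mul eec eq]
  have es : ∀ i j, W.parity ((a - b * e * c) i j) = (a - b * e * c) i j := by
    intro i j
    rw [Matrix.sub_apply, map_sub, ea, mul_assoc, odd_odd_mul eb eec]
  have tr : (p - q * e * c).trace = (e * c * q + t).trace := by
    rw [Matrix.trace_sub, Matrix.trace_add, mul_assoc,
      trace_mul_of_anticommute fun i j k => W.odd_anticomm _ _ (eq i j) (eec j k),
      sub_neg_eq_add, sub_eq_zero.1 hs, add_comm]
  rw [s1, det4_mul_one_add hε es eN iN, h3, tr, ← det4_mul_one_add hε ed eN' iN', dv]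

/-- The logarithmic derivative of an element of `SL(4|4)` has no supertrace. -/
theorem IsSL.str_inverse_mul_map {f : B →ₗ[ℂ] B} (hf : ∀ a b, f (a * b) = f a * b + a * f b)
    (hp : ∀ a, W.parity (f a) = f (W.parity a)) {g Z : SMat B} (hg : W.IsSL g)
    (eZ : W.IsEvenSuper Z) (hZ : g.map f = g * Z) : str Z = 0 := by
  obtain ⟨eg, ug, e, h1, h2, h3⟩ := hg
  obtain ⟨ea, eb, ec, ed⟩ := isEvenSuper_fromBlocks' eg
  obtain ⟨ep, eq, er, et⟩ := isEvenSuper_fromBlocks' eZ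
  rw [str]
  rw [← Matrix.fromBlocks_toBlocks g, ← Matrix.fromBlocks_toBlocks Z,
    Matrix.fromBlocks_multiply, Matrix.fromBlocks_map, Matrix.fromBlocks_inj] at hZ
  obtain ⟨fa, fb, fc, fd⟩ := hZ
  generalize g.toBlocks₁₁ = a at *
  generalize g.toBlocks₁₂ = b at *
  generalize g.toBlocks₂₁ = c at *
  generalize g.toBlocks₂₂ = d at *
  generalize Z.toBlocks₁₁ = p at *
  generalize Z.toBlocks₁₂ = q at *
  generalize Z.toBlocks₂₁ = r at *
  generalize Z.toBlocks₂₂ = t at *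
  have ee : ∀ i j, W.parity (e i j) = e i j := by
    have h4 : d * e.map W.parity = 1 := by
      have hd : d.map W.parity = d := by ext i j; exact ed i j
      calc d * e.map W.parity = d.map W.parity * e.map W.parity := by rw [hd]
        _ = (d * e).map W.parity := (Matrix.map_mul (f := W.parity)).symm
        _ = 1 := by rw [h1]; exact Matrix.map_one _ (map_zero _) (map_one _)
    have h5 : e.map W.parity = e := by
      calc e.map W.parity = e * d * e.map W.parity := by rw [h2, one_mul]
        _ = e := by rw [mul_assoc, h4, mul_one]
    intro i j
    exact congrFun (congrFun h5 i) j
  have sv := schur_variation a b c d e p q r t h2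
  have dv : d * (e * c * q + t) = c * q + d * t := by
    rw [mul_add, ← mul_assoc, ← mul_assoc, h1, one_mul]
  have f1 : f 1 = 0 := by have := hf 1 1; simpa using this
  have fe : e.map f = -(e * d.map f * e) := by
    have h4 := congrArg (fun X : M₄ B => e * X.map f) h1
    simp only [map_mul_of_leibniz f hf] at h4
    have h6 : (1 : M₄ B).map f = 0 := by
      ext i j; by_cases hij : i = j <;> simp [hij, f1]
    rw [h6, mul_zero, mul_add, ← mul_assoc, ← mul_assoc, h2, one_mul] at h4
    exact eq_neg_of_add_eq_zero_right h4
  have s1 : (a - b * e * c).map f = (a - b * e * c) * (p - q * e * c) := by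
    have : (a - b * e * c).map f = a.map f - (b * e * c).map f := by ext; simp
    rw [this, map_mul_of_leibniz f hf, map_mul_of_leibniz f hf, fe, fa, fb, fc, fd, ← sv]
    noncomm_ring
  have d1 : d.map f = d * (e * c * q + t) := by rw [dv, fd]
  have eec := even_odd_mul ee ec
  have eN : ∀ i j, W.parity ((p - q * e * c) i j) = (p - q * e * c) i j := by
    intro i j
    rw [Matrix.sub_apply, map_sub, ep, mul_assoc, odd_odd_mul eq eec]
  have eN' : ∀ i j, W.parity ((e * c * q + t) i j) = (e * c * q + t) i j := by
    intro i j
    rw [Matrix.add_apply, map_add, et, odd_odd_mul eec eq]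
  have es : ∀ i j, W.parity ((a - b * e * c) i j) = (a - b * e * c) i j := by
    intro i j
    rw [Matrix.sub_apply, map_sub, ea, mul_assoc, odd_odd_mul eb eec]
  have k1 := derivation_det4 hf hp es eN s1
  have k2 := derivation_det4 hf hp ed eN' d1
  rw [h3, k2, Matrix.trace_sub, Matrix.trace_add, mul_assoc q,
    trace_mul_of_anticommute fun i j k => W.odd_anticomm _ _ (eq i j) (eec j k)] at k1
  have ud : ∃ x, x * det4 d = 1 := by
    refine ⟨det4 e, ?_⟩
    have : toEvens ee * toEvens ed = 1 := by
      rw [← toEvens_mul]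
      ext i j
      change (e * d) i j = _
      rw [h2]
      by_cases hij : i = j <;> simp [Matrix.one_apply, hij]
    have h7 := congrArg (fun M : M₄ W.evens => ((M.det : W.evens) : B)) this
    simpa [Matrix.det_mul, ← det4_eq] using h7
  obtain ⟨x, hx⟩ := ud
  have k3 := congrArg (fun y => x * y) k1
  simp only [← mul_assoc, hx, one_mul] at k3
  have : p.trace - t.trace = (p.trace - -(e * c * q).trace) -
    ((e * c * q).trace + t.trace) := by abel
  rw [this, ← k3, sub_self]

end Determinant

/-! ### One chirality of the worldsheet -/

section Chirality

variable {B : Type*} [Ring B] [Algebra ℂ B]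

/-- The fields of one chirality, with the light-cone derivative `D`. The matrices `l, m` are the
ghosts of degrees `k, k'`, and `o, a` are the momentum and the antifield of degree `k`. The two
chiralities are `(∂₊, 1, 3, g, λ₁, λ₃, ω₁₊, ω*₁₊)` and `(∂₋, 3, 1, g, λ₃, λ₁, ω₃₋, ω*₃₋)`. -/
structure Sector (B : Type*) [Ring B] [Algebra ℂ B] where
  D : B →ₗ[ℂ] B
  k : ℕ
  k' : ℕ
  g : SMat B
  l : SMat B
  m : SMat B
  o : SMat B
  a : SMat B

namespace Sector

/-- The degrees, the statistics and the constraints. -/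
structure Ok (W : Worldsheet B) (s : Sector B) : Prop where
  degrees : (s.k = 1 ∧ s.k' = 3) ∨ (s.k = 3 ∧ s.k' = 1)
  leibniz : ∀ a b, s.D (a * b) = s.D a * b + a * s.D b
  parity_D : ∀ a, W.parity (s.D a) = s.D (W.parity a)
  g_mem : W.IsSL s.g
  l_even : W.EvenEntries s.l
  l_gr : Gr s.k s.l
  l_pure : tracelessPart (acomm s.l s.l) = 0
  m_even : W.EvenEntries s.m
  m_gr : Gr s.k' s.m
  m_pure : tracelessPart (acomm s.m s.m) = 0
  regular : IsUnit (str (s.m * s.l))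
  o_even : W.EvenEntries s.o
  o_gr : Gr s.k s.o
  a_odd : W.OddEntries s.a
  a_gr : Gr s.k s.a
  a_constraint : tracelessPart (acomm s.l s.a) = 0

/-- `A = -∂g g⁻¹`. -/
def A (s : Sector B) : SMat B := -(s.g.map s.D * Ring.inverse s.g)
/-- `N = -{o, m}`. -/
def N (s : Sector B) : SMat B := -acomm s.o s.m
/-- The operator `3 P_k + 2 P₂ + P_k'`. -/
def d (s : Sector B) (X : SMat B) : SMat B :=
  (3 : ℂ) • proj s.k X + (2 : ℂ) • proj 2 X + proj s.k' X
/-- The projection to the kernel of `{l, ·}`, precomposed with `P_k`. -/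
def P (s : Sector B) (X : SMat B) : SMat B := ghostProj s.m s.l (proj s.k X)
/-- The operator `d - 4 P`. -/
def O (s : Sector B) (X : SMat B) : SMat B := s.d X - (4 : ℂ) • s.P X
/-- The current in the frame of the left action. -/
def J (s : Sector B) : SMat B := s.d s.A + (4 : ℂ) • s.N + (4 : ℂ) • s.a
/-- `Ad_g⁻¹`. -/
def adInv (s : Sector B) (X : SMat B) : SMat B := Ring.inverse s.g * X * s.g
/-- `Ad_g`. -/
def ad (s : Sector B) (X : SMat B) : SMat B := s.g * X * Ring.inverse s.g
/-- The covariant derivative of an adjoint field. -/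
def cov (s : Sector B) (X : SMat B) : SMat B := X.map s.D + comm s.A X

end Sector

variable {W : Worldsheet B}

theorem evenEntries_of_isDiag {X : SMat B} (h : IsDiag X) (e : W.IsEvenSuper X) :
    W.EvenEntries X := by
  obtain ⟨e1, e2, e3, e4⟩ := isEvenSuper_fromBlocks' e
  rintro (i | i) (j | j)
  · exact e1 i j
  · have : X (Sum.inl i) (Sum.inr j) = 0 := congrFun (congrFun h.1 i) j
    rw [this, map_zero]
  · have : X (Sum.inr i) (Sum.inl j) = 0 := congrFun (congrFun h.2 i) j
    rw [this, map_zero]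
  · exact e4 i j

theorem oddEntries_of_isOff {X : SMat B} (h : IsOff X) (e : W.IsEvenSuper X) :
    W.OddEntries X := by
  obtain ⟨e1, e2, e3, e4⟩ := isEvenSuper_fromBlocks' e
  rintro (i | i) (j | j)
  · have : X (Sum.inl i) (Sum.inl j) = 0 := congrFun (congrFun h.1 i) j
    rw [this, map_zero, neg_zero]
  · exact e2 i j
  · exact e3 i j
  · have : X (Sum.inr i) (Sum.inr j) = 0 := congrFun (congrFun h.2 i) j
    rw [this, map_zero, neg_zero]

theorem isEvenSuper_of_isDiag {X : SMat B} (h : IsDiag X) (e : W.EvenEntries X) :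
    W.IsEvenSuper X := by
  rw [h.eq, isEvenSuper_fromBlocks]
  exact ⟨fun i j => e _ _, by simp, by simp, fun i j => e _ _⟩

theorem isEvenSuper_of_isOff {X : SMat B} (h : IsOff X) (e : W.OddEntries X) :
    W.IsEvenSuper X := by
  rw [h.eq, isEvenSuper_fromBlocks]
  exact ⟨by simp, fun i j => e _ _, fun i j => e _ _, by simp⟩

theorem EvenEntries.central {X : SMat B} (h : W.EvenEntries X) : CentralEntries X :=
  fun i j b => W.even_comm _ b (h i j)

theorem EvenEntries.map_parity {X : SMat B} (h : W.EvenEntries X) : X.map W.parity = X := by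
  ext i j; exact h i j
theorem OddEntries.map_parity {X : SMat B} (h : W.OddEntries X) : X.map W.parity = -X := by
  ext i j; exact h i j

theorem EvenEntries.mul {X Y : SMat B} (hX : W.EvenEntries X) (hY : W.EvenEntries Y) :
    W.EvenEntries (X * Y) := by
  intro i j
  have hX' := fun i j => hX i j
  have hY' := fun i j => hY i j
  simp only [Matrix.mul_apply, map_sum, map_mul, hX', hY']
theorem EvenEntries.add {X Y : SMat B} (hX : W.EvenEntries X) (hY : W.EvenEntries Y) :
    W.EvenEntries (X + Y) := by
  intro i j; rw [Matrix.add_apply, map_add, hX, hY]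
theorem EvenEntries.neg {X : SMat B} (hX : W.EvenEntries X) :
    W.EvenEntries (-X) := by
  intro i j; rw [Matrix.neg_apply, map_neg, hX]
theorem EvenEntries.sub {X Y : SMat B} (hX : W.EvenEntries X) (hY : W.EvenEntries Y) :
    W.EvenEntries (X - Y) := by
  intro i j; rw [Matrix.sub_apply, map_sub, hX, hY]
theorem EvenEntries.smul {X : SMat B} (c : ℂ) (hX : W.EvenEntries X) :
    W.EvenEntries (c • X) := by
  intro i j; rw [Matrix.smul_apply, map_smul, hX]
theorem OddEntries.add {X Y : SMat B} (hX : W.OddEntries X) (hY : W.OddEntries Y) :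
    W.OddEntries (X + Y) := by
  intro i j; rw [Matrix.add_apply, map_add, hX, hY, neg_add]
theorem OddEntries.neg {X : SMat B} (hX : W.OddEntries X) : W.OddEntries (-X) := by
  intro i j; rw [Matrix.neg_apply, map_neg, hX]
theorem OddEntries.smul {X : SMat B} (c : ℂ) (hX : W.OddEntries X) :
    W.OddEntries (c • X) := by
  intro i j; rw [Matrix.smul_apply, map_smul, hX, smul_neg]

variable {ε ε' : B}

theorem OddEntries.bsmul (hε : W.parity ε = -ε) {X : SMat B} (hX : W.EvenEntries X) :
    W.OddEntries (ε • X) := by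
  intro i j; rw [Matrix.smul_apply, smul_eq_mul, map_mul, hX, hε, neg_mul]
theorem EvenEntries.bsmul (hε : W.parity ε = -ε) {X : SMat B} (hX : W.OddEntries X) :
    W.EvenEntries (ε • X) := by
  intro i j; rw [Matrix.smul_apply, smul_eq_mul, map_mul, hX, hε, neg_mul_neg]

theorem comm_bsmul_of_even (hε : W.parity ε = -ε) {Y : SMat B} (hY : W.EvenEntries Y)
    (l : SMat B) : comm Y (ε • l) = ε • comm Y l := by
  rw [comm, mul_bsmul hε, EvenEntries.map_parity hY, Matrix.smul_mul, comm, smul_sub]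

theorem comm_bsmul_of_odd (hε : W.parity ε = -ε) {Y : SMat B} (hY : W.OddEntries Y)
    (l : SMat B) : comm Y (ε • l) = -(ε • acomm Y l) := by
  rw [comm, mul_bsmul hε, OddEntries.map_parity hY, Matrix.smul_mul, acomm, smul_add, neg_mul,
    smul_neg, neg_add, sub_eq_add_neg]

theorem tracelessPart_of_isSl {X : SMat B} (hX : IsSl W X) (h : tracelessPart X = 0) (Z : SMat B) :
    comm X Z = 0 := by
  rw [← hX.comm_tracelessPart, h, zero_comm']

theorem isSl_bsmul (hε : W.parity ε = -ε) {l : SMat B} {k : ℕ} (h : W.EvenEntries l)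
    (hl : Gr k l) (hk : Odd k) : IsSl W (ε • l) :=
  have o := (hl.bsmul ε).isOff hk
  ⟨isEvenSuper_of_isOff o (OddEntries.bsmul hε h), o.str_eq⟩

/-- Commutators of `ε l` and `ε' m` are anticommutators of the ghosts. -/
theorem comm_bsmul_bsmul (hε : W.parity ε = -ε) (hε' : W.parity ε' = -ε') {l m : SMat B}
    (hl : W.EvenEntries l) (hm : W.EvenEntries m) :
    comm (ε • l) (ε' • m) = (ε * ε') • acomm l m := by
  rw [comm_bsmul_of_odd hε' (OddEntries.bsmul hε hl), acomm, Matrix.smul_mul,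
    mul_bsmul hε, EvenEntries.map_parity hm, ← smul_add, ← acomm, smul_smul, ← neg_smul,
    ← W.odd_anticomm _ _ hε hε']

/-- Jacobi's identity for a pure spinor. -/
theorem comm_acomm_pure {o m : SMat B} {k : ℕ} (h1 : Gr k m) (hk : Odd k)
    (h2 : W.EvenEntries m) (h3 : tracelessPart (acomm m m) = 0) : comm (acomm o m) m = 0 := by
  have o1 := h1.isOff hk
  have c2 := EvenEntries.central h2
  have hs : IsSl W (acomm m m) :=
    ⟨isEvenSuper_of_isDiag (by
      have := o1.mul o1
      rw [acomm, this.eq, Matrix.fromBlocks_add]; constructor <;> simp)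
      (EvenEntries.add (EvenEntries.mul h2 h2) (EvenEntries.mul h2 h2)), str_acomm_central o1 c2⟩
  have h4 := tracelessPart_of_isSl hs h3 o
  have h5 : comm (acomm o m) m = -(1 / 2 : ℂ) • comm (acomm m m) o := by
    have : comm (acomm m m) o = (2 : ℂ) • (m * m * o - o * m * m) := by
      simp only [comm, acomm, two_smul]; noncomm_ring
    rw [this, smul_smul]
    norm_num
    simp only [comm, acomm]; noncomm_ring
  rw [h5, h4, smul_zero]

namespace Sector.Ok

variable {s : Sector B} (hs : s.Ok W)
include hs

theorem pair : GhostPair s.k' s.k s.m s.l where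
  odd_left := by obtain ⟨h1, h2⟩ | ⟨h1, h2⟩ := hs.degrees <;> rw [h2] <;> decide
  odd_right := by obtain ⟨h1, h2⟩ | ⟨h1, h2⟩ := hs.degrees <;> rw [h1] <;> decide
  add_mod := by obtain ⟨h1, h2⟩ | ⟨h1, h2⟩ := hs.degrees <;> rw [h1, h2]
  gr_left := hs.m_gr
  gr_right := hs.l_gr
  central_left := EvenEntries.central hs.m_even
  central_right := EvenEntries.central hs.l_even
  pure_left := hs.m_pure
  pure_right := hs.l_pure
  regular := hs.regular

theorem odd_k : Odd s.k := hs.pair.odd_right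
theorem odd_k' : Odd s.k' := hs.pair.odd_left

theorem isOff_l : IsOff s.l := hs.pair.isOff_right
theorem isOff_m : IsOff s.m := hs.pair.isOff_left
theorem isOff_a : IsOff s.a := hs.a_gr.isOff hs.odd_k
theorem isOff_o : IsOff s.o := hs.o_gr.isOff hs.odd_k

theorem g_mul_inverse : s.g * Ring.inverse s.g = 1 := Ring.mul_inverse_cancel _ hs.g_mem.2.1
theorem inverse_mul_g : Ring.inverse s.g * s.g = 1 := Ring.inverse_mul_cancel _ hs.g_mem.2.1
theorem even_g : W.IsEvenSuper s.g := hs.g_mem.1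
theorem even_inverse : W.IsEvenSuper (Ring.inverse s.g) :=
  hs.even_g.inverse hs.g_mul_inverse hs.inverse_mul_g

theorem isSl_A : IsSl W s.A := by
  have e : W.IsEvenSuper (Ring.inverse s.g * s.g.map s.D) :=
    hs.even_inverse.mul (hs.even_g.map _ hs.parity_D)
  have h : s.g.map s.D = s.g * (Ring.inverse s.g * s.g.map s.D) := by
    rw [← mul_assoc, hs.g_mul_inverse, one_mul]
  have h0 := IsSL.str_inverse_mul_map hs.leibniz hs.parity_D hs.g_mem e h
  have := (IsSl.conj (W := W) ⟨e, h0⟩ hs.even_g hs.even_inverse hs.inverse_mul_g).neg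
  rwa [← h] at this

theorem isSl_a : IsSl W s.a := ⟨isEvenSuper_of_isOff hs.isOff_a hs.a_odd, hs.isOff_a.str_eq⟩

theorem N_even : W.EvenEntries s.N :=
  EvenEntries.neg (EvenEntries.add (EvenEntries.mul hs.o_even hs.m_even)
    (EvenEntries.mul hs.m_even hs.o_even))

theorem N_gr : Gr 0 s.N :=
  ((hs.o_gr.acomm_central hs.m_gr hs.odd_k hs.odd_k' (EvenEntries.central hs.o_even)).neg).congr
    (by rw [add_comm, hs.pair.add_mod])

theorem isSl_N : IsSl W s.N := by
  refine ⟨isEvenSuper_of_isDiag (hs.N_gr.isDiag (by decide)) hs.N_even, ?_⟩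
  rw [Sector.N, str_neg, str_acomm_central hs.isOff_o (EvenEntries.central hs.o_even), neg_zero]

theorem isSl_J : IsSl W s.J := by
  refine (IsSl.add ?_ (hs.isSl_N.smul _)).add (hs.isSl_a.smul _)
  have h := hs.isSl_A.even
  exact (((IsSl.proj h _).smul _).add ((IsSl.proj h _).smul _)).add (IsSl.proj h _)

theorem isSl_d {X : SMat B} (h : W.IsEvenSuper X) : IsSl W (s.d X) :=
  (((IsSl.proj h _).smul _).add ((IsSl.proj h _).smul _)).add (IsSl.proj h _)

theorem isSl_ad {X : SMat B} (h : IsSl W X) : IsSl W (s.ad X) :=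
  h.conj hs.even_g hs.even_inverse hs.inverse_mul_g
theorem isSl_adInv {X : SMat B} (h : IsSl W X) : IsSl W (s.adInv X) :=
  h.conj hs.even_inverse hs.even_g hs.g_mul_inverse

theorem isSl_cov {X : SMat B} (h : IsSl W X) : IsSl W (s.cov X) :=
  (h.map _ hs.parity_D).add (hs.isSl_A.comm h)

section Ghosts

variable (hε : W.parity ε = -ε)
include hε

theorem isSl_l : IsSl W (ε • s.l) := isSl_bsmul hε hs.l_even hs.l_gr hs.odd_k
theorem isSl_m : IsSl W (ε • s.m) := isSl_bsmul hε hs.m_even hs.m_gr hs.odd_k'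

theorem comm_a_l : tracelessPart (comm s.a (ε • s.l)) = 0 := by
  have h : acomm s.a s.l = acomm s.l s.a := add_comm _ _
  rw [comm_bsmul_of_odd hε hs.a_odd, tracelessPart_neg, tracelessPart_bsmul, h,
    hs.a_constraint, smul_zero, neg_zero]

theorem comm_N_m : comm s.N (ε • s.m) = 0 := by
  rw [comm_bsmul_of_even hε hs.N_even, Sector.N, neg_comm',
    comm_acomm_pure hs.m_gr hs.odd_k' hs.m_even hs.m_pure, neg_zero, smul_zero]

end Ghosts

end Sector.Ok
end Chirality

section Chirality

variable {B : Type*} [Ring B] [Algebra ℂ B] {W : Worldsheet B} {ε ε' : B}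

/-! ### The ghost projector and the two halves of the grading -/

theorem OddEntries.mul_even {X Y : SMat B} (hX : W.OddEntries X) (hY : W.EvenEntries Y) :
    W.OddEntries (X * Y) := by
  intro i j
  have hX' := fun i j => hX i j
  have hY' := fun i j => hY i j
  simp only [Matrix.mul_apply, map_sum, map_mul, hX', hY', neg_mul, Finset.sum_neg_distrib]
theorem EvenEntries.mul_odd {X Y : SMat B} (hX : W.EvenEntries X) (hY : W.OddEntries Y) :
    W.OddEntries (X * Y) := by
  intro i j
  have hX' := fun i j => hX i j
  have hY' := fun i j => hY i j
  simp only [Matrix.mul_apply, map_sum, map_mul, hX', hY', mul_neg, Finset.sum_neg_distrib]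
theorem OddEntries.sub {X Y : SMat B} (hX : W.OddEntries X) (hY : W.OddEntries Y) :
    W.OddEntries (X - Y) := by
  rw [sub_eq_add_neg]; exact OddEntries.add hX (OddEntries.neg hY)

theorem tracelessPart_map_algHom (f : B →ₐ[ℂ] B) (X : SMat B) :
    tracelessPart (X.map f) = (tracelessPart X).map f :=
  tracelessPart_map f.toLinearMap X

theorem OddEntries.tracelessPart {X : SMat B} (hX : W.OddEntries X) :
    W.OddEntries (tracelessPart X) := by
  have h := tracelessPart_map_algHom W.parity X
  rw [OddEntries.map_parity hX, tracelessPart_neg] at h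
  intro i j
  exact (congrFun (congrFun h i) j).symm

theorem EvenEntries.tracelessPart {X : SMat B} (hX : W.EvenEntries X) :
    W.EvenEntries (tracelessPart X) := by
  have h := tracelessPart_map_algHom W.parity X
  rw [EvenEntries.map_parity hX] at h
  intro i j
  exact (congrFun (congrFun h i) j).symm

theorem evenEntries_sig : W.EvenEntries (sig B) := by
  intro i j
  rcases i with i | i <;> rcases j with j | j <;>
    simp [sig, Matrix.fromBlocks, Matrix.one_apply, apply_ite W.parity]

theorem parity_str_mul {l m : SMat B} (hl : W.EvenEntries l) (hm : W.EvenEntries m) :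
    W.parity (str (l * m)) = str (l * m) := by
  have h := str_map W.parity.toLinearMap (l * m)
  have e : (l * m).map W.parity.toLinearMap = l * m :=
    EvenEntries.map_parity (EvenEntries.mul hl hm)
  rw [e] at h
  exact h.symm

theorem parity_inverse {b : B} (h : W.parity b = b) (hb : IsUnit b) :
    W.parity (Ring.inverse b) = Ring.inverse b := by
  have h1 : b * W.parity (Ring.inverse b) = 1 := by
    conv_lhs => rw [← h]
    rw [h, ← h, ← map_mul, h, Ring.mul_inverse_cancel _ hb, map_one]
  calc W.parity (Ring.inverse b) = Ring.inverse b * b * W.parity (Ring.inverse b) := by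
        rw [Ring.inverse_mul_cancel _ hb, one_mul]
    _ = _ := by rw [mul_assoc, h1, mul_one]

theorem ghostShift_odd {l m y : SMat B} (hl : W.EvenEntries l) (hm : W.EvenEntries m)
    (hr : IsUnit (str (l * m))) (hy : W.OddEntries y) : W.OddEntries (ghostShift l m y) := by
  have h1 : W.OddEntries (sig B * tracelessPart (acomm m y)) :=
    EvenEntries.mul_odd evenEntries_sig (OddEntries.tracelessPart
      (OddEntries.add (EvenEntries.mul_odd hm hy) (OddEntries.mul_even hy hm)))
  intro i j
  rw [ghostShift, Matrix.smul_apply, smul_eq_mul, map_mul, map_smul,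
    parity_inverse (parity_str_mul hl hm) hr, h1 i j, mul_neg]

namespace Sector

variable {s : Sector B}

namespace Ok

variable (hs : s.Ok W)
include hs

section Ghosts

variable (hε : W.parity ε = -ε)
include hε

theorem proj_k_comm {x : SMat B} (hx : IsSl W x) :
    proj s.k (comm x (ε • s.l + ε • s.m)) =
      tracelessPart (comm (proj 0 x) (ε • s.l)) + tracelessPart (comm (proj 2 x) (ε • s.m)) := by
  rw [comm_add, proj_add,
    proj_comm (k := s.k) (k' := 0) hx (hs.isSl_l hε).even (hs.l_gr.bsmul ε) (by rw [zero_add]),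
    proj_comm (k := s.k) (k' := 2) hx (hs.isSl_m hε).even (hs.m_gr.bsmul ε)
      (by rcases hs.degrees with ⟨h1, h2⟩ | ⟨h1, h2⟩ <;> rw [h1, h2])]

theorem proj_two_comm {x : SMat B} (hx : IsSl W x) :
    proj 2 (comm x (ε • s.l + ε • s.m)) =
      tracelessPart (comm (proj s.k x) (ε • s.l)) +
        tracelessPart (comm (proj s.k' x) (ε • s.m)) := by
  rw [comm_add, proj_add,
    proj_comm (k := 2) (k' := s.k) hx (hs.isSl_l hε).even (hs.l_gr.bsmul ε)
      (by rcases hs.degrees with ⟨h1, h2⟩ | ⟨h1, h2⟩ <;> rw [h1]),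
    proj_comm (k := 2) (k' := s.k') hx (hs.isSl_m hε).even (hs.m_gr.bsmul ε)
      (by rcases hs.degrees with ⟨h1, h2⟩ | ⟨h1, h2⟩ <;> rw [h2])]

theorem proj_k'_comm {x : SMat B} (hx : IsSl W x) :
    proj s.k' (comm x (ε • s.l + ε • s.m)) =
      tracelessPart (comm (proj 2 x) (ε • s.l)) + tracelessPart (comm (proj 0 x) (ε • s.m)) := by
  rw [comm_add, proj_add,
    proj_comm (k := s.k') (k' := 2) hx (hs.isSl_l hε).even (hs.l_gr.bsmul ε)
      (by rcases hs.degrees with ⟨h1, h2⟩ | ⟨h1, h2⟩ <;> rw [h1, h2]),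
    proj_comm (k := s.k') (k' := 0) hx (hs.isSl_m hε).even (hs.m_gr.bsmul ε) (by rw [zero_add])]

theorem proj_zero_comm {x : SMat B} (hx : IsSl W x) :
    proj 0 (comm x (ε • s.l + ε • s.m)) =
      tracelessPart (comm (proj s.k' x) (ε • s.l)) +
        tracelessPart (comm (proj s.k x) (ε • s.m)) := by
  rw [comm_add, proj_add,
    proj_comm (k := 0) (k' := s.k') hx (hs.isSl_l hε).even (hs.l_gr.bsmul ε)
      (by rcases hs.degrees with ⟨h1, h2⟩ | ⟨h1, h2⟩ <;> rw [h1, h2]),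
    proj_comm (k := 0) (k' := s.k) hx (hs.isSl_m hε).even (hs.m_gr.bsmul ε)
      (by rcases hs.degrees with ⟨h1, h2⟩ | ⟨h1, h2⟩ <;> rw [h1, h2])]

theorem tracelessPart_comm_eq_sum {x : SMat B} (hx : IsSl W x) (X : SMat B) :
    tracelessPart (comm x X) = tracelessPart (comm (proj 0 x) X) +
      tracelessPart (comm (proj s.k x) X) + tracelessPart (comm (proj 2 x) X) +
      tracelessPart (comm (proj s.k' x) X) := by
  rw [← hx.comm_tracelessPart, tracelessPart_eq_sum x, add_comm', add_comm', add_comm']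
  simp only [tracelessPart_add]
  rcases hs.degrees with ⟨h1, h2⟩ | ⟨h1, h2⟩
  · rw [h1, h2]
  · rw [h1, h2]; abel

end Ghosts

theorem gr_P (X : SMat B) : Gr s.k (s.P X) := hs.pair.ghostProj_gr (proj_gr _ _)

theorem odd_proj {X : SMat B} (hX : W.IsEvenSuper X) {j : ℕ} (hj : Odd j) :
    W.OddEntries (proj j X) :=
  oddEntries_of_isOff ((proj_gr j X).isOff hj) (hX.proj j)

theorem odd_shift {X : SMat B} (hX : W.IsEvenSuper X) :
    W.OddEntries (ghostShift s.m s.l (proj s.k X)) :=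
  ghostShift_odd hs.m_even hs.l_even hs.regular (hs.odd_proj hX hs.odd_k)

theorem P_eq (X : SMat B) :
    s.P X = proj s.k X + comm s.m (ghostShift s.m s.l (proj s.k X)) :=
  hs.pair.ghostProj_eq_shift (proj_gr _ _)

theorem odd_P {X : SMat B} (hX : W.IsEvenSuper X) : W.OddEntries (s.P X) := by
  rw [hs.P_eq]
  have h := hs.odd_shift hX
  exact OddEntries.add (hs.odd_proj hX hs.odd_k)
    (OddEntries.sub (EvenEntries.mul_odd hs.m_even h) (OddEntries.mul_even h hs.m_even))

theorem isOff_P (X : SMat B) : IsOff (s.P X) := (hs.gr_P X).isOff hs.odd_k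

theorem isSl_P {X : SMat B} (hX : W.IsEvenSuper X) : IsSl W (s.P X) :=
  ⟨isEvenSuper_of_isOff (hs.isOff_P X) (hs.odd_P hX), (hs.isOff_P X).str_eq⟩

theorem isSl_O {X : SMat B} (hX : W.IsEvenSuper X) : IsSl W (s.O X) :=
  (hs.isSl_d hX).sub ((hs.isSl_P hX).smul _)

theorem P_constraint (X : SMat B) : tracelessPart (acomm s.l (s.P X)) = 0 :=
  hs.pair.acomm_ghostProj (proj_gr _ _)

theorem P_add (X Y : SMat B) : s.P (X + Y) = s.P X + s.P Y := by
  rw [Sector.P, proj_add]; exact hs.pair.ghostProj_add (proj_gr _ _) (proj_gr _ _)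

theorem P_smul (c : ℂ) (X : SMat B) : s.P (c • X) = c • s.P X := by
  rw [Sector.P, proj_smul]; exact hs.pair.ghostProj_smul (proj_gr _ _) c

theorem P_neg (X : SMat B) : s.P (-X) = -s.P X := by
  rw [← neg_one_smul ℂ, hs.P_smul, neg_one_smul]

theorem O_add (X Y : SMat B) : s.O (X + Y) = s.O X + s.O Y := by
  simp only [Sector.O, Sector.d, hs.P_add, proj_add, smul_add]; abel

theorem O_neg (X : SMat B) : s.O (-X) = -s.O X := by
  simp only [Sector.O, Sector.d, hs.P_neg, proj_neg, smul_neg]; abel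

omit hs in
theorem P_congr {X Y : SMat B} (h : tracelessPart X = tracelessPart Y) : s.P X = s.P Y := by
  rw [Sector.P, Sector.P, ← proj_tracelessPart, h, proj_tracelessPart]

theorem O_congr {X Y : SMat B} (h : tracelessPart X = tracelessPart Y) : s.O X = s.O Y := by
  have e : ∀ k, proj k X = proj k Y := fun k => by
    rw [← proj_tracelessPart, h, proj_tracelessPart]
  simp only [Sector.O, Sector.d, Sector.P, e]

section Ghosts

variable (hε : W.parity ε = -ε)
include hε

/-- The image of `[m, ·]` commutes with `m`, since `m²` is a multiple of the identity. -/
theorem comm_P_m {X : SMat B} (hX : W.IsEvenSuper X) :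
    comm (s.P X) (ε • s.m) = comm (proj s.k X) (ε • s.m) := by
  obtain ⟨c, hc⟩ := sq_eq_scalar_of_pure hs.isOff_m (EvenEntries.central hs.m_even) hs.m_pure
  rw [comm_bsmul_of_odd hε (hs.odd_P hX), comm_bsmul_of_odd hε (hs.odd_proj hX hs.odd_k), hs.P_eq]
  set S := ghostShift s.m s.l (proj s.k X)
  have h : acomm (comm s.m S) s.m = 0 := by
    have h1 : acomm (comm s.m S) s.m = comm (s.m * s.m) S := by
      simp only [acomm, comm]; noncomm_ring
    rw [h1]
    have h2 : CentralEntries (s.m * s.m) :=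
      EvenEntries.central (EvenEntries.mul hs.m_even hs.m_even)
    have h3 : ∀ b, c * b = b * c := by
      intro b
      have := h2 (Sum.inl 0) (Sum.inl 0) b
      rw [hc] at this
      simpa using this
    rw [hc, comm, scalar_mul_of_central h3, sub_self]
  have h4 : acomm (proj s.k X + comm s.m S) s.m =
      acomm (proj s.k X) s.m + acomm (comm s.m S) s.m := by
    simp only [acomm]; noncomm_ring
  rw [h4, h, add_zero]

theorem comm_P_l {X : SMat B} (hX : W.IsEvenSuper X) :
    tracelessPart (comm (s.P X) (ε • s.l)) = 0 := by
  have h : acomm (s.P X) s.l = acomm s.l (s.P X) := add_comm _ _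
  rw [comm_bsmul_of_odd hε (hs.odd_P hX), tracelessPart_neg, tracelessPart_bsmul, h,
    hs.P_constraint, smul_zero, neg_zero]

theorem even_proj {X : SMat B} (hX : W.IsEvenSuper X) {j : ℕ} (hj : Even j) :
    W.EvenEntries (proj j X) :=
  evenEntries_of_isDiag ((proj_gr j X).isDiag hj) (hX.proj j)

theorem ghostProj_comm_m {X : SMat B} (hX : W.IsEvenSuper X) :
    ghostProj s.m s.l (tracelessPart (comm (proj 2 X) (ε • s.m))) = 0 := by
  have h2 := hs.even_proj hε hX (j := 2) (by decide)
  refine hs.pair.ghostProj_eq ⟨ε • proj 2 X, ?_, ?_, ?_⟩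
  · rw [proj_bsmul, proj_proj, if_pos rfl]
  · have o : IsOff (comm (proj 2 X) (ε • s.m)) :=
      (((proj_gr 2 X).comm (hs.m_gr.bsmul ε) (hX.proj 2) (hs.isSl_m hε).even)).isOff
        (by rcases hs.degrees with ⟨h1, h2⟩ | ⟨h1, h2⟩ <;> rw [h2] <;> decide)
    rw [o.tracelessPart_eq, comm_bsmul_of_even hε h2,
      bsmul_comm_left_of_central (EvenEntries.central hs.m_even), ← smul_add,
      comm_swap s.m, add_neg_cancel, smul_zero]
  · rw [acomm, mul_zero, zero_mul, add_zero, tracelessPart_zero]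

theorem ghostProj_comm_l {X : SMat B} (hX : W.IsEvenSuper X) :
    ghostProj s.m s.l (tracelessPart (comm (proj 0 X) (ε • s.l))) =
      tracelessPart (comm (proj 0 X) (ε • s.l)) := by
  have h0 := hs.even_proj hε hX (j := 0) (by decide)
  have o : IsOff (comm (proj 0 X) (ε • s.l)) :=
    (((proj_gr 0 X).comm (hs.l_gr.bsmul ε) (hX.proj 0) (hs.isSl_l hε).even)).isOff
      (by rcases hs.degrees with ⟨h1, h2⟩ | ⟨h1, h2⟩ <;> rw [h1] <;> decide)
  obtain ⟨c, hc⟩ := sq_eq_scalar_of_pure hs.isOff_l (EvenEntries.central hs.l_even) hs.l_pure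
  rw [o.tracelessPart_eq]
  refine hs.pair.ghostProj_eq ⟨0, ?_, ?_, ?_⟩
  · rw [proj_zero]
  · rw [comm_zero, add_zero]
  · rw [comm_bsmul_of_even hε h0,
      bsmul_acomm_of_central (EvenEntries.central hs.l_even)]
    have h1 : acomm s.l (comm (proj 0 X) s.l) = comm (proj 0 X) (s.l * s.l) := by
      simp only [acomm, comm]; noncomm_ring
    rw [h1, hc, comm_scalar_central (EvenEntries.central h0), smul_zero, tracelessPart_zero]

/-- The ghost projector of a commutator with the ghosts. -/
theorem P_comm {x : SMat B} (hx : IsSl W x) :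
    s.P (comm x (ε • s.l + ε • s.m)) = tracelessPart (comm (proj 0 x) (ε • s.l)) := by
  have g1 := ((proj_gr 0 x).comm (hs.l_gr.bsmul ε) (hx.even.proj 0) (hs.isSl_l hε).even)
  have g2 := ((proj_gr 2 x).comm (hs.m_gr.bsmul ε) (hx.even.proj 2) (hs.isSl_m hε).even)
  rw [Sector.P, hs.proj_k_comm hε hx,
    hs.pair.ghostProj_add (g1.tracelessPart.congr (by rw [zero_add]))
      (g2.tracelessPart.congr
        (by rcases hs.degrees with ⟨h1, h2⟩ | ⟨h1, h2⟩ <;> rw [h1, h2])),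
    hs.ghostProj_comm_m hε hx.even, hs.ghostProj_comm_l hε hx.even, add_zero]

/-- The operator `d - 4 P` commutes with the ghosts up to a sign on one half of them: this
makes the operator `Ad⁻¹ (d - 4 P) Ad` transform under `Q₀` by a commutator. -/
theorem O_comm {x : SMat B} (hx : IsSl W x) :
    tracelessPart (s.O (comm (ε • s.l + ε • s.m) x)) =
      tracelessPart (comm (ε • s.l + ε • s.m) (s.O x)) -
        tracelessPart (comm (ε • s.l - ε • s.m) x) := by
  have hk := hs.proj_k_comm hε hx
  have h2 := hs.proj_two_comm hε hx
  have hk' := hs.proj_k'_comm hε hx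
  have hP := hs.P_comm hε hx
  have hl := hs.tracelessPart_comm_eq_sum hε hx (ε • s.l)
  have hm := hs.tracelessPart_comm_eq_sum hε hx (ε • s.m)
  have p1 := hs.comm_P_m hε hx.even
  have p2 := hs.comm_P_l hε hx.even
  rw [comm_swap (ε • s.l + ε • s.m) x, hs.O_neg, comm_swap _ (s.O x), comm_swap _ x]
  simp only [Sector.O, Sector.d, hk, h2, hk', hP]
  simp only [comm_add, comm_sub, add_comm', sub_comm',
    smul_comm', tracelessPart_add, tracelessPart_sub, tracelessPart_smul, tracelessPart_neg,
    tracelessPart_tracelessPart, hl, hm, p1, p2]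
  module

end Ghosts

end Ok
end Sector
end Chirality

section Chirality

variable {B : Type*} [Ring B] [Algebra ℂ B] {W : Worldsheet B} {ε ε' : B}

/-! ### Infinitesimal variations of one chirality -/

theorem Inf.comm_eq_zero (hε : W.parity ε = -ε) {X Y : SMat B} (hX : Inf ε X) (hY : Inf ε Y) :
    comm X Y = 0 := by
  rw [comm, hX.mul_eq_zero hε hY, hY.mul_eq_zero hε hX, sub_zero]

namespace Sector

/-- The covariant derivative `D l - [N, l]`, for the ghost `ε l`. -/
def Dl (s : Sector B) (X : SMat B) : SMat B :=
  X.map s.D + comm (proj 0 s.A) X - comm s.N X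
/-- `A_k + a`, the variation of the momentum under `Q₀` up to a sign. -/
def F (s : Sector B) : SMat B := proj s.k s.A + s.a
/-- The BRST variation of the antifield, for `Y = RΛ(ε)`. -/
def Ba (s : Sector B) (Y : SMat B) (η : ℂ) (ε : B) : SMat B :=
  s.Dl (ε • s.l) + η • s.P (s.ad (Y.map s.D))
/-- The operator `Ad_g⁻¹ (d - 4 P) Ad_g`. -/
def K (s : Sector B) (X : SMat B) : SMat B := s.adInv (s.O (s.ad X))
/-- The current in the frame of the right action. -/
def j (s : Sector B) : SMat B := s.adInv s.J
/-- The variation `g ↦ (1 + V) g`, `o ↦ o + p`, `a ↦ a + b`. -/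
def vary (s : Sector B) (V p b : SMat B) : Sector B :=
  { s with g := s.g + V * s.g, o := s.o + p, a := s.a + b }

variable {s : Sector B}

theorem adInv_add (X Y : SMat B) : s.adInv (X + Y) = s.adInv X + s.adInv Y := by
  simp only [adInv, mul_add, add_mul]
theorem adInv_sub (X Y : SMat B) : s.adInv (X - Y) = s.adInv X - s.adInv Y := by
  simp only [adInv, mul_sub, sub_mul]
theorem adInv_neg (X : SMat B) : s.adInv (-X) = -s.adInv X := by
  simp only [adInv, mul_neg, neg_mul]
theorem ad_add (X Y : SMat B) : s.ad (X + Y) = s.ad X + s.ad Y := by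
  simp only [ad, mul_add, add_mul]
theorem ad_neg (X : SMat B) : s.ad (-X) = -s.ad X := by
  simp only [ad, mul_neg, neg_mul]

namespace Ok

variable (hs : s.Ok W)
include hs

theorem adInv_ad (X : SMat B) : s.adInv (s.ad X) = X := by
  rw [adInv, ad, mul_assoc s.g, ← mul_assoc (Ring.inverse s.g), hs.inverse_mul_g, one_mul,
    mul_assoc, hs.inverse_mul_g, mul_one]
theorem ad_adInv (X : SMat B) : s.ad (s.adInv X) = X := by
  rw [adInv, ad, mul_assoc (Ring.inverse s.g), ← mul_assoc s.g, hs.g_mul_inverse, one_mul,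
    mul_assoc, hs.g_mul_inverse, mul_one]
theorem adInv_comm (X Y : SMat B) : s.adInv (comm X Y) = comm (s.adInv X) (s.adInv Y) := by
  have h : ∀ X Y, s.adInv (X * Y) = s.adInv X * s.adInv Y := by
    intro X Y
    simp only [adInv, mul_assoc]
    rw [← mul_assoc s.g, hs.g_mul_inverse, one_mul]
  rw [comm, adInv_sub, h, h, comm]
theorem ad_comm (X Y : SMat B) : s.ad (comm X Y) = comm (s.ad X) (s.ad Y) := by
  rw [← hs.ad_adInv (comm (s.ad X) (s.ad Y)), hs.adInv_comm, hs.adInv_ad, hs.adInv_ad]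
theorem ad_mul_g (X : SMat B) : s.ad X * s.g = s.g * X := by
  rw [ad, mul_assoc, hs.inverse_mul_g, mul_one]

theorem adInv_congr {X Y : SMat B} (hX : IsSl W X) (hY : IsSl W Y)
    (h : tracelessPart X = tracelessPart Y) :
    tracelessPart (s.adInv X) = tracelessPart (s.adInv Y) :=
  hX.conj_congr hY h hs.inverse_mul_g
theorem ad_congr {X Y : SMat B} (hX : IsSl W X) (hY : IsSl W Y)
    (h : tracelessPart X = tracelessPart Y) :
    tracelessPart (s.ad X) = tracelessPart (s.ad Y) :=
  hX.conj_congr hY h hs.g_mul_inverse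

theorem map_g : s.g.map s.D = -(s.A * s.g) := by
  rw [A, neg_mul, neg_neg, mul_assoc, hs.inverse_mul_g, mul_one]
theorem map_inverse : (Ring.inverse s.g).map s.D = Ring.inverse s.g * s.A := by
  have h := map_mul_of_leibniz (f := s.D) hs.leibniz (Ring.inverse s.g) s.g
  have h0 : s.D 1 = 0 := by
    have := hs.leibniz 1 1
    simpa using this
  have h1 : (1 : SMat B).map s.D = 0 := by
    ext i j
    rw [Matrix.map_apply, Matrix.one_apply]
    split_ifs <;> simp [h0]
  rw [hs.inverse_mul_g, h1, hs.map_g] at h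
  have h2 := congrArg (· * Ring.inverse s.g) h
  simp only [zero_mul, add_mul, mul_assoc, hs.g_mul_inverse, mul_one, mul_neg, neg_mul] at h2
  exact (add_neg_eq_zero.mp h2.symm)

/-- `Ad⁻¹` maps the covariant derivative to the derivative. -/
theorem adInv_cov (X : SMat B) : s.adInv (s.cov X) = (s.adInv X).map s.D := by
  rw [adInv, adInv, map_mul_of_leibniz (f := s.D) hs.leibniz, map_mul_of_leibniz (f := s.D) hs.leibniz, hs.map_g,
    hs.map_inverse, cov, comm]
  noncomm_ring
theorem cov_ad (X : SMat B) : s.cov (s.ad X) = s.ad (X.map s.D) := by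
  rw [← hs.ad_adInv (s.cov (s.ad X)), hs.adInv_cov, hs.adInv_ad]

theorem d_add (X Y : SMat B) : s.d (X + Y) = s.d X + s.d Y := by
  simp only [d, proj_add, smul_add]; abel
theorem d_neg (X : SMat B) : s.d (-X) = -s.d X := by
  simp only [d, proj_neg, smul_neg]; abel

theorem isSl_K {X : SMat B} (hX : IsSl W X) : IsSl W (s.K X) :=
  hs.isSl_adInv (hs.isSl_O (hs.isSl_ad hX).even)
theorem isSl_j : IsSl W s.j := hs.isSl_adInv hs.isSl_J
theorem K_add (X Y : SMat B) : s.K (X + Y) = s.K X + s.K Y := by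
  rw [K, ad_add, hs.O_add, adInv_add]; rfl
theorem K_neg (X : SMat B) : s.K (-X) = -s.K X := by
  rw [K, ad_neg, hs.O_neg, adInv_neg]; rfl
theorem K_congr {X Y : SMat B} (hX : IsSl W X) (hY : IsSl W Y)
    (h : tracelessPart X = tracelessPart Y) : s.K X = s.K Y := by
  rw [K, hs.O_congr (hs.ad_congr hX hY h)]; rfl

section Vary

variable (hε : W.parity ε = -ε) (hD : s.D ε = 0)
include hε

theorem inf_O {X : SMat B} (hX : Inf ε X) : Inf ε (s.O X) :=
  (((((hX.proj _).smul _).add ((hX.proj _).smul _)).add (hX.proj _))).sub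
    ((hs.pair.inf_ghostProj hX).smul _)
theorem inf_d {X : SMat B} (hX : Inf ε X) : Inf ε (s.d X) :=
  ((((hX.proj _).smul _).add ((hX.proj _).smul _)).add (hX.proj _))
theorem inf_ad {X : SMat B} (hX : Inf ε X) : Inf ε (s.ad X) := (hX.mul_left hε _).mul_right _
theorem inf_adInv {X : SMat B} (hX : Inf ε X) : Inf ε (s.adInv X) :=
  (hX.mul_left hε _).mul_right _
theorem inf_K {X : SMat B} (hX : Inf ε X) : Inf ε (s.K X) :=
  hs.inf_adInv hε (hs.inf_O hε (hs.inf_ad hε hX))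

variable {V p b : SMat B} (hV : Inf ε V)
include hV

theorem vary_inverse :
    Ring.inverse (s.vary V p b).g = Ring.inverse s.g - Ring.inverse s.g * V := by
  have hVV : V * V = 0 := hV.mul_eq_zero hε hV
  have h1 : (s.g + V * s.g) * (Ring.inverse s.g - Ring.inverse s.g * V) = 1 := by
    have : (s.g + V * s.g) * (Ring.inverse s.g - Ring.inverse s.g * V) =
      s.g * Ring.inverse s.g + V * (s.g * Ring.inverse s.g) - (s.g * Ring.inverse s.g) * V
        - V * (s.g * Ring.inverse s.g) * V := by noncomm_ring
    rw [this, hs.g_mul_inverse, mul_one, hVV]; noncomm_ring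
  have h2 : (Ring.inverse s.g - Ring.inverse s.g * V) * (s.g + V * s.g) = 1 := by
    have : (Ring.inverse s.g - Ring.inverse s.g * V) * (s.g + V * s.g) =
      Ring.inverse s.g * s.g - Ring.inverse s.g * (V * V) * s.g := by noncomm_ring
    rw [this, hs.inverse_mul_g, hVV]; noncomm_ring
  have hu : (s.vary V p b).g = ((⟨_, _, h1, h2⟩ : (SMat B)ˣ) : SMat B) := rfl
  rw [hu, Ring.inverse_unit]; rfl

theorem vary_adInv (X : SMat B) : (s.vary V p b).adInv X = s.adInv X - s.adInv (comm V X) := by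
  have h : Ring.inverse s.g * V * X * (V * s.g) = 0 := by
    have := ((hV.mul_left hε (Ring.inverse s.g)).mul_right X).mul_eq_zero hε (hV.mul_right s.g)
    exact this
  rw [adInv, hs.vary_inverse hε hV]
  have : (Ring.inverse s.g - Ring.inverse s.g * V) * X * (s.vary V p b).g =
    s.adInv X - s.adInv (comm V X) - Ring.inverse s.g * V * X * (V * s.g) := by
    simp only [adInv, comm, vary]; noncomm_ring
  rw [this, h, sub_zero]

theorem vary_ad (X : SMat B) : (s.vary V p b).ad X = s.ad X + comm V (s.ad X) := by
  have h : (V * s.g) * X * (Ring.inverse s.g * V) = 0 := by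
    have := ((hV.mul_right s.g).mul_right X).mul_eq_zero hε (hV.mul_left hε (Ring.inverse s.g))
    exact this
  rw [ad, hs.vary_inverse hε hV]
  have : (s.vary V p b).g * X * (Ring.inverse s.g - Ring.inverse s.g * V) =
    s.ad X + comm V (s.ad X) - (V * s.g) * X * (Ring.inverse s.g * V) := by
    simp only [ad, comm, vary]; noncomm_ring
  rw [this, h, sub_zero]

/-- `Ad⁻¹ (d - 4 P) Ad` changes by the commutator of `d - 4 P` with the bracket with `V`. The ghosts,
and with them `d - 4 P`, are not varied. -/
theorem vary_K (X : SMat B) : (s.vary V p b).K X =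
    s.K X + s.adInv (s.O (comm V (s.ad X)) - comm V (s.O (s.ad X))) := by
  have hO : (s.vary V p b).O = s.O := rfl
  have hi := hs.inf_O hε (hV.comm_left hε (s.ad X))
  rw [K, hO, hs.vary_ad hε hV, hs.vary_adInv hε hV, hs.O_add, comm_add,
    hV.comm_eq_zero hε hi, add_zero, adInv_add, adInv_sub, K]
  abel

include hD

/-- The connection changes by minus a covariant derivative. -/
theorem vary_A : (s.vary V p b).A = s.A - s.cov V := by
  have hDV := hV.map_of_const hs.leibniz hD
  have h1 : V.map s.D * V = 0 := hDV.mul_eq_zero hε hV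
  have h2 : V * s.A * V = 0 := (hV.mul_right s.A).mul_eq_zero hε hV
  rw [A, hs.vary_inverse hε hV]
  have hm : (s.vary V p b).g.map (s.vary V p b).D = s.g.map s.D + (V * s.g).map s.D := by
    ext i j; simp [vary]
  rw [hm, map_mul_of_leibniz (f := s.D) hs.leibniz, hs.map_g]
  have : -((-(s.A * s.g) + (V.map s.D * s.g + V * -(s.A * s.g))) *
      (Ring.inverse s.g - Ring.inverse s.g * V)) =
      s.A * (s.g * Ring.inverse s.g) - V.map s.D * (s.g * Ring.inverse s.g)
       + V * s.A * (s.g * Ring.inverse s.g) - s.A * (s.g * Ring.inverse s.g) * V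
       + V.map s.D * (s.g * Ring.inverse s.g) * V - V * s.A * (s.g * Ring.inverse s.g) * V := by
    noncomm_ring
  rw [this, hs.g_mul_inverse]
  simp only [mul_one, h1, h2, cov, comm]
  noncomm_ring

omit hε hD hV in
theorem vary_N : (s.vary V p b).N = s.N - acomm p s.m := by
  simp only [N, vary, acomm]; noncomm_ring

theorem vary_J : (s.vary V p b).J =
    s.J + (-s.d (s.cov V) - (4 : ℂ) • acomm p s.m + (4 : ℂ) • b) := by
  have hd : (s.vary V p b).d = s.d := rfl
  have ha : (s.vary V p b).a = s.a + b := rfl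
  rw [J, hd, ha, hs.vary_A hε hD hV, hs.vary_N, sub_eq_add_neg, hs.d_add, hs.d_neg, J]
  module

theorem vary_j (hp : Inf ε p) (hb : Inf ε b) : (s.vary V p b).j = s.j +
    s.adInv (-s.d (s.cov V) - (4 : ℂ) • acomm p s.m + (4 : ℂ) • b - comm V s.J) := by
  have hi : Inf ε (-s.d (s.cov V) - (4 : ℂ) • acomm p s.m + (4 : ℂ) • b) :=
    ((hs.inf_d hε ((hV.map_of_const hs.leibniz hD).add
      (hV.comm_right hε _))).neg.sub ((hp.acomm_left hε _).smul _)).add (hb.smul _)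
  rw [j, hs.vary_J hε hD hV, hs.vary_adInv hε hV, comm_add, hV.comm_eq_zero hε hi, add_zero,
    adInv_add, adInv_sub, j]
  abel

end Vary

section Ghosts

variable (hε : W.parity ε = -ε) (hD : s.D ε = 0)
include hε

theorem odd_F : W.OddEntries s.F := OddEntries.add (hs.odd_proj hs.isSl_A.even hs.odd_k) hs.a_odd

theorem acomm_F : acomm (-(ε • s.F)) s.m = comm s.F (ε • s.m) := by
  rw [comm_bsmul_of_odd hε (hs.odd_F hε), acomm, neg_mul, mul_neg, mul_bsmul hε,
    EvenEntries.map_parity hs.m_even, Matrix.smul_mul, acomm, smul_add, neg_add]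

include hD

theorem gr_map_l : Gr s.k ((ε • s.l).map s.D) := (hs.l_gr.bsmul ε).map _
theorem gr_map_m : Gr s.k' ((ε • s.m).map s.D) := (hs.m_gr.bsmul ε).map _

theorem proj_map_ghosts (i : ℕ) : proj i ((ε • s.l + ε • s.m).map s.D) =
    (if s.k % 4 = i % 4 then (ε • s.l).map s.D else 0) +
    (if s.k' % 4 = i % 4 then (ε • s.m).map s.D else 0) := by
  have : (ε • s.l + ε • s.m).map s.D = (ε • s.l).map s.D + (ε • s.m).map s.D := by
    ext i j; simp
  rw [this, proj_add, (hs.gr_map_l hε hD).proj_eq, (hs.gr_map_m hε hD).proj_eq,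
    ((hs.gr_map_l hε hD).isOff hs.odd_k).tracelessPart_eq,
    ((hs.gr_map_m hε hD).isOff hs.odd_k').tracelessPart_eq]

/-- The variation of `A_k + a` under `Q₀`. -/
theorem proj_cov_k : tracelessPart (-proj s.k (s.cov (ε • s.l + ε • s.m)) + s.Dl (ε • s.l)) =
    -tracelessPart (comm (proj 2 s.A) (ε • s.m)) - tracelessPart (comm s.N (ε • s.l)) := by
  have h1 := hs.proj_k_comm hε hs.isSl_A
  have h2 := hs.proj_map_ghosts hε hD s.k
  have h3 : ¬ s.k' % 4 = s.k % 4 := by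
    rcases hs.degrees with ⟨h1, h2⟩ | ⟨h1, h2⟩ <;> rw [h1, h2] <;> decide
  rw [if_pos rfl, if_neg h3] at h2
  rw [cov, proj_add, h1, h2, Dl]
  simp only [tracelessPart_add, tracelessPart_sub, tracelessPart_neg,
    tracelessPart_tracelessPart, tracelessPart_zero]
  abel

/-- The variation of `A₀ - N` under `Q₀`. -/
theorem proj_cov_zero : tracelessPart
      (-proj 0 (s.cov (ε • s.l + ε • s.m)) + acomm (-(ε • s.F)) s.m) =
    -tracelessPart (comm (proj s.k' s.A) (ε • s.l)) + tracelessPart (comm s.a (ε • s.m)) := by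
  have h1 := hs.proj_zero_comm hε hs.isSl_A
  have h2 := hs.proj_map_ghosts hε hD 0
  have h3 : ¬ s.k' % 4 = 0 % 4 ∧ ¬ s.k % 4 = 0 % 4 := by
    rcases hs.degrees with ⟨h1, h2⟩ | ⟨h1, h2⟩ <;> rw [h1, h2] <;> decide
  rw [if_neg h3.2, if_neg h3.1] at h2
  rw [hs.acomm_F hε, cov, proj_add, h1, h2, F, add_comm']
  simp only [tracelessPart_add, tracelessPart_neg,
    tracelessPart_tracelessPart, tracelessPart_zero]
  abel

/-- `Q₀` acts on the current in the frame of the left action by a covariant derivative. -/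
theorem vary_current : tracelessPart (-s.d (s.cov (ε • s.l + ε • s.m)) -
      (4 : ℂ) • acomm (-(ε • s.F)) s.m + (4 : ℂ) • s.Dl (ε • s.l) -
        comm (ε • s.l + ε • s.m) s.J) =
    tracelessPart (s.cov (ε • s.l - ε • s.m)) := by
  have a1 := hs.proj_k_comm hε hs.isSl_A
  have a2 := hs.proj_two_comm hε hs.isSl_A
  have a3 := hs.proj_k'_comm hε hs.isSl_A
  have b1 := hs.proj_map_ghosts hε hD s.k
  have b2 := hs.proj_map_ghosts hε hD 2
  have b3 := hs.proj_map_ghosts hε hD s.k'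
  have h3 : ¬ s.k' % 4 = s.k % 4 ∧ ¬ s.k % 4 = s.k' % 4 ∧ ¬ s.k % 4 = 2 % 4 ∧
      ¬ s.k' % 4 = 2 % 4 := by
    rcases hs.degrees with ⟨h1, h2⟩ | ⟨h1, h2⟩ <;> rw [h1, h2] <;> decide
  rw [if_pos rfl, if_neg h3.1] at b1
  rw [if_neg h3.2.2.1, if_neg h3.2.2.2] at b2
  rw [if_pos rfl, if_neg h3.2.1] at b3
  have hl := hs.tracelessPart_comm_eq_sum hε hs.isSl_A (ε • s.l)
  have hm := hs.tracelessPart_comm_eq_sum hε hs.isSl_A (ε • s.m)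
  have n1 := hs.comm_N_m hε
  have n2 := hs.comm_a_l hε
  have hmap : (ε • s.l - ε • s.m).map s.D = (ε • s.l).map s.D - (ε • s.m).map s.D := by
    ext i j; simp
  rw [hs.acomm_F hε, cov, hs.d_add, comm_swap _ s.J, Dl, cov, hmap]
  simp only [d, a1, a2, a3, b1, b2, b3, J, F]
  simp only [comm_add, comm_sub, add_comm', smul_comm', tracelessPart_add, tracelessPart_sub,
    tracelessPart_smul, tracelessPart_neg, tracelessPart_tracelessPart, hl, hm, n1, n2,
    tracelessPart_zero]
  module

end Ghosts

end Ok
end Sector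
end Chirality

/-! ### The constraints are preserved -/

section Constraints

variable {B : Type*} [Ring B] [Algebra ℂ B] {W : Worldsheet B} {ε ε' : B}

theorem EvenEntries.zero : W.EvenEntries (0 : SMat B) := fun _ _ => map_zero _

namespace Sector.Ok

variable {s : Sector B} (hs : s.Ok W)
include hs

theorem acomm_l_comm {M : SMat B} (hM : W.EvenEntries M) : acomm s.l (comm M s.l) = 0 := by
  obtain ⟨c, hc⟩ := sq_eq_scalar_of_pure hs.isOff_l (EvenEntries.central hs.l_even) hs.l_pure
  have h1 : acomm s.l (comm M s.l) = comm M (s.l * s.l) := by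
    simp only [acomm, comm]; noncomm_ring
  rw [h1, hc, comm_scalar_central (EvenEntries.central hM)]

theorem acomm_l_map : tracelessPart (acomm s.l (s.l.map s.D)) = 0 := by
  have h : (acomm s.l s.l).map s.D = (2 : ℂ) • acomm s.l (s.l.map s.D) := by
    have h1 : (acomm s.l s.l).map s.D = (s.l * s.l).map s.D + (s.l * s.l).map s.D := by
      ext i j; simp [acomm]
    rw [h1, map_mul_of_leibniz (f := s.D) hs.leibniz, acomm, two_smul]; abel
  have h2 := tracelessPart_map s.D (acomm s.l s.l)
  have h3 : (0 : SMat B).map s.D = 0 := by ext i j; simp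
  rw [hs.l_pure, h3, h, tracelessPart_smul] at h2
  exact (smul_eq_zero.mp h2).resolve_left two_ne_zero

section Ghosts

variable (hε : W.parity ε = -ε) (hD : s.D ε = 0)
include hε hD

/-- The variation of the antifield under `Q₀`, written as `ε` times a matrix. -/
theorem Dl_eq : s.Dl (ε • s.l) =
    ε • (s.l.map s.D + comm (proj 0 s.A) s.l - comm s.N s.l) := by
  rw [Sector.Dl, bsmul_map_of_const hs.leibniz hD,
    comm_bsmul_of_even hε (hs.even_proj hε hs.isSl_A.even (by decide)),
    comm_bsmul_of_even hε hs.N_even, ← smul_add, ← smul_sub]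

theorem inf_Dl : Inf ε (s.Dl (ε • s.l)) := by
  rw [hs.Dl_eq hε hD]; exact Inf.bsmul _

theorem odd_Dl : W.OddEntries (s.Dl (ε • s.l)) := by
  have h0 := hs.even_proj hε hs.isSl_A.even (j := 0) (by decide)
  have h : ∀ M, W.EvenEntries M → W.EvenEntries (comm M s.l) := fun M hM =>
    EvenEntries.sub (EvenEntries.mul hM hs.l_even) (EvenEntries.mul hs.l_even hM)
  rw [hs.Dl_eq hε hD]
  refine OddEntries.bsmul hε (EvenEntries.sub (EvenEntries.add ?_ (h _ h0)) (h _ hs.N_even))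
  intro i j
  rw [Matrix.map_apply, hs.parity_D, hs.l_even]

theorem gr_Dl : Gr s.k (s.Dl (ε • s.l)) := by
  have hl := hs.l_gr.bsmul ε
  have h : ∀ M, Gr 0 M → W.IsEvenSuper M → Gr s.k (comm M (ε • s.l)) := fun M hM eM => by
    have := hM.comm hl eM (hs.isSl_l hε).even
    rwa [zero_add] at this
  exact ((hl.map _).add (h _ (proj_gr 0 _) (hs.isSl_A.even.proj 0))).sub
    (h _ hs.N_gr hs.isSl_N.even)

theorem Dl_constraint : tracelessPart (acomm s.l (s.Dl (ε • s.l))) = 0 := by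
  have h0 := hs.even_proj hε hs.isSl_A.even (j := 0) (by decide)
  have h : acomm s.l (s.l.map s.D + comm (proj 0 s.A) s.l - comm s.N s.l) =
      acomm s.l (s.l.map s.D) + acomm s.l (comm (proj 0 s.A) s.l) -
        acomm s.l (comm s.N s.l) := by
    simp only [acomm]; noncomm_ring
  rw [hs.Dl_eq hε hD, bsmul_acomm_of_central (EvenEntries.central hs.l_even), h,
    hs.acomm_l_comm h0, hs.acomm_l_comm hs.N_even, add_zero, sub_zero, tracelessPart_bsmul,
    hs.acomm_l_map, smul_zero]

omit hD in
theorem gr_F : Gr s.k s.F := (proj_gr _ _).add hs.a_gr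

end Ghosts

/-- The constraints are preserved by infinitesimal variations in the allowed directions. -/
theorem vary_ok (hε : W.parity ε = -ε) {V p b : SMat B} (hV : Inf ε V) (sV : IsSl W V)
    (ep : W.EvenEntries p) (gp : Gr s.k p) (ob : W.OddEntries b) (gb : Gr s.k b)
    (cb : tracelessPart (acomm s.l b) = 0) : (s.vary V p b).Ok W where
  degrees := hs.degrees
  leibniz := hs.leibniz
  parity_D := hs.parity_D
  g_mem := by
    have h := IsSL.translate hε hs.g_mem (hs.isSl_adInv sV) (hs.inf_adInv hε hV)
    rwa [← hs.ad_mul_g, hs.ad_adInv] at h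
  l_even := hs.l_even
  l_gr := hs.l_gr
  l_pure := hs.l_pure
  m_even := hs.m_even
  m_gr := hs.m_gr
  m_pure := hs.m_pure
  regular := hs.regular
  o_even := EvenEntries.add hs.o_even ep
  o_gr := hs.o_gr.add gp
  a_odd := OddEntries.add hs.a_odd ob
  a_gr := hs.a_gr.add gb
  a_constraint := by
    have : acomm s.l (s.a + b) = acomm s.l s.a + acomm s.l b := by
      simp only [acomm]; noncomm_ring
    rw [show (s.vary V p b).l = s.l from rfl, show (s.vary V p b).a = s.a + b from rfl, this,
      tracelessPart_add, hs.a_constraint, cb, add_zero]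

end Sector.Ok

namespace Fields

/-- The fields of the chirality with derivative `∂₊`. -/
def plus (φ : Fields B) (W : Worldsheet B) : Sector B where
  D := W.dPlus
  k := 1
  k' := 3
  g := φ.g
  l := φ.lam1
  m := φ.lam3
  o := φ.om1
  a := φ.ast1
/-- The fields of the chirality with derivative `∂₋`. -/
def minus (φ : Fields B) (W : Worldsheet B) : Sector B where
  D := W.dMinus
  k := 3
  k' := 1
  g := φ.g
  l := φ.lam3
  m := φ.lam1
  o := φ.om3
  a := φ.ast3

variable {φ : Fields B}

theorem admissible_iff : φ.Admissible W ↔ (φ.plus W).Ok W ∧ (φ.minus W).Ok W := by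
  have hst : W.EvenEntries φ.lam1 → Gr 1 φ.lam1 →
      str (φ.lam3 * φ.lam1) = -str (φ.lam1 * φ.lam3) := fun h1 h2 => by
    rw [str_mul_off_central (h2.isOff (by decide)) (EvenEntries.central h1), neg_neg]
  have off : ∀ {k : ℕ} {X : SMat B}, Odd k → Gr k X → proj k X = X := fun {k X} hk h =>
    (proj_eq_self_iff k X).2 ⟨h, (h.isOff hk).tracelessPart_eq⟩
  have gr : ∀ {k : ℕ} {X : SMat B}, proj k X = X → Gr k X := fun {k X} h =>
    ((proj_eq_self_iff k X).1 h).1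
  constructor
  · intro h
    exact ⟨⟨Or.inl ⟨rfl, rfl⟩, W.dPlus_mul, W.parity_dPlus, h.g_mem, h.lam1_even,
        gr h.lam1_grade, h.lam1_pure, h.lam3_even, gr h.lam3_grade, h.lam3_pure,
        by rw [plus, hst h.lam1_even (gr h.lam1_grade)]; exact h.lam_regular.neg,
        h.om1_even, gr h.om1_grade, h.ast1_odd, gr h.ast1_grade, h.ast1_constraint⟩,
      ⟨Or.inr ⟨rfl, rfl⟩, W.dMinus_mul, W.parity_dMinus, h.g_mem, h.lam3_even,
        gr h.lam3_grade, h.lam3_pure, h.lam1_even, gr h.lam1_grade, h.lam1_pure,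
        h.lam_regular, h.om3_even, gr h.om3_grade, h.ast3_odd, gr h.ast3_grade,
        h.ast3_constraint⟩⟩
  · rintro ⟨h1, h2⟩
    exact ⟨h1.g_mem, h1.l_even, off (by decide) h1.l_gr, h1.l_pure, h1.m_even,
      off (by decide) h1.m_gr, h1.m_pure, h2.regular, h1.o_even, off (by decide) h1.o_gr,
      h2.o_even, off (by decide) h2.o_gr, h1.a_odd, off (by decide) h1.a_gr, h1.a_constraint,
      h2.a_odd, off (by decide) h2.a_gr, h2.a_constraint⟩

/-- The generator of the variation of `g` from the left. -/
def gen (φ : Fields B) (R : psl →ₗ[ℂ] psl) (η : ℂ) (ε : B) : SMat B :=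
  (ε • φ.lam1 + ε • φ.lam3) + η • φ.Ad (φ.RLam R ε)

theorem brst_g (h : (φ.plus W).Ok W) (R : psl →ₗ[ℂ] psl) (η : ℂ) (ε : B) :
    (φ.brst W R η ε).g = φ.g + φ.gen R η ε * φ.g := by
  change φ.g + ((ε • φ.lam1 + ε • φ.lam3) * φ.g + η • (φ.g * φ.RLam R ε)) = _
  have : φ.Ad (φ.RLam R ε) * φ.g = φ.g * φ.RLam R ε := h.ad_mul_g _
  rw [gen, add_mul (ε • φ.lam1 + ε • φ.lam3), smul_mul_assoc η, this]

theorem brst_plus (h : (φ.plus W).Ok W) (R : psl →ₗ[ℂ] psl) (η : ℂ) (ε : B) :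
    (φ.brst W R η ε).plus W = (φ.plus W).vary (φ.gen R η ε) (-(ε • (φ.plus W).F))
      ((φ.plus W).Ba (φ.RLam R ε) η ε) := by
  have hg := brst_g h R η ε
  have h1 : (φ.brst W R η ε).lam1 = φ.lam1 := by
    change φ.lam1 + ((0 : SMat B) + η • (0 : SMat B)) = _
    simp
  have h3 : (φ.brst W R η ε).lam3 = φ.lam3 := by
    change φ.lam3 + ((0 : SMat B) + η • (0 : SMat B)) = _
    simp
  have ho : (φ.brst W R η ε).om1 = φ.om1 + -(ε • (φ.plus W).F) := by
    change φ.om1 + (-(ε • (φ.plus W).F) + η • (0 : SMat B)) = _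
    simp
  have ha : (φ.brst W R η ε).ast1 = φ.ast1 + (φ.plus W).Ba (φ.RLam R ε) η ε := rfl
  simp only [plus] at *
  simp only [hg, h1, h3, ho, ha, Sector.vary]

theorem brst_minus (h : (φ.plus W).Ok W) (R : psl →ₗ[ℂ] psl) (η : ℂ) (ε : B) :
    (φ.brst W R η ε).minus W = (φ.minus W).vary (φ.gen R η ε) (-(ε • (φ.minus W).F))
      ((φ.minus W).Ba (φ.RLam R ε) η ε) := by
  have hg := brst_g h R η ε
  have h1 : (φ.brst W R η ε).lam1 = φ.lam1 := by
    change φ.lam1 + ((0 : SMat B) + η • (0 : SMat B)) = _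
    simp
  have h3 : (φ.brst W R η ε).lam3 = φ.lam3 := by
    change φ.lam3 + ((0 : SMat B) + η • (0 : SMat B)) = _
    simp
  have ho : (φ.brst W R η ε).om3 = φ.om3 + -(ε • (φ.minus W).F) := by
    change φ.om3 + (-(ε • (φ.minus W).F) + η • (0 : SMat B)) = _
    simp
  have ha : (φ.brst W R η ε).ast3 = φ.ast3 + (φ.minus W).Ba (φ.RLam R ε) η ε := rfl
  simp only [minus] at *
  simp only [hg, h1, h3, ho, ha, Sector.vary]

variable {R : psl →ₗ[ℂ] psl} (hR : IsEvenOperator R)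

/-- The parameter `Λ(ε)` of the gauge symmetry deforming the BRST charge. -/
def Lam (φ : Fields B) (ε : B) : SMat B := φ.AdInv (ε • φ.lam3 - ε • φ.lam1)

theorem isSl_Lam (h : (φ.plus W).Ok W) (hε : W.parity ε = -ε) : IsSl W (φ.Lam ε) :=
  h.isSl_adInv ((h.isSl_m hε).sub (h.isSl_l hε))

theorem inf_RLam (hε : W.parity ε = -ε) : Inf ε (φ.RLam R ε) :=
  ((((Inf.bsmul φ.lam3).sub (Inf.bsmul φ.lam1)).mul_left hε _).mul_right _).extend R

theorem inf_gen (hε : W.parity ε = -ε) (η : ℂ) : Inf ε (φ.gen R η ε) :=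
  ((Inf.bsmul _).add (Inf.bsmul _)).add
    ((((inf_RLam hε).mul_left hε _).mul_right _).smul _)

include hR

theorem isSl_RLam (h : (φ.plus W).Ok W) (hε : W.parity ε = -ε) : IsSl W (φ.RLam R ε) :=
  IsSl.extend hR (isSl_Lam h hε).even

theorem isSl_gen (h : (φ.plus W).Ok W) (hε : W.parity ε = -ε) (η : ℂ) :
    IsSl W (φ.gen R η ε) :=
  ((h.isSl_l hε).add (h.isSl_m hε)).add ((h.isSl_ad (isSl_RLam hR h hε)).smul _)

omit hR in
theorem vary_brst_ok {s : Sector B} (hs : s.Ok W) (hε : W.parity ε = -ε) (hD : s.D ε = 0)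
    {V Y : SMat B} (hV : Inf ε V) (sV : IsSl W V) (hY : IsSl W Y) (η : ℂ) :
    (s.vary V (-(ε • s.F)) (s.Ba Y η ε)).Ok W := by
  have hZ := (hs.isSl_ad (hY.map s.D hs.parity_D)).even
  refine hs.vary_ok hε hV sV (EvenEntries.neg (EvenEntries.bsmul hε (hs.odd_F hε)))
    ((hs.gr_F hε).bsmul _).neg
    (OddEntries.add (hs.odd_Dl hε hD) (OddEntries.smul _ (hs.odd_P hZ)))
    ((hs.gr_Dl hε hD).add ((hs.gr_P _).smul _)) ?_
  have h : acomm s.l (s.Ba Y η ε) =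
      acomm s.l (s.Dl (ε • s.l)) + η • acomm s.l (s.P (s.ad (Y.map s.D))) := by
    simp only [acomm, Sector.Ba, mul_add, add_mul, mul_smul_comm, smul_mul_assoc, smul_add]; abel
  rw [h, tracelessPart_add, tracelessPart_smul, hs.Dl_constraint hε hD, hs.P_constraint,
    smul_zero, add_zero]

theorem brst_admissible (h : φ.Admissible W) (hε : W.IsOddConstant ε) (η : ℂ) :
    (φ.brst W R η ε).Admissible W := by
  obtain ⟨h1, h2⟩ := admissible_iff.1 h
  obtain ⟨e0, e1, e2⟩ := hε
  refine admissible_iff.2 ⟨?_, ?_⟩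
  · rw [brst_plus h1]
    exact vary_brst_ok h1 e0 e1 (inf_gen e0 η) (isSl_gen hR h1 e0 η) (isSl_RLam hR h1 e0) η
  · rw [brst_minus h1]
    exact vary_brst_ok h2 e0 e2 (inf_gen e0 η) (isSl_gen hR h1 e0 η) (isSl_RLam hR h1 e0) η

end Fields
end Constraints

/-! ### Recursion for the deformed currents -/

section Recursion

variable {B : Type*} [Ring B] [Algebra ℂ B] {W : Worldsheet B} {ε : B}

theorem str_mul_congr {X X' Y : SMat B} (hX : IsSl W X) (hX' : IsSl W X')
    (h : tracelessPart X = tracelessPart X') (hY : IsSl W Y) : str (X * Y) = str (X' * Y) := by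
  obtain ⟨c, -, hc⟩ := hX.exists_eq_add_scalar hX' h
  have e : Matrix.scalar (Fin 4 ⊕ Fin 4) c * Y = c • Y := by
    ext i j; simp
  rw [hc, add_mul, str_add, e, str_bsmul, hY.str_eq, mul_zero, add_zero]

theorem str_mul_congr_right {X X' Y : SMat B} (hX : IsSl W X) (hX' : IsSl W X')
    (h : tracelessPart X = tracelessPart X') (hY : IsSl W Y) : str (Y * X) = str (Y * X') := by
  rw [str_mul_comm hY.even hX.even, str_mul_congr hX hX' h hY, str_mul_comm hX'.even hY.even]

theorem proj_congr {k l : ℕ} (h : k % 4 = l % 4) (Z : SMat B) : proj k Z = proj l Z := by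
  have e : ∀ j, Complex.I ^ (3 * k * j) = Complex.I ^ (3 * l * j) := fun j => by
    rw [Complex.I_pow_eq_pow_mod (3 * k * j), Complex.I_pow_eq_pow_mod (3 * l * j)]
    congr 1
    exact ((Nat.ModEq.mul_left 3 h).mul_right j)
  rw [proj, proj]
  simp only [e]

/-- The components of degrees adding up to zero are dual to each other. -/
theorem str_proj_mul {X Y : SMat B} (hX : W.IsEvenSuper X) (hY : W.IsEvenSuper Y) {i j : ℕ}
    (h : (i + j) % 4 = 0) : str (proj i X * Y) = str (X * proj j Y) := by
  have z : ∀ k l, (k + l) % 4 ≠ 0 → str (proj k X * proj l Y) = 0 := fun k l hkl =>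
    str_mul_eq_zero (proj_gr k X) (proj_gr l Y) (hX.proj k) (hY.proj l) hkl
  have p : ∀ k l : ℕ, ∀ Z : SMat B, k % 4 = l % 4 → proj k Z = proj l Z :=
    fun k l Z hkl => proj_congr hkl Z
  have h1 : str (proj i X * Y) = str (proj i X * proj j Y) := by
    rw [← str_tracelessPart_mul' Y (tracelessPart_proj i X), tracelessPart_eq_sum Y]
    simp only [mul_add, str_add]
    have : j % 4 = 0 ∨ j % 4 = 1 ∨ j % 4 = 2 ∨ j % 4 = 3 := by omega
    rcases this with hj | hj | hj | hj
    · rw [p j 0 Y hj, z i 1 (by omega), z i 2 (by omega), z i 3 (by omega)]; simp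
    · rw [p j 1 Y hj, z i 0 (by omega), z i 2 (by omega), z i 3 (by omega)]; simp
    · rw [p j 2 Y hj, z i 0 (by omega), z i 1 (by omega), z i 3 (by omega)]; simp
    · rw [p j 3 Y hj, z i 0 (by omega), z i 1 (by omega), z i 2 (by omega)]; simp
  have h2 : str (X * proj j Y) = str (proj i X * proj j Y) := by
    rw [← str_mul_tracelessPart X (tracelessPart_proj j Y), tracelessPart_eq_sum X]
    simp only [add_mul, str_add]
    have : i % 4 = 0 ∨ i % 4 = 1 ∨ i % 4 = 2 ∨ i % 4 = 3 := by omega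
    rcases this with hj | hj | hj | hj
    · rw [p i 0 X hj, z 1 j (by omega), z 2 j (by omega), z 3 j (by omega)]; simp
    · rw [p i 1 X hj, z 0 j (by omega), z 2 j (by omega), z 3 j (by omega)]; simp
    · rw [p i 2 X hj, z 0 j (by omega), z 1 j (by omega), z 3 j (by omega)]; simp
    · rw [p i 3 X hj, z 0 j (by omega), z 1 j (by omega), z 2 j (by omega)]; simp
  rw [h1, h2]

namespace Sector

variable {s : Sector B}

/-- The currents `(K R)ⁿ j`, the coefficients of the deformation series. -/
def w (s : Sector B) (R : psl →ₗ[ℂ] psl) : ℕ → SMat B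
  | 0 => s.j
  | n + 1 => s.K (extend R (s.w R n))

/-- The result of the `Q₀` variation. -/
def v0 (s : Sector B) (ε : B) : Sector B :=
  s.vary (ε • s.l + ε • s.m) (-(ε • s.F)) (s.Dl (ε • s.l))
/-- The result of the `Q₁` variation with parameter `Y`. -/
def v1 (s : Sector B) (Y : SMat B) : Sector B :=
  s.vary (s.ad Y) 0 (s.P (s.ad (Y.map s.D)))
/-- The parameter `Λ(ε)` of the deformation, up to the sign by which the two chiralities
differ. -/
def lam (s : Sector B) (ε : B) : SMat B := s.adInv (ε • s.l - ε • s.m)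

namespace Ok

variable (hs : s.Ok W)
include hs

theorem isSl_w {R : psl →ₗ[ℂ] psl} (hR : IsEvenOperator R) : ∀ n, IsSl W (s.w R n)
  | 0 => hs.isSl_j
  | n + 1 => hs.isSl_K (IsSl.extend hR (isSl_w hR n).even)

section Vary

variable (hε : W.parity ε = -ε) (hD : s.D ε = 0)
include hε

theorem isSl_lam : IsSl W (s.lam ε) := hs.isSl_adInv ((hs.isSl_l hε).sub (hs.isSl_m hε))

/-- Under `Q₀` the operator `Ad⁻¹ (d - 4 P) Ad` changes by minus the bracket with `Λ`. The argument
is varied at the same time, from `x` to `x + y`. -/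
theorem v0_K {x y : SMat B} (hx : IsSl W x) (hy : Inf ε y) :
    tracelessPart ((s.v0 ε).K (x + y) - s.K x) =
      tracelessPart (s.K y - comm (s.lam ε) x) := by
  have hX : Inf ε (ε • s.l + ε • s.m) := (Inf.bsmul _).add (Inf.bsmul _)
  have h1 : comm (ε • s.l + ε • s.m) (s.ad (x + y)) = comm (ε • s.l + ε • s.m) (s.ad x) := by
    rw [ad_add, comm_add, hX.comm_eq_zero hε (hs.inf_ad hε hy), add_zero]
  have h2 : comm (ε • s.l + ε • s.m) (s.O (s.ad (x + y))) =
      comm (ε • s.l + ε • s.m) (s.O (s.ad x)) := by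
    rw [ad_add, hs.O_add, comm_add, hX.comm_eq_zero hε (hs.inf_O hε (hs.inf_ad hε hy)), add_zero]
  have sX := (hs.isSl_l hε).add (hs.isSl_m hε)
  have sL := (hs.isSl_l hε).sub (hs.isSl_m hε)
  have h3 := hs.O_comm hε (hs.isSl_ad hx)
  have h4 : tracelessPart (s.adInv (s.O (comm (ε • s.l + ε • s.m) (s.ad x)) -
      comm (ε • s.l + ε • s.m) (s.O (s.ad x)))) =
      tracelessPart (s.adInv (-comm (ε • s.l - ε • s.m) (s.ad x))) := by
    refine hs.adInv_congr ((hs.isSl_O (sX.comm (hs.isSl_ad hx)).even).sub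
      (sX.comm (hs.isSl_O (hs.isSl_ad hx).even))) (sL.comm (hs.isSl_ad hx)).neg ?_
    rw [tracelessPart_sub, h3, tracelessPart_neg]; abel
  rw [v0, hs.vary_K hε hX, h1, h2, hs.K_add, tracelessPart_sub, tracelessPart_add,
    tracelessPart_add, h4, adInv_neg, hs.adInv_comm, hs.adInv_ad, tracelessPart_neg,
    tracelessPart_sub, lam]
  abel

/-- Under `Q₁` the operator `Ad⁻¹ (d - 4 P) Ad` changes by its commutator with the bracket with
`Y`. -/
theorem v1_K {x y Y : SMat B} (hY : Inf ε Y) (hy : Inf ε y) :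
    (s.v1 Y).K (x + y) - s.K x = s.K y + s.K (comm Y x) - comm Y (s.K x) := by
  have hX : Inf ε (s.ad Y) := hs.inf_ad hε hY
  have h1 : comm (s.ad Y) (s.ad (x + y)) = comm (s.ad Y) (s.ad x) := by
    rw [ad_add, comm_add, hX.comm_eq_zero hε (hs.inf_ad hε hy), add_zero]
  have h2 : comm (s.ad Y) (s.O (s.ad (x + y))) = comm (s.ad Y) (s.O (s.ad x)) := by
    rw [ad_add, hs.O_add, comm_add, hX.comm_eq_zero hε (hs.inf_O hε (hs.inf_ad hε hy)), add_zero]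
  rw [v1, hs.vary_K hε hX, h1, h2, hs.K_add, adInv_sub, ← hs.ad_comm, hs.adInv_comm,
    hs.adInv_ad]
  change s.K x + s.K y + (s.K (comm Y x) - comm Y (s.K x)) - s.K x = _
  abel

theorem inf_v0_K {x y : SMat B} (hy : Inf ε y) : Inf ε ((s.v0 ε).K (x + y) - s.K x) := by
  have hX : Inf ε (ε • s.l + ε • s.m) := (Inf.bsmul _).add (Inf.bsmul _)
  rw [v0, hs.vary_K hε hX, hs.K_add, add_assoc, add_sub_cancel_left]
  exact (hs.inf_K hε hy).add (hs.inf_adInv hε ((hs.inf_O hε (hX.comm_left hε _)).sub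
    (hX.comm_left hε _)))

theorem inf_v1_K {x y Y : SMat B} (hY : Inf ε Y) (hy : Inf ε y) :
    Inf ε ((s.v1 Y).K (x + y) - s.K x) := by
  rw [hs.v1_K hε hY hy]
  exact ((hs.inf_K hε hy).add (hs.inf_K hε (hY.comm_left hε _))).sub (hY.comm_left hε _)

include hD

theorem v0_ok : (s.v0 ε).Ok W :=
  hs.vary_ok hε ((Inf.bsmul _).add (Inf.bsmul _)) ((hs.isSl_l hε).add (hs.isSl_m hε))
    (EvenEntries.neg (EvenEntries.bsmul hε (hs.odd_F hε))) ((hs.gr_F hε).bsmul _).neg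
    (hs.odd_Dl hε hD) (hs.gr_Dl hε hD) (hs.Dl_constraint hε hD)

omit hD in
theorem v1_ok {Y : SMat B} (hY : Inf ε Y) (sY : IsSl W Y) : (s.v1 Y).Ok W :=
  hs.vary_ok hε (hs.inf_ad hε hY) (hs.isSl_ad sY) EvenEntries.zero Gr.zero
    (hs.odd_P (hs.isSl_ad (sY.map s.D hs.parity_D)).even) (hs.gr_P _) (hs.P_constraint _)

theorem inf_cov {V : SMat B} (hV : Inf ε V) : Inf ε (s.cov V) :=
  (hV.map_of_const hs.leibniz hD).add (hV.comm_right hε _)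

theorem inf_v0_j : Inf ε ((s.v0 ε).j - s.j) := by
  have hX : Inf ε (ε • s.l + ε • s.m) := (Inf.bsmul _).add (Inf.bsmul _)
  have hp : Inf ε (-(ε • s.F)) := (Inf.bsmul _).neg
  rw [v0, hs.vary_j hε hD hX hp (hs.inf_Dl hε hD), add_sub_cancel_left]
  exact hs.inf_adInv hε ((((hs.inf_d hε (hs.inf_cov hε hD hX)).neg.sub
    ((hp.acomm_left hε _).smul _)).add ((hs.inf_Dl hε hD).smul _)).sub (hX.comm_left hε _))

/-- Under `Q₀` the current in the frame of the right action is a derivative of `Λ`. -/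
theorem v0_j : tracelessPart ((s.v0 ε).j - s.j) = tracelessPart ((s.lam ε).map s.D) := by
  have hX : Inf ε (ε • s.l + ε • s.m) := (Inf.bsmul _).add (Inf.bsmul _)
  have hp : Inf ε (-(ε • s.F)) := (Inf.bsmul _).neg
  have sX := (hs.isSl_l hε).add (hs.isSl_m hε)
  have sL := (hs.isSl_l hε).sub (hs.isSl_m hε)
  rw [v0, hs.vary_j hε hD hX hp (hs.inf_Dl hε hD), add_sub_cancel_left, lam, ← hs.adInv_cov]
  refine hs.adInv_congr ?_ (hs.isSl_cov sL) (hs.vary_current hε hD)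
  have e1 : IsSl W (acomm (-(ε • s.F)) s.m) := by
    rw [hs.acomm_F hε]
    exact ((IsSl.proj hs.isSl_A.even _).add hs.isSl_a).comm (hs.isSl_m hε)
  have e2 : IsSl W (s.Dl (ε • s.l)) :=
    (((hs.isSl_l hε).map s.D hs.parity_D).add
      ((IsSl.proj hs.isSl_A.even _).comm (hs.isSl_l hε))).sub (hs.isSl_N.comm (hs.isSl_l hε))
  exact (((hs.isSl_d (hs.isSl_cov sX).even).neg.sub (e1.smul _)).add (e2.smul _)).sub
    (sX.comm hs.isSl_J)

/-- Under `Q₁` the current changes by a commutator, from the conjugation, and by a term from the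
connection and the antifield, which combine to the operator `d - 4 P`. -/
theorem v1_j {Y : SMat B} (hY : Inf ε Y) :
    (s.v1 Y).j - s.j = -s.K (Y.map s.D) - comm Y s.j := by
  have hX : Inf ε (s.ad Y) := hs.inf_ad hε hY
  have hZ := hs.inf_ad hε (hY.map_of_const hs.leibniz hD)
  have hb : Inf ε (s.P (s.ad (Y.map s.D))) := hs.pair.inf_ghostProj hZ
  have h0 : Inf ε (0 : SMat B) := ⟨0, (smul_zero _).symm⟩
  have e : acomm 0 s.m = 0 := by rw [acomm, zero_mul, mul_zero, add_zero]
  rw [v1, hs.vary_j hε hD hX h0 hb, add_sub_cancel_left, hs.cov_ad, e, adInv_sub, hs.adInv_comm,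
    hs.adInv_ad, smul_zero, sub_zero, j, K, O, ← adInv_neg, neg_sub]
  rw [neg_add_eq_sub]

theorem inf_v1_j {Y : SMat B} (hY : Inf ε Y) : Inf ε ((s.v1 Y).j - s.j) := by
  rw [hs.v1_j hε hD hY]
  exact (hs.inf_K hε (hY.map_of_const hs.leibniz hD)).neg.sub (hY.comm_left hε _)

variable {R : psl →ₗ[ℂ] psl} (hR : IsEvenOperator R) (hYB : SolvesCYBE R)

theorem inf_v0_w : ∀ n, Inf ε ((s.v0 ε).w R n - s.w R n)
  | 0 => hs.inf_v0_j hε hD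
  | n + 1 => by
    have h := (inf_v0_w n).extend R
    have := hs.inf_v0_K hε (x := extend R (s.w R n)) h
    rwa [← extend_add, add_sub_cancel] at this

theorem inf_v1_w {Y : SMat B} (hY : Inf ε Y) : ∀ n, Inf ε ((s.v1 Y).w R n - s.w R n)
  | 0 => hs.inf_v1_j hε hD hY
  | n + 1 => by
    have h := (inf_v1_w hY n).extend R
    have := hs.inf_v1_K hε (x := extend R (s.w R n)) hY h
    rwa [← extend_add, add_sub_cancel] at this

include hR hYB

/-- The image under `R` of the recursion for the currents, by the Yang-Baxter equation. -/
theorem extend_comm_of (n : ℕ) :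
    extend R (comm (s.w R n) (extend R (s.lam ε)) - comm (s.lam ε) (extend R (s.w R n))) =
      tracelessPart (comm (extend R (s.w R n)) (extend R (s.lam ε))) := by
  rw [SolvesCYBE.comm_extend hR hYB (hs.isSl_w hR n) (hs.isSl_lam hε),
    comm_swap (s.lam ε), sub_neg_eq_add, add_comm]

/-- Recursion for the variations of the deformed currents: the `Q₀` variation of one order and
the `Q₁` variation of the preceding order add up to commutators. -/
theorem w_rec : ∀ n, tracelessPart ((s.v0 ε).w R (n + 1) - s.w R (n + 1) +
      ((s.v1 (extend R (s.lam ε))).w R n - s.w R n)) =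
    tracelessPart (comm (s.w R n) (extend R (s.lam ε)) -
      comm (s.lam ε) (extend R (s.w R n)))
  | 0 => by
    set Y := extend R (s.lam ε) with hYdef
    have hlam : Inf ε (s.lam ε) := hs.inf_adInv hε ((Inf.bsmul _).sub (Inf.bsmul _))
    have hY : Inf ε Y := hlam.extend R
    have h0 := hs.v0_j hε hD
    have hi := hs.inf_v0_j hε hD
    have h1 := hs.v1_j hε hD hY
    have h2 := hs.v0_K hε (IsSl.extend hR hs.isSl_j.even) (hi.extend R)
    rw [← extend_add, add_sub_cancel, extend_congr R h0, extend_map, ← hYdef] at h2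
    change tracelessPart ((s.v0 ε).K (extend R (s.v0 ε).j) - s.K (extend R s.j) +
      ((s.v1 Y).j - s.j)) = tracelessPart (comm s.j Y - comm (s.lam ε) (extend R s.j))
    rw [tracelessPart_add, h2, h1, comm_swap s.j Y]
    simp only [tracelessPart_sub, tracelessPart_neg]
    abel
  | n + 1 => by
    set Y := extend R (s.lam ε) with hYdef
    have hlam : Inf ε (s.lam ε) := hs.inf_adInv hε ((Inf.bsmul _).sub (Inf.bsmul _))
    have hY : Inf ε Y := hlam.extend R
    have sY : IsSl W Y := IsSl.extend hR (hs.isSl_lam hε).even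
    have ih := w_rec n
    rw [← hYdef] at ih
    have i0 := (hs.inf_v0_w hε hD (R := R) (n + 1)).extend R
    have i1 := (hs.inf_v1_w hε hD (R := R) hY n).extend R
    have sx := IsSl.extend hR (hs.isSl_w hR n).even
    have h0 := hs.v0_K hε (IsSl.extend hR (hs.isSl_w hR (n + 1)).even) i0
    have h1 := hs.v1_K hε (x := extend R (s.w R n)) hY i1
    have hx : extend R ((s.v0 ε).w R (n + 1) - s.w R (n + 1)) +
        extend R ((s.v1 Y).w R n - s.w R n) =
        tracelessPart (comm (extend R (s.w R n)) Y) := by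
      rw [← extend_add, extend_congr R ih, hs.extend_comm_of hε hD hR hYB]
    have hK : s.K (tracelessPart (comm (extend R (s.w R n)) Y)) =
        s.K (comm (extend R (s.w R n)) Y) :=
      hs.K_congr (IsSl.tracelessPart (sx.comm sY).even) (sx.comm sY)
        (tracelessPart_tracelessPart _)
    have h2 : s.K (extend R ((s.v0 ε).w R (n + 1) - s.w R (n + 1))) +
        s.K (extend R ((s.v1 Y).w R n - s.w R n)) = -s.K (comm Y (extend R (s.w R n))) := by
      rw [← hs.K_add, hx, hK, comm_swap, hs.K_neg]
    rw [← extend_add, add_sub_cancel] at h0 h1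
    change tracelessPart ((s.v0 ε).K (extend R ((s.v0 ε).w R (n + 1))) -
      s.K (extend R (s.w R (n + 1))) + ((s.v1 Y).K (extend R ((s.v1 Y).w R n)) -
      s.K (extend R (s.w R n)))) = _
    rw [tracelessPart_add, h0, h1, ← tracelessPart_add]
    congr 1
    have h3 : s.K (comm Y (extend R (s.w R n))) =
        -s.K (extend R ((s.v0 ε).w R (n + 1) - s.w R (n + 1))) -
          s.K (extend R ((s.v1 Y).w R n - s.w R n)) := by
      rw [← neg_add', h2, neg_neg]
    rw [comm_swap (s.w R (n + 1)) Y, h3]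
    change _ = -comm Y (s.K (extend R (s.w R n))) - _
    abel

end Vary

end Ok
end Sector
end Recursion

/-! ### Invariance of the interaction terms -/

section Invariance

variable {B : Type*} [Ring B] [Algebra ℂ B] {W : Worldsheet B} {ε : B}

namespace Fields

variable {φ : Fields B}

theorem jp_eq : φ.jp W = -(φ.plus W).j := rfl

theorem dPS_eq (X : SMat B) : dPS X = (φ.minus W).d X := by
  change dPS X = (3 : ℂ) • proj 3 X + (2 : ℂ) • proj 2 X + proj 1 X
  rw [dPS]; abel

theorem jm_eq : φ.jm W = (φ.minus W).j := by
  rw [jm, dPS_eq (W := W) (φ := φ)]; rfl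

theorem RK_eq (R : psl →ₗ[ℂ] psl) (X : SMat B) :
    φ.RK R X = extend R ((φ.minus W).K X) := by
  rw [RK, dPS_eq (W := W) (φ := φ)]; rfl

theorem RLam_eq (R : psl →ₗ[ℂ] psl) : φ.RLam R ε = extend R ((φ.minus W).lam ε) := rfl

theorem lam_plus : (φ.plus W).lam ε = -(φ.minus W).lam ε := by
  rw [Sector.lam, Sector.lam, ← neg_sub, Sector.adInv_neg]; rfl

/-- The corrections to the Lagrangian in terms of the currents of the two chiralities. -/
theorem Ldef_succ (R : psl →ₗ[ℂ] psl) (n : ℕ) :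
    φ.Ldef W R (n + 1) = (1 / 4 : ℂ) • str ((φ.plus W).j * extend R ((φ.minus W).w R n)) := by
  have h : ∀ n, (φ.RK R)^[n] (extend R (φ.jm W)) = extend R ((φ.minus W).w R n) := by
    intro n
    induction n with
    | zero => rw [jm_eq]; rfl
    | succ n ih => rw [Function.iterate_succ_apply', ih, RK_eq (W := W)]; rfl
  rw [Ldef, h, jp_eq, neg_mul, str_neg, smul_neg, neg_neg]

theorem Q0_plus (R : psl →ₗ[ℂ] psl) : (φ + φ.Q W R ε 0).plus W = (φ.plus W).v0 ε := by
  have h1 : (φ + φ.Q W R ε 0).lam1 = φ.lam1 := add_zero _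
  have h3 : (φ + φ.Q W R ε 0).lam3 = φ.lam3 := add_zero _
  rw [plus, h1, h3]; rfl

theorem Q0_minus (R : psl →ₗ[ℂ] psl) : (φ + φ.Q W R ε 0).minus W = (φ.minus W).v0 ε := by
  have h1 : (φ + φ.Q W R ε 0).lam1 = φ.lam1 := add_zero _
  have h3 : (φ + φ.Q W R ε 0).lam3 = φ.lam3 := add_zero _
  have hg : (φ + φ.Q W R ε 0).g = φ.g + (ε • φ.lam3 + ε • φ.lam1) * φ.g := by
    rw [add_comm (ε • φ.lam3)]; rfl
  rw [minus, h1, h3, hg]; rfl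

theorem Q1_plus (h : (φ.plus W).Ok W) (R : psl →ₗ[ℂ] psl) :
    (φ + φ.Q W R ε 1).plus W = (φ.plus W).v1 (φ.RLam R ε) := by
  have h1 : (φ + φ.Q W R ε 1).lam1 = φ.lam1 := add_zero _
  have h3 : (φ + φ.Q W R ε 1).lam3 = φ.lam3 := add_zero _
  have hg : (φ + φ.Q W R ε 1).g = φ.g + φ.Ad (φ.RLam R ε) * φ.g := by
    have : φ.Ad (φ.RLam R ε) * φ.g = φ.g * φ.RLam R ε := h.ad_mul_g _
    rw [this]; rfl
  rw [plus, h1, h3, hg]; rfl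

theorem Q1_minus (h : (φ.plus W).Ok W) (R : psl →ₗ[ℂ] psl) :
    (φ + φ.Q W R ε 1).minus W = (φ.minus W).v1 (φ.RLam R ε) := by
  have h1 : (φ + φ.Q W R ε 1).lam1 = φ.lam1 := add_zero _
  have h3 : (φ + φ.Q W R ε 1).lam3 = φ.lam3 := add_zero _
  have hg : (φ + φ.Q W R ε 1).g = φ.g + φ.Ad (φ.RLam R ε) * φ.g := by
    have : φ.Ad (φ.RLam R ε) * φ.g = φ.g * φ.RLam R ε := h.ad_mul_g _
    rw [this]; rfl
  rw [minus, h1, h3, hg]; rfl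

section Transpose

variable (h1 : (φ.plus W).Ok W) (h2 : (φ.minus W).Ok W)
include h1 h2

theorem str_adInv_mul {X Y : SMat B} (hX : W.IsEvenSuper X) (hY : W.IsEvenSuper Y) :
    str ((φ.plus W).adInv X * Y) = str (X * (φ.minus W).ad Y) := by
  have := str_mul_comm (W := W) h1.even_inverse ((hX.mul h1.even_g).mul hY)
  change str (Ring.inverse φ.g * X * φ.g * Y) = str (X * (φ.g * Y * Ring.inverse φ.g))
  change str (Ring.inverse φ.g * (X * φ.g * Y)) = str (X * φ.g * Y * Ring.inverse φ.g) at this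
  simpa only [mul_assoc] using this

theorem str_mul_adInv {X Y : SMat B} (hX : W.IsEvenSuper X) (hY : W.IsEvenSuper Y) :
    str (X * (φ.minus W).adInv Y) = str ((φ.plus W).ad X * Y) := by
  have e : W.IsEvenSuper ((φ.minus W).adInv Y) := (h1.even_inverse.mul hY).mul h1.even_g
  have e2 : W.IsEvenSuper ((φ.plus W).ad X) := (h1.even_g.mul hX).mul h1.even_inverse
  rw [str_mul_comm hX e, str_mul_comm e2 hY]
  exact str_adInv_mul h1 h2 hY hX

theorem str_P_mul {X Y : SMat B} (hX : W.IsEvenSuper X) (hY : W.IsEvenSuper Y) :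
    str ((φ.plus W).P X * Y) = str (X * (φ.minus W).P Y) := by
  have t1 : proj 1 ((φ.plus W).P X) = (φ.plus W).P X :=
    (proj_eq_self_iff _ _).2 ⟨h1.gr_P X, (h1.isOff_P X).tracelessPart_eq⟩
  have t2 : proj 3 ((φ.minus W).P Y) = (φ.minus W).P Y :=
    (proj_eq_self_iff _ _).2 ⟨h2.gr_P Y, (h2.isOff_P Y).tracelessPart_eq⟩
  have q1 := str_proj_mul (h1.isSl_P hX).even hY (i := 1) (j := 3) rfl
  have q2 := str_proj_mul hX (h2.isSl_P hY).even (i := 1) (j := 3) rfl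
  rw [t1] at q1
  rw [t2] at q2
  rw [q1, ← q2]
  exact h2.pair.str_ghostProj_mul (proj_gr 1 X) (proj_gr 3 Y)

/-- The operators `d - 4 P` of the two chiralities are transposed to each other. -/
theorem str_O_mul {X Y : SMat B} (hX : W.IsEvenSuper X) (hY : W.IsEvenSuper Y) :
    str ((φ.plus W).O X * Y) = str (X * (φ.minus W).O Y) := by
  have p1 := str_proj_mul hX hY (i := 1) (j := 3) rfl
  have p2 := str_proj_mul hX hY (i := 2) (j := 2) rfl
  have p3 := str_proj_mul hX hY (i := 3) (j := 1) rfl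
  have hP := str_P_mul h1 h2 hX hY
  have e1 : (φ.plus W).O X = (3 : ℂ) • proj 1 X + (2 : ℂ) • proj 2 X + proj 3 X -
    (4 : ℂ) • (φ.plus W).P X := rfl
  have e2 : (φ.minus W).O Y = (3 : ℂ) • proj 3 Y + (2 : ℂ) • proj 2 Y + proj 1 Y -
    (4 : ℂ) • (φ.minus W).P Y := rfl
  simp only [e1, e2, add_mul, sub_mul, mul_add, mul_sub, str_add, str_sub, smul_mul_assoc,
    mul_smul_comm, str_smul, p1, p2, p3, hP]

/-- The operators `Ad⁻¹ (d - 4 P) Ad` of the two chiralities are transposed to each other. -/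
theorem str_K_mul {X Y : SMat B} (hX : IsSl W X) (hY : IsSl W Y) :
    str ((φ.plus W).K X * Y) = str (X * (φ.minus W).K Y) := by
  have eX : W.IsEvenSuper ((φ.plus W).ad X) := (h1.isSl_ad hX).even
  have eY : W.IsEvenSuper ((φ.minus W).ad Y) := (h2.isSl_ad hY).even
  rw [Sector.K, str_adInv_mul h1 h2 (h1.isSl_O eX).even hY.even, str_O_mul h1 h2 eX eY, Sector.K,
    str_mul_adInv h1 h2 hX.even (h2.isSl_O eY).even]

end Transpose

variable {R : psl →ₗ[ℂ] psl}

theorem str_sub_mul (hε : W.parity ε = -ε) {X X' Y Y' : SMat B} (hX : Inf ε (X' - X))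
    (hY : Inf ε (Y' - Y)) :
    str (X' * Y') - str (X * Y) = str ((X' - X) * Y) + str (X * (Y' - Y)) := by
  have h := hX.mul_eq_zero hε hY
  have e : X' * Y' = X * Y + (X' - X) * Y + X * (Y' - Y) + (X' - X) * (Y' - Y) := by
    noncomm_ring
  rw [e, h, add_zero, str_add, str_add]; abel

/-- The terms of order at least two: the variation vanishes identically. -/
theorem invariance_add_two (hR : IsEvenOperator R) (hanti : IsAntisymmetric R)
    (hYB : SolvesCYBE R) (h1 : (φ.plus W).Ok W) (h2 : (φ.minus W).Ok W)
    (hε : W.IsOddConstant ε) (n : ℕ) :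
    ((φ + φ.Q W R ε 0).Ldef W R (n + 2) - φ.Ldef W R (n + 2)) +
      ((φ + φ.Q W R ε 1).Ldef W R (n + 1) - φ.Ldef W R (n + 1)) = 0 := by
  obtain ⟨e0, e1, e2⟩ := hε
  set p := φ.plus W
  set m := φ.minus W
  set Λ := m.lam ε
  set Y := extend R Λ with hYdef
  have hY : φ.RLam R ε = Y := RLam_eq R
  have sΛ : IsSl W Λ := h2.isSl_lam e0
  have sY : IsSl W Y := IsSl.extend hR sΛ.even
  have iY : Inf ε Y := ((((Inf.bsmul _).sub (Inf.bsmul _)).mul_left e0 _).mul_right _).extend R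
  have w0 := h2.isSl_w hR n
  have w1 := h2.isSl_w hR (n + 1)
  have x0 := IsSl.extend hR w0.even
  have x1 := IsSl.extend hR w1.even
  have i0 := (h2.inf_v0_w e0 e2 (R := R) (n + 1)).extend R
  have i1 := (h2.inf_v1_w e0 e2 (R := R) iY n).extend R
  have j0 := h1.inf_v0_j e0 e1
  have j1 := h1.inf_v1_j e0 e1 iY
  have q0 := h1.v0_ok e0 e1
  have hrec := h2.w_rec e0 e2 hR hYB n
  rw [extend_sub] at i0 i1
  simp only [Ldef_succ, Q0_plus, Q0_minus, Q1_plus h1, Q1_minus h1, hY]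
  rw [← smul_sub, ← smul_sub, ← smul_add, str_sub_mul e0 j0 i0, str_sub_mul e0 j1 i1]
  have hx : (extend R ((m.v0 ε).w R (n + 1)) - extend R (m.w R (n + 1))) +
      (extend R ((m.v1 Y).w R n) - extend R (m.w R n)) =
      tracelessPart (comm (extend R (m.w R n)) Y) := by
    rw [← extend_sub, ← extend_sub, ← extend_add, extend_congr R hrec,
      h2.extend_comm_of e0 e2 hR hYB]
  -- The current is varied by the derivative of the parameter, which `R` moves across the trace.
  have a0 : str (((p.v0 ε).j - p.j) * extend R (m.w R (n + 1))) =
      str (Y.map W.dPlus * m.w R (n + 1)) := by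
    have := h1.v0_j e0 e1
    rw [str_mul_congr (q0.isSl_j.sub h1.isSl_j) ((h1.isSl_lam e0).map p.D h1.parity_D) this x1]
    have e : (p.lam ε).map p.D = -(Λ.map W.dPlus) := by
      rw [lam_plus]; ext i j; exact map_neg W.dPlus _
    rw [e, neg_mul, str_neg, ← str_extend_mul hanti, extend_map]
  have a1 : str (((p.v1 Y).j - p.j) * extend R (m.w R n)) =
      -str (Y.map W.dPlus * m.w R (n + 1)) - str (comm Y p.j * extend R (m.w R n)) := by
    have hk := str_K_mul h1 h2 (sY.map W.dPlus W.parity_dPlus) x0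
    rw [h1.v1_j e0 e1 iY, sub_mul, str_sub, neg_mul, str_neg]
    exact congrArg (fun t => -t - _) hk
  have a2 : str (p.j * (extend R ((m.v0 ε).w R (n + 1)) - extend R (m.w R (n + 1)))) +
      str (p.j * (extend R ((m.v1 Y).w R n) - extend R (m.w R n))) =
      str (p.j * comm (extend R (m.w R n)) Y) := by
    rw [← str_add, ← mul_add, hx]
    exact str_mul_congr_right (IsSl.tracelessPart (x0.comm sY).even) (x0.comm sY)
      (tracelessPart_tracelessPart _) h1.isSl_j
  have a3 : str (comm Y p.j * extend R (m.w R n)) = str (p.j * comm (extend R (m.w R n)) Y) := by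
    rw [str_comm_mul sY.even h1.isSl_j.even x0.even, ← str_comm_mul h1.isSl_j.even x0.even sY.even,
      str_mul_comm sY.even (h1.isSl_j.comm x0).even]
  have : ∀ a b c d x z : B, a = x → c = -x - z → b + d = z → (1 / 4 : ℂ) • (a + b + (c + d)) = 0 := by
    intro a b c d x z ha hc hb
    rw [show a + b + (c + d) = a + c + (b + d) by abel, ha, hc, hb,
      show x + (-x - z) + z = 0 by abel, smul_zero]
  exact this _ _ _ _ _ _ a0 (by rw [a1, a3]) a2

end Fields
end Invariance

/-! ### Invariance of the undeformed Lagrangian and of the first correction -/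

section Invariance

variable {B : Type*} [Ring B] [Algebra ℂ B] {W : Worldsheet B} {ε : B}

theorem str_map_of_leibniz {f : B →ₗ[ℂ] B} (hf : ∀ a b, f (a * b) = f a * b + a * f b)
    (X Y : SMat B) : f (str (X * Y)) = str (X.map f * Y) + str (X * Y.map f) := by
  rw [← str_add, ← map_mul_of_leibniz f hf, str_map]

namespace Fields

variable {φ : Fields B} (h1 : (φ.plus W).Ok W) (h2 : (φ.minus W).Ok W)
include h1 h2

/-- The flatness of `A = -dg g⁻¹`. -/
theorem comm_A_A : comm (φ.plus W).A (φ.minus W).A =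
    (φ.plus W).A.map W.dMinus - (φ.minus W).A.map W.dPlus := by
  have a1 : (φ.plus W).A = -(φ.g.map W.dPlus * Ring.inverse φ.g) := rfl
  have a2 : (φ.minus W).A = -(φ.g.map W.dMinus * Ring.inverse φ.g) := rfl
  have i1 : (Ring.inverse φ.g).map W.dPlus = Ring.inverse φ.g * (φ.plus W).A := h1.map_inverse
  have i2 : (Ring.inverse φ.g).map W.dMinus = Ring.inverse φ.g * (φ.minus W).A := h2.map_inverse
  have hc : (φ.g.map W.dPlus).map W.dMinus = (φ.g.map W.dMinus).map W.dPlus := by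
    ext i j; exact (W.dPlus_dMinus _).symm
  have n : ∀ (f : B →ₗ[ℂ] B) (X : SMat B), (-X).map f = -X.map f := fun f X => by ext; simp
  have e1 : (φ.plus W).A.map W.dMinus = -((φ.g.map W.dPlus).map W.dMinus * Ring.inverse φ.g) +
      (φ.plus W).A * (φ.minus W).A := by
    conv_lhs => rw [a1]
    rw [n, map_mul_of_leibniz W.dMinus W.dMinus_mul, i2, a1]; noncomm_ring
  have e2 : (φ.minus W).A.map W.dPlus = -((φ.g.map W.dMinus).map W.dPlus * Ring.inverse φ.g) +
      (φ.minus W).A * (φ.plus W).A := by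
    conv_lhs => rw [a2]
    rw [n, map_mul_of_leibniz W.dPlus W.dPlus_mul, i1, a2]; noncomm_ring
  rw [e1, e2, hc, comm]; abel

theorem str_om1_comm (M : SMat B) :
    str (φ.om1 * comm M φ.lam3) = str ((φ.plus W).N * M) := by
  have := str_mul_off_central (w := φ.om1 * M) h1.isOff_m (EvenEntries.central h1.m_even)
  have hN : (φ.plus W).N * M = -(φ.om1 * φ.lam3 * M) - φ.lam3 * (φ.om1 * M) := by
    change -acomm φ.om1 φ.lam3 * M = _
    rw [acomm]; noncomm_ring
  have hc : φ.om1 * comm M φ.lam3 = φ.om1 * M * φ.lam3 - φ.om1 * φ.lam3 * M := by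
    rw [comm]; noncomm_ring
  have e : str (φ.lam3 * (φ.om1 * M)) = -str (φ.om1 * M * φ.lam3) := this
  rw [hN, hc, str_sub, str_sub, str_neg, e]; abel

omit h1 h2 in
theorem str_N_mul {s : Sector B} (hs : s.Ok W) {X : SMat B} (hX : IsSl W X) :
    str (s.N * proj 0 X) = str (s.N * X) := by
  have h : tracelessPart (proj 0 s.N) = tracelessPart s.N := by
    rw [hs.N_gr.proj_eq, if_pos rfl, tracelessPart_tracelessPart]
  rw [← str_proj_mul hs.isSl_N.even hX.even (i := 0) (j := 0) rfl,
    str_mul_congr (IsSl.proj hs.isSl_N.even _) hs.isSl_N h hX]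

/-- The undeformed Lagrangian in terms of the current of one chirality. -/
theorem L0_eq : φ.L0 W = (1 / 4 : ℂ) • str ((φ.plus W).A * (φ.minus W).J) +
    str (φ.om1 * (φ.lam3.map W.dMinus +
      comm (proj 0 (φ.minus W).A - (φ.minus W).N) φ.lam3)) -
    str ((φ.plus W).F * φ.ast3) + str (φ.om3 * φ.lam1.map W.dPlus) := by
  have eA := h1.isSl_A
  have eN := h2.isSl_N
  have b1 := str_N_mul h2 eA
  have b2 : str ((φ.minus W).N * (φ.plus W).N) = str ((φ.plus W).N * (φ.minus W).N) :=
    str_mul_comm h2.isSl_N.even h1.isSl_N.even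
  have b3 : str ((φ.minus W).N * (φ.plus W).A) = str ((φ.plus W).A * (φ.minus W).N) :=
    str_mul_comm h2.isSl_N.even h1.isSl_A.even
  have b4 : str (proj 1 (φ.plus W).A * φ.ast3) = str ((φ.plus W).A * φ.ast3) := by
    have t : proj 3 φ.ast3 = φ.ast3 :=
      (proj_eq_self_iff _ _).2 ⟨h2.a_gr, h2.isOff_a.tracelessPart_eq⟩
    have := str_proj_mul h1.isSl_A.even h2.isSl_a.even (i := 1) (j := 3) rfl
    exact this.trans (congrArg (fun t => str ((φ.plus W).A * t)) t)
  have c1 : (φ.minus W).J = dPS (φ.minus W).A + (4 : ℂ) • (φ.minus W).N + (4 : ℂ) • φ.ast3 := by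
    rw [dPS_eq (W := W) (φ := φ)]; rfl
  have c2 : (φ.plus W).F = proj 1 (φ.plus W).A + φ.ast1 := rfl
  have c3 : φ.L0 W = str ((1 / 4 : ℂ) • ((φ.plus W).A * dPS (φ.minus W).A)
    + φ.om1 * φ.lam3.map W.dMinus + φ.om3 * φ.lam1.map W.dPlus
    + (φ.plus W).N * proj 0 (φ.minus W).A + (φ.minus W).N * proj 0 (φ.plus W).A
    - (φ.minus W).N * (φ.plus W).N - φ.ast1 * φ.ast3) := rfl
  rw [c3, c1, c2, mul_add φ.om1, str_add (φ.om1 * _), str_om1_comm h1 h2]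
  simp only [str_add, str_sub, str_smul, mul_add, mul_sub, add_mul, mul_smul_comm, b1, b2, b3, b4]
  module

/-- The variation of the undeformed Lagrangian. -/
theorem L0_sub (hε : W.parity ε = -ε) {ψ : Fields B} (k1 : (ψ.plus W).Ok W)
    (k2 : (ψ.minus W).Ok W) (l1 : ψ.lam1 = φ.lam1) (l3 : ψ.lam3 = φ.lam3)
    (iA : Inf ε ((ψ.plus W).A - (φ.plus W).A)) (iJ : Inf ε ((ψ.minus W).J - (φ.minus W).J))
    (io : Inf ε (ψ.om1 - φ.om1))
    (iM : Inf ε (proj 0 (ψ.minus W).A - (ψ.minus W).N - (proj 0 (φ.minus W).A - (φ.minus W).N)))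
    (iF : Inf ε ((ψ.plus W).F - (φ.plus W).F)) (ia : Inf ε (ψ.ast3 - φ.ast3)) :
    ψ.L0 W - φ.L0 W = (1 / 4 : ℂ) • (str (((ψ.plus W).A - (φ.plus W).A) * (φ.minus W).J) +
        str ((φ.plus W).A * ((ψ.minus W).J - (φ.minus W).J))) +
      (str ((ψ.om1 - φ.om1) * (φ.lam3.map W.dMinus +
          comm (proj 0 (φ.minus W).A - (φ.minus W).N) φ.lam3)) +
        str ((φ.plus W).N * (proj 0 (ψ.minus W).A - (ψ.minus W).N -
          (proj 0 (φ.minus W).A - (φ.minus W).N)))) -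
      (str (((ψ.plus W).F - (φ.plus W).F) * φ.ast3) + str ((φ.plus W).F * (ψ.ast3 - φ.ast3))) +
      str ((ψ.om3 - φ.om3) * φ.lam1.map W.dPlus) := by
  have hT : φ.lam3.map W.dMinus + comm (proj 0 (ψ.minus W).A - (ψ.minus W).N) φ.lam3 -
      (φ.lam3.map W.dMinus + comm (proj 0 (φ.minus W).A - (φ.minus W).N) φ.lam3) =
      comm (proj 0 (ψ.minus W).A - (ψ.minus W).N - (proj 0 (φ.minus W).A - (φ.minus W).N))
        φ.lam3 := by
    rw [sub_comm' _ (proj 0 (φ.minus W).A - (φ.minus W).N), add_sub_add_left_eq_sub]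
  have e1 := str_sub_mul hε iA iJ
  have e2 := str_sub_mul hε io (hT ▸ iM.comm_left hε φ.lam3)
  have e3 := str_sub_mul hε iF ia
  rw [hT, str_om1_comm h1 h2] at e2
  rw [L0_eq k1 k2, L0_eq h1 h2, l1, l3, sub_mul ψ.om3, str_sub (ψ.om3 * _), ← e1, ← e2, ← e3, smul_sub]
  abel

omit h1 h2 in
theorem P_proj (s : Sector B) (X : SMat B) : s.P (proj s.k X) = s.P X := by
  rw [Sector.P, Sector.P, proj_proj, if_pos rfl]

omit h1 h2 in
theorem P_a {s : Sector B} (hs : s.Ok W) : s.P s.a = s.a := by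
  have t : proj s.k s.a = s.a :=
    (proj_eq_self_iff _ _).2 ⟨hs.a_gr, hs.isOff_a.tracelessPart_eq⟩
  rw [Sector.P, t]
  exact hs.pair.ghostProj_eq ⟨0, proj_zero _, by rw [comm_zero, add_zero], hs.a_constraint⟩

/-- The `Q₁` variation of the undeformed Lagrangian. -/
theorem L0_v1 (hε : W.IsOddConstant ε) {ψ : Fields B} {Y : SMat B} (iY : Inf ε Y)
    (sY : IsSl W Y) (kp : ψ.plus W = (φ.plus W).v1 Y) (km : ψ.minus W = (φ.minus W).v1 Y) :
    ψ.L0 W - φ.L0 W = -(1 / 4 : ℂ) • (str (Y.map W.dPlus * (φ.minus W).j) +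
      str ((φ.plus W).j * Y.map W.dMinus)) := by
  obtain ⟨e0, e1, e2⟩ := hε
  have q1 : (ψ.plus W).Ok W := kp ▸ h1.v1_ok e0 iY sY
  have q2 : (ψ.minus W).Ok W := km ▸ h2.v1_ok e0 iY sY
  set p := φ.plus W with hp
  set m := φ.minus W with hm
  have sp : IsSl W (Y.map W.dPlus) := sY.map _ W.parity_dPlus
  have sm : IsSl W (Y.map W.dMinus) := sY.map _ W.parity_dMinus
  set Zp := p.ad (Y.map W.dPlus)
  set Zm := m.ad (Y.map W.dMinus)
  have sZp : IsSl W Zp := h1.isSl_ad sp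
  have sZm : IsSl W Zm := h2.isSl_ad sm
  have iZp : Inf ε Zp := h1.inf_ad e0 (iY.map_of_const W.dPlus_mul e1)
  have iZm : Inf ε Zm := h2.inf_ad e0 (iY.map_of_const W.dMinus_mul e2)
  have cp : p.cov (p.ad Y) = Zp := h1.cov_ad Y
  have cm : m.cov (m.ad Y) = Zm := h2.cov_ad Y
  have l1 : ψ.lam1 = φ.lam1 := congrArg Sector.l kp
  have l3 : ψ.lam3 = φ.lam3 := congrArg Sector.l km
  have o1 : ψ.om1 - φ.om1 = 0 := by
    have : ψ.om1 = φ.om1 + 0 := congrArg Sector.o kp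
    rw [this]; abel
  have o3 : ψ.om3 - φ.om3 = 0 := by
    have : ψ.om3 = φ.om3 + 0 := congrArg Sector.o km
    rw [this]; abel
  have a1 : (ψ.plus W).a = p.a + p.P Zp := congrArg Sector.a kp
  have a3 : ψ.ast3 - φ.ast3 = m.P Zm := by
    have : ψ.ast3 = φ.ast3 + m.P Zm := congrArg Sector.a km
    rw [this]; abel
  have dA : ∀ {s : Sector B} (_ : s.Ok W) (_ : s.D ε = 0), (s.v1 Y).A = s.A - s.cov (s.ad Y) :=
    fun hs h => hs.vary_A e0 h (hs.inf_ad e0 iY)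
  have dAp : (ψ.plus W).A - p.A = -Zp := by
    rw [kp, dA h1 e1, cp]; abel
  have dM : proj 0 (ψ.minus W).A - (ψ.minus W).N - (proj 0 m.A - m.N) = -proj 0 Zm := by
    have hN : (m.v1 Y).N = m.N - acomm 0 m.m := Sector.Ok.vary_N h2
    have h0 : acomm 0 m.m = 0 := by rw [acomm, zero_mul, mul_zero, add_zero]
    rw [km, dA h2 e2, cm, hN, h0, proj_sub]; abel
  have dJ : (ψ.minus W).J - m.J = -m.O Zm := by
    have h0 : acomm 0 m.m = 0 := by rw [acomm, zero_mul, mul_zero, add_zero]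
    rw [km, Sector.v1, h2.vary_J e0 e2 (h2.inf_ad e0 iY), cm, h0, Sector.O, smul_zero]
    change m.J + (-m.d Zm - 0 + (4 : ℂ) • m.P Zm) - m.J = _
    abel
  have dF : (ψ.plus W).F - p.F = p.P Zp - proj 1 Zp := by
    have k : (ψ.plus W).k = 1 := rfl
    have k' : p.k = 1 := rfl
    rw [Sector.F, Sector.F, a1, kp, dA h1 e1, cp]
    change proj 1 (p.A - Zp) + (p.a + p.P Zp) - (proj 1 p.A + p.a) = _
    rw [proj_sub]; abel
  have iPp : Inf ε (p.P Zp) := h1.pair.inf_ghostProj iZp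
  have iPm : Inf ε (m.P Zm) := h2.pair.inf_ghostProj iZm
  have key := L0_sub h1 h2 e0 q1 q2 l1 l3 (by rw [dAp]; exact iZp.neg)
    (by rw [dJ]; exact (h2.inf_O e0 iZm).neg) (by rw [o1]; exact ⟨0, (smul_zero _).symm⟩)
    (by rw [dM]; exact (iZm.proj 0).neg) (by rw [dF]; exact iPp.sub (iZp.proj 1))
    (by rw [a3]; exact iPm)
  rw [← hp, ← hm, dAp, dM, dJ, dF, o1, o3, a3] at key
  have sa3 : IsSl W φ.ast3 := h2.isSl_a
  have sa1 : IsSl W p.a := h1.isSl_a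
  have f1 : str (p.P Zp * φ.ast3) = str (proj 1 Zp * φ.ast3) := by
    have := str_P_mul h1 h2 (IsSl.proj sZp.even 1).even sa3.even
    have e : m.P φ.ast3 = φ.ast3 := P_a h2
    rw [e] at this
    rw [← this]
    exact congrArg (fun t => str (t * φ.ast3)) (P_proj p Zp).symm
  have f2 : str (p.F * m.P Zm) = str (p.P p.A * Zm) + str (p.a * Zm) := by
    have hF : p.P p.F = p.P p.A + p.a := by
      rw [Sector.F, h1.P_add, P_proj, P_a h1]
    have := str_P_mul h1 h2 (h1.isSl_A.even.proj 1 |>.add sa1.even) sZm.even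
    rw [← str_add, ← add_mul, ← hF]
    exact this.symm
  have f3 : str (p.N * proj 0 Zm) = str (p.N * Zm) := str_N_mul h1 sZm
  have f4 : str (p.A * m.O Zm) = str (p.J * Zm) - (4 : ℂ) • str (p.N * Zm) -
      (4 : ℂ) • str (p.a * Zm) - (4 : ℂ) • str (p.P p.A * Zm) := by
    have hJ : p.J = p.d p.A + (4 : ℂ) • p.N + (4 : ℂ) • p.a := rfl
    rw [← str_O_mul h1 h2 h1.isSl_A.even sZm.even, hJ, Sector.O]
    simp only [sub_mul, add_mul, smul_mul_assoc, str_sub, str_add, str_smul]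
    abel
  have f5 : str (Zp * m.J) = str (Y.map W.dPlus * m.j) :=
    (str_mul_adInv h1 h2 sp.even h2.isSl_J.even).symm
  have f6 : str (p.J * Zm) = str (p.j * Y.map W.dMinus) :=
    (str_adInv_mul h1 h2 h1.isSl_J.even sm.even).symm
  rw [key]
  simp only [neg_mul, mul_neg, sub_mul, zero_mul, str_neg, str_sub, str_zero, f1, f2, f3, f4, f5,
    f6]
  module

/-- The first correction: its variation cancels that of the undeformed Lagrangian. -/
theorem invariance_one {R : psl →ₗ[ℂ] psl} (hR : IsEvenOperator R) (hanti : IsAntisymmetric R)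
    (hε : W.IsOddConstant ε) :
    ((φ + φ.Q W R ε 0).Ldef W R 1 - φ.Ldef W R 1) +
      ((φ + φ.Q W R ε 1).Ldef W R 0 - φ.Ldef W R 0) = 0 := by
  obtain ⟨e0, e1, e2⟩ := hε
  set Λ := (φ.minus W).lam ε
  set Y := extend R Λ with hYdef
  have hY : φ.RLam R ε = Y := RLam_eq R
  have sΛ : IsSl W Λ := h2.isSl_lam e0
  have sY : IsSl W Y := IsSl.extend hR sΛ.even
  have iY : Inf ε Y := ((((Inf.bsmul _).sub (Inf.bsmul _)).mul_left e0 _).mul_right _).extend R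
  have j0 := h1.inf_v0_j e0 e1
  have i0 := (h2.inf_v0_j e0 e2).extend R
  have q0 := h1.v0_ok e0 e1
  rw [extend_sub] at i0
  have b := L0_v1 h1 h2 ⟨e0, e1, e2⟩ iY sY (by rw [Q1_plus h1 R, hY]) (by rw [Q1_minus h1 R, hY])
  have c1 := Ldef_succ (φ := φ) (W := W) R 0
  have c2 := Ldef_succ (φ := φ + φ.Q W R ε 0) (W := W) R 0
  rw [Q0_plus, Q0_minus] at c2
  have a0 : str ((((φ.plus W).v0 ε).j - (φ.plus W).j) * extend R (φ.minus W).j) =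
      str (Y.map W.dPlus * (φ.minus W).j) := by
    have := h1.v0_j e0 e1
    rw [str_mul_congr (q0.isSl_j.sub h1.isSl_j)
      ((h1.isSl_lam e0).map (φ.plus W).D h1.parity_D) this (IsSl.extend hR h2.isSl_j.even)]
    have e : ((φ.plus W).lam ε).map (φ.plus W).D = -(Λ.map W.dPlus) := by
      rw [lam_plus]; ext i j; exact map_neg W.dPlus _
    rw [e, neg_mul, str_neg, ← str_extend_mul hanti, extend_map]
  have a1 : extend R ((φ.minus W).v0 ε).j - extend R (φ.minus W).j = Y.map W.dMinus := by
    rw [← extend_sub, extend_congr R (h2.v0_j e0 e2), extend_map]; rfl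
  change (φ + φ.Q W R ε 0).Ldef W R (0 + 1) - φ.Ldef W R (0 + 1) +
    ((φ + φ.Q W R ε 1).L0 W - φ.L0 W) = 0
  rw [b, c1, c2, ← smul_sub]
  have d := str_sub_mul e0 j0 i0
  rw [a0, a1] at d
  change (1 / 4 : ℂ) • (str (((φ.plus W).v0 ε).j * extend R ((φ.minus W).v0 ε).j) -
    str ((φ.plus W).j * extend R (φ.minus W).j)) + _ = 0
  rw [d]
  module

end Fields
end Invariance

/-! ### Total derivatives: the undeformed Lagrangian under `Q₀` -/

section Invariance

variable {B : Type*} [Ring B] [Algebra ℂ B] {W : Worldsheet B} {ε : B}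

namespace Fields

variable {φ : Fields B} (h1 : (φ.plus W).Ok W) (h2 : (φ.minus W).Ok W)
include h1 h2

/-- The remaining part of the variation of the kinetic term: it is cancelled by that of
`ω₃₋ ∂₊λ₁`. -/
theorem kinetic_remainder (hε : W.IsOddConstant ε) :
    str ((φ.minus W).A * ((ε • φ.lam3 - ε • φ.lam1).map W.dPlus)) -
      str ((ε • φ.lam1 + ε • φ.lam3).map W.dPlus * (φ.minus W).J) =
    -(4 : ℂ) • str ((ε • φ.lam1).map W.dPlus * (φ.minus W).F) := by
  obtain ⟨e0, e1, e2⟩ := hε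
  have sA := h2.isSl_A
  set m := φ.minus W with hm
  have g1 : Gr 1 ((ε • φ.lam1).map W.dPlus) := (h1.l_gr.bsmul ε).map _
  have g3 : Gr 3 ((ε • φ.lam3).map W.dPlus) := (h1.m_gr.bsmul ε).map _
  have s1 : IsSl W ((ε • φ.lam1).map W.dPlus) := (h1.isSl_l e0).map _ W.parity_dPlus
  have s3 : IsSl W ((ε • φ.lam3).map W.dPlus) := (h1.isSl_m e0).map _ W.parity_dPlus
  have ea : (ε • φ.lam1 + ε • φ.lam3).map W.dPlus =
      (ε • φ.lam1).map W.dPlus + (ε • φ.lam3).map W.dPlus := by ext; simp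
  have es : (ε • φ.lam3 - ε • φ.lam1).map W.dPlus =
      (ε • φ.lam3).map W.dPlus - (ε • φ.lam1).map W.dPlus := by ext; simp
  rw [ea, es]
  set x1 := (ε • φ.lam1).map W.dPlus
  set x3 := (ε • φ.lam3).map W.dPlus
  have t1 : proj 1 x1 = x1 :=
    (proj_eq_self_iff _ _).2 ⟨g1, (g1.isOff (by decide)).tracelessPart_eq⟩
  have t3 : proj 3 x3 = x3 :=
    (proj_eq_self_iff _ _).2 ⟨g3, (g3.isOff (by decide)).tracelessPart_eq⟩
  have r1 : str (m.A * x1) = str (x1 * proj 3 m.A) := by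
    have := str_proj_mul s1.even sA.even (i := 1) (j := 3) rfl
    rw [t1] at this
    rw [str_mul_comm sA.even s1.even, this]
  have r3 : str (m.A * x3) = str (x3 * proj 1 m.A) := by
    have := str_proj_mul s3.even sA.even (i := 3) (j := 1) rfl
    rw [t3] at this
    rw [str_mul_comm sA.even s3.even, this]
  have z : ∀ {i j : ℕ} {x y : SMat B}, Gr i x → Gr j y → IsSl W x → IsSl W y →
      (i + j) % 4 ≠ 0 → str (x * y) = 0 := fun hx hy sx sy h =>
    str_mul_eq_zero hx hy sx.even sy.even h
  have pA : ∀ k, IsSl W (proj k m.A) := fun k => IsSl.proj sA.even k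
  have z1 : str (x1 * proj 2 m.A) = 0 := z g1 (proj_gr 2 _) s1 (pA 2) (by decide)
  have z2 : str (x1 * proj 1 m.A) = 0 := z g1 (proj_gr 1 _) s1 (pA 1) (by decide)
  have z3 : str (x1 * m.N) = 0 := z g1 h2.N_gr s1 h2.isSl_N (by decide)
  have z4 : str (x3 * proj 2 m.A) = 0 := z g3 (proj_gr 2 _) s3 (pA 2) (by decide)
  have z5 : str (x3 * proj 3 m.A) = 0 := z g3 (proj_gr 3 _) s3 (pA 3) (by decide)
  have z6 : str (x3 * m.N) = 0 := z g3 h2.N_gr s3 h2.isSl_N (by decide)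
  have z7 : str (x3 * m.a) = 0 := z g3 (show Gr 3 m.a from h2.a_gr) s3 h2.isSl_a (by decide)
  have hJ : m.J = (3 : ℂ) • proj 3 m.A + (2 : ℂ) • proj 2 m.A + proj 1 m.A + (4 : ℂ) • m.N +
    (4 : ℂ) • m.a := rfl
  have hF : m.F = proj 3 m.A + m.a := rfl
  rw [hJ, hF]
  simp only [mul_sub, mul_add, add_mul, mul_smul_comm, str_add, str_sub, str_smul, r1, r3, z1, z2,
    z3, z4, z5, z6, z7]
  module

/-- The undeformed Lagrangian is invariant under `Q₀` up to a total derivative. -/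
theorem invariance_zero (hε : W.IsOddConstant ε) (R : psl →ₗ[ℂ] psl) :
    (φ + φ.Q W R ε 0).L0 W - φ.L0 W =
      W.dPlus (-(1 / 4 : ℂ) • str ((φ.minus W).A * (ε • φ.lam3 - ε • φ.lam1))) +
        W.dMinus ((1 / 4 : ℂ) • str ((φ.plus W).A * (ε • φ.lam3 - ε • φ.lam1))) := by
  have rem := kinetic_remainder h1 h2 hε
  obtain ⟨e0, e1, e2⟩ := hε
  set ψ := φ + φ.Q W R ε 0
  have kp : ψ.plus W = (φ.plus W).v0 ε := Q0_plus R
  have km : ψ.minus W = (φ.minus W).v0 ε := Q0_minus R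
  have q1 : (ψ.plus W).Ok W := kp ▸ h1.v0_ok e0 e1
  have q2 : (ψ.minus W).Ok W := km ▸ h2.v0_ok e0 e2
  have flat := comm_A_A h1 h2
  set p := φ.plus W with hp
  set m := φ.minus W with hm
  have s1 : IsSl W (ε • φ.lam1) := h1.isSl_l e0
  have s3 : IsSl W (ε • φ.lam3) := h1.isSl_m e0
  have sAp := h1.isSl_A
  have sAm := h2.isSl_A
  have l1 : ψ.lam1 = φ.lam1 := congrArg Sector.l kp
  have l3 : ψ.lam3 = φ.lam3 := congrArg Sector.l km
  have sX : IsSl W (ε • φ.lam1 + ε • φ.lam3) := s1.add s3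
  have sL : IsSl W (ε • φ.lam3 - ε • φ.lam1) := s3.sub s1
  have iX : Inf ε (ε • φ.lam1 + ε • φ.lam3) := (Inf.bsmul _).add (Inf.bsmul _)
  have hX : ε • φ.lam3 + ε • φ.lam1 = ε • φ.lam1 + ε • φ.lam3 := add_comm _ _
  have iX' : Inf ε (ε • φ.lam3 + ε • φ.lam1) := hX ▸ iX
  have o1 : ψ.om1 - φ.om1 = -(ε • p.F) := by
    have : ψ.om1 = φ.om1 + -(ε • p.F) := congrArg Sector.o kp
    rw [this]; abel
  have o3 : ψ.om3 - φ.om3 = -(ε • m.F) := by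
    have : ψ.om3 = φ.om3 + -(ε • m.F) := congrArg Sector.o km
    rw [this]; abel
  have a1 : (ψ.plus W).a = p.a + p.Dl (ε • φ.lam1) := congrArg Sector.a kp
  have a3 : ψ.ast3 - φ.ast3 = m.Dl (ε • φ.lam3) := by
    have : ψ.ast3 = φ.ast3 + m.Dl (ε • φ.lam3) := congrArg Sector.a km
    rw [this]; abel
  have dAp : (ψ.plus W).A - p.A = -p.cov (ε • φ.lam1 + ε • φ.lam3) := by
    have : (ψ.plus W).A = p.A - p.cov (ε • φ.lam1 + ε • φ.lam3) := by
      rw [kp]; exact h1.vary_A e0 e1 iX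
    rw [this, sub_sub_cancel_left]
  have dAm : (ψ.minus W).A = m.A - m.cov (ε • φ.lam3 + ε • φ.lam1) := by
    rw [km]; exact h2.vary_A e0 e2 iX'
  have dM : proj 0 (ψ.minus W).A - (ψ.minus W).N - (proj 0 m.A - m.N) =
      -proj 0 (m.cov (ε • φ.lam3 + ε • φ.lam1)) + acomm (-(ε • m.F)) φ.lam1 := by
    have hN : (m.v0 ε).N = m.N - acomm (-(ε • m.F)) m.m := Sector.Ok.vary_N h2
    have hm : m.m = φ.lam1 := rfl
    rw [dAm, km, hN, hm, proj_sub]; abel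
  have dJ : (ψ.minus W).J - m.J = -m.d (m.cov (ε • φ.lam3 + ε • φ.lam1)) -
      (4 : ℂ) • acomm (-(ε • m.F)) φ.lam1 + (4 : ℂ) • m.Dl (ε • φ.lam3) := by
    rw [km]; exact sub_eq_iff_eq_add'.2 (h2.vary_J e0 e2 iX')
  have dF : (ψ.plus W).F - p.F =
      -proj 1 (p.cov (ε • φ.lam1 + ε • φ.lam3)) + p.Dl (ε • φ.lam1) := by
    have h : (ψ.plus W).A = p.A - p.cov (ε • φ.lam1 + ε • φ.lam3) := by
      rw [sub_eq_iff_eq_add'.1 dAp]; abel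
    rw [Sector.F, Sector.F, a1, h]
    change proj 1 (p.A - _) + (p.a + _) - (proj 1 p.A + p.a) = _
    rw [proj_sub]; abel
  have icp := h1.inf_cov e0 e1 iX
  have icm := h2.inf_cov e0 e2 iX'
  have ioF : Inf ε (-(ε • m.F)) := (Inf.bsmul _).neg
  have iDp : Inf ε (p.Dl (ε • φ.lam1)) := h1.inf_Dl e0 e1
  have iDm : Inf ε (m.Dl (ε • φ.lam3)) := h2.inf_Dl e0 e2
  have key := L0_sub h1 h2 e0 q1 q2 l1 l3 (by rw [dAp]; exact icp.neg)
    (by rw [dJ]; exact ((h2.inf_d e0 icm).neg.sub ((ioF.acomm_left e0 _).smul _)).add (iDm.smul _))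
    (by rw [o1]; exact (Inf.bsmul _).neg)
    (by rw [dM]; exact (icm.proj 0).neg.add (ioF.acomm_left e0 _))
    (by rw [dF]; exact (icp.proj 1).neg.add iDp) (by rw [a3]; exact iDm)
  rw [← hp, ← hm] at key
  have sa3 : IsSl W φ.ast3 := h2.isSl_a
  have sN : IsSl W p.N := h1.isSl_N
  have eFm : acomm (-(ε • m.F)) φ.lam1 = comm m.F (ε • φ.lam1) := h2.acomm_F e0
  have sFm : IsSl W m.F := (IsSl.proj sAm.even _).add h2.isSl_a
  have sDm : IsSl W (m.Dl (ε • φ.lam3)) :=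
    ((s3.map m.D h2.parity_D).add ((IsSl.proj sAm.even _).comm s3)).sub (h2.isSl_N.comm s3)
  have scm : IsSl W (m.cov (ε • φ.lam3 + ε • φ.lam1)) := h2.isSl_cov (hX ▸ sX)
  -- the kinetic term
  have k1 : str (((ψ.plus W).A - p.A) * m.J) + str (p.A * ((ψ.minus W).J - m.J)) =
      W.dMinus (str (p.A * (ε • φ.lam3 - ε • φ.lam1))) -
        W.dPlus (str (m.A * (ε • φ.lam3 - ε • φ.lam1))) -
        (4 : ℂ) • str ((ε • φ.lam1).map W.dPlus * m.F) := by
    have vc := h2.vary_current e0 e2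
    have hJ : str (p.A * ((ψ.minus W).J - m.J)) =
        str (p.A * (m.cov (ε • φ.lam3 - ε • φ.lam1))) +
          str (p.A * comm (ε • φ.lam1 + ε • φ.lam3) m.J) := by
      rw [← str_add, ← mul_add]
      refine str_mul_congr_right ?_ ((h2.isSl_cov sL).add (sX.comm h2.isSl_J)) ?_ sAp
      · rw [dJ, eFm]
        exact ((h2.isSl_d scm.even).neg.sub ((sFm.comm s1).smul _)).add (sDm.smul _)
      · have vc' : tracelessPart ((-m.d (m.cov (ε • φ.lam3 + ε • φ.lam1)) -
            (4 : ℂ) • acomm (-(ε • m.F)) φ.lam1 + (4 : ℂ) • m.Dl (ε • φ.lam3)) -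
            comm (ε • φ.lam3 + ε • φ.lam1) m.J) =
            tracelessPart (m.cov (ε • φ.lam3 - ε • φ.lam1)) := vc
        rw [tracelessPart_sub, hX, sub_eq_iff_eq_add] at vc'
        rw [dJ, hX, vc', tracelessPart_add]
    have c1 : str (p.cov (ε • φ.lam1 + ε • φ.lam3) * m.J) =
        str ((ε • φ.lam1 + ε • φ.lam3).map W.dPlus * m.J) +
          str (p.A * comm (ε • φ.lam1 + ε • φ.lam3) m.J) := by
      rw [← str_comm_mul sAp.even sX.even h2.isSl_J.even, ← str_add, ← add_mul]; rfl
    have c2 : str (p.A * (m.cov (ε • φ.lam3 - ε • φ.lam1))) =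
        str (p.A * (ε • φ.lam3 - ε • φ.lam1).map W.dMinus) +
          str (p.A.map W.dMinus * (ε • φ.lam3 - ε • φ.lam1)) -
          str (m.A.map W.dPlus * (ε • φ.lam3 - ε • φ.lam1)) := by
      have : str (p.A * comm m.A (ε • φ.lam3 - ε • φ.lam1)) =
          str (p.A.map W.dMinus * (ε • φ.lam3 - ε • φ.lam1)) -
          str (m.A.map W.dPlus * (ε • φ.lam3 - ε • φ.lam1)) := by
        rw [← str_comm_mul sAp.even sAm.even sL.even, flat, sub_mul, str_sub]
      rw [add_sub_assoc, ← this, ← str_add, ← mul_add]; rfl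
    have d1 := str_map_of_leibniz W.dMinus_mul p.A (ε • φ.lam3 - ε • φ.lam1)
    have d2 := str_map_of_leibniz W.dPlus_mul m.A (ε • φ.lam3 - ε • φ.lam1)
    rw [hJ, c2, dAp, neg_mul, str_neg, c1, d1, d2]
    have rem' := sub_eq_iff_eq_add.1 rem
    rw [rem']
    module
  -- the kinetic terms of the ghosts
  have mulF : ∀ {s : Sector B} (_ : s.Ok W) (T : SMat B), -(ε • s.F) * T = s.F * (ε • T) :=
    fun hs T => by
      rw [mul_bsmul e0, OddEntries.map_parity (hs.odd_F e0), neg_mul, neg_mul, Matrix.smul_mul,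
        smul_neg]
  have k2 : str ((ψ.om1 - φ.om1) * (φ.lam3.map W.dMinus + comm (proj 0 m.A - m.N) φ.lam3)) =
      str (p.F * (ψ.ast3 - φ.ast3)) := by
    have := h2.Dl_eq e0 e2
    rw [o1, mulF h1, a3, sub_comm', ← add_sub_assoc]
    exact congrArg (fun t => str (p.F * t)) this.symm
  have k3 : str ((ψ.om3 - φ.om3) * φ.lam1.map W.dPlus) =
      str ((ε • φ.lam1).map W.dPlus * m.F) := by
    have := bsmul_map_of_const W.dPlus_mul e1 φ.lam1
    rw [o3, mulF h2, ← this, str_mul_comm sFm.even (s1.map _ W.parity_dPlus).even]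
  -- the remaining terms cancel by the constraint on the antifield and Jacobi's identity
  have k4 : str (p.N * (proj 0 (ψ.minus W).A - (ψ.minus W).N - (proj 0 m.A - m.N))) =
      str (((ψ.plus W).F - p.F) * φ.ast3) := by
    have v1 := h1.proj_cov_k e0 e1
    have v2 := h2.proj_cov_zero e0 e2
    have sP1 : IsSl W (proj 1 m.A) := IsSl.proj sAm.even 1
    have sP2 : IsSl W (proj 2 p.A) := IsSl.proj sAp.even 2
    have t3 : tracelessPart φ.ast3 = φ.ast3 := h2.isOff_a.tracelessPart_eq
    have n3 : comm p.N (ε • φ.lam3) = 0 := h1.comm_N_m e0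
    have c3 : tracelessPart (comm φ.ast3 (ε • φ.lam3)) = 0 := h2.comm_a_l e0
    have x1 : str (p.N * (proj 0 (ψ.minus W).A - (ψ.minus W).N - (proj 0 m.A - m.N))) =
        str (p.N * comm φ.ast3 (ε • φ.lam1)) := by
      have sM : IsSl W (proj 0 (ψ.minus W).A - (ψ.minus W).N - (proj 0 m.A - m.N)) :=
        ((IsSl.proj q2.isSl_A.even 0).sub q2.isSl_N).sub
          ((IsSl.proj sAm.even 0).sub h2.isSl_N)
      have : str (p.N * comm (proj 1 m.A) (ε • φ.lam3)) = 0 := by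
        rw [comm_swap, mul_neg, str_neg, ← str_comm_mul sN.even s3.even sP1.even, n3, zero_mul,
          str_zero, neg_zero]
      have e : str (p.N * (-comm (proj 1 m.A) (ε • φ.lam3) + comm φ.ast3 (ε • φ.lam1))) =
          str (p.N * comm φ.ast3 (ε • φ.lam1)) := by
        rw [mul_add, str_add, mul_neg, str_neg, this, neg_zero, zero_add]
      rw [← e]
      refine str_mul_congr_right sM ((sP1.comm s3).neg.add (sa3.comm s1)) ?_ sN
      rw [dM, tracelessPart_add _ (comm φ.ast3 _), tracelessPart_neg]
      exact v2
    have x2 : str (((ψ.plus W).F - p.F) * φ.ast3) =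
        -str (comm p.N (ε • φ.lam1) * φ.ast3) := by
      have c3' : str (comm (proj 2 p.A) (ε • φ.lam3) * φ.ast3) = 0 := by
        rw [str_comm_mul sP2.even s3.even sa3.even, comm_swap, mul_neg, str_neg,
          str_mul_congr_right (sa3.comm s3) ⟨Worldsheet.IsEvenSuper.zero, str_zero⟩
            (c3.trans tracelessPart_zero.symm) sP2, mul_zero, str_zero, neg_zero]
      rw [← str_mul_tracelessPart _ t3, dF]
      have v1' : tracelessPart (-proj 1 (p.cov (ε • φ.lam1 + ε • φ.lam3)) + p.Dl (ε • φ.lam1)) =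
        -tracelessPart (comm (proj 2 p.A) (ε • φ.lam3)) -
          tracelessPart (comm p.N (ε • φ.lam1)) := v1
      rw [v1', sub_mul, neg_mul, str_sub, str_neg, str_mul_tracelessPart _ t3,
        str_mul_tracelessPart _ t3, c3']
      abel
    rw [x1, x2, comm_swap, mul_neg, str_neg, str_comm_mul sN.even s1.even sa3.even]
  rw [key, k1, k2, k3, k4, map_smul, map_smul]
  module

/-- The deformed action is invariant under the BRST transformations to all orders. -/
theorem invariance {R : psl →ₗ[ℂ] psl} (hR : IsEvenOperator R) (hanti : IsAntisymmetric R)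
    (hYB : SolvesCYBE R) (hε : W.IsOddConstant ε) (n : ℕ) : ∃ b c : B,
      ∑ km ∈ Finset.HasAntidiagonal.antidiagonal n,
        ((φ + φ.Q W R ε km.1).Ldef W R km.2 - φ.Ldef W R km.2) = W.dPlus b + W.dMinus c := by
  have h0 : ∀ k m, (φ + φ.Q W R ε (k + 2)).Ldef W R m - φ.Ldef W R m = 0 := by
    intro k m
    have : φ + φ.Q W R ε (k + 2) = φ := by
      ext : 1 <;> exact add_zero _
    rw [this, sub_self]
  match n with
  | 0 =>
    refine ⟨_, _, (Finset.sum_singleton _ _).trans (invariance_zero h1 h2 hε R)⟩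
  | 1 =>
    refine ⟨0, 0, ?_⟩
    rw [Finset.Nat.sum_antidiagonal_succ, map_zero, map_zero, add_zero]
    exact (congrArg _ (Finset.sum_singleton _ _)).trans (invariance_one h1 h2 hR hanti hε)
  | n + 2 =>
    refine ⟨0, 0, ?_⟩
    rw [Finset.Nat.sum_antidiagonal_succ, Finset.Nat.sum_antidiagonal_succ,
      Finset.sum_eq_zero (fun _ _ => h0 _ _), map_zero, map_zero, add_zero, add_zero]
    exact invariance_add_two hR hanti hYB h1 h2 hε n

end Fields
end Invariance

/-! ### Nilpotency: second variations of one chirality -/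

section Nilpotency

variable {B : Type*} [Ring B] [Algebra ℂ B] {W : Worldsheet B} {ε ε' : B}

theorem comm_jacobi (X Y Z : SMat B) :
    comm (comm X Y) Z = comm X (comm Y Z) + comm (comm X Z) Y := by
  simp only [comm]; noncomm_ring

theorem isSl_zero : IsSl W (0 : SMat B) := ⟨Worldsheet.IsEvenSuper.zero, str_zero⟩

namespace Sector

variable {s : Sector B}

/-- The matrix `S₂` in the ghost projection of `Ad (∂Y)`. -/
def S (s : Sector B) (Y : SMat B) : SMat B :=
  ghostShift s.m s.l (proj s.k (s.ad (Y.map s.D)))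

namespace Ok

variable (hs : s.Ok W)
include hs

theorem cov_gen (X Y : SMat B) (η : ℂ) :
    s.cov (X + η • s.ad Y) = s.cov X + η • s.ad (Y.map s.D) := by
  have : (X + η • s.ad Y).map s.D = X.map s.D + η • (s.ad Y).map s.D := by ext; simp
  rw [← hs.cov_ad, cov, cov, cov, this, comm_add, comm_smul, smul_add]; abel

section Ghosts

variable (hε : W.parity ε = -ε) (hε' : W.parity ε' = -ε')
include hε

/-- The bracket of two copies of a pure spinor is central. -/
theorem comm_l_l (hε' : W.parity ε' = -ε') : tracelessPart (comm (ε • s.l) (ε' • s.l)) = 0 := by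
  rw [comm_bsmul_bsmul hε hε' hs.l_even hs.l_even, tracelessPart_bsmul, hs.l_pure, smul_zero]
theorem comm_m_m (hε' : W.parity ε' = -ε') : tracelessPart (comm (ε • s.m) (ε' • s.m)) = 0 := by
  rw [comm_bsmul_bsmul hε hε' hs.m_even hs.m_even, tracelessPart_bsmul, hs.m_pure, smul_zero]

theorem isOff_comm_l {x : SMat B} {i : ℕ} (gx : Gr i x) (hi : Even i) (hx : W.IsEvenSuper x) :
    IsOff (comm x (ε • s.l)) :=
  (gx.comm (hs.l_gr.bsmul ε) hx (hs.isSl_l hε).even).isOff (hi.add_odd hs.odd_k)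
theorem isOff_comm_m {x : SMat B} {i : ℕ} (gx : Gr i x) (hi : Even i) (hx : W.IsEvenSuper x) :
    IsOff (comm x (ε • s.m)) :=
  (gx.comm (hs.m_gr.bsmul ε) hx (hs.isSl_m hε).even).isOff (hi.add_odd hs.odd_k')

variable (hD : s.D ε = 0)
include hD

/-- The variation of `A_k + a`. -/
theorem vary_F {Y : SMat B} (hY : Inf ε Y) (η : ℂ) {p : SMat B} :
    (s.vary (ε • s.l + ε • s.m + η • s.ad Y) p (s.Ba Y η ε)).F =
      s.F - comm (proj 2 s.A) (ε • s.m) - comm s.N (ε • s.l) + η • comm s.m (s.S Y) := by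
  have hX : Inf ε (ε • s.l + ε • s.m + η • s.ad Y) :=
    ((Inf.bsmul _).add (Inf.bsmul _)).add ((hs.inf_ad hε hY).smul η)
  have hc := hs.cov_gen (ε • s.l + ε • s.m) Y η
  have h1 := hs.proj_cov_k hε hD
  have h2 := hs.gr_Dl hε hD
  have o1 : IsOff (-proj s.k (s.cov (ε • s.l + ε • s.m)) + s.Dl (ε • s.l)) :=
    (((proj_gr _ _).neg).add h2).isOff hs.odd_k
  have o2 := hs.isOff_comm_m hε (proj_gr 2 s.A) (by decide) (hs.isSl_A.even.proj 2)
  have o3 := hs.isOff_comm_l hε hs.N_gr (by decide) hs.isSl_N.even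
  rw [o1.tracelessPart_eq, o2.tracelessPart_eq, o3.tracelessPart_eq] at h1
  rw [F, hs.vary_A hε hD hX, hc]
  change proj s.k (s.A - _) + (s.a + (s.Dl (ε • s.l) + η • s.P (s.ad (Y.map s.D)))) = _
  rw [hs.P_eq, proj_sub, proj_add, proj_smul, F, S]
  rw [neg_add_eq_sub, sub_eq_iff_eq_add] at h1
  rw [h1]
  module

/-- The variation of `A₀ - N`, up to the center. -/
theorem vary_A0_N {Y : SMat B} (hY : Inf ε Y) (η : ℂ) {b : SMat B} (Z : SMat B) :
    comm (proj 0 (s.vary (ε • s.l + ε • s.m + η • s.ad Y) (-(ε • s.F)) b).A -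
        (s.vary (ε • s.l + ε • s.m + η • s.ad Y) (-(ε • s.F)) b).N) Z =
      comm (proj 0 s.A - s.N) Z + comm (-comm (proj s.k' s.A) (ε • s.l) + comm s.a (ε • s.m)) Z -
        η • comm (proj 0 (s.ad (Y.map s.D))) Z := by
  have hX : Inf ε (ε • s.l + ε • s.m + η • s.ad Y) :=
    ((Inf.bsmul _).add (Inf.bsmul _)).add ((hs.inf_ad hε hY).smul η)
  have hc := hs.cov_gen (ε • s.l + ε • s.m) Y η
  have sF : IsSl W s.F := (IsSl.proj hs.isSl_A.even _).add hs.isSl_a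
  have sl := hs.isSl_l hε
  have sm := hs.isSl_m hε
  have h1 := hs.proj_cov_zero hε hD
  have h2 : comm (-proj 0 (s.cov (ε • s.l + ε • s.m)) + acomm (-(ε • s.F)) s.m) Z =
      comm (-comm (proj s.k' s.A) (ε • s.l) + comm s.a (ε • s.m)) Z := by
    refine IsSl.comm_congr (W := W) ?_ ?_ ?_ Z
    · rw [hs.acomm_F hε]
      exact (IsSl.proj (hs.isSl_cov (sl.add sm)).even 0).neg.add (sF.comm sm)
    · exact ((IsSl.proj hs.isSl_A.even _).comm sl).neg.add (hs.isSl_a.comm sm)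
    · rw [h1, tracelessPart_add, tracelessPart_neg]
  rw [hs.vary_A hε hD hX, hs.vary_N, hc, proj_sub, proj_add, proj_smul, ← h2]
  simp only [sub_comm', add_comm', neg_comm', smul_comm']
  abel

/-- The variation of the BRST variation of the antifield. -/
theorem vary_Ba {Y y : SMat B} (hY : Inf ε Y) (hy : Inf ε y) (Z : SMat B) (f : B) (η : ℂ) :
    (s.vary (ε • s.l + ε • s.m + η • s.ad Y) (-(ε • s.F)) (s.Ba Y η ε)).Ba (Z - y) η f =
      s.Ba Z η f +
        comm (-comm (proj s.k' s.A) (ε • s.l) + comm s.a (ε • s.m)) (f • s.l) -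
        η • comm (proj 0 (s.ad (Y.map s.D))) (f • s.l) +
        η • s.P (comm (ε • s.l + ε • s.m) (s.ad (Z.map s.D))) +
        η • s.P (η • comm (s.ad Y) (s.ad (Z.map s.D)) - s.ad (y.map s.D)) := by
  have hX : Inf ε (ε • s.l + ε • s.m + η • s.ad Y) :=
    ((Inf.bsmul _).add (Inf.bsmul _)).add ((hs.inf_ad hε hY).smul η)
  have h1 := hs.vary_A0_N hε hD hY η (b := s.Ba Y η ε) (f • s.l)
  set t := s.vary (ε • s.l + ε • s.m + η • s.ad Y) (-(ε • s.F)) (s.Ba Y η ε)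
  have h2 : t.Dl (f • t.l) = s.Dl (f • s.l) +
      comm (-comm (proj s.k' s.A) (ε • s.l) + comm s.a (ε • s.m)) (f • s.l) -
      η • comm (proj 0 (s.ad (Y.map s.D))) (f • s.l) := by
    change (f • s.l).map s.D + comm (proj 0 t.A) (f • s.l) - comm t.N (f • s.l) = _
    rw [add_sub_assoc, ← sub_comm', h1, Dl, sub_comm' (proj 0 s.A)]
    abel
  have hm : (Z - y).map s.D = Z.map s.D - y.map s.D := by ext; simp
  have iy := hy.map_of_const hs.leibniz hD
  have h3 : t.ad ((Z - y).map t.D) = s.ad (Z.map s.D) +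
      comm (ε • s.l + ε • s.m) (s.ad (Z.map s.D)) +
      (η • comm (s.ad Y) (s.ad (Z.map s.D)) - s.ad (y.map s.D)) := by
    change t.ad ((Z - y).map s.D) = _
    have h0 := hX.comm_eq_zero hε (hs.inf_ad hε iy)
    rw [hs.vary_ad hε hX, hm, sub_eq_add_neg (Z.map s.D), ad_add, ad_neg, comm_add,
      ← neg_one_smul ℂ (s.ad (y.map s.D)), comm_smul, h0, smul_zero, add_zero,
      add_comm' (ε • s.l + ε • s.m), smul_comm', neg_one_smul]
    abel
  have hP : t.P = s.P := rfl
  rw [Ba, h2, hP, h3, hs.P_add, hs.P_add, Ba]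
  module

omit hD

/-- The bracket of two ghosts that acts on the fields as a Lorentz transformation. -/
theorem lorentz (hε' : W.parity ε' = -ε') : ((2 : ℂ) • (ε * ε')) • acomm s.l s.m =
      (2 : ℂ) • comm (ε • s.m) (ε' • s.l) ∧
    comm (ε' • s.m) (ε • s.l) = -comm (ε • s.m) (ε' • s.l) := by
  have h : acomm s.m s.l = acomm s.l s.m := add_comm _ _
  rw [comm_bsmul_bsmul hε hε' hs.m_even hs.l_even, comm_bsmul_bsmul hε' hε hs.m_even hs.l_even,
    h, smul_assoc, W.odd_anticomm _ _ hε' hε, neg_smul]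
  exact ⟨rfl, rfl⟩

theorem a_jacobi (hε' : W.parity ε' = -ε') (b : SMat B) :
    comm (-comm b (ε' • s.l) + comm s.a (ε' • s.m)) (ε • s.l) -
      comm (-comm b (ε • s.l) + comm s.a (ε • s.m)) (ε' • s.l) =
    comm (((2 : ℂ) • (ε * ε')) • acomm s.l s.m) s.a := by
  have sl := hs.isSl_l hε
  have sl' := hs.isSl_l hε'
  obtain ⟨t1, t2⟩ := hs.lorentz hε hε'
  have j1 := comm_jacobi b (ε' • s.l) (ε • s.l)
  have z1 : comm b (comm (ε' • s.l) (ε • s.l)) = 0 := by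
    rw [comm_swap, tracelessPart_of_isSl (sl'.comm sl) (hs.comm_l_l hε' hε), neg_zero]
  have j2 := comm_jacobi s.a (ε' • s.m) (ε • s.l)
  have z2 : comm (comm s.a (ε • s.l)) (ε' • s.m) = 0 :=
    tracelessPart_of_isSl (hs.isSl_a.comm sl) (hs.comm_a_l hε) _
  have j3 := comm_jacobi s.a (ε • s.m) (ε' • s.l)
  have z3 : comm (comm s.a (ε' • s.l)) (ε • s.m) = 0 :=
    tracelessPart_of_isSl (hs.isSl_a.comm sl') (hs.comm_a_l hε') _
  rw [z1, zero_add] at j1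
  rw [z2, add_zero, t2] at j2
  rw [z3, add_zero] at j3
  rw [add_comm', add_comm', neg_comm', neg_comm', j1, j2, j3, t1, comm_swap _ s.a, comm_smul,
    ← neg_one_smul ℂ (comm (ε • s.m) _), comm_smul]
  module

omit hε in
theorem comm_N_l : comm s.N s.l = comm (acomm s.l s.m) s.o + comm (acomm s.o s.l) s.m := by
  simp only [N, comm, acomm]; noncomm_ring

include hD in
/-- The commutator of two BRST transformations of the antifield. -/
theorem antifield_commutator (hε' : W.parity ε' = -ε') (hD' : s.D ε' = 0) {Y Y' y y' : SMat B}
    (hY : Inf ε Y) (hY' : Inf ε' Y') (sY : IsSl W Y) (sY' : IsSl W Y') (hy : Inf ε y)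
    (hy' : Inf ε' y') (η : ℂ) (h : y' - y = -η • tracelessPart (comm Y Y')) :
    s.a + s.Ba Y' η ε' + (s.vary (ε' • s.l + ε' • s.m + η • s.ad Y') (-(ε' • s.F))
        (s.Ba Y' η ε')).Ba (Y - y') η ε =
      s.a + s.Ba Y η ε + (s.vary (ε • s.l + ε • s.m + η • s.ad Y) (-(ε • s.F))
        (s.Ba Y η ε)).Ba (Y' - y) η ε' +
      comm (((2 : ℂ) • (ε * ε')) • acomm s.l s.m) s.a := by
  have sZ : IsSl W (s.ad (Y.map s.D)) := hs.isSl_ad (sY.map _ hs.parity_D)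
  have sZ' : IsSl W (s.ad (Y'.map s.D)) := hs.isSl_ad (sY'.map _ hs.parity_D)
  -- the terms of second order in the deformation parameter differ by the center
  have hP : s.P (η • comm (s.ad Y') (s.ad (Y.map s.D)) - s.ad (y'.map s.D)) =
      s.P (η • comm (s.ad Y) (s.ad (Y'.map s.D)) - s.ad (y.map s.D)) := by
    have e1 : (y' - y).map s.D = y'.map s.D - y.map s.D := by ext; simp
    have e2 : (-η • tracelessPart (comm Y Y')).map s.D =
        -η • tracelessPart ((comm Y Y').map s.D) := by
      rw [tracelessPart_map]; ext; simp
    have sC : IsSl W ((comm Y Y').map s.D) := (sY.comm sY').map _ hs.parity_D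
    have e3 : (η • comm (s.ad Y') (s.ad (Y.map s.D)) - s.ad (y'.map s.D)) -
        (η • comm (s.ad Y) (s.ad (Y'.map s.D)) - s.ad (y.map s.D)) =
        s.ad (η • (tracelessPart ((comm Y Y').map s.D) - (comm Y Y').map s.D)) := by
      have ha : ∀ (c : ℂ) (X : SMat B), s.ad (c • X) = c • s.ad X := fun c X => by
        simp only [ad, mul_smul_comm, smul_mul_assoc]
      have hs1 : ∀ X X' : SMat B, s.ad (X - X') = s.ad X - s.ad X' := fun X X' => by
        simp only [ad, mul_sub, sub_mul]
      rw [h, e2] at e1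
      have e4 : s.ad (-η • tracelessPart ((comm Y Y').map s.D)) =
          s.ad (y'.map s.D) - s.ad (y.map s.D) := by rw [e1, hs1]
      rw [ha] at e4
      rw [ha, hs1, comm_map_of_leibniz s.D hs.leibniz, ad_add, ← comm_map_of_leibniz s.D hs.leibniz,
        hs.ad_comm, hs.ad_comm, comm_swap (s.ad (Y.map s.D))]
      rw [← sub_eq_zero] at e4 ⊢
      rw [← e4]
      module
    have e5 : tracelessPart (s.ad (η • (tracelessPart ((comm Y Y').map s.D) -
        (comm Y Y').map s.D))) = 0 := by
      have z : s.ad 0 = (0 : SMat B) := by rw [ad, mul_zero, zero_mul]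
      rw [hs.ad_congr (((IsSl.tracelessPart sC.even).sub sC).smul η) isSl_zero
        (by rw [tracelessPart_smul, tracelessPart_sub, tracelessPart_tracelessPart, sub_self,
          smul_zero, tracelessPart_zero]), z, tracelessPart_zero]
    refine P_congr ?_
    rw [← sub_eq_zero, ← tracelessPart_sub, e3, e5]
  have p1 : s.P (comm (ε' • s.l + ε' • s.m) (s.ad (Y.map s.D))) =
      -comm (proj 0 (s.ad (Y.map s.D))) (ε' • s.l) := by
    rw [comm_swap, hs.P_neg, hs.P_comm hε' sZ,
      (hs.isOff_comm_l hε' (proj_gr 0 _) (by decide) (sZ.even.proj 0)).tracelessPart_eq]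
  have p2 : s.P (comm (ε • s.l + ε • s.m) (s.ad (Y'.map s.D))) =
      -comm (proj 0 (s.ad (Y'.map s.D))) (ε • s.l) := by
    rw [comm_swap, hs.P_neg, hs.P_comm hε sZ',
      (hs.isOff_comm_l hε (proj_gr 0 _) (by decide) (sZ'.even.proj 0)).tracelessPart_eq]
  have ja := hs.a_jacobi hε hε' (proj s.k' s.A)
  rw [hs.vary_Ba hε' hD' hY' hy' Y ε η, hs.vary_Ba hε hD hY hy Y' ε' η, hP, p1, p2, ← ja]
  module

/-- The parameter of the gauge symmetry of the momentum in the commutator of two BRST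
transformations. -/
def _root_.PureSpinor.Sector.shift (s : Sector B) (Y Y' : SMat B) (η : ℂ) (ε ε' : B) : SMat B :=
  -(((2 : ℂ) • (ε * ε')) • (proj 2 s.A + tracelessPart (acomm s.o s.l))) +
    η • (ε' • s.S Y - ε • s.S Y')

omit hε in
theorem even_acomm_o_l : W.EvenEntries (acomm s.o s.l) :=
  EvenEntries.add (EvenEntries.mul hs.o_even hs.l_even) (EvenEntries.mul hs.l_even hs.o_even)

omit hε in
theorem gr_acomm_o_l : Gr 2 (acomm s.o s.l) :=
  (hs.o_gr.acomm_central hs.l_gr hs.odd_k hs.odd_k (EvenEntries.central hs.o_even)).congr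
    (by rcases hs.degrees with ⟨h1, h2⟩ | ⟨h1, h2⟩ <;> rw [h1])

omit hε in
theorem isSl_acomm_o_l : IsSl W (acomm s.o s.l) :=
  ⟨isEvenSuper_of_isDiag (hs.gr_acomm_o_l.isDiag (by decide)) hs.even_acomm_o_l,
    str_acomm_central hs.isOff_o (EvenEntries.central hs.o_even)⟩

theorem shift_even (hε' : W.parity ε' = -ε') {Y Y' : SMat B} (sY : IsSl W Y) (sY' : IsSl W Y')
    (η : ℂ) : W.EvenEntries (s.shift Y Y' η ε ε') := by
  have h2 := hs.even_proj hε hs.isSl_A.even (j := 2) (by decide)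
  have h3 := EvenEntries.tracelessPart hs.even_acomm_o_l
  have hp : W.parity ((2 : ℂ) • (ε * ε')) = (2 : ℂ) • (ε * ε') := by
    rw [map_smul, map_mul, hε, hε', neg_mul_neg]
  refine EvenEntries.add (EvenEntries.neg ?_) (EvenEntries.smul η (EvenEntries.sub
    (EvenEntries.bsmul hε' (hs.odd_shift (hs.isSl_ad (sY.map _ hs.parity_D)).even))
    (EvenEntries.bsmul hε (hs.odd_shift (hs.isSl_ad (sY'.map _ hs.parity_D)).even))))
  intro i j
  rw [Matrix.smul_apply, smul_eq_mul, map_mul, hp, (EvenEntries.add h2 h3) i j]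

omit hε in
theorem proj_shift (Y Y' : SMat B) (η : ℂ) :
    proj 2 (s.shift Y Y' η ε ε') = s.shift Y Y' η ε ε' := by
  have h1 : proj 2 (tracelessPart (acomm s.o s.l)) = tracelessPart (acomm s.o s.l) :=
    (proj_eq_self_iff _ _).2 ⟨hs.gr_acomm_o_l.tracelessPart, tracelessPart_tracelessPart _⟩
  have h2 : ∀ Y, proj 2 (s.S Y) = s.S Y := fun Y =>
    (proj_eq_self_iff _ _).2 ⟨hs.pair.gr_shift (proj_gr _ _), traceless_shift _⟩
  rw [shift, proj_add, proj_neg, proj_bsmul, proj_add, proj_proj, if_pos rfl, h1, proj_smul,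
    proj_sub, proj_bsmul, proj_bsmul, h2, h2]

include hD in
/-- The commutator of two BRST transformations of the momentum. -/
theorem momentum_commutator (hε' : W.parity ε' = -ε') (hD' : s.D ε' = 0) {Y Y' : SMat B}
    (hY : Inf ε Y) (hY' : Inf ε' Y') (η : ℂ) {p p' : SMat B} :
    s.o + -(ε' • s.F) + -(ε • (s.vary (ε' • s.l + ε' • s.m + η • s.ad Y') p' (s.Ba Y' η ε')).F) =
      s.o + -(ε • s.F) + -(ε' • (s.vary (ε • s.l + ε • s.m + η • s.ad Y) p (s.Ba Y η ε)).F) +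
      (comm (((2 : ℂ) • (ε * ε')) • acomm s.l s.m) s.o +
        comm s.m (s.shift Y Y' η ε ε')) := by
  have h2 := hs.even_proj hε hs.isSl_A.even (j := 2) (by decide)
  have hc : ε' * ε = -(ε * ε') := W.odd_anticomm _ _ hε' hε
  have he : W.parity ((2 : ℂ) • (ε * ε')) = (2 : ℂ) • (ε * ε') := by
    rw [map_smul, map_mul, hε, hε', neg_mul_neg]
  have cm := EvenEntries.central hs.m_even
  have c1 : comm (((2 : ℂ) • (ε * ε')) • acomm s.l s.m) s.o =
      ((2 : ℂ) • (ε * ε')) • comm (acomm s.l s.m) s.o := by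
    rw [comm_swap, bsmul_comm_of_central (fun b => W.even_comm _ b he), comm_swap s.o, smul_neg,
      neg_neg]
  have c2 : comm s.m (s.shift Y Y' η ε ε') =
      ((2 : ℂ) • (ε * ε')) • (comm (proj 2 s.A) s.m + comm (acomm s.o s.l) s.m) +
        η • (ε' • comm s.m (s.S Y) - ε • comm s.m (s.S Y')) := by
    rw [shift, comm_add, comm_smul, comm_sub, bsmul_comm_left_of_central cm,
      bsmul_comm_left_of_central cm, ← neg_one_smul ℂ (((2 : ℂ) • (ε * ε')) • _), comm_smul,
      bsmul_comm_left_of_central cm, comm_add, hs.isSl_acomm_o_l.comm_tracelessPart_right,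
      comm_swap s.m (proj 2 s.A), comm_swap s.m (acomm s.o s.l), ← neg_add, smul_neg, neg_one_smul,
      neg_neg]
  have cN := hs.comm_N_l
  rw [hs.vary_F hε hD hY, hs.vary_F hε' hD' hY', comm_bsmul_of_even hε h2,
    comm_bsmul_of_even hε' h2, comm_bsmul_of_even hε hs.N_even, comm_bsmul_of_even hε' hs.N_even,
    c1, c2, cN]
  have h22 : (2 : ℂ) • (ε * ε') = ε * ε' + ε * ε' := two_smul _ _
  simp only [h22, add_smul, smul_add, smul_sub, smul_smul, hc, neg_smul, smul_comm ε η,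
    smul_comm ε' η]
  abel

end Ghosts

end Ok
end Sector
end Nilpotency

/-! ### Nilpotency up to gauge transformations -/

section NilpotencyFields

variable {B : Type*} [Ring B] [Algebra ℂ B] {W : Worldsheet B} {φ : Fields B} {ε ε' : B}
  {R : psl →ₗ[ℂ] psl} {η : ℂ}

/-- The bracket of a central anticommutator of two pure spinors with one of them vanishes. -/
theorem comm_bsmul_acomm_pure {o m : SMat B} {k : ℕ} (h1 : Gr k m) (hk : Odd k)
    (h2 : W.EvenEntries m) (h3 : tracelessPart (acomm m m) = 0) (e : B) :
    comm (e • acomm o m) m = 0 := by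
  rw [comm_swap, bsmul_comm_left_of_central (EvenEntries.central h2), comm_swap m,
    comm_acomm_pure h1 hk h2 h3, neg_zero, smul_zero, neg_zero]

namespace Fields

theorem brst_lam (φ : Fields B) (W : Worldsheet B) (R : psl →ₗ[ℂ] psl) (η : ℂ) (ε : B) :
    (φ.brst W R η ε).lam1 = φ.lam1 ∧ (φ.brst W R η ε).lam3 = φ.lam3 := by
  constructor
  · change φ.lam1 + ((0 : SMat B) + η • (0 : SMat B)) = _
    simp
  · change φ.lam3 + ((0 : SMat B) + η • (0 : SMat B)) = _
    simp

/-- Minus the change of `RΛ(ε)` under the BRST transformation with parameter `ε'`. -/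
def varyRLam (φ : Fields B) (R : psl →ₗ[ℂ] psl) (η : ℂ) (ε' ε : B) : SMat B :=
  extend R (φ.AdInv (comm (φ.gen R η ε') (ε • φ.lam3 - ε • φ.lam1)))

theorem inf_varyRLam (hε' : W.parity ε' = -ε') (η : ℂ) (ε : B) :
    Inf ε' (φ.varyRLam R η ε' ε) :=
  ((((inf_gen hε' η).comm_left hε' _).mul_left hε' _).mul_right _).extend R

/-- The ghosts are invariant, so `RΛ(ε)` changes only through the conjugation by `g`. -/
theorem brst_RLam (h1 : (φ.plus W).Ok W) (hε' : W.parity ε' = -ε') (η : ℂ) (ε : B) :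
    (φ.brst W R η ε').RLam R ε = φ.RLam R ε - φ.varyRLam R η ε' ε := by
  obtain ⟨l1, l3⟩ := brst_lam φ W R η ε'
  have h : (φ.brst W R η ε').AdInv (ε • φ.lam3 - ε • φ.lam1) =
      φ.AdInv (ε • φ.lam3 - ε • φ.lam1) -
        φ.AdInv (comm (φ.gen R η ε') (ε • φ.lam3 - ε • φ.lam1)) := by
    change ((φ.brst W R η ε').plus W).adInv _ = _
    rw [brst_plus h1, h1.vary_adInv hε' (inf_gen hε' η)]
    rfl
  rw [RLam, l1, l3, h, extend_sub]
  rfl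

section Commutator

variable (hR : IsEvenOperator R) (h1 : (φ.plus W).Ok W) (h2 : (φ.minus W).Ok W)
  (hε : W.parity ε = -ε) (hε' : W.parity ε' = -ε')
include h1 h2 hε hε'

/-- The commutator of two variations of `RΛ`: here the classical Yang-Baxter equation enters. -/
theorem varyRLam_sub (hR : IsEvenOperator R) (hYB : SolvesCYBE R) (η : ℂ) :
    φ.varyRLam R η ε' ε - φ.varyRLam R η ε ε' =
      -η • tracelessPart (comm (φ.RLam R ε) (φ.RLam R ε')) := by
  have sa := h1.isSl_l hε
  have sb := h1.isSl_m hε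
  have sa' := h1.isSl_l hε'
  have sb' := h1.isSl_m hε'
  have c1 := h1.comm_l_l hε hε'
  have c2 := h1.comm_m_m hε hε'
  have hY := hYB.comm_extend hR (isSl_Lam h1 hε) (isSl_Lam h1 hε')
  change tracelessPart (comm (φ.RLam R ε) (φ.RLam R ε')) =
    extend R (comm (φ.RLam R ε) (φ.Lam ε') + comm (φ.Lam ε) (φ.RLam R ε')) at hY
  change IsSl W (ε • φ.lam1) at sa
  change IsSl W (ε • φ.lam3) at sb
  change IsSl W (ε' • φ.lam1) at sa'
  change IsSl W (ε' • φ.lam3) at sb'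
  change tracelessPart (comm (ε • φ.lam1) (ε' • φ.lam1)) = 0 at c1
  change tracelessPart (comm (ε • φ.lam3) (ε' • φ.lam3)) = 0 at c2
  -- the brackets of the ghosts are central by the pure spinor constraints
  have e1 : comm (ε' • φ.lam1 + ε' • φ.lam3) (ε • φ.lam3 - ε • φ.lam1) -
      comm (ε • φ.lam1 + ε • φ.lam3) (ε' • φ.lam3 - ε' • φ.lam1) =
      (2 : ℂ) • (comm (ε • φ.lam1) (ε' • φ.lam1) - comm (ε • φ.lam3) (ε' • φ.lam3)) := by
    simp only [comm, two_smul]; noncomm_ring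
  have e2 : extend R (φ.AdInv ((2 : ℂ) • (comm (ε • φ.lam1) (ε' • φ.lam1) -
      comm (ε • φ.lam3) (ε' • φ.lam3)))) = 0 := by
    have := h1.adInv_congr (((sa.comm sa').sub (sb.comm sb')).smul 2) isSl_zero
      (by rw [tracelessPart_smul, tracelessPart_sub, c1, c2, sub_zero, smul_zero,
        tracelessPart_zero])
    have h0 : (φ.plus W).adInv 0 = 0 := by rw [Sector.adInv, mul_zero, zero_mul]
    rw [h0] at this
    have := extend_congr R this
    rwa [extend_zero] at this
  have e3 : ∀ Y' l : SMat B, φ.AdInv (comm (φ.Ad Y') l) = comm Y' (φ.AdInv l) := fun Y' l => by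
    have := h1.adInv_comm ((φ.plus W).ad Y') l
    rwa [h1.adInv_ad] at this
  have e4 : ∀ X Y : SMat B, φ.AdInv (X - Y) = φ.AdInv X - φ.AdInv Y := (φ.plus W).adInv_sub
  have e5 : ∀ (c : ℂ) (X : SMat B), φ.AdInv (c • X) = c • φ.AdInv X := fun c X => by
    simp only [AdInv, mul_smul_comm, smul_mul_assoc]
  have e6 : comm (φ.gen R η ε') (ε • φ.lam3 - ε • φ.lam1) -
      comm (φ.gen R η ε) (ε' • φ.lam3 - ε' • φ.lam1) =
      (2 : ℂ) • (comm (ε • φ.lam1) (ε' • φ.lam1) - comm (ε • φ.lam3) (ε' • φ.lam3)) -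
        η • (comm (φ.Ad (φ.RLam R ε)) (ε' • φ.lam3 - ε' • φ.lam1) -
          comm (φ.Ad (φ.RLam R ε')) (ε • φ.lam3 - ε • φ.lam1)) := by
    rw [← e1, gen, gen, add_comm' _ (η • φ.Ad (φ.RLam R ε')), add_comm' _ (η • φ.Ad (φ.RLam R ε)),
      smul_comm', smul_comm']
    module
  rw [hY, varyRLam, varyRLam, ← extend_sub, ← e4, e6, e4, extend_sub, e2, e5, e4, e3, e3,
    zero_sub, extend_smul, neg_smul]
  congr 3
  rw [comm_swap (φ.Lam ε)]
  exact sub_eq_add_neg _ _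

/-- The parameter of the local Lorentz transformation. -/
theorem lorentz_isSl : IsSl W (((2 : ℂ) • (ε * ε')) • acomm φ.lam1 φ.lam3) := by
  have h := (h1.lorentz hε hε').1
  change ((2 : ℂ) • (ε * ε')) • acomm φ.lam1 φ.lam3 = (2 : ℂ) • comm (ε • φ.lam3) (ε' • φ.lam1)
    at h
  rw [h]
  exact ((h1.isSl_m hε).comm (h1.isSl_l hε')).smul 2

omit h2 hε in
theorem brst_brst_g (hψ : ((φ.brst W R η ε').plus W).Ok W) :
    ((φ.brst W R η ε').brst W R η ε).g =
      φ.g + (φ.gen R η ε + φ.gen R η ε' + φ.gen R η ε * φ.gen R η ε' +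
        η • (comm (φ.gen R η ε') (φ.Ad (φ.RLam R ε)) - φ.Ad (φ.varyRLam R η ε' ε))) * φ.g := by
  have hV := inf_gen (φ := φ) (R := R) hε' η
  have hy := inf_varyRLam (φ := φ) (R := R) hε' η ε
  have hAd : ∀ X, (φ.brst W R η ε').Ad X = φ.Ad X + comm (φ.gen R η ε') (φ.Ad X) := fun X => by
    change ((φ.brst W R η ε').plus W).ad X = _
    rw [brst_plus h1, h1.vary_ad hε' hV]
    rfl
  have hs : ∀ X Y : SMat B, φ.Ad (X - Y) = φ.Ad X - φ.Ad Y := fun X Y => by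
    simp only [Ad, mul_sub, sub_mul]
  have hz : comm (φ.gen R η ε') (φ.Ad (φ.varyRLam R η ε' ε)) = 0 :=
    hV.comm_eq_zero hε' (h1.inf_ad hε' hy)
  obtain ⟨l1, l3⟩ := brst_lam φ W R η ε'
  have hG : (φ.brst W R η ε').gen R η ε = φ.gen R η ε +
      η • (comm (φ.gen R η ε') (φ.Ad (φ.RLam R ε)) - φ.Ad (φ.varyRLam R η ε' ε)) := by
    rw [gen, l1, l3, brst_RLam h1 hε', hAd, hs, comm_sub, hz, show φ.gen R η ε = (ε • φ.lam1 + ε • φ.lam3) +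
      η • φ.Ad (φ.RLam R ε) from rfl, sub_zero]
    generalize ε • φ.lam1 + ε • φ.lam3 = x
    module
  have hi : Inf ε' (η • (comm (φ.gen R η ε') (φ.Ad (φ.RLam R ε)) -
      φ.Ad (φ.varyRLam R η ε' ε))) :=
    ((hV.comm_left hε' _).sub (h1.inf_ad hε' hy)).smul η
  rw [brst_g hψ, brst_g h1, hG]
  set T := η • (comm (φ.gen R η ε') (φ.Ad (φ.RLam R ε)) - φ.Ad (φ.varyRLam R η ε' ε))
  have h0 : T * (φ.gen R η ε' * φ.g) = 0 := by
    rw [← mul_assoc, hi.mul_eq_zero hε' hV, zero_mul]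
  rw [mul_add (_ + T), add_mul _ T (φ.gen R η ε' * φ.g), h0]
  noncomm_ring

/-- The commutator of two BRST transformations of `g`. -/
theorem group_commutator (hR : IsEvenOperator R) (hYB : SolvesCYBE R) (η : ℂ)
    (hψ : ((φ.brst W R η ε').plus W).Ok W) (hψ' : ((φ.brst W R η ε).plus W).Ok W) :
    ∃ z, W.parity z = z ∧ ((φ.brst W R η ε').brst W R η ε).g =
      ((φ.brst W R η ε).brst W R η ε').g +
        (((2 : ℂ) • (ε * ε')) • acomm φ.lam1 φ.lam3 + Matrix.scalar (Fin 4 ⊕ Fin 4) z) *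
          φ.g := by
  have sY := isSl_RLam hR h1 hε
  have sY' := isSl_RLam hR h1 hε'
  have sa : IsSl W (ε • φ.lam1) := h1.isSl_l hε
  have sb : IsSl W (ε • φ.lam3) := h1.isSl_m hε
  have sa' : IsSl W (ε' • φ.lam1) := h1.isSl_l hε'
  have sb' : IsSl W (ε' • φ.lam3) := h1.isSl_m hε'
  have c1 : tracelessPart (comm (ε • φ.lam1) (ε' • φ.lam1)) = 0 := h1.comm_l_l hε hε'
  have c2 : tracelessPart (comm (ε • φ.lam3) (ε' • φ.lam3)) = 0 := h1.comm_m_m hε hε'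
  obtain ⟨t1, t2⟩ : ((2 : ℂ) • (ε * ε')) • acomm φ.lam1 φ.lam3 =
      (2 : ℂ) • comm (ε • φ.lam3) (ε' • φ.lam1) ∧
    comm (ε' • φ.lam3) (ε • φ.lam1) = -comm (ε • φ.lam3) (ε' • φ.lam1) := h1.lorentz hε hε'
  have sC := sY.comm sY'
  have sT := lorentz_isSl h1 h2 hε hε'
  have sP := IsSl.tracelessPart sC.even
  set Y := φ.RLam R ε
  set Y' := φ.RLam R ε'
  have hs : ∀ X Y : SMat B, φ.Ad (X - Y) = φ.Ad X - φ.Ad Y := fun X Y => by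
    simp only [Ad, mul_sub, sub_mul]
  have hc : ∀ (c : ℂ) (X : SMat B), φ.Ad (c • X) = c • φ.Ad X := fun c X => by
    simp only [Ad, mul_smul_comm, smul_mul_assoc]
  have hAc : φ.Ad (comm Y Y') = comm (φ.Ad Y) (φ.Ad Y') := h1.ad_comm Y Y'
  set T := comm (ε • φ.lam1 + ε • φ.lam3) (ε' • φ.lam1 + ε' • φ.lam3) +
    (η * η) • φ.Ad (tracelessPart (comm Y Y') - comm Y Y') with hT
  have sT' : IsSl W T :=
    ((sa.add sb).comm (sa'.add sb')).add ((h1.isSl_ad (sP.sub sC)).smul _)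
  have hp : tracelessPart T = tracelessPart (((2 : ℂ) • (ε * ε')) • acomm φ.lam1 φ.lam3) := by
    have e1 : tracelessPart (φ.Ad (tracelessPart (comm Y Y') - comm Y Y')) = 0 := by
      have := h1.ad_congr (sP.sub sC) isSl_zero
        (by rw [tracelessPart_sub, tracelessPart_tracelessPart, sub_self, tracelessPart_zero])
      have h0 : (φ.plus W).ad 0 = 0 := by rw [Sector.ad, mul_zero, zero_mul]
      rwa [h0, tracelessPart_zero] at this
    have e2 : comm (ε • φ.lam1 + ε • φ.lam3) (ε' • φ.lam1 + ε' • φ.lam3) =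
        comm (ε • φ.lam1) (ε' • φ.lam1) + comm (ε • φ.lam3) (ε' • φ.lam3) +
          (2 : ℂ) • comm (ε • φ.lam3) (ε' • φ.lam1) := by
      rw [add_comm', comm_add, comm_add, comm_swap (ε • φ.lam1) (ε' • φ.lam3), t2]
      module
    rw [hT, e2, tracelessPart_add, tracelessPart_add, tracelessPart_add, tracelessPart_smul,
      tracelessPart_smul, e1, c1, c2, t1, tracelessPart_smul]
    simp
  obtain ⟨z, hz, hTz⟩ := sT'.exists_eq_add_scalar sT hp
  refine ⟨z, hz, ?_⟩
  have hy := varyRLam_sub h1 h2 hε hε' hR hYB η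
  have hAy := congrArg φ.Ad hy
  rw [hs, hc, sub_eq_iff_eq_add] at hAy
  rw [← hTz, brst_brst_g h1 hε' hψ, brst_brst_g h1 hε hψ', hAy, add_assoc φ.g, ← add_mul, hT, hs,
    hAc]
  congr 2
  change _ + η • (comm _ (φ.Ad Y) - (-η • φ.Ad (tracelessPart (comm Y Y')) + _)) =
    _ + η • (comm _ (φ.Ad Y') - _) + _
  have g1 : φ.gen R η ε = (ε • φ.lam1 + ε • φ.lam3) + η • φ.Ad Y := rfl
  have g2 : φ.gen R η ε' = (ε' • φ.lam1 + ε' • φ.lam3) + η • φ.Ad Y' := rfl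
  rw [g1, g2]
  generalize ε • φ.lam1 + ε • φ.lam3 = x
  generalize ε' • φ.lam1 + ε' • φ.lam3 = x'
  simp only [comm, add_mul, mul_add, smul_mul_assoc, mul_smul_comm]
  module

end Commutator

/-- The BRST transformations commute up to gauge transformations. -/
theorem nilpotency (hR : IsEvenOperator R) (hYB : SolvesCYBE R) (h : φ.Admissible W)
    (hε : W.IsOddConstant ε) (hε' : W.IsOddConstant ε') (η : ℂ) :
    ∃ (z : B) (u v : SMat B), W.parity z = z ∧ W.EvenEntries u ∧ proj 2 u = u ∧
      W.EvenEntries v ∧ proj 2 v = v ∧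
      (φ.brst W R η ε').brst W R η ε = (φ.brst W R η ε).brst W R η ε' +
        φ.gauge (((2 : ℂ) • (ε * ε')) • acomm φ.lam1 φ.lam3) z u v := by
  obtain ⟨h1, h2⟩ := admissible_iff.1 h
  obtain ⟨k1, k2⟩ := admissible_iff.1 (brst_admissible hR h hε η)
  obtain ⟨k1', k2'⟩ := admissible_iff.1 (brst_admissible hR h hε' η)
  obtain ⟨e0, e1, e2⟩ := hε
  obtain ⟨e0', e1', e2'⟩ := hε'
  obtain ⟨z, hz, hg⟩ := group_commutator h1 h2 e0 e0' hR hYB η k1' k1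
  have sY := isSl_RLam hR h1 e0
  have sY' := isSl_RLam hR h1 e0'
  have iY := inf_RLam (φ := φ) (R := R) e0
  have iY' := inf_RLam (φ := φ) (R := R) e0'
  have iy := inf_varyRLam (φ := φ) (R := R) e0 η ε'
  have iy' := inf_varyRLam (φ := φ) (R := R) e0' η ε
  have hy := varyRLam_sub h1 h2 e0 e0' hR hYB η
  have hl : acomm φ.lam3 φ.lam1 = acomm φ.lam1 φ.lam3 := acomm_swap _ _
  have gm : ∀ ε, φ.gen R η ε = ε • (φ.minus W).l + ε • (φ.minus W).m +
      η • (φ.minus W).ad (φ.RLam R ε) := fun ε => by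
    rw [add_comm (ε • (φ.minus W).l)]; rfl
  have bp := fun ε => brst_plus h1 R η ε
  have bm := fun ε => brst_minus h1 R η ε
  refine ⟨z, (φ.plus W).shift (φ.RLam R ε) (φ.RLam R ε') η ε ε',
    (φ.minus W).shift (φ.RLam R ε) (φ.RLam R ε') η ε ε', hz, h1.shift_even e0 e0' sY sY' η,
    h1.proj_shift _ _ η, h2.shift_even e0 e0' sY sY' η, h2.proj_shift _ _ η, ?_⟩
  obtain ⟨l1, l3⟩ := brst_lam φ W R η ε
  obtain ⟨l1', l3'⟩ := brst_lam φ W R η ε'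
  obtain ⟨m1, m3⟩ := brst_lam (φ.brst W R η ε) W R η ε'
  obtain ⟨m1', m3'⟩ := brst_lam (φ.brst W R η ε') W R η ε
  ext1
  · exact hg
  · change _ = ((φ.brst W R η ε).brst W R η ε').lam1 + comm _ φ.lam1
    have h0 : comm (((2 : ℂ) • (ε * ε')) • acomm φ.lam3 φ.lam1) φ.lam1 = 0 :=
      comm_bsmul_acomm_pure h1.l_gr h1.odd_k h1.l_even h1.l_pure _
    rw [m1, m1', l1, l1', ← hl, h0, add_zero]
  · change _ = ((φ.brst W R η ε).brst W R η ε').lam3 + comm _ φ.lam3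
    have h0 : comm (((2 : ℂ) • (ε * ε')) • acomm φ.lam1 φ.lam3) φ.lam3 = 0 :=
      comm_bsmul_acomm_pure h1.m_gr h1.odd_k' h1.m_even h1.m_pure _
    rw [m3, m3', l3, l3', h0, add_zero]
  · have := h1.momentum_commutator e0 e1 e0' e1' iY iY' η
      (p := -(ε • (φ.plus W).F)) (p' := -(ε' • (φ.plus W).F))
    change (((φ.brst W R η ε').brst W R η ε).plus W).o =
      (((φ.brst W R η ε).brst W R η ε').plus W).o + _
    rw [brst_plus k1, brst_plus k1', bp, bp]
    exact this
  · have := h2.momentum_commutator e0 e2 e0' e2' iY iY' η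
      (p := -(ε • (φ.minus W).F)) (p' := -(ε' • (φ.minus W).F))
    rw [← gm, ← gm] at this
    change (((φ.brst W R η ε').brst W R η ε).minus W).o =
      (((φ.brst W R η ε).brst W R η ε').minus W).o + (comm _ (φ.minus W).o + _)
    rw [brst_minus k1, brst_minus k1', bm, bm, ← hl]
    exact this
  · have := h1.antifield_commutator e0 e1 e0' e1' iY iY' sY sY' iy iy' η hy
    rw [← brst_RLam h1 e0', ← brst_RLam h1 e0] at this
    change (((φ.brst W R η ε').brst W R η ε).plus W).a =
      (((φ.brst W R η ε).brst W R η ε').plus W).a + _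
    rw [brst_plus k1, brst_plus k1', bp, bp]
    exact this
  · have := h2.antifield_commutator e0 e2 e0' e2' iY iY' sY sY' iy iy' η hy
    rw [← brst_RLam h1 e0', ← brst_RLam h1 e0, ← gm, ← gm] at this
    change (((φ.brst W R η ε').brst W R η ε).minus W).a =
      (((φ.brst W R η ε).brst W R η ε').minus W).a + comm _ (φ.minus W).a
    rw [brst_minus k1, brst_minus k1', bm, bm, ← hl]
    exact this

end Fields
end NilpotencyFields

/-! ### Integrals over a torus -/

section Torus

variable {p q : ℝ × ℝ}

/-- The integral of a derivative of a periodic function vanishes: the direction of the derivative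
is a combination of the periods, and the boundary terms of the unit square cancel in pairs. -/
theorem torusIntegral_deriv (hpq : LinearIndependent ℝ ![p, q]) (w : ℝ × ℝ)
    (f : torusFunctions p q) : torusIntegral p q (torusDeriv p q w f) = 0 := by
  obtain ⟨a, b, hw⟩ : ∃ a b : ℝ, w = a • p + b • q := by
    have ht := hpq.span_eq_top_of_card_eq_finrank' (by simp)
    have hm : w ∈ Submodule.span ℝ (Set.range ![p, q]) := ht ▸ Submodule.mem_top
    obtain ⟨c, hc⟩ := (Submodule.mem_span_range_iff_exists_fun ℝ).1 hm
    exact ⟨c 0, c 1, by rw [← hc]; simp [Fin.sum_univ_two]⟩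
  let L : ℝ × ℝ →L[ℝ] ℝ × ℝ :=
    (ContinuousLinearMap.fst ℝ ℝ ℝ).smulRight p + (ContinuousLinearMap.snd ℝ ℝ ℝ).smulRight q
  let F : ℝ × ℝ → ℂ := fun x => (f : ℝ × ℝ → ℂ) (L x)
  have hF : ∀ x, HasFDerivAt F ((fderiv ℝ (f : ℝ × ℝ → ℂ) (L x)).comp L) x := fun x =>
    (torusFunctions_differentiable f (L x)).hasFDerivAt.comp x L.hasFDerivAt
  have hc : Continuous F := (torusFunctions_differentiable f).continuous.comp L.continuous
  have hd : Continuous fun x => fderiv ℝ (f : ℝ × ℝ → ℂ) (L x) w :=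
    ((f.2.1.continuous_fderiv (by simp)).comp L.continuous).clm_apply continuous_const
  have key : ∀ x : ℝ × ℝ, (a • (fderiv ℝ (f : ℝ × ℝ → ℂ) (L x)).comp L) (1, 0) +
      (b • (fderiv ℝ (f : ℝ × ℝ → ℂ) (L x)).comp L) (0, 1) =
        fderiv ℝ (f : ℝ × ℝ → ℂ) (L x) w := fun x => by
    have e1 : L (1, 0) = p := by simp [L]
    have e2 : L (0, 1) = q := by simp [L]
    simp only [_root_.smul_apply, ContinuousLinearMap.comp_apply, e1, e2, hw, map_add,
      map_smul]
  have h := MeasureTheory.integral_divergence_prod_Icc_of_hasFDerivAt_of_le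
    (fun x => a • F x) (fun x => b • F x)
    (fun x => a • (fderiv ℝ (f : ℝ × ℝ → ℂ) (L x)).comp L)
    (fun x => b • (fderiv ℝ (f : ℝ × ℝ → ℂ) (L x)).comp L) (0, 0) (1, 1) (by simp)
    (hc.const_smul a).continuousOn (hc.const_smul b).continuousOn
    (fun x _ => (hF x).const_smul a) (fun x _ => (hF x).const_smul b)
    (by simp only [key]; exact hd.continuousOn.integrableOn_compact isCompact_Icc)
  simp only [key] at h
  have p1 : ∀ x : ℝ, F (x, 1) = F (x, 0) := fun x => by
    have := f.2.2.2 (x • p)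
    simpa [F, L] using this
  have p2 : ∀ y : ℝ, F (1, y) = F (0, y) := fun y => by
    have := f.2.2.1 (y • q)
    simpa [F, L, add_comm] using this
  simp only [p1, p2, sub_self, zero_add] at h
  change _ * (∫ x in Set.Icc ((0, 0) : ℝ × ℝ) (1, 1), fderiv ℝ (f : ℝ × ℝ → ℂ) (L x) w) = 0
  rw [h, mul_zero]

/-- The integral of a superfield over the torus. -/
def torusFieldIntegral (p q : ℝ × ℝ) (N : ℕ) : TorusFields p q N →ₗ[ℂ] Grassmann N :=
  (TensorProduct.lid ℂ (Grassmann N)).toLinearMap ∘ₗ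
    (LinearMap.rTensor (Grassmann N) (torusIntegral p q) :
      torusFunctions p q ⊗[ℂ] Grassmann N →ₗ[ℂ] ℂ ⊗[ℂ] Grassmann N)

theorem torusFieldIntegral_deriv (hpq : LinearIndependent ℝ ![p, q]) (N : ℕ) (w : ℝ × ℝ)
    (a : TorusFields p q N) : torusFieldIntegral p q N (torusFieldDeriv p q N w a) = 0 := by
  induction a using TorusFields.induction with
  | zero => simp
  | add x y hx hy => rw [map_add, map_add, hx, hy, add_zero]
  | mk f u =>
    change torusIntegral p q (torusDeriv p q w f) • u = 0
    rw [torusIntegral_deriv hpq, zero_smul]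

theorem torusAction_eq (N : ℕ) (R : psl →ₗ[ℂ] psl) (n : ℕ) (φ : Fields (TorusFields p q N)) :
    torusAction p q N R n φ = torusFieldIntegral p q N (φ.Ldef (torus p q N) R n) := rfl

theorem sum_torusAction_sub_eq_zero (hpq : LinearIndependent ℝ ![p, q]) {N : ℕ}
    {R : psl →ₗ[ℂ] psl} (hR : IsEvenOperator R) (hanti : IsAntisymmetric R) (hYB : SolvesCYBE R)
    {φ : Fields (TorusFields p q N)} (h : φ.Admissible (torus p q N)) {ε : TorusFields p q N}
    (hε : (torus p q N).IsOddConstant ε) (n : ℕ) :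
    ∑ km ∈ Finset.HasAntidiagonal.antidiagonal n,
      (torusAction p q N R km.2 (φ + φ.Q (torus p q N) R ε km.1) -
        torusAction p q N R km.2 φ) = 0 := by
  obtain ⟨h1, h2⟩ := Fields.admissible_iff.1 h
  obtain ⟨b, c, hbc⟩ := Fields.invariance h1 h2 hR hanti hYB hε n
  simp only [torusAction_eq, ← map_sub]
  rw [← map_sum, hbc, map_add]
  change torusFieldIntegral p q N (torusFieldDeriv p q N (1, 0) b) +
    torusFieldIntegral p q N (torusFieldDeriv p q N (0, 1) c) = 0
  rw [torusFieldIntegral_deriv hpq, torusFieldIntegral_deriv hpq, add_zero]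

end Torus

/-- For a field configuration that satisfies the constraints, the projectors exist and are
unique. -/
theorem Fields.existsUnique_ghostProj {B : Type*} [Ring B] [Algebra ℂ B] {W : Worldsheet B}
    {φ : Fields B} (h : φ.Admissible W) :
    (∀ y, proj 3 y = y → ∃! z, IsGhostProj φ.lam1 φ.lam3 y z) ∧
      ∀ y, proj 1 y = y → ∃! z, IsGhostProj φ.lam3 φ.lam1 y z := by
  obtain ⟨h1, h2⟩ := Fields.admissible_iff.1 h
  exact ⟨fun y hy => h2.pair.existsUnique ((proj_eq_self_iff _ _).1 hy).1,
    fun y hy => h1.pair.existsUnique ((proj_eq_self_iff _ _).1 hy).1⟩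

end PureSpinor

end

theorem mainTheorem1 (R : PureSpinor.psl →ₗ[ℂ] PureSpinor.psl)
    (hR : PureSpinor.IsEvenOperator R) (hanti : PureSpinor.IsAntisymmetric R)
    (hYB : PureSpinor.SolvesCYBE R) :
    -- On every worldsheet, for all field configurations:
    (∀ {B : Type*} [Ring B] [Algebra ℂ B] (W : PureSpinor.Worldsheet B)
        (φ : PureSpinor.Fields B), φ.Admissible W →
      -- the projectors `𝒫₃₁` and `𝒫₁₃` exist and are unique;
      (∀ y, PureSpinor.proj 3 y = y →
        ∃! z, PureSpinor.IsGhostProj φ.lam1 φ.lam3 y z) ∧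
      (∀ y, PureSpinor.proj 1 y = y →
        ∃! z, PureSpinor.IsGhostProj φ.lam3 φ.lam1 y z) ∧
      -- the BRST transformations preserve the constraints on the fields;
      (∀ ε, W.IsOddConstant ε → ∀ η : ℂ, (φ.brst W R η ε).Admissible W) ∧
      -- `Q S_def = 0` at each order in `η`: `∑_{k+m=n} Q_k L_m` is a total derivative;
      (∀ ε, W.IsOddConstant ε → ∀ n : ℕ, ∃ b c : B,
        ∑ km ∈ Finset.HasAntidiagonal.antidiagonal n,
          ((φ + φ.Q W R ε km.1).Ldef W R km.2 - φ.Ldef W R km.2) =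
            W.dPlus b + W.dMinus c) ∧
      -- `Q` is nilpotent, without equations of motion, up to gauge transformations.
      (∀ ε ε', W.IsOddConstant ε → W.IsOddConstant ε' → ∀ η : ℂ,
        ∃ (z : B) (u v : PureSpinor.SMat B), W.parity z = z ∧
          W.EvenEntries u ∧ PureSpinor.proj 2 u = u ∧
          W.EvenEntries v ∧ PureSpinor.proj 2 v = v ∧
          (φ.brst W R η ε').brst W R η ε = (φ.brst W R η ε).brst W R η ε' +
            φ.gauge (((2 : ℂ) • (ε * ε')) • PureSpinor.acomm φ.lam1 φ.lam3) z u v)) ∧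
    -- In particular, the action integral over any torus satisfies `Q S_def = 0`.
    (∀ (p q : ℝ × ℝ), LinearIndependent ℝ ![p, q] → ∀ (N : ℕ)
        (φ : PureSpinor.Fields (PureSpinor.TorusFields p q N)),
      φ.Admissible (PureSpinor.torus p q N) →
      ∀ ε, (PureSpinor.torus p q N).IsOddConstant ε → ∀ n : ℕ,
        ∑ km ∈ Finset.HasAntidiagonal.antidiagonal n,
          (PureSpinor.torusAction p q N R km.2
              (φ + φ.Q (PureSpinor.torus p q N) R ε km.1) -
            PureSpinor.torusAction p q N R km.2 φ) = 0) := by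
  refine ⟨fun W φ h => ?_, fun p q hpq N φ h ε hε n =>
    PureSpinor.sum_torusAction_sub_eq_zero hpq hR hanti hYB h hε n⟩
  obtain ⟨h1, h2⟩ := PureSpinor.Fields.admissible_iff.1 h
  obtain ⟨k1, k2⟩ := PureSpinor.Fields.existsUnique_ghostProj h
  exact ⟨k1, k2, fun ε hε η => PureSpinor.Fields.brst_admissible hR h hε η,
    fun ε hε n => PureSpinor.Fields.invariance h1 h2 hR hanti hYB hε n,
    fun ε ε' hε hε' η => PureSpinor.Fields.nilpotency hR hYB h hε hε' η⟩
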